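/- Let $k\ge 2$ be a fixed integer. Let $P_0,\dots,P_{k-1}$ be convex polygons in the plane (closed, with nonempty interior), each given by the list of its vertices in counterclockwise order, with $n$ vertices in total. Let $\mathcal C=(\mathbb R^2)^k/\{(\mathbf x,\dots,\mathbf x):\mathbf x\in\mathbb R^2\}$ be the configuration space, whose elements are called placements, let $\pi\colon(\mathbb R^2)^k\to\mathcal C$ be the quotient map, and for $\mathbf v=(\mathbf v_0,\dots,\mathbf v_{k-1})\in(\mathbb R^2)^k$ put $$I(\mathbf v)=(P_0+\mathbf v_0)\cap\dots\cap(P_{k-1}+\mathbf v_{k-1}).$$ The area of $I(\mathbf v)$ depends only on the placement $\pi(\mathbf v)$; let $M\subset\mathcal C$ be the set of all placements that maximize it. Suppose that some $\mathbf v$ with $\pi(\mathbf v)\in M$ is given, and put $I_{\max}=I(\mathbf v)$. Then $\pi$ restricts to a bijection from the product $$N=\prod_{i<k}\bigl((-P_i)-(-I_{\max})\bigr),\qquad (-P_i)-(-I_{\max})=\{\mathbf x\in\mathbb R^2: I_{\max}\subset\mathbf x+P_i\},$$ of Minkowski differences ($A-B=\{\mathbf x:\mathbf x+B\subset A\}$)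 onto $M$. Moreover, on a real RAM (exact $+,-,\times,/,<,=$ on real numbers in unit time, together with integer arithmetic for addressing), one can compute from $P_0,\dots,P_{k-1}$ and $\mathbf v$, in $O(n)$ time, a system of $O(n)$ linear constraints on $\mathcal C$ (inequalities $f(c)\ge 0$ or equations $f(c)=0$, where $f$ is a linear functional on $\mathcal C$ plus a constant) whose solution set is $M$ and in which no constraint is redundant, that is, omitting any one of them changes the solution set. The algorithm and the constants in $O(n)$ depend only on $k$. -/

import Mathlib

open scoped Pointwise ENNReal
open MeasureTheory

/-! ### Convex polygons, placements and the overlap area -/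

/-- The plane `ℝ²`; `volume` on it is two-dimensional Lebesgue measure. -/
abbrev Plane : Type := ℝ × ℝ

/-- Twice the signed area of the triangle `p q r`; it is positive iff `p`, `q`, `r` make a left
turn. -/
def orient (p q r : Plane) : ℝ :=
  (q.1 - p.1) * (r.2 - p.2) - (q.2 - p.2) * (r.1 - p.1)

/-- A convex polygon, given by the list of its (at least three) vertices in counterclockwise order.
A list of points is the counterclockwise list of the vertices of a convex polygon with nonempty
interior iff any three of the points, taken in the order of the list, make a left turn. -/
structure ConvexPolygon where
  /-- the number of vertices -/
  size : ℕ
  /-- the vertices -/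
  vertex : Fin size → Plane
  three_le_size : 3 ≤ size
  counterclockwise : ∀ a b c : Fin size, a < b → b < c →
    0 < orient (vertex a) (vertex b) (vertex c)

/-- The closed region bounded by the polygon. -/
def ConvexPolygon.region (P : ConvexPolygon) : Set Plane :=
  convexHull ℝ (Set.range P.vertex)

/-- The total number `n` of vertices. -/
def totalVertices {k : ℕ} (P : Fin k → ConvexPolygon) : ℕ := ∑ i, (P i).size

/-- The subspace `{(x, …, x)}` of `(ℝ²)ᵏ`. -/
def diagonal (k : ℕ) : Submodule ℝ (Fin k → Plane) :=
  LinearMap.range (LinearMap.pi fun _ : Fin k => (LinearMap.id : Plane →ₗ[ℝ] Plane))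

/-- The configuration space `(ℝ²)ᵏ / {(x, …, x)}`; its elements are the placements. -/
abbrev Config (k : ℕ) : Type := (Fin k → Plane) ⧸ diagonal k

/-- The placement `(v₀; …; vₖ₋₁)` of a tuple of translations: the quotient map. -/
def toConfig {k : ℕ} (v : Fin k → Plane) : Config k := (diagonal k).mkQ v

/-- `(P₀ + v₀) ∩ … ∩ (Pₖ₋₁ + vₖ₋₁)`. -/
def overlap {k : ℕ} (P : Fin k → ConvexPolygon) (v : Fin k → Plane) : Set Plane :=
  ⋂ i, (v i +ᵥ (P i).region)

theorem overlap_add_const {k : ℕ} (P : Fin k → ConvexPolygon) (v : Fin k → Plane) (x : Plane) :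
    overlap P (fun i => x + v i) = x +ᵥ overlap P v := by
  ext y
  simp only [overlap, Set.mem_iInter, Set.mem_vadd_set_iff_neg_vadd_mem, vadd_eq_add, neg_add_rev,
    add_assoc]

theorem volume_overlap_congr {k : ℕ} (P : Fin k → ConvexPolygon) (v w : Fin k → Plane)
    (h : -v + w ∈ diagonal k) : volume (overlap P v) = volume (overlap P w) := by
  obtain ⟨x, hx⟩ := h
  have hw : w = fun i => x + v i := by
    funext i
    have := congrFun hx i
    simp only [LinearMap.pi_apply, LinearMap.id_apply, Pi.add_apply, Pi.neg_apply] at this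
    rw [this]; abel
  rw [hw, overlap_add_const, measure_vadd]

/-- The overlap area `Π` as a function on the configuration space. -/
noncomputable def overlapArea {k : ℕ} (P : Fin k → ConvexPolygon) (c : Config k) : ℝ≥0∞ :=
  Quotient.liftOn' c (fun v => volume (overlap P v)) fun v w h =>
    volume_overlap_congr P v w (QuotientAddGroup.leftRel_apply.mp h)

/-- The set `M` of all placements that maximize the overlap area. -/
def maximizers {k : ℕ} (P : Fin k → ConvexPolygon) : Set (Config k) :=
  {c | ∀ c', overlapArea P c' ≤ overlapArea P c}

/-- The Minkowski difference `A - B = {x | x + B ⊆ A}`. -/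
def minkowskiDiff (A B : Set Plane) : Set Plane := {x | x +ᵥ B ⊆ A}

/-- The product over `i` of the Minkowski differences `(-Pᵢ) - (-I)`; the `i`-th factor is the set
of all `x` with `I ⊆ x + Pᵢ`. -/
def differenceProduct {k : ℕ} (P : Fin k → ConvexPolygon) (I : Set Plane) :
    Set (Fin k → Plane) :=
  Set.univ.pi fun i => minkowskiDiff (-(P i).region) (-I)

/-- A linear constraint on placements: `functional c + const ≥ 0`, or `functional c + const = 0`
if `isEquality` is true. -/
structure LinearConstraint (k : ℕ) where
  functional : Config k →ₗ[ℝ] ℝ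
  const : ℝ
  isEquality : Bool

/-- The placement `c` satisfies the constraint. -/
def LinearConstraint.Holds {k : ℕ} (L : LinearConstraint k) (c : Config k) : Prop :=
  match L.isEquality with
  | true => L.functional c + L.const = 0
  | false => 0 ≤ L.functional c + L.const

/-- The system of constraints `L` describes the set `S`. -/
def Describes {k m : ℕ} (L : Fin m → LinearConstraint k) (S : Set (Config k)) : Prop :=
  {c | ∀ j, (L j).Holds c} = S

/-- No constraint of the system is redundant: dropping any one of them changes the solution
set. -/
def Irredundant {k m : ℕ} (L : Fin m → LinearConstraint k) : Prop :=
  ∀ j, {c | ∀ j', j' ≠ j → (L j').Holds c} ≠ {c | ∀ j', (L j').Holds c}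

/-! ### The real RAM

A program works on arrays of natural numbers and arrays of real numbers.  The name of an array is a
literal of the program, so a program uses finitely many of them; an index into an array is
computed, so there is random access.  On natural numbers there are `+`, truncated `-`, `<`, `=`; on
real numbers there are exact `+`, `-`, `×`, `/`, `<`, `=`.  Each operation, each literal, each
access to memory and each control step takes one unit of time. -/

namespace RealRAM

/-- The contents of the memory: cell `i` of array `a`. -/
structure State where
  int : ℕ → ℕ → ℕ
  real : ℕ → ℕ → ℝ

/-- Expressions for natural numbers. -/
inductive IntExpr where
  | lit (n : ℕ)
  | cell (array : ℕ) (index : IntExpr)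
  | add (e f : IntExpr)
  | sub (e f : IntExpr)

def IntExpr.eval (s : State) : IntExpr → ℕ
  | lit n => n
  | cell a e => s.int a (e.eval s)
  | add e f => e.eval s + f.eval s
  | sub e f => e.eval s - f.eval s

/-- The time to evaluate an expression. -/
def IntExpr.time : IntExpr → ℕ
  | lit _ => 1
  | cell _ e => e.time + 1
  | add e f => e.time + f.time + 1
  | sub e f => e.time + f.time + 1

/-- Expressions for real numbers; the only constants are rational. -/
inductive RealExpr where
  | lit (q : ℚ)
  | cell (array : ℕ) (index : IntExpr)
  | add (e f : RealExpr)
  | sub (e f : RealExpr)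
  | mul (e f : RealExpr)
  | div (e f : RealExpr)

/-- The value of an expression.  A quotient by zero has the value zero (a program can test for it
beforehand). -/
noncomputable def RealExpr.eval (s : State) : RealExpr → ℝ
  | lit q => (q : ℝ)
  | cell a e => s.real a (e.eval s)
  | add e f => e.eval s + f.eval s
  | sub e f => e.eval s - f.eval s
  | mul e f => e.eval s * f.eval s
  | div e f => e.eval s / f.eval s

def RealExpr.time : RealExpr → ℕ
  | lit _ => 1
  | cell _ e => e.time + 1
  | add e f => e.time + f.time + 1
  | sub e f => e.time + f.time + 1
  | mul e f => e.time + f.time + 1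
  | div e f => e.time + f.time + 1

/-- Tests. -/
inductive Test where
  | intLt (e f : IntExpr)
  | intEq (e f : IntExpr)
  | realLt (e f : RealExpr)
  | realEq (e f : RealExpr)
  | not (b : Test)
  | and (b c : Test)

def Test.Holds (s : State) : Test → Prop
  | intLt e f => e.eval s < f.eval s
  | intEq e f => e.eval s = f.eval s
  | realLt e f => e.eval s < f.eval s
  | realEq e f => e.eval s = f.eval s
  | not b => ¬ b.Holds s
  | and b c => b.Holds s ∧ c.Holds s

def Test.time : Test → ℕ
  | intLt e f => e.time + f.time + 1
  | intEq e f => e.time + f.time + 1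
  | realLt e f => e.time + f.time + 1
  | realEq e f => e.time + f.time + 1
  | not b => b.time + 1
  | and b c => b.time + c.time + 1

/-- Programs. -/
inductive Program where
  | skip
  | setInt (array : ℕ) (index value : IntExpr)
  | setReal (array : ℕ) (index : IntExpr) (value : RealExpr)
  | seq (p q : Program)
  | cond (b : Test) (p q : Program)
  | loop (b : Test) (p : Program)

/-- The memory after writing `x` to cell `i` of the integer array `a`. -/
def State.writeInt (s : State) (a i x : ℕ) : State :=
  { s with int := Function.update s.int a (Function.update (s.int a) i x) }

/-- The memory after writing `x` to cell `i` of the real array `a`. -/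
def State.writeReal (s : State) (a i : ℕ) (x : ℝ) : State :=
  { s with real := Function.update s.real a (Function.update (s.real a) i x) }

/-- `Runs p s s' t`: started with memory `s`, the program `p` halts after `t` units of time with
memory `s'`.  (`cond b p q` runs `p` if `b` holds and `q` otherwise; `loop b p` repeats `p` as long
as `b` holds.) -/
inductive Runs : Program → State → State → ℕ → Prop where
  | skip (s : State) : Runs .skip s s 1
  | setInt (s : State) (a : ℕ) (e f : IntExpr) :
      Runs (.setInt a e f) s (s.writeInt a (e.eval s) (f.eval s)) (e.time + f.time + 1)
  | setReal (s : State) (a : ℕ) (e : IntExpr) (f : RealExpr) :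
      Runs (.setReal a e f) s (s.writeReal a (e.eval s) (f.eval s)) (e.time + f.time + 1)
  | seq {p q : Program} {s s₁ s₂ : State} {t₁ t₂ : ℕ} :
      Runs p s s₁ t₁ → Runs q s₁ s₂ t₂ → Runs (.seq p q) s s₂ (t₁ + t₂)
  | cond_true {b : Test} {p q : Program} {s s' : State} {t : ℕ} :
      b.Holds s → Runs p s s' t → Runs (.cond b p q) s s' (b.time + 1 + t)
  | cond_false {b : Test} {p q : Program} {s s' : State} {t : ℕ} :
      ¬ b.Holds s → Runs q s s' t → Runs (.cond b p q) s s' (b.time + 1 + t)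
  | loop_true {b : Test} {p : Program} {s s₁ s₂ : State} {t₁ t₂ : ℕ} :
      b.Holds s → Runs p s s₁ t₁ → Runs (.loop b p) s₁ s₂ t₂ →
      Runs (.loop b p) s s₂ (b.time + 1 + t₁ + t₂)
  | loop_false {b : Test} {p : Program} {s : State} :
      ¬ b.Holds s → Runs (.loop b p) s s (b.time + 1)

end RealRAM

/-! ### Input and output -/

/-- The sequence `x₀, y₀, x₁, y₁, …` of the coordinates of finitely many points, continued by
zeros. -/
def coordinates {m : ℕ} (f : Fin m → Plane) (c : ℕ) : ℝ :=
  if h : c / 2 < m then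
    if c % 2 = 0 then (f ⟨c / 2, h⟩).1 else (f ⟨c / 2, h⟩).2
  else 0

/-- The memory at the start.  Integer array `0` holds the numbers of vertices of `P₀, …, Pₖ₋₁`.
Real array `0` holds the coordinates of `v₀, …, vₖ₋₁`, and real array `i + 1` holds the coordinates
of the vertices of `Pᵢ` in counterclockwise order.  All other cells hold zero. -/
noncomputable def inputState {k : ℕ} (P : Fin k → ConvexPolygon) (v : Fin k → Plane) :
    RealRAM.State where
  int a c := if h : a = 0 ∧ c < k then (P ⟨c, h.2⟩).size else 0
  real a c :=
    if a = 0 then coordinates v c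
    else if h : a - 1 < k then coordinates (P ⟨a - 1, h⟩).vertex c
    else 0

/-- The memory `s` holds the system `L` of `m` linear constraints.  Integer array `1` holds the
number `m`, followed for each constraint by a `1` if it is an equality and a `0` if it is an
inequality.  Cells `2 j` and `2 j + 1` of real array `k + 1 + i` hold the two coefficients of `vᵢ`
in the `j`-th constraint, and cell `j` of real array `2 k + 1` holds its constant term. -/
def Outputs {k m : ℕ} (s : RealRAM.State) (L : Fin m → LinearConstraint k) : Prop :=
  s.int 1 0 = m ∧
  ∀ j : Fin m,
    s.int 1 (j + 1) = (if (L j).isEquality then 1 else 0) ∧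
    (∀ v : Fin k → Plane, (L j).functional (toConfig v) =
      ∑ i : Fin k, (s.real (k + 1 + i) (2 * j) * (v i).1 +
        s.real (k + 1 + i) (2 * j + 1) * (v i).2)) ∧
    s.real (2 * k + 1) j = (L j).const

/-! Geometry. Let `v` be maximal with overlap `I`. For another maximal `w`, convexity of the
polygons puts the midpoint of a point of `I(v)` and a point of `I(w)` into `I((v+w)/2)`, whose area
is no larger. This is the equality case of the Brunn–Minkowski inequality, so `I(w) = d + I(v)` for
some `d` (`exists_vadd_eq_of_midpoints`), and `-d + w` is a representative of the same placement
that lies in `N`. The representative is unique, because a compact set of positive area is not a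
proper translate of itself. Together this is `bijOn_toConfig`. The equality case is proved by
transport: vertical lines that cut off equal areas of the two bodies are matched, and the gap
between the arithmetic and the harmonic mean of the section lengths must vanish
(`translate_of_lintegral_midpoint_le`). Hence in every direction the projections are translates of
each other, by the component of the difference of the centroids, and a separation argument finishes.

Constraints. The sides of the translated polygons are half-planes with normals `m g` and constants
`c g`, for `g < n`, and `I` is their intersection. Let `S g` be `c g` minus the maximum of `m g` on
`I`. With `y i = v i - x i`, the `i`-th factor of `N` becomes the set of all `y` with `m g · y ≤ S
g` for the sides `g` of the `i`-th polygon (`mem_maximizers_iff`). This set contains `0`, and its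
shape is read off from the normals with `S g = 0`. If they positively span the plane, the set is a
point, described by two equations. If consecutive ones leave an angle of exactly `π`, it is a
segment, described by one equation and two inequalities. Otherwise it has interior points, and its
essential sides describe it. The three cases are `localSystem_point`, `localSystem_segment` and
`localSystem_polygon`.

Elimination. A placement of `w` is maximal iff a single vector `u` makes all `v i - w i - u` satisfy
these systems. Injectivity of `π` on `N` means that the factors have no common direction of motion,
so two of the equations have independent normals (`exists_equation`). They determine `u`.
Substituting it into the other constraints gives functionals on the configuration space, and
irredundancy survives (`Gauge.exists_translate_iff`, `Gauge.exists_only_violated`).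

Linear time. From the lexicographically smallest vertex on, the normals of a polygon are sorted by
angle, so `k` merges sort all of them, keeping the tighter one of two half-planes with the same
direction. Implied half-planes are removed from the cyclic list by comparing entries with their
neighbours. Local strictness all around implies global irredundancy (`StrictChain.slack_nonneg`),
and a potential bounds the number of steps (`trim_ensures`). The slacks `S g` are found by turning
the list of sides of `I` at most `k + 1` times while the sides of all polygons are visited in order
of direction (`Locating.lt`). Everything else is a bounded number of linear scans. There are at most
`n + 2k` constraints before the elimination, and `n ≥ 1` makes this `O(n)`.

Programs are verified with weakest preconditions for loop-free code, invariants with a decreasing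
measure for loops, and the notion `Triple`, whose time constant is uniform in all inputs. -/

set_option linter.unusedSimpArgs false

/-! ### Transport between one-dimensional densities -/

/-- The quantile function of a positive continuous density on an interval. -/
theorem exists_quantile {f : ℝ → ℝ} {a b A : ℝ} (hab : a < b) (hc : ContinuousOn f (Set.Ioo a b))
    (hpos : ∀ x ∈ Set.Ioo a b, 0 < f x) (hi : IntegrableOn f (Set.Ioo a b))
    (hA : ∫ x in Set.Ioo a b, f x = A) :
    ∃ X : ℝ → ℝ, StrictMonoOn X (Set.Ioo 0 A) ∧ X '' Set.Ioo 0 A = Set.Ioo a b ∧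
      ∀ t ∈ Set.Ioo 0 A, HasDerivAt X (f (X t))⁻¹ t := by
  have hii : IntervalIntegrable f volume a b := by
    rw [intervalIntegrable_iff_integrableOn_Ioo_of_le hab.le]; exact hi
  -- The quantile function will be the inverse of this primitive, which maps `(a, b)` increasingly
  -- onto `(0, A)`.
  set F : ℝ → ℝ := fun x => ∫ t in a..x, f t with hF
  have hderiv : ∀ x ∈ Set.Ioo a b, HasDerivAt F (f x) x := by
    intro x hx
    apply intervalIntegral.integral_hasDerivAt_right
    · exact hii.mono_set (by rw [Set.uIcc_of_le hx.1.le, Set.uIcc_of_le hab.le]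
                             exact Set.Icc_subset_Icc_right hx.2.le)
    · exact hc.stronglyMeasurableAtFilter isOpen_Ioo x hx
    · exact hc.continuousAt (isOpen_Ioo.mem_nhds hx)
  have hcont : ContinuousOn F (Set.Icc a b) := by
    have := intervalIntegral.continuousOn_primitive_interval (f := f) (μ := volume) (a := a) (b := b)
      (by rw [Set.uIcc_of_le hab.le, integrableOn_Icc_iff_integrableOn_Ioo]; exact hi)
    rwa [Set.uIcc_of_le hab.le] at this
  have hmono : StrictMonoOn F (Set.Icc a b) := by
    apply strictMonoOn_of_deriv_pos (convex_Icc a b) hcont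
    intro x hx
    rw [interior_Icc] at hx
    rw [(hderiv x hx).deriv]
    exact hpos x hx
  have hFa : F a = 0 := by simp [hF]
  have hFb : F b = A := by
    rw [← hA, hF]
    simp only
    rw [intervalIntegral.integral_of_le hab.le, integral_Ioc_eq_integral_Ioo]
  have himg : F '' Set.Ioo a b = Set.Ioo 0 A := by
    apply Set.Subset.antisymm
    · rintro _ ⟨x, hx, rfl⟩
      rw [← hFa, ← hFb]
      exact ⟨hmono ⟨le_rfl, hab.le⟩ ⟨hx.1.le, hx.2.le⟩ hx.1,
        hmono ⟨hx.1.le, hx.2.le⟩ ⟨hab.le, le_rfl⟩ hx.2⟩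
    · rw [← hFa, ← hFb]
      exact intermediate_value_Ioo hab.le hcont
  have hinj : Set.InjOn F (Set.Ioo a b) := (hmono.mono Set.Ioo_subset_Icc_self).injOn
  set X := Function.invFunOn F (Set.Ioo a b) with hX
  have hXm : ∀ t ∈ Set.Ioo 0 A, X t ∈ Set.Ioo a b := by
    intro t ht; rw [← himg] at ht; exact Function.invFunOn_mem ht
  have hXe : ∀ t ∈ Set.Ioo 0 A, F (X t) = t := by
    intro t ht; rw [← himg] at ht; exact Function.invFunOn_eq ht
  have hXs : StrictMonoOn X (Set.Ioo 0 A) := by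
    intro s hs t ht hst
    rw [← hXe s hs, ← hXe t ht] at hst
    exact (hmono.lt_iff_lt (Set.Ioo_subset_Icc_self (hXm s hs))
      (Set.Ioo_subset_Icc_self (hXm t ht))).1 hst
  have hXi : X '' Set.Ioo 0 A = Set.Ioo a b := by
    apply Set.Subset.antisymm
    · rintro _ ⟨t, ht, rfl⟩; exact hXm t ht
    · intro x hx
      have hFx : F x ∈ Set.Ioo 0 A := himg ▸ Set.mem_image_of_mem F hx
      exact ⟨F x, hFx, hinj (hXm _ hFx) hx (hXe _ hFx)⟩
  refine ⟨X, hXs, hXi, fun t ht => ?_⟩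
  have hnh : Set.Ioo 0 A ∈ nhds t := isOpen_Ioo.mem_nhds ht
  refine HasDerivAt.of_local_left_inverse ?_ (hderiv _ (hXm t ht)) (hpos _ (hXm t ht)).ne' ?_
  -- A monotone function whose image is an interval has no jumps.
  · apply hXs.continuousAt_of_image_mem_nhds hnh
    rw [hXi]; exact isOpen_Ioo.mem_nhds (hXm t ht)
  · filter_upwards [hnh] with s hs using hXe s hs

/-- Equality case of the one-dimensional transport inequality. -/
theorem translate_of_lintegral_midpoint_le {f g : ℝ → ℝ} {h : ℝ → ℝ≥0∞} {a b c d A : ℝ}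
    (hab : a < b) (hcd : c < d)
    (hfc : ContinuousOn f (Set.Ioo a b)) (hfp : ∀ x ∈ Set.Ioo a b, 0 < f x)
    (hfi : IntegrableOn f (Set.Ioo a b)) (hfA : ∫ x in Set.Ioo a b, f x = A)
    (hgc : ContinuousOn g (Set.Ioo c d)) (hgp : ∀ x ∈ Set.Ioo c d, 0 < g x)
    (hgi : IntegrableOn g (Set.Ioo c d)) (hgA : ∫ x in Set.Ioo c d, g x = A)
    (hmid : ∀ x ∈ Set.Ioo a b, ∀ y ∈ Set.Ioo c d, ENNReal.ofReal ((f x + g y) / 2) ≤ h ((x + y) / 2))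
    (hh : ∫⁻ z, h z ≤ ENNReal.ofReal A) :
    ∃ e, c = a + e ∧ d = b + e ∧ ∀ x ∈ Set.Ioo a b, g (x + e) = f x := by
  obtain ⟨X, hXs, hXi, hXd⟩ := exists_quantile hab hfc hfp hfi hfA
  obtain ⟨Y, hYs, hYi, hYd⟩ := exists_quantile hcd hgc hgp hgi hgA
  have hA : 0 < A := by
    by_contra hA
    rw [Set.Ioo_eq_empty (by linarith), Set.image_empty] at hXi
    exact (Set.nonempty_Ioo.2 hab).ne_empty hXi.symm
  have hXm : ∀ t ∈ Set.Ioo 0 A, X t ∈ Set.Ioo a b := fun t ht => hXi ▸ Set.mem_image_of_mem X ht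
  have hYm : ∀ t ∈ Set.Ioo 0 A, Y t ∈ Set.Ioo c d := fun t ht => hYi ▸ Set.mem_image_of_mem Y ht
  have hXc : ContinuousOn X (Set.Ioo 0 A) := fun t ht => (hXd t ht).continuousAt.continuousWithinAt
  have hYc : ContinuousOn Y (Set.Ioo 0 A) := fun t ht => (hYd t ht).continuousAt.continuousWithinAt
  set u : ℝ → ℝ := fun t => f (X t) with hu
  set w : ℝ → ℝ := fun t => g (Y t) with hw
  have hup : ∀ t ∈ Set.Ioo 0 A, 0 < u t := fun t ht => hfp _ (hXm t ht)
  have hwp : ∀ t ∈ Set.Ioo 0 A, 0 < w t := fun t ht => hgp _ (hYm t ht)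
  have huc : ContinuousOn u (Set.Ioo 0 A) := hfc.comp hXc hXm
  have hwc : ContinuousOn w (Set.Ioo 0 A) := hgc.comp hYc hYm
  -- `X t` and `Y t` cut off the same mass `t`. The substitution `z = Z t` bounds the integral of
  -- `h` from below by an integral over `(0, A)`.
  set Z : ℝ → ℝ := fun t => (X t + Y t) / 2 with hZ
  set Z' : ℝ → ℝ := fun t => ((u t)⁻¹ + (w t)⁻¹) / 2 with hZ'
  have hZd : ∀ t ∈ Set.Ioo 0 A, HasDerivWithinAt Z (Z' t) (Set.Ioo 0 A) t := fun t ht =>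
    (((hXd t ht).add (hYd t ht)).div_const 2).hasDerivWithinAt
  have hZinj : Set.InjOn Z (Set.Ioo 0 A) := by
    have : StrictMonoOn Z (Set.Ioo 0 A) := by
      intro s hs t ht hst
      have h1 := hXs hs ht hst
      have h2 := hYs hs ht hst
      simp only [hZ]; linarith
    exact this.injOn
  have hcv := lintegral_image_eq_lintegral_abs_deriv_mul measurableSet_Ioo hZd hZinj h
  -- The product of `(1/u + 1/w)/2`, the speed of `Z`, and `(u + w)/2`, the lower bound for `h`, is
  -- `1 + ψ`. The excess `ψ` vanishes only where `u = w`.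
  set ψ : ℝ → ℝ := fun t => (u t - w t) ^ 2 / (4 * (u t * w t)) with hψ
  have hψ0 : ∀ t ∈ Set.Ioo 0 A, 0 ≤ ψ t := fun t ht => by
    have := hup t ht; have := hwp t ht; simp only [hψ]; positivity
  have hle : ∫⁻ t in Set.Ioo 0 A, (1 + ENNReal.ofReal (ψ t)) ≤ ENNReal.ofReal A := by
    calc ∫⁻ t in Set.Ioo 0 A, (1 + ENNReal.ofReal (ψ t))
        ≤ ∫⁻ t in Set.Ioo 0 A, ENNReal.ofReal |Z' t| * h (Z t) := by
          apply setLIntegral_mono' measurableSet_Ioo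
          intro t ht
          have h1 := hup t ht
          have h2 := hwp t ht
          have h3 : 0 < Z' t := by simp only [hZ']; positivity
          calc 1 + ENNReal.ofReal (ψ t) = ENNReal.ofReal (1 + ψ t) := by
                rw [ENNReal.ofReal_add zero_le_one (hψ0 t ht), ENNReal.ofReal_one]
            _ = ENNReal.ofReal (|Z' t| * ((u t + w t) / 2)) := by
                rw [abs_of_pos h3]
                congr 1
                simp only [hψ, hZ']
                field_simp
                ring
            _ = ENNReal.ofReal |Z' t| * ENNReal.ofReal ((u t + w t) / 2) :=
                ENNReal.ofReal_mul (abs_nonneg _)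
            _ ≤ _ := by gcongr; exact hmid _ (hXm t ht) _ (hYm t ht)
      _ = ∫⁻ z in Z '' Set.Ioo 0 A, h z := hcv.symm
      _ ≤ ∫⁻ z, h z := setLIntegral_le_lintegral _ _
      _ ≤ ENNReal.ofReal A := hh
  have hψc : ContinuousOn ψ (Set.Ioo 0 A) := by
    apply ContinuousOn.div ((huc.sub hwc).pow 2) (continuousOn_const.mul (huc.mul hwc))
    intro t ht
    exact (mul_pos four_pos (mul_pos (hup t ht) (hwp t ht))).ne'
  rw [lintegral_add_left measurable_const, setLIntegral_one, Real.volume_Ioo, sub_zero] at hle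
  -- The summand `1` already uses up the whole bound `A`, which is finite.
  have hzero : ∫⁻ t in Set.Ioo 0 A, ENNReal.ofReal (ψ t) = 0 := by
    by_contra hne
    exact absurd hle (not_le.2 (ENNReal.lt_add_right ENNReal.ofReal_ne_top hne))
  have hae : ψ =ᵐ[volume.restrict (Set.Ioo 0 A)] 0 := by
    have hm : AEMeasurable (fun t => ENNReal.ofReal (ψ t)) (volume.restrict (Set.Ioo 0 A)) :=
      ENNReal.measurable_ofReal.comp_aemeasurable (hψc.aemeasurable measurableSet_Ioo)
    have h1 := (lintegral_eq_zero_iff' hm).1 hzero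
    filter_upwards [h1, ae_restrict_mem measurableSet_Ioo] with t ht htm
    have : ENNReal.ofReal (ψ t) = 0 := ht
    exact le_antisymm (ENNReal.ofReal_eq_zero.1 this) (hψ0 t htm)
  -- So far `ψ` vanishes almost everywhere; continuity makes this everywhere on the open interval.
  have heq : ∀ t ∈ Set.Ioo 0 A, u t = w t := by
    intro t ht
    have h0 := Measure.eqOn_open_of_ae_eq hae isOpen_Ioo hψc continuousOn_const ht
    have h1 := hup t ht; have h2 := hwp t ht
    simp only [hψ, Pi.zero_apply, div_eq_zero_iff] at h0
    rcases h0 with h0 | h0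
    · exact sub_eq_zero.1 (pow_eq_zero_iff two_ne_zero |>.1 h0)
    · exact absurd h0 (mul_pos four_pos (mul_pos h1 h2)).ne'
  -- `X` and `Y` now have the same derivative `1/u = 1/w`, so they differ by a constant.
  obtain ⟨e, he⟩ : ∃ e, ∀ t ∈ Set.Ioo 0 A, Y t - X t = e := by
    apply isOpen_Ioo.exists_is_const_of_deriv_eq_zero isPreconnected_Ioo
    · intro t ht
      exact ((hYd t ht).sub (hXd t ht)).differentiableAt.differentiableWithinAt
    · intro t ht
      have := ((hYd t ht).sub (hXd t ht)).deriv
      have h2 : deriv (fun t => Y t - X t) t = 0 := by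
        rw [show (fun t => Y t - X t) = Y - X from rfl, this]
        have := heq t ht; simp only [hu, hw] at this
        rw [this]; simp
      exact h2
  have himg : Set.Ioo c d = Set.Ioo (a + e) (b + e) := by
    rw [← hYi, show Set.Ioo (a + e) (b + e) = (fun x => x + e) '' Set.Ioo a b by simp, ← hXi,
      Set.image_image]
    apply Set.image_congr
    intro t ht; linarith [he t ht]
  refine ⟨e, ?_, ?_, ?_⟩
  · rw [← csInf_Ioo hcd, himg, csInf_Ioo (by linarith)]
  · rw [← csSup_Ioo hcd, himg, csSup_Ioo (by linarith)]
  · intro x hx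
    obtain ⟨t, ht, rfl⟩ : x ∈ X '' Set.Ioo 0 A := hXi.symm ▸ hx
    rw [show X t + e = Y t by linarith [he t ht]]
    exact (heq t ht).symm

/-! ### Sections of convex bodies in the plane -/

/-- The length of the vertical section of a planar set. -/
noncomputable def sectionLength (K : Set Plane) (x : ℝ) : ℝ := volume.real (Prod.mk x ⁻¹' K)

theorem volume_eq_lintegral_section {K : Set Plane} (hK : MeasurableSet K) :
    volume K = ∫⁻ x, volume (Prod.mk x ⁻¹' K) := by
  rw [Measure.volume_eq_prod, Measure.prod_apply hK]

theorem section_eq_Icc {K : Set Plane} (hK : IsCompact K) (hc : Convex ℝ K) {x : ℝ}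
    (hx : x ∈ Prod.fst '' K) : ∃ l u, l ≤ u ∧ Prod.mk x ⁻¹' K = Set.Icc l u := by
  have h1 : IsCompact (Prod.mk x ⁻¹' K) := by
    have : Prod.mk x ⁻¹' K = Prod.snd '' (K ∩ Prod.fst ⁻¹' {x}) := by
      ext y
      constructor
      · intro hy; exact ⟨(x, y), ⟨hy, rfl⟩, rfl⟩
      · rintro ⟨⟨x', y'⟩, ⟨hy, hx'⟩, rfl⟩
        simp only [Set.mem_preimage, Set.mem_singleton_iff] at hx'
        subst hx'; exact hy
    rw [this]
    exact (hK.inter_right (isClosed_singleton.preimage continuous_fst)).image continuous_snd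
  have h2 : Convex ℝ (Prod.mk x ⁻¹' K) := by
    intro y hy z hz α β hα hβ hαβ
    have := hc hy hz hα hβ hαβ
    simp only [Set.mem_preimage]
    convert this using 1
    ext <;> simp [← add_mul, hαβ]
  have h3 : (Prod.mk x ⁻¹' K).Nonempty := by
    obtain ⟨⟨x', y⟩, hy, rfl⟩ := hx; exact ⟨y, hy⟩
  have h4 := eq_Icc_of_connected_compact ⟨h3, h2.isPreconnected⟩ h1
  refine ⟨_, _, ?_, h4⟩
  rw [h4] at h3
  exact Set.nonempty_Icc.1 h3

theorem sectionLength_of_eq_Icc {K : Set Plane} {x l u : ℝ} (hlu : l ≤ u)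
    (h : Prod.mk x ⁻¹' K = Set.Icc l u) : sectionLength K x = u - l := by
  rw [sectionLength, h, Real.volume_real_Icc_of_le hlu]

theorem volume_section {K : Set Plane} (hK : IsCompact K) (hc : Convex ℝ K) (x : ℝ) :
    volume (Prod.mk x ⁻¹' K) = ENNReal.ofReal (sectionLength K x) := by
  suffices h : volume (Prod.mk x ⁻¹' K) ≠ ⊤ by rw [sectionLength, ofReal_measureReal h]
  by_cases hx : x ∈ Prod.fst '' K
  · obtain ⟨l, u, -, h⟩ := section_eq_Icc hK hc hx
    rw [h, Real.volume_Icc]; exact ENNReal.ofReal_ne_top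
  · have : Prod.mk x ⁻¹' K = ∅ := by
      ext y; simp only [Set.mem_preimage, Set.mem_empty_iff_false, iff_false]
      intro hy; exact hx ⟨_, hy, rfl⟩
    rw [this]; simp

theorem sectionLength_of_notMem {K : Set Plane} {x : ℝ} (hx : x ∉ Prod.fst '' K) :
    sectionLength K x = 0 := by
  have : Prod.mk x ⁻¹' K = ∅ := by
    ext y; simp only [Set.mem_preimage, Set.mem_empty_iff_false, iff_false]
    intro hy; exact hx ⟨_, hy, rfl⟩
  rw [sectionLength, this]; simp

/-- A convex combination of two sections is contained in the section over the combined abscissa;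
comparing the upper and the lower ends gives concavity. -/
theorem concaveOn_sectionLength {K : Set Plane} (hK : IsCompact K) (hc : Convex ℝ K) :
    ConcaveOn ℝ (Prod.fst '' K) (sectionLength K) := by
  have hconv : Convex ℝ (Prod.fst '' K) := hc.linear_image (LinearMap.fst ℝ ℝ ℝ)
  refine ⟨hconv, ?_⟩
  intro x hx y hy α β hα hβ hαβ
  obtain ⟨l, u, hlu, h⟩ := section_eq_Icc hK hc hx
  obtain ⟨l', u', hlu', h'⟩ := section_eq_Icc hK hc hy
  obtain ⟨l'', u'', hlu'', h''⟩ := section_eq_Icc hK hc (hconv hx hy hα hβ hαβ)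
  rw [sectionLength_of_eq_Icc hlu h, sectionLength_of_eq_Icc hlu' h',
    sectionLength_of_eq_Icc hlu'' h'']
  have key : ∀ s ∈ Set.Icc l u, ∀ t ∈ Set.Icc l' u', α * s + β * t ∈ Set.Icc l'' u'' := by
    intro s hs t ht
    rw [← h] at hs; rw [← h'] at ht; rw [← h'']
    exact hc hs ht hα hβ hαβ
  have h1 := (key u ⟨hlu, le_rfl⟩ u' ⟨hlu', le_rfl⟩).2
  have h2 := (key l ⟨le_rfl, hlu⟩ l' ⟨le_rfl, hlu'⟩).1
  simp only [smul_eq_mul]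
  nlinarith

/-- The section lengths of a planar convex body form a positive continuous density. -/
theorem sectionLength_profile {K : Set Plane} (hK : IsCompact K) (hc : Convex ℝ K)
    (hv : 0 < volume K) :
    ∃ a b, a < b ∧ Prod.fst '' K = Set.Icc a b ∧
      ContinuousOn (sectionLength K) (Set.Ioo a b) ∧
      (∀ x ∈ Set.Ioo a b, 0 < sectionLength K x) ∧
      IntegrableOn (sectionLength K) (Set.Ioo a b) ∧
      ∫ x in Set.Ioo a b, sectionLength K x = volume.real K := by
  have hne : K.Nonempty := nonempty_of_measure_ne_zero hv.ne'
  have hI := eq_Icc_of_connected_compact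
    ⟨hne.image Prod.fst, (hc.linear_image (LinearMap.fst ℝ ℝ ℝ)).isPreconnected⟩
    (hK.image continuous_fst)
  set a := sInf (Prod.fst '' K)
  set b := sSup (Prod.fst '' K)
  have hf0 : ∀ x, 0 ≤ sectionLength K x := fun x => measureReal_nonneg
  have hout : ∀ x, x ∉ Set.Icc a b → sectionLength K x = 0 := by
    intro x hx; rw [← hI] at hx; exact sectionLength_of_notMem hx
  have hvol : volume K = ∫⁻ x, ENNReal.ofReal (sectionLength K x) := by
    rw [volume_eq_lintegral_section hK.measurableSet]
    simp_rw [volume_section hK hc]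
  have hvol' : volume K = ∫⁻ x in Set.Ioo a b, ENNReal.ofReal (sectionLength K x) := by
    rw [hvol, ← setLIntegral_congr Ioo_ae_eq_Icc.symm, ← lintegral_indicator measurableSet_Icc]
    congr 1; ext x
    by_cases hx : x ∈ Set.Icc a b
    · rw [Set.indicator_of_mem hx]
    · rw [Set.indicator_of_notMem hx, hout x hx]; simp
  have hab : a < b := by
    by_contra hab
    rw [Set.Ioo_eq_empty hab] at hvol'
    simp at hvol'; exact hv.ne' hvol'
  have hconc := concaveOn_sectionLength hK hc
  have hcont : ContinuousOn (sectionLength K) (Set.Ioo a b) := by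
    have := hconc.continuousOn_interior
    rwa [hI, interior_Icc] at this
  rw [hI] at hconc
  have hpos : ∀ x ∈ Set.Ioo a b, 0 < sectionLength K x := by
    obtain ⟨x₀, hx₀, hp⟩ : ∃ x₀ ∈ Set.Ioo a b, 0 < sectionLength K x₀ := by
      by_contra hno
      push Not at hno
      have : ∫⁻ x in Set.Ioo a b, ENNReal.ofReal (sectionLength K x) = 0 := by
        rw [setLIntegral_congr_fun measurableSet_Ioo
          (g := fun _ => 0) (fun x hx => ENNReal.ofReal_eq_zero.2 (hno x hx))]
        simp
      exact hv.ne' (hvol'.trans this)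
    intro x hx
    -- Every interior point lies strictly between `x₀` and an end of the interval, or is `x₀`.
    -- Concavity carries the positive value at `x₀` to it.
    obtain ⟨z, hz, hzx⟩ : ∃ z ∈ Set.Icc a b, x ∈ openSegment ℝ x₀ z ∨ x = x₀ := by
      rcases lt_trichotomy x x₀ with h | h | h
      · exact ⟨a, ⟨le_rfl, hab.le⟩, Or.inl (by
          rw [openSegment_symm, openSegment_eq_Ioo (by linarith [hx.1])]; exact ⟨hx.1, h⟩)⟩
      · exact ⟨a, ⟨le_rfl, hab.le⟩, Or.inr h⟩
      · exact ⟨b, ⟨hab.le, le_rfl⟩, Or.inl (by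
          rw [openSegment_eq_Ioo (by linarith [hx.2])]; exact ⟨h, hx.2⟩)⟩
    rcases hzx with ⟨α, β, hα, hβ, hαβ, rfl⟩ | rfl
    · have h1 := hconc.2 (Set.Ioo_subset_Icc_self hx₀) hz hα.le hβ.le hαβ
      simp only [smul_eq_mul] at h1 ⊢
      have := hf0 z
      have : 0 < α * sectionLength K x₀ := mul_pos hα hp
      have : 0 ≤ β * sectionLength K z := mul_nonneg hβ.le (hf0 z)
      linarith
    · exact hp
  have hfin : volume K ≠ ⊤ := hK.measure_lt_top.ne
  have hm : AEStronglyMeasurable (sectionLength K) (volume.restrict (Set.Ioo a b)) :=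
    hcont.aestronglyMeasurable measurableSet_Ioo
  have hint : IntegrableOn (sectionLength K) (Set.Ioo a b) := by
    refine ⟨hm, ?_⟩
    rw [hasFiniteIntegral_iff_ofReal (Filter.Eventually.of_forall hf0), ← hvol']
    exact hfin.lt_top
  refine ⟨a, b, hab, hI, hcont, hpos, hint, ?_⟩
  rw [integral_eq_lintegral_of_nonneg_ae (Filter.Eventually.of_forall hf0) hm, ← hvol']
  rfl

/-- This is Fubini's theorem. It expresses the translation between two projections by first moments,
which depend linearly on the direction of projection. -/
theorem setIntegral_fst {K : Set Plane} (hK : IsCompact K) :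
    Integrable (fun x => x * sectionLength K x) ∧
      ∫ p in K, p.1 = ∫ x, x * sectionLength K x := by
  have hi : Integrable (K.indicator (fun p : Plane => p.1)) (volume.prod volume) := by
    rw [← Measure.volume_eq_prod, integrable_indicator_iff hK.measurableSet]
    exact continuous_fst.continuousOn.integrableOn_compact hK
  have hin : ∀ x : ℝ, ∫ y, K.indicator (fun p : Plane => p.1) (x, y) = x * sectionLength K x := by
    intro x
    have : (fun y => K.indicator (fun p : Plane => p.1) (x, y)) =
        (Prod.mk x ⁻¹' K).indicator (fun _ => x) := by
      ext y; rfl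
    rw [this, integral_indicator_const _ (measurable_prodMk_left hK.measurableSet), sectionLength,
      smul_eq_mul, mul_comm]
  constructor
  · have := hi.integral_prod_left
    simpa only [hin] using this
  · rw [← integral_indicator hK.measurableSet, Measure.volume_eq_prod, integral_prod _ hi]
    simp only [hin]

/-- Equality in the Brunn–Minkowski inequality for two planar bodies of the same area: first
coordinates agree up to a translation, which is determined by the first moments. -/
theorem fst_image_eq_of_midpoints {K L R : Set Plane} (hK : IsCompact K) (hKc : Convex ℝ K)
    (hL : IsCompact L) (hLc : Convex ℝ L) (hR : MeasurableSet R) (hv : 0 < volume K)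
    (hKL : volume L = volume K) (hRK : volume R ≤ volume K)
    (hmid : ∀ p ∈ K, ∀ q ∈ L, (2⁻¹ : ℝ) • (p + q) ∈ R) :
    ∃ e, Prod.fst '' L = (fun x => x + e) '' (Prod.fst '' K) ∧
      ∫ p in L, p.1 = (∫ p in K, p.1) + volume.real K * e := by
  obtain ⟨a, b, hab, hI, hfc, hfp, hfi, hfA⟩ := sectionLength_profile hK hKc hv
  obtain ⟨c, d, hcd, hJ, hgc, hgp, hgi, hgA⟩ := sectionLength_profile hL hLc (hKL ▸ hv)
  have hKL' : volume.real L = volume.real K := by simp only [measureReal_def, hKL]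
  rw [hKL'] at hgA
  obtain ⟨e, hc, hd, hg⟩ := translate_of_lintegral_midpoint_le
    (h := fun z => volume (Prod.mk z ⁻¹' R)) hab hcd hfc hfp hfi hfA hgc hgp hgi hgA
    (by
      intro x hx y hy
      obtain ⟨l, u, hlu, h⟩ := section_eq_Icc hK hKc (hI ▸ Set.Ioo_subset_Icc_self hx)
      obtain ⟨l', u', hlu', h'⟩ := section_eq_Icc hL hLc (hJ ▸ Set.Ioo_subset_Icc_self hy)
      rw [sectionLength_of_eq_Icc hlu h, sectionLength_of_eq_Icc hlu' h']
      -- The average of the two section intervals is an interval whose length is the mean of their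
      -- lengths.
      have hsub : Set.Icc ((l + l') / 2) ((u + u') / 2) ⊆ Prod.mk ((x + y) / 2) ⁻¹' R := by
        intro z hz
        obtain ⟨s, hs, t, ht, hst⟩ : ∃ s ∈ Set.Icc l u, ∃ t ∈ Set.Icc l' u', s + t = 2 * z := by
          have : 2 * z ∈ Set.Icc l u + Set.Icc l' u' := by
            rw [Set.Icc_add_Icc hlu hlu']
            constructor <;> linarith [hz.1, hz.2]
          obtain ⟨s, hs, t, ht, hst⟩ := this
          exact ⟨s, hs, t, ht, hst⟩
        rw [← h] at hs; rw [← h'] at ht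
        have := hmid _ hs _ ht
        have e1 : ((x + y) / 2, z) = (2⁻¹ : ℝ) • ((x, s) + (y, t) : Plane) := by
          refine Prod.ext ?_ ?_
          · simp only [Prod.smul_fst, Prod.fst_add, smul_eq_mul]; ring
          · simp only [Prod.smul_snd, Prod.snd_add, smul_eq_mul, hst]; ring
        rw [Set.mem_preimage, e1]; exact this
      calc ENNReal.ofReal ((u - l + (u' - l')) / 2)
          = volume (Set.Icc ((l + l') / 2) ((u + u') / 2)) := by
            rw [Real.volume_Icc]; congr 1; ring
        _ ≤ _ := measure_mono hsub)
    (by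
      rw [← volume_eq_lintegral_section hR]
      rw [measureReal_def, ENNReal.ofReal_toReal hK.measure_lt_top.ne]; exact hRK)
  refine ⟨e, ?_, ?_⟩
  · rw [hI, hJ, hc, hd]; simp
  · obtain ⟨hi1, hi2⟩ := setIntegral_fst hK
    obtain ⟨-, hi3⟩ := setIntegral_fst hL
    have hKint : Integrable (sectionLength K) := by
      have h0 : IntegrableOn (sectionLength K) (Set.Icc a b) :=
        (integrableOn_Icc_iff_integrableOn_Ioo).2 hfi
      rw [← integrable_indicator_iff measurableSet_Icc] at h0
      have h1 : (Set.Icc a b).indicator (sectionLength K) = sectionLength K := by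
        apply Set.indicator_eq_self.2
        intro x hx
        by_contra hx'
        rw [← hI] at hx'
        exact hx (sectionLength_of_notMem hx')
      rwa [h1] at h0
    have hKA : ∫ x, sectionLength K x = volume.real K := by
      rw [← hfA, ← integral_Icc_eq_integral_Ioo, setIntegral_eq_integral_of_forall_compl_eq_zero]
      intro x hx; rw [← hI] at hx; exact sectionLength_of_notMem hx
    -- Over the two ends of the projection the section lengths need not agree, but these form a null
    -- set.
    have hae : ∀ᵐ x : ℝ, sectionLength L (x + e) = sectionLength K x := by
      have h1 : ∀ᵐ x : ℝ, x ≠ a := Measure.ae_ne volume a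
      have h2 : ∀ᵐ x : ℝ, x ≠ b := Measure.ae_ne volume b
      filter_upwards [h1, h2] with x hxa hxb
      by_cases hx : x ∈ Set.Ioo a b
      · exact hg x hx
      · have hx' : x ∉ Set.Icc a b := fun h =>
          hx ⟨lt_of_le_of_ne h.1 (Ne.symm hxa), lt_of_le_of_ne h.2 hxb⟩
        have hx2 : x + e ∉ Set.Icc c d := by
          rw [hc, hd]; intro h; exact hx' ⟨by linarith [h.1], by linarith [h.2]⟩
        rw [← hI] at hx'; rw [← hJ] at hx2
        rw [sectionLength_of_notMem hx', sectionLength_of_notMem hx2]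
    rw [hi2, hi3, ← integral_add_right_eq_self _ e]
    rw [← hKA, ← integral_mul_const, ← integral_add hi1 (hKint.mul_const e)]
    apply integral_congr_ae
    filter_upwards [hae] with x hx
    rw [hx]; ring

/-- The rotation with cosine `p` and sine `-q`. -/
noncomputable def planeRotation (p q : ℝ) (h : p ^ 2 + q ^ 2 = 1) : Plane ≃L[ℝ] Plane :=
  LinearEquiv.toContinuousLinearEquiv
    { toFun := fun x => (p * x.1 + q * x.2, -q * x.1 + p * x.2)
      invFun := fun x => (p * x.1 - q * x.2, q * x.1 + p * x.2)
      map_add' := fun x y => by ext <;> simp <;> ring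
      map_smul' := fun c x => by ext <;> simp <;> ring
      left_inv := fun x => by
        ext
        · simp only; linear_combination x.1 * h
        · simp only; linear_combination x.2 * h
      right_inv := fun x => by
        ext
        · simp only; linear_combination x.1 * h
        · simp only; linear_combination x.2 * h }

theorem planeRotation_apply (p q : ℝ) (h : p ^ 2 + q ^ 2 = 1) (x : Plane) :
    planeRotation p q h x = (p * x.1 + q * x.2, -q * x.1 + p * x.2) := rfl

theorem measurePreserving_planeRotation (p q : ℝ) (h : p ^ 2 + q ^ 2 = 1) :
    MeasurePreserving (planeRotation p q h) := by
  refine ⟨(planeRotation p q h).continuous.measurable, ?_⟩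
  have hT : ((planeRotation p q h : Plane ≃L[ℝ] Plane) : Plane → Plane) =
      Matrix.toLin (Module.Basis.finTwoProd ℝ) (Module.Basis.finTwoProd ℝ) !![p, q; -q, p] := by
    ext x <;> simp [Matrix.toLin_finTwoProd, planeRotation_apply]
  have hd : LinearMap.det (Matrix.toLin (Module.Basis.finTwoProd ℝ) (Module.Basis.finTwoProd ℝ)
      !![p, q; -q, p]) = 1 := by
    rw [LinearMap.det_toLin, Matrix.det_fin_two_of]; linarith
  rw [hT, Measure.map_linearMap_addHaar_eq_smul_addHaar _ (by rw [hd]; exact one_ne_zero), hd]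
  simp

/-- Equality in the Brunn–Minkowski inequality for two planar convex bodies of the same area: they
are translates of each other. -/
theorem exists_vadd_eq_of_midpoints {K L R : Set Plane} (hK : IsCompact K) (hKc : Convex ℝ K)
    (hL : IsCompact L) (hLc : Convex ℝ L) (hR : MeasurableSet R) (hv : 0 < volume K)
    (hKL : volume L = volume K) (hRK : volume R ≤ volume K)
    (hmid : ∀ p ∈ K, ∀ q ∈ L, (2⁻¹ : ℝ) • (p + q) ∈ R) : ∃ d : Plane, L = d +ᵥ K := by
  have hA : 0 < volume.real K := ENNReal.toReal_pos hv.ne' hK.measure_lt_top.ne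
  -- The difference of the centroids. Since moments are linear, the translation between the
  -- projections in the direction `(p, q)` is the inner product of `(p, q)` with this one vector.
  set d : Plane := ((volume.real K)⁻¹ * ((∫ p in L, p.1) - ∫ p in K, p.1),
    (volume.real K)⁻¹ * ((∫ p in L, p.2) - ∫ p in K, p.2)) with hd
  have hint : ∀ S : Set Plane, IsCompact S → IntegrableOn (fun p : Plane => p.1) S ∧
      IntegrableOn (fun p : Plane => p.2) S := fun S hS =>
    ⟨continuous_fst.continuousOn.integrableOn_compact hS,
      continuous_snd.continuousOn.integrableOn_compact hS⟩
  have hunit : ∀ p q : ℝ, p ^ 2 + q ^ 2 = 1 →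
      (fun x : Plane => p * x.1 + q * x.2) '' L =
        (fun x : Plane => p * (d + x).1 + q * (d + x).2) '' K := by
    intro p q h
    set T := planeRotation p q h with hT
    have hmp := measurePreserving_planeRotation p q h
    have hme : MeasurableEmbedding T := T.toHomeomorph.measurableEmbedding
    have hvol : ∀ S : Set Plane, volume (T '' S) = volume S := by
      intro S
      rw [← hmp.measure_preimage_emb hme, Set.preimage_image_eq _ T.injective]
    have hfst : ∀ S : Set Plane, Prod.fst '' (T '' S) = (fun x : Plane => p * x.1 + q * x.2) '' S := by
      intro S; rw [Set.image_image]; rfl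
    have hmom : ∀ S : Set Plane, IsCompact S → ∫ x in T '' S, x.1 =
        p * (∫ x in S, x.1) + q * ∫ x in S, x.2 := by
      intro S hS
      rw [hmp.setIntegral_image_emb hme]
      simp only [planeRotation_apply]
      rw [integral_add ((hint S hS).1.const_mul p) ((hint S hS).2.const_mul q),
        integral_const_mul, integral_const_mul]
    obtain ⟨e, he1, he2⟩ := fst_image_eq_of_midpoints (K := T '' K) (L := T '' L) (R := T '' R)
      (hK.image T.continuous) (hKc.linear_image (T : Plane →ₗ[ℝ] Plane)) (hL.image T.continuous)
      (hLc.linear_image (T : Plane →ₗ[ℝ] Plane)) (hme.measurableSet_image.2 hR)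
      (by rwa [hvol]) (by rw [hvol, hvol, hKL]) (by rw [hvol, hvol]; exact hRK)
      (by
        rintro _ ⟨x, hx, rfl⟩ _ ⟨y, hy, rfl⟩
        exact ⟨_, hmid x hx y hy, by rw [map_smul, map_add]⟩)
    rw [hmom L hL, hmom K hK, measureReal_def, hvol, ← measureReal_def] at he2
    have he : e = p * d.1 + q * d.2 := by
      simp only [hd]
      field_simp
      linarith
    rw [hfst, hfst, Set.image_image] at he1
    rw [he1]
    apply Set.image_congr
    intro x _
    rw [he]; simp only [Prod.fst_add, Prod.snd_add]; ring
  -- Functionals that are not of length one are rescaled; the zero functional only needs both sets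
  -- to be nonempty.
  have hlin : ∀ p q : ℝ, (fun x : Plane => p * x.1 + q * x.2) '' L =
        (fun x : Plane => p * (d + x).1 + q * (d + x).2) '' K := by
    intro p q
    by_cases h0 : p ^ 2 + q ^ 2 = 0
    · have hp : p = 0 := by nlinarith [sq_nonneg p, sq_nonneg q]
      have hq : q = 0 := by nlinarith [sq_nonneg p, sq_nonneg q]
      have hKn : K.Nonempty := nonempty_of_measure_ne_zero hv.ne'
      have hLn : L.Nonempty := nonempty_of_measure_ne_zero (by rw [hKL]; exact hv.ne')
      simp [hp, hq, hKn, hLn]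
    · set r := Real.sqrt (p ^ 2 + q ^ 2) with hr
      have hpos : 0 < p ^ 2 + q ^ 2 := lt_of_le_of_ne (by positivity) (Ne.symm h0)
      have hr0 : 0 < r := Real.sqrt_pos.2 hpos
      have hr2 : r ^ 2 = p ^ 2 + q ^ 2 := Real.sq_sqrt hpos.le
      have := hunit (p / r) (q / r) (by field_simp; linarith)
      have h2 := congrArg (Set.image (fun x => r * x)) this
      rw [Set.image_image, Set.image_image] at h2
      convert h2 using 2
      · field_simp
      · field_simp
  -- A closed convex set is determined by its images under all linear functionals.
  have hsep : ∀ S S' : Set Plane, Convex ℝ S' → IsClosed S' →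
      (∀ p q : ℝ, (fun x : Plane => p * x.1 + q * x.2) '' S ⊆
        (fun x : Plane => p * x.1 + q * x.2) '' S') → S ⊆ S' := by
    intro S S' hc hcl hss x hx
    by_contra hx'
    obtain ⟨f, u, hf, hfx⟩ := geometric_hahn_banach_closed_point hc hcl hx'
    have hfe : ∀ y : Plane, f y = f (1, 0) * y.1 + f (0, 1) * y.2 := by
      intro y
      have : y = y.1 • ((1 : ℝ), (0 : ℝ)) + y.2 • ((0 : ℝ), (1 : ℝ)) := by ext <;> simp
      conv_lhs => rw [this]
      rw [map_add, map_smul, map_smul]; simp only [smul_eq_mul]; ring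
    obtain ⟨y, hy, hyx⟩ := hss (f (1, 0)) (f (0, 1)) ⟨x, hx, rfl⟩
    have h1 := hf y hy
    simp only at hyx
    rw [hfe] at h1 hfx
    linarith
  have himg : ∀ p q : ℝ, (fun x : Plane => p * x.1 + q * x.2) '' L =
      (fun x : Plane => p * x.1 + q * x.2) '' (d +ᵥ K) := by
    intro p q
    rw [hlin p q, ← Set.image_vadd, Set.image_image]
    rfl
  refine ⟨d, Set.Subset.antisymm ?_ ?_⟩
  · exact hsep _ _ (hKc.vadd d) (hK.vadd d).isClosed fun p q => (himg p q).subset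
  · exact hsep _ _ hLc hL.isClosed fun p q => (himg p q).symm.subset

/-! ### Directions in the plane -/

def dot (a b : Plane) : ℝ := a.1 * b.1 + a.2 * b.2

def cross (a b : Plane) : ℝ := a.1 * b.2 - a.2 * b.1

theorem dot_add (a b c : Plane) : dot a (b + c) = dot a b + dot a c := by simp [dot]; ring
theorem dot_sub (a b c : Plane) : dot a (b - c) = dot a b - dot a c := by simp [dot]; ring
theorem dot_smul (a : Plane) (r : ℝ) (b : Plane) : dot a (r • b) = r * dot a b := by
  simp [dot]; ring
theorem dot_self_pos {a : Plane} (h : a ≠ 0) : 0 < dot a a := by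
  have : a.1 ≠ 0 ∨ a.2 ≠ 0 := by
    by_contra hc; push Not at hc; exact h (Prod.ext hc.1 hc.2)
  unfold dot
  rcases this with h | h
  · nlinarith [mul_self_pos.2 h, mul_self_nonneg a.2]
  · nlinarith [mul_self_pos.2 h, mul_self_nonneg a.1]

/-- The nonzero vector `a` points in the direction with angle `θ`. -/
def HasAngle (a : Plane) (θ : ℝ) : Prop := ∃ r > 0, a = (r * Real.cos θ, r * Real.sin θ)

noncomputable def angle (a : Plane) : ℝ := Complex.arg ⟨a.1, a.2⟩

theorem hasAngle_angle {a : Plane} (h : a ≠ 0) : HasAngle a (angle a) := by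
  have hz : (⟨a.1, a.2⟩ : ℂ) ≠ 0 := by
    intro h0; apply h
    exact Prod.ext (congrArg Complex.re h0) (congrArg Complex.im h0)
  refine ⟨‖(⟨a.1, a.2⟩ : ℂ)‖, norm_pos_iff.2 hz, ?_⟩
  rw [angle, Complex.norm_mul_cos_arg, Complex.norm_mul_sin_arg]

theorem HasAngle.ne_zero {a : Plane} {α : ℝ} (h : HasAngle a α) : a ≠ 0 := by
  obtain ⟨r, hr, rfl⟩ := h
  intro h0
  have h1 := congrArg Prod.fst h0
  have h2 := congrArg Prod.snd h0
  simp [hr.ne'] at h1 h2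
  have := Real.sin_sq_add_cos_sq α
  rw [h1, h2] at this; norm_num at this

theorem HasAngle.add_int_mul {a : Plane} {α : ℝ} (h : HasAngle a α) (z : ℤ) :
    HasAngle a (α + z * (2 * Real.pi)) := by
  obtain ⟨r, hr, rfl⟩ := h
  exact ⟨r, hr, by rw [Real.cos_add_int_mul_two_pi, Real.sin_add_int_mul_two_pi]⟩

theorem HasAngle.cross_eq {a b : Plane} {α β : ℝ} (ha : HasAngle a α) (hb : HasAngle b β) :
    ∃ r > 0, cross a b = r * Real.sin (β - α) := by
  obtain ⟨r, hr, rfl⟩ := ha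
  obtain ⟨s, hs, rfl⟩ := hb
  exact ⟨r * s, by positivity, by simp only [cross, Real.sin_sub]; ring⟩

theorem HasAngle.dot_eq {a b : Plane} {α β : ℝ} (ha : HasAngle a α) (hb : HasAngle b β) :
    ∃ r > 0, dot a b = r * Real.cos (β - α) := by
  obtain ⟨r, hr, rfl⟩ := ha
  obtain ⟨s, hs, rfl⟩ := hb
  exact ⟨r * s, by positivity, by simp only [dot, Real.cos_sub]; ring⟩

theorem HasAngle.cross_pos {a b : Plane} {α β : ℝ} (ha : HasAngle a α) (hb : HasAngle b β)
    (h1 : α < β) (h2 : β < α + Real.pi) : 0 < cross a b := by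
  obtain ⟨r, hr, h⟩ := ha.cross_eq hb
  rw [h]; exact mul_pos hr (Real.sin_pos_of_pos_of_lt_pi (by linarith) (by linarith))

theorem HasAngle.cross_neg {a b : Plane} {α β : ℝ} (ha : HasAngle a α) (hb : HasAngle b β)
    (h1 : α + Real.pi < β) (h2 : β < α + 2 * Real.pi) : cross a b < 0 := by
  obtain ⟨r, hr, h⟩ := ha.cross_eq hb
  have : Real.sin (β - α) = Real.sin (β - α - 2 * Real.pi) := (Real.sin_sub_two_pi _).symm
  rw [h, this]
  exact mul_neg_of_pos_of_neg hr (Real.sin_neg_of_neg_of_neg_pi_lt (by linarith) (by linarith))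

theorem HasAngle.cross_eq_zero_of_eq {a b : Plane} {α : ℝ} (ha : HasAngle a α)
    (hb : HasAngle b α) : cross a b = 0 := by
  obtain ⟨r, hr, h⟩ := ha.cross_eq hb
  rw [h, sub_self, Real.sin_zero, mul_zero]

theorem HasAngle.cross_eq_zero_of_add_pi {a b : Plane} {α : ℝ} (ha : HasAngle a α)
    (hb : HasAngle b (α + Real.pi)) : cross a b = 0 := by
  obtain ⟨r, hr, h⟩ := ha.cross_eq hb
  rw [h, add_sub_cancel_left, Real.sin_pi, mul_zero]

theorem HasAngle.lt_of_cross_pos {a b : Plane} {α β : ℝ} (ha : HasAngle a α) (hb : HasAngle b β)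
    (h : 0 < cross a b) (h2 : β < α + 2 * Real.pi) : β < α + Real.pi := by
  by_contra hc
  rcases (not_lt.1 hc).lt_or_eq with hlt | heq
  · exact absurd h (not_lt.2 (ha.cross_neg hb hlt h2).le)
  · rw [ha.cross_eq_zero_of_add_pi (heq ▸ hb)] at h; exact lt_irrefl _ h

/-- The vectors with angle in `(0, π]`. -/
def InUpperHalf (a : Plane) : Prop := 0 < a.2 ∨ (a.2 = 0 ∧ a.1 < 0)

theorem inUpperHalf_iff {a : Plane} : InUpperHalf a ↔ 0 < angle a := by
  unfold InUpperHalf angle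
  constructor
  · rintro (h | ⟨h1, h2⟩)
    · have h1 : 0 ≤ Complex.arg ⟨a.1, a.2⟩ := Complex.arg_nonneg_iff.2 h.le
      rcases h1.lt_or_eq with h2 | h2
      · exact h2
      · have := (Complex.arg_eq_zero_iff.1 h2.symm).2
        simp at this; exact absurd this h.ne'
    · rw [Complex.arg_eq_pi_iff.2 ⟨h2, h1⟩]; exact Real.pi_pos
  · intro h
    have h1 : 0 ≤ a.2 := Complex.arg_nonneg_iff.1 h.le
    rcases h1.lt_or_eq with h2 | h2
    · exact Or.inl h2
    · refine Or.inr ⟨h2.symm, ?_⟩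
      by_contra hc
      have : Complex.arg ⟨a.1, a.2⟩ = 0 := Complex.arg_eq_zero_iff.2 ⟨not_lt.1 hc, h2.symm⟩
      rw [this] at h; exact lt_irrefl _ h

theorem angle_le_pi (a : Plane) : angle a ≤ Real.pi := Complex.arg_le_pi _
theorem neg_pi_lt_angle (a : Plane) : -Real.pi < angle a := Complex.neg_pi_lt_arg _

/-- The comparison of angles by the signs of coordinates and of a cross product. -/
theorem angle_lt_iff {a b : Plane} (ha : a ≠ 0) (hb : b ≠ 0) :
    angle a < angle b ↔
      (¬ InUpperHalf a ∧ InUpperHalf b) ∨ ((InUpperHalf a ↔ InUpperHalf b) ∧ 0 < cross a b) := by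
  have hA := hasAngle_angle ha
  have hB := hasAngle_angle hb
  have p1 := angle_le_pi a
  have p2 := angle_le_pi b
  have p3 := neg_pi_lt_angle a
  have p4 := neg_pi_lt_angle b
  rw [inUpperHalf_iff, inUpperHalf_iff]
  -- Two angles in the same one of the half-turns `(-π, 0]` and `(0, π]` differ by less than `π`, so
  -- the sign of the cross product orders them.
  have key : ∀ {a b : Plane}, HasAngle a (angle a) → HasAngle b (angle b) → (0 < angle a ↔ 0 < angle b) →
      angle a < angle b → 0 < cross a b := by
    intro a b hA hB hiff hlt
    refine hA.cross_pos hB hlt ?_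
    by_cases h : 0 < angle a
    · linarith [angle_le_pi b]
    · have := hiff.not.1 h; linarith [neg_pi_lt_angle a]
  constructor
  · intro h
    by_cases h1 : 0 < angle a
    · have h2 : 0 < angle b := h1.trans h
      exact Or.inr ⟨⟨fun _ => h2, fun _ => h1⟩, key hA hB ⟨fun _ => h2, fun _ => h1⟩ h⟩
    · by_cases h2 : 0 < angle b
      · exact Or.inl ⟨h1, h2⟩
      · exact Or.inr ⟨⟨fun h => absurd h h1, fun h => absurd h h2⟩,
          key hA hB ⟨fun h => absurd h h1, fun h => absurd h h2⟩ h⟩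
  · rintro (⟨h1, h2⟩ | ⟨h1, h2⟩)
    · linarith
    · rcases lt_trichotomy (angle a) (angle b) with h | h | h
      · exact h
      · rw [hA.cross_eq_zero_of_eq (h ▸ hB)] at h2; exact absurd h2 (lt_irrefl _)
      · have := key hB hA h1.symm h
        have h3 : cross b a = - cross a b := by unfold cross; ring
        linarith

/-! ### The boundary of a convex polygon -/

theorem orient_rotate (p q r : Plane) : orient p q r = orient q r p := by unfold orient; ring

namespace ConvexPolygon

theorem size_pos (P : ConvexPolygon) : 0 < P.size := by have := P.three_le_size; omega

/-- The vertices, continued periodically. -/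
def cyc (P : ConvexPolygon) (t : ℕ) : Plane := P.vertex ⟨t % P.size, Nat.mod_lt _ P.size_pos⟩

theorem cyc_add_size (P : ConvexPolygon) (t : ℕ) : P.cyc (t + P.size) = P.cyc t := by
  simp [cyc]

theorem cyc_of_lt (P : ConvexPolygon) {t : ℕ} (h : t < P.size) : P.cyc t = P.vertex ⟨t, h⟩ := by
  simp [cyc, Nat.mod_eq_of_lt h]

/-- This moves a vertex into the period that starts at `s`, where the order of indices decides
orientations. -/
theorem vertex_eq_cyc (P : ConvexPolygon) (s : ℕ) (j : Fin P.size) :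
    ∃ t, s ≤ t ∧ t < s + P.size ∧ P.vertex j = P.cyc t := by
  have h0 := P.size_pos
  refine ⟨s + (j + P.size - s % P.size) % P.size, by omega,
    by have := Nat.mod_lt (j + P.size - s % P.size) h0; omega, ?_⟩
  rw [cyc]
  congr 1
  ext
  simp only
  rw [Nat.add_mod_mod]
  have h1 := Nat.mod_lt s h0
  have h2 : s + (j + P.size - s % P.size) = j + P.size * (1 + s / P.size) := by
    have := Nat.mod_add_div s P.size
    rw [mul_add]; omega
  rw [h2, Nat.add_mul_mod_self_left, Nat.mod_eq_of_lt j.2]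

/-- After a common multiple of the period is subtracted, at most `c`, or `b` and `c`, lie beyond the
first period. Reducing them gives a cyclic rotation of an increasing triple, and `orient` is
invariant under rotation. -/
theorem orient_cyc_pos (P : ConvexPolygon) {a b c : ℕ} (hab : a < b) (hbc : b < c)
    (hca : c < a + P.size) : 0 < orient (P.cyc a) (P.cyc b) (P.cyc c) := by
  have h0 := P.size_pos
  have ha := Nat.mod_lt a h0
  obtain ⟨q, a', ha', rfl⟩ : ∃ q a', a' < P.size ∧ a = a' + P.size * q :=
    ⟨a / P.size, a % P.size, ha, (Nat.mod_add_div a P.size).symm⟩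
  have hmod : ∀ t u, t = u + P.size * q → P.cyc t = P.cyc u := by
    rintro _ u rfl; simp [cyc]
  obtain ⟨b', rfl⟩ : ∃ b', b = b' + P.size * q := ⟨b - P.size * q, by omega⟩
  obtain ⟨c', rfl⟩ : ∃ c', c = c' + P.size * q := ⟨c - P.size * q, by omega⟩
  rw [hmod _ a' rfl, hmod _ b' rfl, hmod _ c' rfl, P.cyc_of_lt ha']
  by_cases hb : b' < P.size
  · rw [P.cyc_of_lt hb]
    by_cases hc : c' < P.size
    · rw [P.cyc_of_lt hc]
      exact P.counterclockwise _ _ _ (by simp only [Fin.mk_lt_mk]; omega)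
        (by simp only [Fin.mk_lt_mk]; omega)
    · obtain ⟨c'', rfl⟩ : ∃ c'', c' = c'' + P.size := ⟨c' - P.size, by omega⟩
      rw [P.cyc_add_size, P.cyc_of_lt (by omega : c'' < P.size), ← orient_rotate]
      exact P.counterclockwise _ _ _ (by simp only [Fin.mk_lt_mk]; omega)
        (by simp only [Fin.mk_lt_mk]; omega)
  · obtain ⟨b'', rfl⟩ : ∃ b'', b' = b'' + P.size := ⟨b' - P.size, by omega⟩
    obtain ⟨c'', rfl⟩ : ∃ c'', c' = c'' + P.size := ⟨c' - P.size, by omega⟩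
    rw [P.cyc_add_size, P.cyc_add_size, P.cyc_of_lt (by omega : c'' < P.size),
      P.cyc_of_lt (by omega : b'' < P.size), orient_rotate]
    exact P.counterclockwise _ _ _ (by simp only [Fin.mk_lt_mk]; omega)
        (by simp only [Fin.mk_lt_mk]; omega)

theorem orient_cyc_nonneg (P : ConvexPolygon) (t : ℕ) (j : Fin P.size) :
    0 ≤ orient (P.cyc t) (P.cyc (t + 1)) (P.vertex j) := by
  obtain ⟨u, hu1, hu2, hu⟩ := P.vertex_eq_cyc t j
  rw [hu]
  rcases hu1.lt_or_eq with h | rfl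
  · rcases (Nat.succ_le_of_lt h).lt_or_eq with h | rfl
    · exact (P.orient_cyc_pos (Nat.lt_succ_self t) h hu2).le
    · unfold orient; apply le_of_eq; ring
  · unfold orient; apply le_of_eq; ring

/-- The polygon is the intersection of the half-planes to the left of its sides. -/
theorem mem_region_iff (P : ConvexPolygon) (q : Plane) :
    q ∈ P.region ↔ ∀ t, 0 ≤ orient (P.cyc t) (P.cyc (t + 1)) q := by
  constructor
  · intro hq t
    have hconv : Convex ℝ {x : Plane | 0 ≤ orient (P.cyc t) (P.cyc (t + 1)) x} := by
      intro x hx y hy α β hα hβ hαβ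
      have e : orient (P.cyc t) (P.cyc (t + 1)) (α • x + β • y) =
          α * orient (P.cyc t) (P.cyc (t + 1)) x + β * orient (P.cyc t) (P.cyc (t + 1)) y := by
        have : β = 1 - α := by linarith
        subst this
        simp only [orient, Prod.fst_add, Prod.snd_add, Prod.smul_fst, Prod.smul_snd, smul_eq_mul]
        ring
      simp only [Set.mem_ofPred_eq] at hx hy ⊢
      rw [e]; positivity
    exact convexHull_min (by rintro _ ⟨j, rfl⟩; exact P.orient_cyc_nonneg t j) hconv hq
  · intro h
    have h3 := P.three_le_size
    -- The polygon is cut into the fan of triangles at vertex `0`. The sign of `g j` tells on which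
    -- side of the ray through vertex `j` the point lies. A change of sign between `j` and `j + 1`
    -- puts it into the triangle `0, j, j + 1`, whose areas supply barycentric coordinates.
    set g : ℕ → ℝ := fun j => orient (P.cyc 0) (P.cyc j) q with hg
    have hg1 : 0 ≤ g 1 := h 0
    have hgm : g (P.size - 1) ≤ 0 := by
      have h1 := h (P.size - 1)
      rw [Nat.sub_add_cancel (by omega : 1 ≤ P.size)] at h1
      have h2 : P.cyc P.size = P.cyc 0 := by have := P.cyc_add_size 0; rwa [zero_add] at this
      rw [h2] at h1
      simp only [hg]
      have : orient (P.cyc 0) (P.cyc (P.size - 1)) q = - orient (P.cyc (P.size - 1)) (P.cyc 0) q := by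
        unfold orient; ring
      linarith
    obtain ⟨j, hj1, hj2, hj3, hj4⟩ : ∃ j, 1 ≤ j ∧ j + 1 < P.size ∧ 0 ≤ g j ∧ g (j + 1) ≤ 0 := by
      by_contra hno
      push Not at hno
      have : ∀ j, 1 ≤ j → j < P.size → 0 ≤ g j ∧ (1 < j → 0 < g j) := by
        intro j hj
        induction j, hj using Nat.le_induction with
        | base => intro _; exact ⟨hg1, fun h => absurd h (lt_irrefl _)⟩
        | succ j hj ih =>
          intro hlt
          have := hno j hj hlt (ih (by omega)).1
          exact ⟨this.le, fun _ => this⟩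
      have := (this (P.size - 1) (by omega) (by omega)).2 (by omega)
      linarith
    have hD : 0 < orient (P.cyc 0) (P.cyc j) (P.cyc (j + 1)) :=
      P.orient_cyc_pos (by omega) (by omega) (by omega)
    have hα := h j
    set D := orient (P.cyc 0) (P.cyc j) (P.cyc (j + 1)) with hDdef
    have hmem : ∀ t, P.cyc t ∈ P.region := fun t => subset_convexHull ℝ _ ⟨_, rfl⟩
    have hcomb : q = (orient (P.cyc j) (P.cyc (j + 1)) q / D) • P.cyc 0 +
        (-g (j + 1) / D) • P.cyc j + (g j / D) • P.cyc (j + 1) := by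
      ext
      · simp only [Prod.fst_add, Prod.smul_fst, smul_eq_mul]
        field_simp
        simp only [hDdef, hg, orient]; ring
      · simp only [Prod.snd_add, Prod.smul_snd, smul_eq_mul]
        field_simp
        simp only [hDdef, hg, orient]; ring
    rw [hcomb]
    have hc : Convex ℝ P.region := convex_convexHull ℝ _
    set w : Fin 3 → ℝ := ![orient (P.cyc j) (P.cyc (j + 1)) q / D, -g (j + 1) / D, g j / D] with hw
    set z : Fin 3 → Plane := ![P.cyc 0, P.cyc j, P.cyc (j + 1)] with hz
    have hw0 : ∀ i ∈ Finset.univ, 0 ≤ w i := by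
      intro i _
      fin_cases i
      · exact div_nonneg hα hD.le
      · exact div_nonneg (by linarith) hD.le
      · exact div_nonneg hj3 hD.le
    have hw1 : ∑ i, w i = 1 := by
      rw [Fin.sum_univ_three]
      change orient (P.cyc j) (P.cyc (j + 1)) q / D + -g (j + 1) / D + g j / D = 1
      field_simp
      simp only [hDdef, hg, orient]; ring
    have hz0 : ∀ i ∈ Finset.univ, z i ∈ P.region := by
      intro i _
      fin_cases i
      · exact hmem _
      · exact hmem _
      · exact hmem _
    have := hc.sum_mem hw0 hw1 hz0
    rwa [Fin.sum_univ_three] at this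

/-- The outer normal vector of the side that starts at the vertex with index `t`; it has the length of
the side. -/
def normal (P : ConvexPolygon) (t : ℕ) : Plane :=
  ((P.cyc (t + 1)).2 - (P.cyc t).2, (P.cyc t).1 - (P.cyc (t + 1)).1)

theorem orient_eq_dot (P : ConvexPolygon) (t : ℕ) (q : Plane) :
    orient (P.cyc t) (P.cyc (t + 1)) q = dot (P.normal t) (P.cyc t) - dot (P.normal t) q := by
  unfold orient dot normal; ring

theorem normal_add_size (P : ConvexPolygon) (t : ℕ) : P.normal (t + P.size) = P.normal t := by
  rw [normal, normal, add_right_comm, P.cyc_add_size, P.cyc_add_size]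

/-- By periodicity one round of sides suffices, from any side on. The freedom in `s` allows the
round to begin at the lexicographically smallest vertex. -/
theorem mem_region_iff_dot (P : ConvexPolygon) (s : ℕ) (q : Plane) :
    q ∈ P.region ↔ ∀ t < P.size, dot (P.normal (s + t)) q ≤ dot (P.normal (s + t)) (P.cyc (s + t)) := by
  rw [mem_region_iff]
  simp only [orient_eq_dot, sub_nonneg]
  constructor
  · intro h t _; exact h _
  · intro h t
    have h0 := P.size_pos
    have hmod : ∀ u, P.normal u = P.normal (u % P.size) ∧ P.cyc u = P.cyc (u % P.size) := by
      intro u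
      have e : ∀ w, P.cyc (u % P.size + w) = P.cyc (u + w) := by intro w; simp [cyc]
      have e0 : P.cyc (u % P.size) = P.cyc u := e 0
      exact ⟨by rw [normal, normal, e 1, e0], e0.symm⟩
    have := h ((t + s * P.size - s) % P.size) (Nat.mod_lt _ h0)
    have hle : s ≤ t + s * P.size := by nlinarith
    have e2 : (s + (t + s * P.size - s) % P.size) % P.size = t % P.size := by
      rw [Nat.add_mod_mod, Nat.add_sub_cancel' hle, Nat.add_mul_mod_self_right]
    rw [(hmod (s + _)).1, (hmod (s + _)).2, e2, ← (hmod t).1, ← (hmod t).2] at this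
    exact this

theorem cross_normal_pos (P : ConvexPolygon) (t : ℕ) :
    0 < cross (P.normal t) (P.normal (t + 1)) := by
  have h3 := P.three_le_size
  have := P.orient_cyc_pos (a := t) (b := t + 1) (c := t + 2) (by omega) (by omega) (by omega)
  have e : cross (P.normal t) (P.normal (t + 1)) =
      orient (P.cyc t) (P.cyc (t + 1)) (P.cyc (t + 2)) := by
    unfold cross normal orient; ring_nf
  rwa [e]

theorem normal_ne_zero (P : ConvexPolygon) (t : ℕ) : P.normal t ≠ 0 := by
  intro h
  have := P.cross_normal_pos t
  rw [h] at this
  simp [cross] at this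

/-- The sides close up, so the normals sum to zero. If no product with `u` were positive, all of
them would vanish, and two consecutive normals, being independent, would force `u = 0`. -/
theorem exists_dot_normal_pos (P : ConvexPolygon) (s : ℕ) {u : Plane} (hu : u ≠ 0) :
    ∃ t < P.size, 0 < dot (P.normal (s + t)) u := by
  by_contra hno
  push Not at hno
  have hsum : ∑ t ∈ Finset.range P.size, dot (P.normal (s + t)) u = 0 := by
    let F : ℕ → ℝ := fun t => (P.cyc (s + t)).2 * u.1 - (P.cyc (s + t)).1 * u.2
    have e : ∀ t, dot (P.normal (s + t)) u = F (t + 1) - F t := by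
      intro t; simp only [F, dot, normal, add_assoc]; ring
    rw [Finset.sum_congr rfl (fun t _ => e t), Finset.sum_range_sub F]
    simp only [F, P.cyc_add_size, add_zero, sub_self]
  have hz := (Finset.sum_eq_zero_iff_of_nonpos
    (fun t ht => hno t (Finset.mem_range.1 ht))).1 hsum
  have h3 := P.three_le_size
  have h0 := hz 0 (Finset.mem_range.2 (by omega))
  have h1 := hz 1 (Finset.mem_range.2 (by omega))
  have hc := P.cross_normal_pos s
  simp only [add_zero, dot, cross] at h0 h1 hc
  apply hu
  have e1 : cross (P.normal s) (P.normal (s + 1)) * u.1 = 0 := by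
    unfold cross; linear_combination (P.normal (s + 1)).2 * h0 - (P.normal s).2 * h1
  have e2 : cross (P.normal s) (P.normal (s + 1)) * u.2 = 0 := by
    unfold cross; linear_combination -(P.normal (s + 1)).1 * h0 + (P.normal s).1 * h1
  have hne := (P.cross_normal_pos s).ne'
  exact Prod.ext ((mul_eq_zero.1 e1).resolve_left hne) ((mul_eq_zero.1 e2).resolve_left hne)

/-- A vertex is lexicographically smaller than another point. -/
def LexLT (p q : Plane) : Prop := p.1 < q.1 ∨ (p.1 = q.1 ∧ p.2 < q.2)

/-- This is why the starting vertex is chosen lexicographically. On the lower chain of the polygon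
the sides go forward in this order and the normals have angles in `(-π, 0]`; on the upper chain the
sides go back and the angles are in `(0, π]`. The cut of `angle` thus falls at the smallest vertex.
-/
theorem inUpperHalf_normal_iff (P : ConvexPolygon) (t : ℕ) :
    InUpperHalf (P.normal t) ↔ LexLT (P.cyc (t + 1)) (P.cyc t) := by
  unfold InUpperHalf LexLT normal
  simp only [sub_pos, sub_neg, sub_eq_zero]
  constructor
  · rintro (h | ⟨h1, h2⟩)
    · exact Or.inl h
    · exact Or.inr ⟨h1.symm, h2⟩
  · rintro (h | ⟨h1, h2⟩)
    · exact Or.inl h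
    · exact Or.inr ⟨h1.symm, h2⟩

theorem cyc_injOn (P : ConvexPolygon) {a b : ℕ} (hab : a < b) (hb : b < a + P.size) :
    P.cyc a ≠ P.cyc b := by
  intro h
  have h3 := P.three_le_size
  by_cases hc : b + 1 < a + P.size
  · have := P.orient_cyc_pos hab (Nat.lt_succ_self b) hc
    rw [h] at this; simp [orient] at this
  · have := P.orient_cyc_pos (a := a) (b := a + 1) (c := b) (by omega) (by omega) hb
    rw [h] at this; simp [orient] at this

/-- Starting from the lexicographically smallest vertex, the angles of the normals increase. -/
theorem angle_normal_lt (P : ConvexPolygon) {s : ℕ}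
    (hs : ∀ t, ¬ LexLT (P.cyc t) (P.cyc s)) {t : ℕ} (ht : t + 1 < P.size) :
    angle (P.normal (s + t)) < angle (P.normal (s + (t + 1))) := by
  have hc := P.cross_normal_pos (s + t)
  rw [angle_lt_iff (P.normal_ne_zero _) (P.normal_ne_zero _)]
  by_cases h1 : InUpperHalf (P.normal (s + t))
  · by_cases h2 : InUpperHalf (P.normal (s + (t + 1)))
    · exact Or.inr ⟨⟨fun _ => h2, fun _ => h1⟩, hc⟩
    · exfalso
      have h0 : 0 ≤ orient (P.cyc (s + t)) (P.cyc (s + t + 1)) (P.cyc s) :=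
        P.orient_cyc_nonneg _ _
      have h0' : 0 ≤ orient (P.cyc (s + t + 1)) (P.cyc (s + t + 1 + 1)) (P.cyc s) :=
        P.orient_cyc_nonneg _ _
      have hne : P.cyc s ≠ P.cyc (s + t + 1) := P.cyc_injOn (by omega) (by omega)
      have hs1 := hs (s + t + 1)
      have h3 := P.three_le_size
      have hne2 : P.cyc (s + t + 1) ≠ P.cyc (s + t + 1 + 1) := P.cyc_injOn (by omega) (by omega)
      rw [inUpperHalf_normal_iff] at h1 h2
      simp only [← add_assoc] at h2
      have hcr : 0 < orient (P.cyc (s + t)) (P.cyc (s + t + 1)) (P.cyc (s + t + 1 + 1)) :=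
        P.orient_cyc_pos (by omega) (by omega) (by omega)
      generalize P.cyc (s + t) = a at *
      generalize P.cyc (s + t + 1) = b at *
      generalize P.cyc (s + t + 1 + 1) = c at *
      generalize P.cyc s = o at *
      -- Here the angle would fall at the vertex `b`, so both neighbours `a` and `c` would be
      -- lexicographically larger than `b`. But the smallest vertex `o` lies in the cone at `b`
      -- spanned by `a` and `c`: the vector from `b` to `o` is a nonnegative combination of those to
      -- `a` and `c`, so `o` could not precede `b`.
      have e1 : orient a b c * (o.1 - b.1) = orient b c o * (a.1 - b.1) + orient a b o * (c.1 - b.1) := by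
        unfold orient; ring
      have e2 : orient a b c * (o.2 - b.2) = orient b c o * (a.2 - b.2) + orient a b o * (c.2 - b.2) := by
        unfold orient; ring
      have hba : LexLT b a := h1
      have hbc : LexLT b c := by
        unfold LexLT at h2 ⊢
        rcases lt_trichotomy b.1 c.1 with h | h | h
        · exact Or.inl h
        · rcases lt_trichotomy b.2 c.2 with h' | h' | h'
          · exact Or.inr ⟨h, h'⟩
          · exact absurd (Prod.ext h h') hne2
          · exact absurd (Or.inr ⟨h.symm, h'⟩) h2
        · exact absurd (Or.inl h) h2
      have hob : LexLT o b := by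
        unfold LexLT at hs1 ⊢
        rcases lt_trichotomy o.1 b.1 with h | h | h
        · exact Or.inl h
        · rcases lt_trichotomy o.2 b.2 with h' | h' | h'
          · exact Or.inr ⟨h, h'⟩
          · exact absurd (Prod.ext h h') hne
          · exact absurd (Or.inr ⟨h.symm, h'⟩) hs1
        · exact absurd (Or.inl h) hs1
      have a1 : 0 ≤ a.1 - b.1 := by rcases hba with h | ⟨h, -⟩ <;> linarith
      have c1 : 0 ≤ c.1 - b.1 := by rcases hbc with h | ⟨h, -⟩ <;> linarith
      have k1 : 0 ≤ orient b c o * (a.1 - b.1) := mul_nonneg h0' a1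
      have k2 : 0 ≤ orient a b o * (c.1 - b.1) := mul_nonneg h0 c1
      rcases hob with h | ⟨h, h'⟩
      · have : orient a b c * (o.1 - b.1) < 0 := mul_neg_of_pos_of_neg hcr (by linarith)
        linarith
      · rw [h, sub_self, mul_zero] at e1
        have z1 : orient b c o * (a.1 - b.1) = 0 := by linarith
        have z2 : orient a b o * (c.1 - b.1) = 0 := by linarith
        have : orient a b c * (o.2 - b.2) < 0 := mul_neg_of_pos_of_neg hcr (by linarith)
        have k3 : 0 ≤ orient b c o * (a.2 - b.2) := by
          rcases hba with h | ⟨h, h'⟩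
          · rcases mul_eq_zero.1 z1 with z | z
            · rw [z, zero_mul]
            · linarith
          · exact mul_nonneg h0' (by linarith)
        have k4 : 0 ≤ orient a b o * (c.2 - b.2) := by
          rcases hbc with h | ⟨h, h'⟩
          · rcases mul_eq_zero.1 z2 with z | z
            · rw [z, zero_mul]
            · linarith
          · exact mul_nonneg h0 (by linarith)
        linarith
  · by_cases h2 : InUpperHalf (P.normal (s + (t + 1)))
    · exact Or.inl ⟨h1, h2⟩
    · exact Or.inr ⟨⟨fun h => absurd h h1, fun h => absurd h h2⟩, hc⟩

/-- The average of the vertices works: every vertex satisfies the inequality of the side `t`, and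
the vertex `t + 2` does so strictly. -/
theorem exists_interior (P : ConvexPolygon) :
    ∃ o, ∀ t, dot (P.normal t) o < dot (P.normal t) (P.cyc t) := by
  refine ⟨(P.size : ℝ)⁻¹ • ∑ j, P.vertex j, fun t => ?_⟩
  have hpos : (0 : ℝ) < P.size := Nat.cast_pos.2 P.size_pos
  have h3 := P.three_le_size
  have hlin : ∀ (f : Fin P.size → Plane) (a : Plane), dot a (∑ j, f j) = ∑ j, dot a (f j) := by
    intro f a
    simp only [dot, Prod.fst_sum, Prod.snd_sum, Finset.mul_sum, Finset.sum_add_distrib]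
  have hnn : ∀ j, dot (P.normal t) (P.vertex j) ≤ dot (P.normal t) (P.cyc t) := by
    intro j
    have := P.orient_cyc_nonneg t j
    rw [orient_eq_dot] at this; linarith
  have hlt : ∑ j, dot (P.normal t) (P.vertex j) < ∑ _j : Fin P.size, dot (P.normal t) (P.cyc t) := by
    apply Finset.sum_lt_sum (fun j _ => hnn j)
    refine ⟨⟨(t + 2) % P.size, Nat.mod_lt _ P.size_pos⟩, Finset.mem_univ _, ?_⟩
    have := P.orient_cyc_pos (a := t) (b := t + 1) (c := t + 2) (by omega) (by omega) (by omega)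
    rw [orient_eq_dot] at this
    have e : P.vertex ⟨(t + 2) % P.size, Nat.mod_lt _ P.size_pos⟩ = P.cyc (t + 2) := rfl
    rw [e]; linarith
  rw [dot_smul, hlin, inv_mul_lt_iff₀ hpos]
  simpa using hlt

theorem isCompact_region (P : ConvexPolygon) : IsCompact P.region :=
  (Set.finite_range _).isCompact_convexHull ℝ

theorem convex_region (P : ConvexPolygon) : Convex ℝ P.region := convex_convexHull ℝ _

end ConvexPolygon

/-! ### The set of maximal placements -/

theorem mem_overlap {k : ℕ} {P : Fin k → ConvexPolygon} {v : Fin k → Plane} {q : Plane} :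
    q ∈ overlap P v ↔ ∀ i, q - v i ∈ (P i).region := by
  simp only [overlap, Set.mem_iInter, Set.mem_vadd_set_iff_neg_vadd_mem, vadd_eq_add]
  refine forall_congr' fun i => ?_
  rw [neg_add_eq_sub]

theorem isCompact_overlap {k : ℕ} (hk : 0 < k) (P : Fin k → ConvexPolygon) (v : Fin k → Plane) :
    IsCompact (overlap P v) :=
  ((P ⟨0, hk⟩).isCompact_region.vadd (v ⟨0, hk⟩)).of_isClosed_subset
    (isClosed_iInter fun i => ((P i).isCompact_region.vadd (v i)).isClosed)
    (Set.iInter_subset _ _)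

theorem convex_overlap {k : ℕ} (P : Fin k → ConvexPolygon) (v : Fin k → Plane) :
    Convex ℝ (overlap P v) :=
  convex_iInter fun i => (P i).convex_region.vadd (v i)

theorem toConfig_eq_iff {k : ℕ} {v w : Fin k → Plane} :
    toConfig v = toConfig w ↔ ∃ x : Plane, ∀ i, w i = x + v i := by
  rw [toConfig, toConfig, Submodule.mkQ_apply, Submodule.mkQ_apply, Submodule.Quotient.eq]
  constructor
  · rintro ⟨x, hx⟩
    refine ⟨-x, fun i => ?_⟩
    have : x = v i - w i := congrFun hx i
    rw [this]; abel
  · rintro ⟨x, hx⟩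
    refine ⟨-x, ?_⟩
    funext i
    simp only [LinearMap.pi_apply, LinearMap.id_apply, Pi.sub_apply, hx i]
    abel

theorem toConfig_surjective {k : ℕ} : Function.Surjective (toConfig (k := k)) :=
  Submodule.mkQ_surjective _

theorem toConfig_mem_maximizers {k : ℕ} {P : Fin k → ConvexPolygon} {v : Fin k → Plane} :
    toConfig v ∈ maximizers P ↔ ∀ w, volume (overlap P w) ≤ volume (overlap P v) := by
  constructor
  · intro h w; exact h (toConfig w)
  · intro h c
    obtain ⟨w, rfl⟩ := toConfig_surjective c
    exact h w

/-- Moving an interior point of each polygon to the origin gives a placement whose overlap has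
interior points. The maximal area is at least that of this overlap. -/
theorem volume_overlap_pos_of_mem_maximizers {k : ℕ} {P : Fin k → ConvexPolygon}
    {v : Fin k → Plane} (h : toConfig v ∈ maximizers P) : 0 < volume (overlap P v) := by
  rw [toConfig_mem_maximizers] at h
  choose o ho using fun i => (P i).exists_interior
  refine lt_of_lt_of_le ?_ (h fun i => -o i)
  apply Measure.measure_pos_of_nonempty_interior
  let U : Set Plane := ⋂ i : Fin k, ⋂ t : Fin (P i).size,
    {q | dot ((P i).normal t) (q + o i) < dot ((P i).normal t) ((P i).cyc t)}
  have hU : IsOpen U := by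
    apply isOpen_iInter_of_finite; intro i
    apply isOpen_iInter_of_finite; intro t
    apply isOpen_lt _ continuous_const
    unfold dot; fun_prop
  refine ⟨0, interior_maximal (s := overlap P fun i => -o i) ?_ hU ?_⟩
  · intro q hq
    rw [mem_overlap]
    intro i
    rw [(P i).mem_region_iff_dot 0, sub_neg_eq_add]
    intro t ht
    simp only [zero_add]
    simp only [U, Set.mem_iInter] at hq
    exact (hq i ⟨t, ht⟩).le
  · simp only [U, Set.mem_iInter]
    intro i t
    have := ho i t
    simpa using this

theorem mem_differenceProduct {k : ℕ} {P : Fin k → ConvexPolygon} {I : Set Plane}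
    {x : Fin k → Plane} :
    x ∈ differenceProduct P I ↔ ∀ i, ∀ q ∈ I, q - x i ∈ (P i).region := by
  simp only [differenceProduct, Set.mem_pi, Set.mem_univ, true_implies, minkowskiDiff]
  refine forall_congr' fun i => ?_
  constructor
  · intro h q hq
    have h1 : x i + -q ∈ -(P i).region := h ⟨-q, by simpa using hq, rfl⟩
    rw [Set.mem_neg] at h1
    rwa [neg_add, neg_neg, neg_add_eq_sub] at h1
  · rintro h _ ⟨y, hy, rfl⟩
    rw [Set.mem_neg] at hy ⊢
    have := h _ hy
    change -(x i + y) ∈ (P i).region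
    rw [neg_add, neg_add_eq_sub]; exact this

theorem mem_differenceProduct_iff_subset {k : ℕ} {P : Fin k → ConvexPolygon} {I : Set Plane}
    {x : Fin k → Plane} : x ∈ differenceProduct P I ↔ I ⊆ overlap P x := by
  rw [mem_differenceProduct]
  constructor
  · intro h q hq; rw [mem_overlap]; intro i; exact h i q hq
  · intro h i q hq; exact mem_overlap.1 (h hq) i

/-- A compact subset of full measure of a convex set with nonempty interior is the whole set. -/
theorem eq_of_subset_of_volume_le {K L : Set Plane} (hK : IsCompact K) (hKi : 0 < volume K)
    (hKc : Convex ℝ K) (hLc : Convex ℝ L) (hKL : K ⊆ L)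
    (hv : volume L ≤ volume K) : K = L := by
  have hKne : (interior K).Nonempty := by
    by_contra h
    have h0 : volume (interior K) = 0 := by rw [Set.not_nonempty_iff_eq_empty.1 h]; simp
    have h1 : volume (frontier K) = 0 := hKc.addHaar_frontier volume
    have h2 : K ⊆ interior K ∪ frontier K := by
      rw [← closure_eq_interior_union_frontier]; exact subset_closure
    have := (measure_mono (μ := volume) h2).trans (measure_union_le _ _)
    rw [h0, h1] at this
    simp at this; exact hKi.ne' this
  have hLne : (interior L).Nonempty := hKne.mono (interior_mono hKL)
  apply hKL.antisymm
  by_contra hno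
  rw [Set.not_subset] at hno
  obtain ⟨y, hyL, hyK⟩ := hno
  -- Interior points of `L` accumulate at `y`, which has a neighbourhood disjoint from the closed
  -- set `K`. So `L` contains an open set outside `K`, and this has positive area.
  have hcl : y ∈ closure (interior L) := by
    rw [hLc.closure_interior_eq_closure_of_nonempty_interior hLne]; exact subset_closure hyL
  obtain ⟨z, hzK, hzL⟩ := mem_closure_iff.1 hcl Kᶜ hK.isClosed.isOpen_compl hyK
  have hopen : IsOpen (Kᶜ ∩ interior L) := hK.isClosed.isOpen_compl.inter isOpen_interior
  have hpos : 0 < volume (Kᶜ ∩ interior L) := hopen.measure_pos volume ⟨z, hzK, hzL⟩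
  have hsub : K ∪ (Kᶜ ∩ interior L) ⊆ L :=
    Set.union_subset hKL (Set.inter_subset_right.trans interior_subset)
  have h1 := measure_mono (μ := volume) hsub
  rw [measure_union (Set.disjoint_left.2 fun a ha hb => hb.1 ha) hopen.measurableSet] at h1
  exact absurd (h1.trans hv) (not_le.2 (ENNReal.lt_add_right hK.measure_lt_top.ne hpos.ne'))

/-- An overlap that contains `I` has at least its area, so members of `N` are maximal. For two
members of `N` with the same placement both overlaps equal `I`, and they differ by a translation,
which must be zero. For a maximal `w`, the midpoints of points of `I(v)` and `I(w)` lie in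
`I((v+w)/2)`, so equality in the Brunn–Minkowski inequality makes `I(w)` a translate of `I(v)`. -/
theorem bijOn_toConfig {k : ℕ} (hk : 0 < k) {P : Fin k → ConvexPolygon} {v : Fin k → Plane}
    (hv : toConfig v ∈ maximizers P) :
    Set.BijOn toConfig (differenceProduct P (overlap P v)) (maximizers P) := by
  have hpos := volume_overlap_pos_of_mem_maximizers hv
  have hmax := toConfig_mem_maximizers.1 hv
  have hI := isCompact_overlap hk P v
  have hIc := convex_overlap P v
  refine ⟨?_, ?_, ?_⟩
  · intro x hx
    rw [mem_differenceProduct_iff_subset] at hx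
    rw [toConfig_mem_maximizers]
    exact fun w => (hmax w).trans (measure_mono hx)
  · intro x hx y hy hxy
    rw [mem_differenceProduct_iff_subset] at hx hy
    obtain ⟨d, hd⟩ := toConfig_eq_iff.1 hxy
    have e1 := eq_of_subset_of_volume_le hI hpos hIc
      (convex_overlap P x) hx (hmax x)
    have e2 := eq_of_subset_of_volume_le hI hpos hIc
      (convex_overlap P y) hy (hmax y)
    have e3 : overlap P y = d +ᵥ overlap P x := by
      rw [← overlap_add_const]; congr 1; funext i; exact hd i
    rw [← e1, ← e2] at e3
    -- A nonzero translation would move a point of the compact set that is extreme in the direction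
    -- `d` out of the set.
    have hd0 : d = 0 := by
      have hne : (overlap P v).Nonempty := nonempty_of_measure_ne_zero hpos.ne'
      obtain ⟨p, hp, hpm⟩ := hI.exists_isMaxOn hne
        (f := fun q => dot d q) (by unfold dot; fun_prop)
      have h1 : d + p ∈ overlap P v := by rw [e3]; exact ⟨p, hp, rfl⟩
      have h2 : dot d (d + p) ≤ dot d p := hpm h1
      rw [dot_add] at h2
      by_contra h0
      have := dot_self_pos h0
      linarith
    funext i
    rw [hd i, hd0, zero_add]
  · intro c hc
    obtain ⟨w, rfl⟩ := toConfig_surjective c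
    have hwmax := toConfig_mem_maximizers.1 hc
    obtain ⟨d, hd⟩ := exists_vadd_eq_of_midpoints hI hIc (isCompact_overlap hk P w)
      (convex_overlap P w)
      (isCompact_overlap hk P fun i => (2⁻¹ : ℝ) • (v i + w i)).measurableSet hpos
      (le_antisymm (hmax w) (hwmax v)) (hmax _) (by
        intro p hp q hq
        rw [mem_overlap] at hp hq ⊢
        intro i
        have := (P i).convex_region (hp i) (hq i) (a := 2⁻¹) (b := 2⁻¹) (by norm_num) (by norm_num)
          (by norm_num)
        convert this using 1
        rw [← smul_sub, ← smul_add]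
        congr 1; abel)
    refine ⟨fun i => -d + w i, ?_, ?_⟩
    · rw [mem_differenceProduct_iff_subset, overlap_add_const, hd, ← vadd_assoc, vadd_eq_add,
        neg_add_cancel, zero_vadd]
    · rw [toConfig_eq_iff]
      exact ⟨d, fun i => by abel⟩

/-! ### Half-planes sorted by angle -/

/-- For half-planes `a · q ≤ x`, `b · q ≤ y`, `c · q ≤ z` with normals sorted by angle, this number is
positive iff the second one is not implied by the other two. -/
def margin (a b c : Plane) (x y z : ℝ) : ℝ := cross b c * x + cross a b * z - cross a c * y

/-- Three vectors in the plane satisfy `(b × c) a + (a × b) c = (a × c) b`. Hence constants may be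
replaced by slacks at any point `q`. A point on one or two of the boundary lines makes terms vanish.
-/
theorem margin_slack (a b c q : Plane) (x y z : ℝ) :
    margin a b c (x - dot a q) (y - dot b q) (z - dot c q) = margin a b c x y z := by
  unfold margin cross dot; ring

/-- An infinite sequence of half-planes with normals turning left, none of which is implied by its
two neighbours. -/
structure StrictChain (a : ℕ → Plane) (c τ : ℕ → ℝ) : Prop where
  hasAngle : ∀ t, HasAngle (a t) (τ t)
  lt : ∀ t, τ t < τ (t + 1)
  lt_add_pi : ∀ t, τ (t + 1) < τ t + Real.pi
  margin_pos : ∀ t, 0 < margin (a t) (a (t + 1)) (a (t + 2)) (c t) (c (t + 1)) (c (t + 2))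

theorem StrictChain.strictMono {a : ℕ → Plane} {c τ : ℕ → ℝ} (h : StrictChain a c τ) :
    StrictMono τ := strictMono_nat_of_lt_succ h.lt

/-- Move along line `0` in the direction of `a 0` turned left. The line `t` is then crossed at the
parameter `φ t / σ t`. Positive margins make these parameters increase with `t` as long as the
directions stay within `π` of the first, so the later half-planes contain `q` if the half-plane `1`
does. The induction uses the cross-multiplied form, since `σ` vanishes at the angles `0` and `π`. -/
theorem StrictChain.slack_nonneg {a : ℕ → Plane} {c τ : ℕ → ℝ} (h : StrictChain a c τ) {q : Plane}
    (h0 : c 0 = dot (a 0) q) (h1 : dot (a 1) q ≤ c 1) (n : ℕ) (hn : τ (n + 1) ≤ τ 0 + Real.pi) :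
    dot (a (n + 1)) q ≤ c (n + 1) ∧
      (0 < n ∨ dot (a 1) q < c 1 → dot (a (n + 1)) q < c (n + 1)) := by
  set φ : ℕ → ℝ := fun t => c t - dot (a t) q with hφ
  set σ : ℕ → ℝ := fun t => cross (a 0) (a t) with hσ
  have hm : ∀ t, 0 < margin (a t) (a (t + 1)) (a (t + 2)) (φ t) (φ (t + 1)) (φ (t + 2)) := by
    intro t; simp only [hφ, margin_slack]; exact h.margin_pos t
  have hcross : ∀ t, 0 < cross (a t) (a (t + 1)) := fun t =>
    (h.hasAngle t).cross_pos (h.hasAngle _) (h.lt t) (h.lt_add_pi t)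
  have key : ∀ n, τ (n + 1) ≤ τ 0 + Real.pi → 0 ≤ φ (n + 1) ∧
      (0 < n ∨ 0 < φ 1 → 0 < φ (n + 1)) ∧ 0 ≤ φ (n + 1) * σ n - φ n * σ (n + 1) := by
    intro n
    induction n with
    | zero =>
      intro _
      have e0 : φ 0 = 0 := by simp only [hφ]; linarith
      have e1 : σ 0 = 0 := by simp only [hσ, cross]; ring
      refine ⟨by simp only [hφ]; simpa using h1, ?_, by rw [e0, e1]; simp⟩
      rintro (h | h)
      · exact absurd h (lt_irrefl _)
      · exact h
    | succ n ih =>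
      intro hn
      have hlt : τ (n + 1) < τ 0 + Real.pi := (h.lt (n + 1)).trans_le hn
      obtain ⟨i1, -, i3⟩ := ih hlt.le
      have hσ1 : 0 < σ (n + 1) := (h.hasAngle 0).cross_pos (h.hasAngle _)
        (h.strictMono (Nat.succ_pos n)) hlt
      have hσ2 : 0 ≤ σ (n + 2) := by
        rcases hn.lt_or_eq with h' | h'
        · exact ((h.hasAngle 0).cross_pos (h.hasAngle _) (h.strictMono (Nat.succ_pos _)) h').le
        · have := h.hasAngle (n + 2)
          rw [h'] at this
          exact ((h.hasAngle 0).cross_eq_zero_of_add_pi this).ge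
      have hm' := hm n
      have id1 : cross (a n) (a (n + 1)) * (φ (n + 2) * σ (n + 1) - φ (n + 1) * σ (n + 2)) =
          σ (n + 1) * margin (a n) (a (n + 1)) (a (n + 2)) (φ n) (φ (n + 1)) (φ (n + 2)) +
          cross (a (n + 1)) (a (n + 2)) * (φ (n + 1) * σ n - φ n * σ (n + 1)) := by
        simp only [hσ]; unfold margin cross; ring
      have hpos : 0 < cross (a n) (a (n + 1)) * (φ (n + 2) * σ (n + 1) - φ (n + 1) * σ (n + 2)) := by
        rw [id1]
        have := mul_pos hσ1 hm'
        have := mul_nonneg (hcross (n + 1)).le i3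
        linarith
      have hD := (mul_pos_iff_of_pos_left (hcross n)).1 hpos
      have h2 : 0 < φ (n + 2) * σ (n + 1) := by
        have := mul_nonneg i1 hσ2; linarith
      have h3 := (mul_pos_iff_of_pos_right hσ1).1 h2
      exact ⟨h3.le, fun _ => h3, hD.le⟩
  obtain ⟨k1, k2, -⟩ := key n hn
  simp only [hφ, sub_nonneg, sub_pos] at k1 k2
  exact ⟨k1, k2⟩

/-- A periodic sequence of half-planes with normals turning left once per period, none of which is
implied by its two neighbours. -/
structure StrictCycle (r : ℕ) (a : ℤ → Plane) (c τ : ℤ → ℝ) : Prop where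
  hasAngle : ∀ t, HasAngle (a t) (τ t)
  lt : ∀ t, τ t < τ (t + 1)
  lt_add_pi : ∀ t, τ (t + 1) < τ t + Real.pi
  margin_pos : ∀ t, 0 < margin (a t) (a (t + 1)) (a (t + 2)) (c t) (c (t + 1)) (c (t + 2))
  normal_period : ∀ t z, a (t + r * z) = a t
  const_period : ∀ t z, c (t + r * z) = c t
  angle_period : ∀ t z, τ (t + r * z) = τ t + z * (2 * Real.pi)

namespace StrictCycle

variable {r : ℕ} {a : ℤ → Plane} {c τ : ℤ → ℝ}

theorem forward (h : StrictCycle r a c τ) (j : ℤ) :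
    StrictChain (fun t => a (j + t)) (fun t => c (j + t)) (fun t => τ (j + t)) where
  hasAngle t := h.hasAngle _
  lt t := by have := h.lt (j + t); push_cast; rwa [← add_assoc]
  lt_add_pi t := by have := h.lt_add_pi (j + t); push_cast; rwa [← add_assoc]
  margin_pos t := by have := h.margin_pos (j + t); push_cast; simpa only [← add_assoc] using this

/-- Reflection in the first axis reverses orientation, so the cycle read backwards is again a chain.
-/
theorem backward (h : StrictCycle r a c τ) (j : ℤ) :
    StrictChain (fun t => ((a (j - t)).1, -(a (j - t)).2)) (fun t => c (j - t))
      (fun t => -τ (j - t)) where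
  hasAngle t := by
    obtain ⟨s, hs, e⟩ := h.hasAngle (j - t)
    exact ⟨s, hs, by rw [e]; simp⟩
  lt t := by
    have := h.lt (j - t - 1)
    rw [sub_add_cancel] at this
    push_cast; rw [← sub_sub]; linarith
  lt_add_pi t := by
    have := h.lt_add_pi (j - t - 1)
    rw [sub_add_cancel] at this
    push_cast; rw [← sub_sub]; linarith
  margin_pos t := by
    have := h.margin_pos (j - t - 2)
    rw [show j - t - 2 + 1 = j - (t + 1) by ring, show j - t - 2 + 2 = j - t by ring,
      show j - t - 2 = j - (t + 2) by ring] at this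
    push_cast
    convert this using 1
    unfold margin cross; ring

theorem forward_slack (h : StrictCycle r a c τ) {j i : ℤ} {q : Plane} (h0 : c j = dot (a j) q)
    (h1 : dot (a (j + 1)) q ≤ c (j + 1)) (hij : j < i) (hi : τ i ≤ τ j + Real.pi) :
    dot (a i) q ≤ c i ∧ (j + 1 < i ∨ dot (a (j + 1)) q < c (j + 1) → dot (a i) q < c i) := by
  obtain ⟨n, rfl⟩ : ∃ n : ℕ, i = j + (n + 1 : ℕ) :=
    ⟨(i - j - 1).toNat, by push_cast; rw [Int.toNat_of_nonneg (by omega)]; ring⟩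
  have := (h.forward j).slack_nonneg (q := q) (by simpa using h0) (by simpa using h1) n
    (by simpa using hi)
  refine ⟨this.1, fun hs => this.2 ?_⟩
  rcases hs with hs | hs
  · left; push_cast at hs; omega
  · right; simpa using hs

theorem backward_slack (h : StrictCycle r a c τ) {j i : ℤ} {q : Plane} (h0 : c j = dot (a j) q)
    (h1 : dot (a (j - 1)) q ≤ c (j - 1)) (hij : i < j) (hi : τ j - Real.pi ≤ τ i) :
    dot (a i) q ≤ c i ∧ (i < j - 1 ∨ dot (a (j - 1)) q < c (j - 1) → dot (a i) q < c i) := by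
  obtain ⟨n, rfl⟩ : ∃ n : ℕ, i = j - (n + 1 : ℕ) :=
    ⟨(j - i - 1).toNat, by push_cast; rw [Int.toNat_of_nonneg (by omega)]; ring⟩
  have hd : ∀ u : Plane, dot (u.1, -u.2) (q.1, -q.2) = dot u q := by
    intro u; unfold dot; ring
  have := (h.backward j).slack_nonneg (q := (q.1, -q.2)) (by simpa [hd] using h0)
    (by simpa [hd] using h1) n (by simp only [Nat.cast_zero, sub_zero]; linarith)
  simp only [hd] at this
  refine ⟨this.1, fun hs => this.2 ?_⟩
  rcases hs with hs | hs
  · left; push_cast at hs; omega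
  · right; simpa using hs

theorem exists_period (h : StrictCycle r a c τ) (i : ℤ) (x : ℝ) :
    ∃ z : ℤ, τ (i + r * z) ∈ Set.Ioc x (x + 2 * Real.pi) := by
  obtain ⟨z, hz, -⟩ := existsUnique_add_zsmul_mem_Ioc Real.two_pi_pos (τ i) x
  refine ⟨z, ?_⟩
  rw [h.angle_period]
  simpa [zsmul_eq_mul] using hz

/-- The intersection of two consecutive boundary lines satisfies all constraints. -/
theorem vertex_feasible (h : StrictCycle r a c τ) {j : ℤ} {q : Plane} (h0 : c j = dot (a j) q)
    (h1 : c (j + 1) = dot (a (j + 1)) q) (i : ℤ) : dot (a i) q ≤ c i := by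
  obtain ⟨z, hz1, hz2⟩ := h.exists_period i (τ j - Real.pi)
  rw [← h.normal_period i z, ← h.const_period i z]
  generalize i + r * z = i' at *
  rcases lt_trichotomy i' j with hlt | rfl | hlt
  -- Half-planes up to half a turn behind `j` are reached by the backward chain. It needs the
  -- half-plane `j - 1` to contain `q`; the margin of `j - 1`, `j`, `j + 1` shows this, because two
  -- of its slacks vanish at `q`.
  · have hpre : 0 < margin (a (j - 1)) (a j) (a (j + 1)) (c (j - 1)) (c j) (c (j + 1)) := by
      have := h.margin_pos (j - 1)
      rwa [sub_add_cancel, show j - 1 + 2 = j + 1 by ring] at this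
    rw [← margin_slack _ _ _ q, h0, h1] at hpre
    have hc := (h.hasAngle j).cross_pos (h.hasAngle (j + 1)) (h.lt j) (h.lt_add_pi j)
    unfold margin at hpre
    have : 0 < cross (a j) (a (j + 1)) * (c (j - 1) - dot (a (j - 1)) q) := by linarith
    have := (mul_pos_iff_of_pos_left hc).1 this
    exact (h.backward_slack h0 (by linarith) hlt hz1.le).1
  · exact h0.ge
  · exact (h.forward_slack h0 h1.ge hlt (by linarith)).1

/-- Every constraint is tight at a point where all the others are slack. -/
theorem exists_only_tight (h : StrictCycle r a c τ) (j : ℤ) :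
    ∃ q : Plane, c j = dot (a j) q ∧ ∀ i : ℤ, (∀ z : ℤ, i + r * z ≠ j) → dot (a i) q < c i := by
  have hsolve : ∀ t : ℤ, ∃ q : Plane, c t = dot (a t) q ∧ c (t + 1) = dot (a (t + 1)) q := by
    intro t
    have hc := ((h.hasAngle t).cross_pos (h.hasAngle (t + 1)) (h.lt t) (h.lt_add_pi t)).ne'
    set D := cross (a t) (a (t + 1)) with hD
    refine ⟨((c t * (a (t + 1)).2 - c (t + 1) * (a t).2) / D,
      ((a t).1 * c (t + 1) - (a (t + 1)).1 * c t) / D), ?_, ?_⟩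
    · simp only [dot]; field_simp; rw [hD, cross]; ring
    · simp only [dot]; field_simp; rw [hD, cross]; ring
  obtain ⟨p, hp1, hp2⟩ := hsolve (j - 1)
  rw [sub_add_cancel] at hp2
  obtain ⟨q, hq1, hq2⟩ := hsolve j
  have hmar : 0 < margin (a (j - 1)) (a j) (a (j + 1)) (c (j - 1)) (c j) (c (j + 1)) := by
    have := h.margin_pos (j - 1)
    rwa [sub_add_cancel, show j - 1 + 2 = j + 1 by ring] at this
  have c1 : 0 < cross (a (j - 1)) (a j) := by
    have h2 := h.lt (j - 1); have h3 := h.lt_add_pi (j - 1)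
    rw [sub_add_cancel] at h2 h3
    exact (h.hasAngle _).cross_pos (h.hasAngle _) h2 h3
  have c2 := (h.hasAngle j).cross_pos (h.hasAngle (j + 1)) (h.lt j) (h.lt_add_pi j)
  have hp3 : dot (a (j + 1)) p < c (j + 1) := by
    have hm := hmar
    rw [← margin_slack _ _ _ p, hp1, hp2] at hm
    unfold margin at hm
    have : 0 < cross (a (j - 1)) (a j) * (c (j + 1) - dot (a (j + 1)) p) := by linarith
    linarith [(mul_pos_iff_of_pos_left c1).1 this]
  have hq3 : dot (a (j - 1)) q < c (j - 1) := by
    have hm := hmar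
    rw [← margin_slack _ _ _ q, hq1, hq2] at hm
    unfold margin at hm
    have : 0 < cross (a j) (a (j + 1)) * (c (j - 1) - dot (a (j - 1)) q) := by linarith
    linarith [(mul_pos_iff_of_pos_left c2).1 this]
  -- The witness is the midpoint of the two end points `p` and `q` of the side on line `j`. Each of
  -- the neighbouring constraints is tight at one of them and slack at the other, so it is slack at
  -- the midpoint.
  have hmid : ∀ u : Plane, dot u ((2⁻¹ : ℝ) • (p + q)) = (dot u p + dot u q) / 2 := by
    intro u; rw [dot_smul, dot_add]; ring
  refine ⟨(2⁻¹ : ℝ) • (p + q), by rw [hmid]; linarith, fun i hi => ?_⟩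
  obtain ⟨z, hz1, hz2⟩ := h.exists_period i (τ j - Real.pi)
  rw [← h.normal_period i z, ← h.const_period i z]
  have hne := hi z
  generalize i + r * z = i' at *
  rcases lt_or_gt_of_ne hne with hlt | hlt
  · exact (h.backward_slack (by rw [hmid]; linarith) (by rw [hmid]; linarith) hlt hz1.le).2
      (Or.inr (by rw [hmid]; linarith))
  · exact (h.forward_slack (by rw [hmid]; linarith) (by rw [hmid]; linarith) hlt (by linarith)).2
      (Or.inr (by rw [hmid]; linarith))

end StrictCycle

/-! ### Cyclic lists of half-planes stored in a segment of an array -/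

def cycNext (lo hi p : ℕ) : ℕ := if p + 1 = hi then lo else p + 1
def cycPrev (lo hi p : ℕ) : ℕ := if p = lo then hi - 1 else p - 1

/-- The normals with indices `B lo, …, B (hi - 1)` turn left once. -/
structure CyclicOrder (m : ℕ → Plane) (B : ℕ → ℕ) (lo hi : ℕ) (τ : ℕ → ℝ) : Prop where
  lt_hi : lo < hi
  hasAngle : ∀ p, lo ≤ p → p < hi → HasAngle (m (B p)) (τ p)
  lt : ∀ p, lo ≤ p → p + 1 < hi → τ p < τ (p + 1)
  lt_add_pi : ∀ p, lo ≤ p → p + 1 < hi → τ (p + 1) < τ p + Real.pi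
  wrap_lt : τ (hi - 1) < τ lo + 2 * Real.pi
  wrap_lt_add_pi : τ lo + 2 * Real.pi < τ (hi - 1) + Real.pi

/-- The half-plane in position `p` is not implied by its two neighbours. -/
def StrictAt (m : ℕ → Plane) (c : ℕ → ℝ) (B : ℕ → ℕ) (lo hi p : ℕ) : Prop :=
  0 < margin (m (B (cycPrev lo hi p))) (m (B p)) (m (B (cycNext lo hi p)))
    (c (B (cycPrev lo hi p))) (c (B p)) (c (B (cycNext lo hi p)))

theorem CyclicOrder.strictMonoOn {m : ℕ → Plane} {B : ℕ → ℕ} {lo hi : ℕ} {τ : ℕ → ℝ}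
    (h : CyclicOrder m B lo hi τ) {p q : ℕ} (hp : lo ≤ p) (hpq : p < q) (hq : q < hi) :
    τ p < τ q := by
  induction q, hpq using Nat.le_induction with
  | base => exact h.lt p hp hq
  | succ q hpq ih => exact (ih (by omega)).trans (h.lt q (by omega) hq)

/-- The gaps between consecutive directions add up to `2π` and each of them is less than `π`. -/
theorem CyclicOrder.three_le {m : ℕ → Plane} {B : ℕ → ℕ} {lo hi : ℕ} {τ : ℕ → ℝ}
    (h : CyclicOrder m B lo hi τ) : lo + 3 ≤ hi := by
  have h1 := h.wrap_lt_add_pi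
  have h0 := h.lt_hi
  have hpi := Real.pi_pos
  by_contra hc
  obtain rfl | rfl : hi = lo + 1 ∨ hi = lo + 2 := by omega
  · simp only [Nat.add_sub_cancel] at h1; linarith
  · have h2 := h.lt_add_pi lo le_rfl (by omega)
    have e : lo + 2 - 1 = lo + 1 := by omega
    rw [e] at h1; linarith

/-- The segment is unrolled to a periodic sequence indexed by all integers, with `2π` added to the
angles in each round. Arguments about neighbours then need no cases at the ends. -/
theorem CyclicOrder.strictCycle {m : ℕ → Plane} {c : ℕ → ℝ} {B : ℕ → ℕ} {lo hi : ℕ} {τ : ℕ → ℝ}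
    (h : CyclicOrder m B lo hi τ) (hs : ∀ p, lo ≤ p → p < hi → StrictAt m c B lo hi p) :
    StrictCycle (hi - lo) (fun t => m (B (lo + (t % (hi - lo : ℕ)).toNat)))
      (fun t => c (B (lo + (t % (hi - lo : ℕ)).toNat)))
      (fun t => τ (lo + (t % (hi - lo : ℕ)).toNat) + (t / (hi - lo : ℕ) : ℤ) * (2 * Real.pi)) := by
  have hlt := h.lt_hi
  obtain ⟨r, hr, rfl⟩ : ∃ r, 0 < r ∧ hi = lo + r := ⟨hi - lo, by omega, by omega⟩
  rw [Nat.add_sub_cancel_left]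
  have hr' : (0 : ℤ) < r := by exact_mod_cast hr
  have hdecomp : ∀ t : ℤ, ∃ n : ℕ, n < r ∧ ∃ z : ℤ, t = n + r * z := by
    intro t
    refine ⟨(t % r).toNat, ?_, t / r, ?_⟩
    · have := Int.emod_lt_of_pos t hr'; have := Int.emod_nonneg t hr'.ne'; omega
    · rw [Int.toNat_of_nonneg (Int.emod_nonneg t hr'.ne')]
      exact (Int.emod_add_mul_ediv t r).symm
  have hmod : ∀ (n : ℕ) (z : ℤ), n < r → ((n + r * z : ℤ) % r).toNat = n := by
    intro n z hn
    rw [Int.add_mul_emod_self_left, Int.emod_eq_of_lt (by omega) (by omega)]; simp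
  have hdiv : ∀ (n : ℕ) (z : ℤ), n < r → ((n + r * z : ℤ) / r) = z := by
    intro n z hn
    rw [Int.add_mul_ediv_left _ _ hr'.ne', Int.ediv_eq_zero_of_lt (by omega) (by omega), zero_add]
  have hnext : ∀ (n : ℕ) (z : ℤ), n < r →
      lo + ((n + r * z + 1 : ℤ) % r).toNat = cycNext lo (lo + r) (lo + n) ∧
      ((n + r * z + 1 : ℤ) / r) = if n + 1 = r then z + 1 else z := by
    intro n z hn
    by_cases hn' : n + 1 = r
    · have e : (n + r * z + 1 : ℤ) = ((0 : ℕ) : ℤ) + r * (z + 1) := by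
        rw [← hn']; push_cast; ring
      rw [e, hmod 0 _ hr, hdiv 0 _ hr, if_pos hn', cycNext, if_pos (by omega)]
      exact ⟨rfl, rfl⟩
    · have e : (n + r * z + 1 : ℤ) = ((n + 1 : ℕ) : ℤ) + r * z := by push_cast; ring
      rw [e, hmod (n + 1) _ (by omega), hdiv (n + 1) _ (by omega), if_neg hn', cycNext,
        if_neg (by omega)]
      exact ⟨rfl, rfl⟩
  have hstep : ∀ t : ℤ, τ (lo + (t % r).toNat) + (t / r : ℤ) * (2 * Real.pi) <
      τ (lo + ((t + 1) % r).toNat) + ((t + 1) / r : ℤ) * (2 * Real.pi) ∧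
      τ (lo + ((t + 1) % r).toNat) + ((t + 1) / r : ℤ) * (2 * Real.pi) <
      τ (lo + (t % r).toNat) + (t / r : ℤ) * (2 * Real.pi) + Real.pi := by
    intro t
    obtain ⟨n, hn, z, rfl⟩ := hdecomp t
    obtain ⟨e1, e2⟩ := hnext n z hn
    rw [e1, e2, hmod n z hn, hdiv n z hn]
    by_cases hn' : n + 1 = r
    · rw [if_pos hn', cycNext, if_pos (by omega)]
      have h1 := h.wrap_lt
      have h2 := h.wrap_lt_add_pi
      rw [show lo + r - 1 = lo + n by omega] at h1 h2
      push_cast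
      constructor <;> nlinarith
    · rw [if_neg hn', cycNext, if_neg (by omega)]
      have h1 := h.lt (lo + n) (by omega) (by omega)
      have h2 := h.lt_add_pi (lo + n) (by omega) (by omega)
      constructor <;> linarith
  have hper : ∀ t z : ℤ, (t + r * z) % r = t % r := fun t z => Int.add_mul_emod_self_left _ _ _
  refine ⟨?_, fun t => (hstep t).1, fun t => (hstep t).2, ?_, ?_, ?_, ?_⟩
  · intro t
    have h1 := Int.emod_lt_of_pos t hr'
    have h2 := Int.emod_nonneg t hr'.ne'
    exact (h.hasAngle _ (by omega) (by omega)).add_int_mul _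
  · intro t
    obtain ⟨n, hn, z, e⟩ := hdecomp (t + 1)
    obtain ⟨e1, -⟩ := hnext n z hn
    have e0 : lo + (t % r).toNat = cycPrev lo (lo + r) (lo + n) := by
      obtain ⟨n', hn', z', rfl⟩ := hdecomp t
      obtain ⟨e2, -⟩ := hnext n' z' hn'
      rw [hmod n' z' hn']
      rw [e, hmod n z hn] at e2
      unfold cycNext at e2
      unfold cycPrev
      split_ifs at e2 ⊢ <;> omega
    have := hs (lo + n) (by omega) (by omega)
    unfold StrictAt at this
    rw [← e0, ← e1, ← e] at this
    rw [e, hmod n z hn]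
    rwa [show t + 1 + 1 = t + 2 by ring] at this
  · intro t z; simp only [hper]
  · intro t z; simp only [hper]
  · intro t z
    simp only [hper]
    rw [Int.add_mul_ediv_left _ _ hr'.ne']; push_cast; ring

section
variable {m : ℕ → Plane} {c : ℕ → ℝ} {B : ℕ → ℕ} {lo hi : ℕ} {τ : ℕ → ℝ}

theorem CyclicOrder.vertex_feasible (h : CyclicOrder m B lo hi τ)
    (hs : ∀ p, lo ≤ p → p < hi → StrictAt m c B lo hi p) {q : Plane}
    (h0 : c (B lo) = dot (m (B lo)) q) (h1 : c (B (lo + 1)) = dot (m (B (lo + 1))) q) (p : ℕ)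
    (hp : lo ≤ p) (hp' : p < hi) : dot (m (B p)) q ≤ c (B p) := by
  have h3 := h.three_le
  have := (h.strictCycle hs).vertex_feasible (j := 0) (q := q) (by simpa using h0)
    (by
      have e : ((0 + 1 : ℤ) % (hi - lo : ℕ)).toNat = 1 := by
        rw [Int.emod_eq_of_lt (by omega) (by omega)]; rfl
      simp only [e]; exact h1) (p - lo : ℕ)
  rw [Int.emod_eq_of_lt (by omega) (by omega)] at this
  rw [Int.toNat_natCast, show lo + (p - lo) = p by omega] at this
  exact this

theorem CyclicOrder.exists_only_tight (h : CyclicOrder m B lo hi τ)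
    (hs : ∀ p, lo ≤ p → p < hi → StrictAt m c B lo hi p) (p : ℕ) (hp : lo ≤ p) (hp' : p < hi) :
    ∃ q : Plane, c (B p) = dot (m (B p)) q ∧
      ∀ p', lo ≤ p' → p' < hi → p' ≠ p → dot (m (B p')) q < c (B p') := by
  obtain ⟨q, hq1, hq2⟩ := (h.strictCycle hs).exists_only_tight (p - lo : ℕ)
  have e : ∀ p, lo ≤ p → p < hi → lo + (((p - lo : ℕ) : ℤ) % (hi - lo : ℕ)).toNat = p := by
    intro p hp hp'
    rw [Int.emod_eq_of_lt (by omega) (by omega), Int.toNat_natCast]; omega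
  rw [e p hp hp'] at hq1
  refine ⟨q, hq1, fun p' hq hq' hne => ?_⟩
  have := hq2 (p' - lo : ℕ) (by
    intro z hz
    rcases lt_trichotomy z 0 with hz0 | rfl | hz0
    · have : ((hi - lo : ℕ) : ℤ) * z ≤ ((hi - lo : ℕ) : ℤ) * (-1) :=
        mul_le_mul_of_nonneg_left (by omega) (by omega)
      omega
    · omega
    · have : ((hi - lo : ℕ) : ℤ) * 1 ≤ ((hi - lo : ℕ) : ℤ) * z :=
        mul_le_mul_of_nonneg_left (by omega) (by omega)
      omega)
  rwa [e p' hq hq'] at this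

/-- Push the point at which only `p` is tight slightly across that line, along its normal. The other
constraints are strict there and survive by continuity. -/
theorem CyclicOrder.exists_only_violated (h : CyclicOrder m B lo hi τ)
    (hs : ∀ p, lo ≤ p → p < hi → StrictAt m c B lo hi p) (p : ℕ) (hp : lo ≤ p) (hp' : p < hi) :
    ∃ q : Plane, c (B p) < dot (m (B p)) q ∧
      ∀ p', lo ≤ p' → p' < hi → p' ≠ p → dot (m (B p')) q ≤ c (B p') := by
  obtain ⟨q, hq1, hq2⟩ := h.exists_only_tight hs p hp hp'
  have hev : ∀ᶠ ε in nhdsWithin (0 : ℝ) (Set.Ioi 0), ∀ p' ∈ Finset.Ico lo hi, p' ≠ p →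
      dot (m (B p')) (q + ε • m (B p)) < c (B p') := by
    rw [Filter.eventually_all_finset]
    intro p' hp'
    rw [Finset.mem_Ico] at hp'
    by_cases hne : p' = p
    · exact Filter.Eventually.of_forall fun ε h => absurd hne h
    · have hcont : Continuous fun ε : ℝ => dot (m (B p')) (q + ε • m (B p)) := by
        unfold dot; fun_prop
      have : ∀ᶠ ε in nhds (0 : ℝ), dot (m (B p')) (q + ε • m (B p)) < c (B p') := by
        apply hcont.continuousAt.eventually_lt continuousAt_const
        simpa using hq2 p' hp'.1 hp'.2 hne
      exact (this.filter_mono nhdsWithin_le_nhds).mono fun ε h _ => h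
  obtain ⟨ε, hε, hpos⟩ := (hev.and self_mem_nhdsWithin).exists
  refine ⟨q + ε • m (B p), ?_, fun p' h1 h2 hne => (hε p' (Finset.mem_Ico.2 ⟨h1, h2⟩) hne).le⟩
  rw [dot_add, dot_smul, hq1]
  have := mul_pos (Set.mem_Ioi.1 hpos) (dot_self_pos (h.hasAngle p hp hp').ne_zero)
  linarith

/-! Moving the first entry to the end of the segment. -/

theorem CyclicOrder.rotate (h : CyclicOrder m B lo hi τ) :
    CyclicOrder m (Function.update B hi (B lo)) (lo + 1) (hi + 1)
      (Function.update τ hi (τ lo + 2 * Real.pi)) := by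
  have h3 := h.three_le
  have hu : ∀ {α : Type} (f : ℕ → α) x p, p < hi → Function.update f hi x p = f p :=
    fun f x p hp => Function.update_of_ne (by omega) _ _
  have hu' : ∀ {α : Type} (f : ℕ → α) x, Function.update f hi x hi = x :=
    fun f x => Function.update_self _ _ _
  refine ⟨by omega, fun p hp hp' => ?_, fun p hp hp' => ?_, fun p hp hp' => ?_, ?_, ?_⟩
  · by_cases e : p = hi
    · subst e; rw [hu', hu']
      have := (h.hasAngle lo le_rfl h.lt_hi).add_int_mul 1
      simpa using this
    · rw [hu _ _ _ (by omega), hu _ _ _ (by omega)]; exact h.hasAngle p (by omega) (by omega)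
  · by_cases e : p + 1 = hi
    · subst e; rw [hu', hu _ _ _ (by omega)]; have := h.wrap_lt; simpa using this
    · rw [hu _ _ _ (by omega), hu _ _ _ (by omega)]; exact h.lt p (by omega) (by omega)
  · by_cases e : p + 1 = hi
    · subst e; rw [hu', hu _ _ _ (by omega)]; have := h.wrap_lt_add_pi; simpa using this
    · rw [hu _ _ _ (by omega), hu _ _ _ (by omega)]; exact h.lt_add_pi p (by omega) (by omega)
  · rw [Nat.add_sub_cancel, hu', hu _ _ _ (by omega)]
    have := h.lt lo le_rfl (by omega); linarith
  · rw [Nat.add_sub_cancel, hu', hu _ _ _ (by omega)]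
    have := h.lt_add_pi lo le_rfl (by omega); linarith

theorem StrictAt.rotate {p : ℕ} (hp : lo < p) (hp' : p < hi)
    (hs : StrictAt m c B lo hi p) :
    StrictAt m c (Function.update B hi (B lo)) (lo + 1) (hi + 1) p := by
  have hu : ∀ x p, p < hi → Function.update B hi x p = B p :=
    fun x p hp => Function.update_of_ne (by omega) _ _
  have hu' : ∀ x, Function.update B hi x hi = x := fun x => Function.update_self _ _ _
  have e1 : Function.update B hi (B lo) (cycPrev (lo + 1) (hi + 1) p) = B (cycPrev lo hi p) := by
    unfold cycPrev
    by_cases e : p = lo + 1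
    · rw [if_pos e, if_neg (by omega), Nat.add_sub_cancel, hu', e]; rfl
    · rw [if_neg e, if_neg (by omega), hu _ _ (by omega)]
  have e2 : Function.update B hi (B lo) (cycNext (lo + 1) (hi + 1) p) = B (cycNext lo hi p) := by
    unfold cycNext
    by_cases e : p + 1 = hi
    · rw [if_neg (by omega), if_pos e, e, hu']
    · rw [if_neg (by omega), if_neg e, hu _ _ (by omega)]
  unfold StrictAt at hs ⊢
  rwa [e1, e2, hu _ _ hp']

theorem StrictAt.rotate_last (h3 : lo + 3 ≤ hi) (hs : StrictAt m c B lo hi lo) :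
    StrictAt m c (Function.update B hi (B lo)) (lo + 1) (hi + 1) hi := by
  have hu : ∀ x p, p < hi → Function.update B hi x p = B p :=
    fun x p hp => Function.update_of_ne (by omega) _ _
  have hu' : ∀ x, Function.update B hi x hi = x := fun x => Function.update_self _ _ _
  unfold StrictAt cycPrev cycNext at hs ⊢
  rw [if_pos rfl, if_neg (by omega)] at hs
  rw [if_neg (by omega), if_pos rfl, hu', hu _ _ (by omega), hu _ _ (by omega)]
  exact hs

/-! Deleting the first entry and moving the last entry to its place. -/

/-- At the common interior point `o` all slacks are positive, so the margin can fail to be positive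
only if `a × d` is positive. The margin formula at `q` then bounds the slack of `b` from below by
the slacks of `a` and `d`. Thus an interior point guarantees that the two neighbours of an implied
half-plane still turn left. -/
theorem implied_of_margin_nonpos {a b d : Plane} {x y z : ℝ} (h : margin a b d x y z ≤ 0)
    (hab : 0 < cross a b) (hbd : 0 < cross b d) {o : Plane} (ha : dot a o < x) (hb : dot b o < y)
    (hd : dot d o < z) :
    0 < cross a d ∧ ∀ q, dot a q ≤ x → dot d q ≤ z → dot b q ≤ y := by
  have e := margin_slack a b d o x y z
  have h1 : 0 < cross a d := by
    unfold margin at e h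
    by_contra hc
    have := mul_nonneg (neg_nonneg.2 (not_lt.1 hc)) (sub_pos.2 hb).le
    have := mul_pos hbd (sub_pos.2 ha)
    have := mul_pos hab (sub_pos.2 hd)
    linarith
  refine ⟨h1, fun q h2 h3 => ?_⟩
  have e := margin_slack a b d q x y z
  rw [← e] at h
  unfold margin at h
  have k1 := mul_nonneg hbd.le (sub_nonneg.2 h2)
  have k2 := mul_nonneg hab.le (sub_nonneg.2 h3)
  have k3 : 0 ≤ cross a d * (y - dot b q) := by linarith
  linarith [(mul_nonneg_iff_of_pos_left h1).1 k3]

theorem CyclicOrder.cross_pos (h : CyclicOrder m B lo hi τ) {p : ℕ} (hp : lo ≤ p) (hp' : p + 1 < hi) :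
    0 < cross (m (B p)) (m (B (p + 1))) :=
  (h.hasAngle p hp (by omega)).cross_pos (h.hasAngle _ (by omega) hp') (h.lt p hp hp')
    (h.lt_add_pi p hp hp')

theorem CyclicOrder.cross_pos_wrap (h : CyclicOrder m B lo hi τ) :
    0 < cross (m (B (hi - 1))) (m (B lo)) := by
  have h3 := h.three_le
  have := (h.hasAngle lo le_rfl h.lt_hi).add_int_mul 1
  simp only [Int.cast_one, one_mul] at this
  exact (h.hasAngle (hi - 1) (by omega) (by omega)).cross_pos this h.wrap_lt h.wrap_lt_add_pi

/-- The old last entry comes to the front, with its angle lowered by a revolution. The hypothesis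
keeps the new gap between it and the next entry below `π`. -/
theorem CyclicOrder.delete (h : CyclicOrder m B lo hi τ)
    (hc : 0 < cross (m (B (hi - 1))) (m (B (lo + 1)))) :
    CyclicOrder m (Function.update B lo (B (hi - 1))) lo (hi - 1)
      (Function.update τ lo (τ (hi - 1) - 2 * Real.pi)) := by
  have h3 := h.three_le
  have hu : ∀ {α : Type} (f : ℕ → α) x p, lo < p → Function.update f lo x p = f p :=
    fun f x p hp => Function.update_of_ne (by omega) _ _
  have hu' : ∀ {α : Type} (f : ℕ → α) x, Function.update f lo x lo = x :=
    fun f x => Function.update_self _ _ _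
  have hA : HasAngle (m (B (hi - 1))) (τ (hi - 1) - 2 * Real.pi) := by
    have := (h.hasAngle (hi - 1) (by omega) (by omega)).add_int_mul (-1)
    simpa [sub_eq_add_neg] using this
  have h1 := h.wrap_lt
  have h2 := h.lt lo le_rfl (by omega)
  have h4 := h.strictMonoOn (p := lo + 1) (q := hi - 1) (by omega) (by omega) (by omega)
  have hgap : τ (lo + 1) < τ (hi - 1) - 2 * Real.pi + Real.pi :=
    hA.lt_of_cross_pos (h.hasAngle _ (by omega) (by omega)) hc (by linarith)
  refine ⟨by omega, fun p hp hp' => ?_, fun p hp hp' => ?_, fun p hp hp' => ?_, ?_, ?_⟩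
  · by_cases e : p = lo
    · subst e; rw [hu', hu']; exact hA
    · rw [hu _ _ _ (by omega), hu _ _ _ (by omega)]; exact h.hasAngle p (by omega) (by omega)
  · by_cases e : p = lo
    · subst e; rw [hu', hu _ _ _ (by omega)]; linarith
    · rw [hu _ _ _ (by omega), hu _ _ _ (by omega)]; exact h.lt p (by omega) (by omega)
  · by_cases e : p = lo
    · subst e; rw [hu', hu _ _ _ (by omega)]; exact hgap
    · rw [hu _ _ _ (by omega), hu _ _ _ (by omega)]; exact h.lt_add_pi p (by omega) (by omega)
  · have := h.lt (hi - 1 - 1) (by omega) (by omega)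
    rw [show hi - 1 - 1 + 1 = hi - 1 by omega] at this
    rw [hu', hu _ _ _ (by omega)]; linarith
  · have := h.lt_add_pi (hi - 1 - 1) (by omega) (by omega)
    rw [show hi - 1 - 1 + 1 = hi - 1 by omega] at this
    rw [hu', hu _ _ _ (by omega)]; linarith

/-- Only the two neighbours of the deleted entry see different neighbours afterwards; the bounds on
`p` exclude them. -/
theorem StrictAt.delete {p : ℕ} (hp : lo + 2 ≤ p) (hp' : p + 1 < hi)
    (hs : StrictAt m c B lo hi p) :
    StrictAt m c (Function.update B lo (B (hi - 1))) lo (hi - 1) p := by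
  have hu : ∀ x p, lo < p → Function.update B lo x p = B p :=
    fun x p hp => Function.update_of_ne (by omega) _ _
  have hu' : ∀ x, Function.update B lo x lo = x := fun x => Function.update_self _ _ _
  have e1 : Function.update B lo (B (hi - 1)) (cycPrev lo (hi - 1) p) = B (cycPrev lo hi p) := by
    unfold cycPrev
    rw [if_neg (by omega), if_neg (by omega), hu _ _ (by omega)]
  have e2 : Function.update B lo (B (hi - 1)) (cycNext lo (hi - 1) p) = B (cycNext lo hi p) := by
    unfold cycNext
    by_cases e : p + 1 = hi - 1
    · rw [if_pos e, if_neg (by omega), hu', e]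
    · rw [if_neg e, if_neg (by omega), hu _ _ (by omega)]
  unfold StrictAt at hs ⊢
  rwa [e1, e2, hu _ _ (by omega)]

/-- Normals that are sorted by angle and positively span the plane turn left once. -/
theorem CyclicOrder.of_angle_lt (hlt : lo < hi) (h0 : ∀ p, lo ≤ p → p < hi → m (B p) ≠ 0)
    (hs : ∀ p, lo ≤ p → p + 1 < hi → angle (m (B p)) < angle (m (B (p + 1))))
    (hspan : ∀ u : Plane, u ≠ 0 → ∃ p, lo ≤ p ∧ p < hi ∧ 0 < dot (m (B p)) u) :
    CyclicOrder m B lo hi (fun p => angle (m (B p))) := by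
  have hmono : ∀ p q, lo ≤ p → p ≤ q → q < hi → angle (m (B p)) ≤ angle (m (B q)) := by
    intro p q hp hpq hq
    induction q, hpq using Nat.le_induction with
    | base => exact le_rfl
    | succ q hpq ih => exact (ih (by omega)).trans (hs q (by omega) hq).le
  have hA : ∀ p, lo ≤ p → p < hi → HasAngle (m (B p)) (angle (m (B p))) :=
    fun p hp hp' => hasAngle_angle (h0 p hp hp')
  -- An open half-circle of directions contains one of the normals.
  have hgap : ∀ x y : ℝ, x + Real.pi ≤ y → (∀ p, lo ≤ p → p < hi → ∃ z : ℤ,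
      y ≤ angle (m (B p)) + z * (2 * Real.pi) ∧
        angle (m (B p)) + z * (2 * Real.pi) ≤ x + 2 * Real.pi) → False := by
    intro x y hxy hall
    have hU : HasAngle (Real.cos ((x + y) / 2), Real.sin ((x + y) / 2)) ((x + y) / 2) :=
      ⟨1, one_pos, by simp⟩
    obtain ⟨p, hp, hp', hpos⟩ := hspan _ hU.ne_zero
    obtain ⟨z, hz1, hz2⟩ := hall p hp hp'
    obtain ⟨r, hr, e⟩ := hU.dot_eq ((hA p hp hp').add_int_mul z)
    have hcomm : ∀ u w : Plane, dot u w = dot w u := by intro u w; unfold dot; ring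
    rw [hcomm, e] at hpos
    have hcos := (mul_pos_iff_of_pos_left hr).1 hpos
    have := Real.cos_nonpos_of_pi_div_two_le_of_le
      (x := angle (m (B p)) + z * (2 * Real.pi) - (x + y) / 2) (by linarith) (by linarith)
    linarith
  refine ⟨hlt, hA, hs, fun p hp hp' => ?_, ?_, ?_⟩
  · by_contra hc
    refine hgap (angle (m (B p))) (angle (m (B (p + 1)))) (not_lt.1 hc) fun q hq hq' => ?_
    by_cases hqp : q ≤ p
    · refine ⟨1, ?_, ?_⟩
      · have := neg_pi_lt_angle (m (B q)); have := angle_le_pi (m (B (p + 1)))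
        push_cast; linarith
      · have := hmono q p hq hqp (by omega); push_cast; linarith
    · refine ⟨0, ?_, ?_⟩
      · have := hmono (p + 1) q (by omega) (by omega) hq'; push_cast; linarith
      · have := neg_pi_lt_angle (m (B p)); have := angle_le_pi (m (B q))
        push_cast; linarith
  · have := neg_pi_lt_angle (m (B lo)); have := angle_le_pi (m (B (hi - 1))); linarith
  · by_contra hc
    refine hgap (angle (m (B (hi - 1)))) (angle (m (B lo)) + 2 * Real.pi) (by linarith)
      fun q hq hq' => ⟨1, ?_, ?_⟩
    · have := hmono lo q le_rfl hq hq'; push_cast; linarith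
    · have := hmono q (hi - 1) hq (by omega) (by omega); push_cast; linarith

end

/-! ### Reasoning about programs -/

namespace RealRAM

theorem State.writeInt_int_self (s : State) (a i x : ℕ) :
    (s.writeInt a i x).int a = Function.update (s.int a) i x := Function.update_self _ _ _

theorem State.writeInt_int_of_ne (s : State) {a b : ℕ} (i x : ℕ) (h : b ≠ a) :
    (s.writeInt a i x).int b = s.int b := Function.update_of_ne h _ _

theorem State.writeInt_real (s : State) (a i x : ℕ) : (s.writeInt a i x).real = s.real := rfl

theorem State.writeReal_real_self (s : State) (a i : ℕ) (x : ℝ) :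
    (s.writeReal a i x).real a = Function.update (s.real a) i x := Function.update_self _ _ _

theorem State.writeReal_real_of_ne (s : State) {a b : ℕ} (i : ℕ) (x : ℝ) (h : b ≠ a) :
    (s.writeReal a i x).real b = s.real b := Function.update_of_ne h _ _

theorem State.writeReal_int (s : State) (a i : ℕ) (x : ℝ) : (s.writeReal a i x).int = s.int := rfl

/-- The time of a loop-free program. -/
def Program.cost : Program → ℕ
  | skip => 1
  | setInt _ e f => e.time + f.time + 1
  | setReal _ e f => e.time + f.time + 1
  | seq p q => p.cost + q.cost
  | cond b p q => b.time + 1 + max p.cost q.cost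
  -- A dummy value: `wp` is false for loops, so no time bound of a loop is taken from here.
  | loop _ _ => 0

/-- The weakest precondition of a loop-free program. -/
def Program.wp : Program → (State → Prop) → State → Prop
  | skip, Q, s => Q s
  | setInt a e f, Q, s => Q (s.writeInt a (e.eval s) (f.eval s))
  | setReal a e f, Q, s => Q (s.writeReal a (e.eval s) (f.eval s))
  | seq p q, Q, s => p.wp (q.wp Q) s
  | cond b p q, Q, s => (b.Holds s → p.wp Q s) ∧ (¬ b.Holds s → q.wp Q s)
  | loop _ _, _, _ => False

/-- The integer arrays a program may write to. -/
def Program.WritesInt : Program → ℕ → Prop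
  | setInt b _ _, a => a = b
  | seq p q, a => p.WritesInt a ∨ q.WritesInt a
  | cond _ p q, a => p.WritesInt a ∨ q.WritesInt a
  | loop _ p, a => p.WritesInt a
  | _, _ => False

/-- The real arrays a program may write to. -/
def Program.WritesReal : Program → ℕ → Prop
  | setReal b _ _, a => a = b
  | seq p q, a => p.WritesReal a ∨ q.WritesReal a
  | cond _ p q, a => p.WritesReal a ∨ q.WritesReal a
  | loop _ p, a => p.WritesReal a
  | _, _ => False

/-- Two states agree on all arrays that `p` does not write to. -/
def SameOutside (p : Program) (s s' : State) : Prop :=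
  (∀ a, ¬ p.WritesInt a → s'.int a = s.int a) ∧ ∀ a, ¬ p.WritesReal a → s'.real a = s.real a

theorem SameOutside.refl (p : Program) (s : State) : SameOutside p s s :=
  ⟨fun _ _ => rfl, fun _ _ => rfl⟩

theorem SameOutside.trans {p : Program} {s s' s'' : State} (h : SameOutside p s s')
    (h' : SameOutside p s' s'') : SameOutside p s s'' :=
  ⟨fun a ha => (h'.1 a ha).trans (h.1 a ha), fun a ha => (h'.2 a ha).trans (h.2 a ha)⟩

theorem SameOutside.mono {p q : Program} {s s' : State} (h : SameOutside p s s')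
    (hi : ∀ a, p.WritesInt a → q.WritesInt a) (hr : ∀ a, p.WritesReal a → q.WritesReal a) :
    SameOutside q s s' :=
  ⟨fun a ha => h.1 a fun h => ha (hi a h), fun a ha => h.2 a fun h => ha (hr a h)⟩

theorem Runs.sameOutside {p : Program} {s s' : State} {t : ℕ} (h : Runs p s s' t) :
    SameOutside p s s' := by
  induction h with
  | skip s => exact SameOutside.refl _ _
  | setInt s a e f => exact ⟨fun b hb => State.writeInt_int_of_ne _ _ _ hb, fun _ _ => rfl⟩
  | setReal s a e f => exact ⟨fun _ _ => rfl, fun b hb => State.writeReal_real_of_ne _ _ _ hb⟩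
  | seq _ _ ih1 ih2 =>
    exact (ih1.mono (fun _ => Or.inl) fun _ => Or.inl).trans
      (ih2.mono (fun _ => Or.inr) fun _ => Or.inr)
  | cond_true _ _ ih => exact ih.mono (fun _ => Or.inl) fun _ => Or.inl
  | cond_false _ _ ih => exact ih.mono (fun _ => Or.inr) fun _ => Or.inr
  | loop_true _ _ _ ih1 ih2 => exact SameOutside.trans ⟨ih1.1, ih1.2⟩ ih2
  | loop_false _ => exact SameOutside.refl _ _

/-- Started in `s`, the program halts within time `T` in a state with the property `Q`. -/
def Ensures (p : Program) (s : State) (T : ℕ) (Q : State → Prop) : Prop :=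
  ∃ s' t, Runs p s s' t ∧ t ≤ T ∧ Q s'

theorem Ensures.frame {p : Program} {s : State} {T : ℕ} {Q : State → Prop} (h : Ensures p s T Q) :
    Ensures p s T fun s' => SameOutside p s s' ∧ Q s' := by
  obtain ⟨s', t, hr, ht, hq⟩ := h
  exact ⟨s', t, hr, ht, hr.sameOutside, hq⟩

theorem Ensures.mono {p : Program} {s : State} {T T' : ℕ} {Q Q' : State → Prop}
    (h : Ensures p s T Q) (hT : T ≤ T') (hQ : ∀ s', SameOutside p s s' → Q s' → Q' s') :
    Ensures p s T' Q' := by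
  obtain ⟨s', t, hr, ht, hq⟩ := h
  exact ⟨s', t, hr, ht.trans hT, hQ s' hr.sameOutside hq⟩

theorem Ensures.seq {p q : Program} {s : State} {T T' : ℕ} {Q R : State → Prop}
    (h : Ensures p s T Q) (h' : ∀ s', SameOutside p s s' → Q s' → Ensures q s' T' R) :
    Ensures (.seq p q) s (T + T') R := by
  obtain ⟨s₁, t₁, hr, ht, hq⟩ := h
  obtain ⟨s₂, t₂, hr', ht', hq'⟩ := h' s₁ hr.sameOutside hq
  exact ⟨s₂, _, hr.seq hr', Nat.add_le_add ht ht', hq'⟩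

theorem Ensures.cond {b : Test} {p q : Program} {s : State} {T : ℕ} {Q : State → Prop}
    (hp : b.Holds s → Ensures p s T Q) (hq : ¬ b.Holds s → Ensures q s T Q) :
    Ensures (.cond b p q) s (b.time + 1 + T) Q := by
  by_cases hb : b.Holds s
  · obtain ⟨s', t, hr, ht, h⟩ := hp hb
    exact ⟨s', _, .cond_true hb hr, by omega, h⟩
  · obtain ⟨s', t, hr, ht, h⟩ := hq hb
    exact ⟨s', _, .cond_false hb hr, by omega, h⟩

theorem Ensures.of_wp {p : Program} {s : State} {Q : State → Prop} (h : p.wp Q s) :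
    Ensures p s p.cost Q := by
  induction p generalizing s Q with
  | skip => exact ⟨s, 1, .skip s, le_rfl, h⟩
  | setInt a e f => exact ⟨_, _, .setInt s a e f, le_rfl, h⟩
  | setReal a e f => exact ⟨_, _, .setReal s a e f, le_rfl, h⟩
  | seq p q ihp ihq => exact (ihp h).seq fun s' _ hs' => ihq hs'
  | cond b p q ihp ihq =>
    exact Ensures.cond (fun hb => (ihp (h.1 hb)).mono (le_max_left _ _) fun _ _ h => h)
      fun hb => (ihq (h.2 hb)).mono (le_max_right _ _) fun _ _ h => h
  | loop b p => exact h.elim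

/-- A loop with a loop-free body, an invariant `Inv` and a decreasing measure `μ`. -/
theorem Ensures.loop {b : Test} {p : Program} {s₀ : State} (Inv : State → Prop) (μ : State → ℕ)
    (h₀ : Inv s₀)
    (hstep : ∀ s, SameOutside p s₀ s → Inv s → b.Holds s → p.wp (fun s' => Inv s' ∧ μ s' < μ s) s) :
    Ensures (.loop b p) s₀ ((μ s₀ + 1) * (b.time + 1 + p.cost)) fun s => Inv s ∧ ¬ b.Holds s := by
  have key : ∀ N s, μ s = N → SameOutside p s₀ s → Inv s →
      Ensures (.loop b p) s ((N + 1) * (b.time + 1 + p.cost)) fun s => Inv s ∧ ¬ b.Holds s := by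
    intro N
    induction N using Nat.strong_induction_on with
    | _ N ih =>
      intro s hN hs hI
      by_cases hb : b.Holds s
      · obtain ⟨s₁, t₁, hr, ht, hI₁, hμ⟩ := Ensures.of_wp (hstep s hs hI hb)
        obtain ⟨s₂, t₂, hr', ht', hq⟩ := ih (μ s₁) (hN ▸ hμ) s₁ rfl (hs.trans hr.sameOutside) hI₁
        refine ⟨s₂, _, .loop_true hb hr hr', ?_, hq⟩
        have : (μ s₁ + 1 + 1) * (b.time + 1 + p.cost) ≤ (N + 1) * (b.time + 1 + p.cost) :=
          Nat.mul_le_mul_right _ (by omega)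
        nlinarith
      · exact ⟨s, _, .loop_false hb, by nlinarith, hI, hb⟩
  exact key _ s₀ rfl (SameOutside.refl _ _) h₀

/-- The programs of a list, one after the other. -/
def block : List Program → Program
  | [] => .skip
  | p :: ps => .seq p (block ps)

/-- The programs `f 0, …, f (n - 1)`, one after the other. -/
def unroll (f : ℕ → Program) : ℕ → Program
  | 0 => .skip
  | n + 1 => .seq (unroll f n) (f n)

/-- The first cell of an integer array, used as a variable. -/
abbrev ivar (a : ℕ) : IntExpr := .cell a (.lit 0)

abbrev setVar (a : ℕ) (e : IntExpr) : Program := .setInt a (.lit 0) e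

abbrev incr (a : ℕ) : Program := setVar a (.add (ivar a) (.lit 1))

end RealRAM

/-! ### Removing implied half-planes from a cyclic list -/

/-- The state of the removal: the last `cnt` entries have been compared with their neighbours. -/
structure TrimInv (m : ℕ → Plane) (c : ℕ → ℝ) (B₀ : ℕ → ℕ) (lo₀ hi₀ : ℕ) (B : ℕ → ℕ)
    (lo hi cnt : ℕ) : Prop where
  order : ∃ τ, CyclicOrder m B lo hi τ
  cnt_le : cnt ≤ hi - lo
  strict : ∀ p, hi ≤ p + cnt → p < hi → StrictAt m c B lo hi p
  mem : ∀ p, lo ≤ p → p < hi → ∃ p₀, lo₀ ≤ p₀ ∧ p₀ < hi₀ ∧ B p = B₀ p₀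
  implied : ∀ q, (∀ p, lo ≤ p → p < hi → dot (m (B p)) q ≤ c (B p)) →
    ∀ p, lo₀ ≤ p → p < hi₀ → dot (m (B₀ p)) q ≤ c (B₀ p)
  size_le : hi - lo ≤ hi₀ - lo₀

section
variable {m : ℕ → Plane} {c : ℕ → ℝ} {B₀ B : ℕ → ℕ} {lo₀ hi₀ lo hi cnt : ℕ}

theorem strictAt_first_iff (h : lo + 3 ≤ hi) : StrictAt m c B lo hi lo ↔
    0 < margin (m (B (hi - 1))) (m (B lo)) (m (B (lo + 1))) (c (B (hi - 1))) (c (B lo))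
      (c (B (lo + 1))) := by
  unfold StrictAt cycPrev cycNext
  rw [if_pos rfl, if_neg (by omega)]

theorem TrimInv.three_le (h : TrimInv m c B₀ lo₀ hi₀ B lo hi cnt) : lo + 3 ≤ hi := by
  obtain ⟨τ, hτ⟩ := h.order
  exact hτ.three_le

/-- The first entry has passed the test, so at the end of the list it extends the block of entries
known to be strict. -/
theorem TrimInv.rotate (h : TrimInv m c B₀ lo₀ hi₀ B lo hi cnt) (hcnt : cnt < hi - lo)
    (hs : StrictAt m c B lo hi lo) :
    TrimInv m c B₀ lo₀ hi₀ (Function.update B hi (B lo)) (lo + 1) (hi + 1) (cnt + 1) := by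
  have h3 := h.three_le
  obtain ⟨τ, hτ⟩ := h.order
  have hu : ∀ x p, p < hi → Function.update B hi x p = B p :=
    fun x p hp => Function.update_of_ne (by omega) _ _
  have hu' : ∀ x, Function.update B hi x hi = x := fun x => Function.update_self _ _ _
  refine ⟨⟨_, hτ.rotate⟩, by omega, fun p hp hp' => ?_, fun p hp hp' => ?_, fun q hq => ?_,
    by have := h.size_le; omega⟩
  · by_cases e : p = hi
    · subst e; exact StrictAt.rotate_last h3 hs
    · exact StrictAt.rotate (by omega) (by omega) (h.strict p (by omega) (by omega))
  · by_cases e : p = hi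
    · subst e; rw [hu']; exact h.mem lo le_rfl (by omega)
    · rw [hu _ _ (by omega)]; exact h.mem p (by omega) (by omega)
  · refine h.implied q fun p hp hp' => ?_
    by_cases e : p = lo
    · subst e
      have := hq hi (by omega) (by omega)
      rwa [hu'] at this
    · have := hq p (by omega) (by omega)
      rwa [hu _ _ hp'] at this

/-- The count drops by two. The old last entry has lost its successor and moves to the front to be
tested again. The earliest counted entry may have been the successor of the deleted one, so it is
given up too. -/
theorem TrimInv.delete (h : TrimInv m c B₀ lo₀ hi₀ B lo hi cnt) (hcnt : cnt < hi - lo) {o : Plane}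
    (ho : ∀ p, lo₀ ≤ p → p < hi₀ → dot (m (B₀ p)) o < c (B₀ p))
    (hs : ¬ StrictAt m c B lo hi lo) :
    TrimInv m c B₀ lo₀ hi₀ (Function.update B lo (B (hi - 1))) lo (hi - 1) (cnt - 2) := by
  have h3 := h.three_le
  obtain ⟨τ, hτ⟩ := h.order
  rw [strictAt_first_iff h3, not_lt] at hs
  have ho' : ∀ p, lo ≤ p → p < hi → dot (m (B p)) o < c (B p) := by
    intro p hp hp'
    obtain ⟨p₀, h1, h2, e⟩ := h.mem p hp hp'
    rw [e]; exact ho p₀ h1 h2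
  obtain ⟨hc, himp⟩ := implied_of_margin_nonpos hs hτ.cross_pos_wrap
    (hτ.cross_pos le_rfl (by omega)) (ho' _ (by omega) (by omega)) (ho' _ (by omega) (by omega))
    (ho' _ (by omega) (by omega))
  have hu : ∀ x p, lo < p → Function.update B lo x p = B p :=
    fun x p hp => Function.update_of_ne (by omega) _ _
  have hu' : ∀ x, Function.update B lo x lo = x := fun x => Function.update_self _ _ _
  have hτ' := hτ.delete hc
  have h3' := hτ'.three_le
  refine ⟨⟨_, hτ'⟩, by omega, fun p hp hp' => ?_, fun p hp hp' => ?_, fun q hq => ?_,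
    by have := h.size_le; omega⟩
  · exact StrictAt.delete (by omega) (by omega) (h.strict p (by omega) (by omega))
  · by_cases e : p = lo
    · subst e; rw [hu']; exact h.mem _ (by omega) (by omega)
    · rw [hu _ _ (by omega)]; exact h.mem p (by omega) (by omega)
  · have hlast : dot (m (B (hi - 1))) q ≤ c (B (hi - 1)) := by
      have := hq lo le_rfl (by omega)
      rwa [hu'] at this
    have hmid : ∀ p, lo < p → p < hi - 1 → dot (m (B p)) q ≤ c (B p) := by
      intro p hp hp'
      have := hq p hp.le hp'
      rwa [hu _ _ hp] at this
    refine h.implied q fun p hp hp' => ?_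
    by_cases e : p = lo
    · subst e; exact himp q hlast (hmid _ (by omega) (by omega))
    · by_cases e' : p = hi - 1
      · subst e'; exact hlast
      · exact hmid p (by omega) (by omega)

end

namespace RealRAM

def crossExpr (X Y : ℕ) (e f : IntExpr) : RealExpr :=
  .sub (.mul (.cell X e) (.cell Y f)) (.mul (.cell Y e) (.cell X f))

/-- The expression for the margin of the constraints `e`, `f`, `g`. -/
def marginExpr (X Y C : ℕ) (e f g : IntExpr) : RealExpr :=
  .sub (.add (.mul (crossExpr X Y f g) (.cell C e)) (.mul (crossExpr X Y e f) (.cell C g)))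
    (.mul (crossExpr X Y e g) (.cell C f))

/-- The normal vectors stored in two real arrays. -/
def State.normal (s : State) (X Y : ℕ) (g : ℕ) : Plane := (s.real X g, s.real Y g)

theorem eval_crossExpr (s : State) (X Y : ℕ) (e f : IntExpr) : (crossExpr X Y e f).eval s =
    cross (s.normal X Y (e.eval s)) (s.normal X Y (f.eval s)) := rfl

theorem eval_marginExpr (s : State) (X Y C : ℕ) (e f g : IntExpr) :
    (marginExpr X Y C e f g).eval s =
    margin (s.normal X Y (e.eval s)) (s.normal X Y (f.eval s)) (s.normal X Y (g.eval s))
      (s.real C (e.eval s)) (s.real C (f.eval s)) (s.real C (g.eval s)) := rfl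

/-- The body of `trim`. -/
def trimBody (B X Y C : ℕ) : Program :=
  .cond (.realLt (.lit 0) (marginExpr X Y C (.cell B (.sub (ivar 21) (.lit 1))) (.cell B (ivar 20))
      (.cell B (.add (ivar 20) (.lit 1)))))
    (block [.setInt B (ivar 21) (.cell B (ivar 20)), incr 21, incr 20, incr 22])
    (block [.setInt B (ivar 20) (.cell B (.sub (ivar 21) (.lit 1))),
      setVar 21 (.sub (ivar 21) (.lit 1)), setVar 22 (.sub (ivar 22) (.lit 2))])

/-- Removes implied half-planes from the cyclic list in the segment of the integer array `B` between
the values of the variables `20` and `21`. -/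
def trim (B X Y C : ℕ) : Program :=
  .seq (setVar 22 (.lit 0))
    (.loop (.intLt (ivar 22) (.sub (ivar 21) (ivar 20))) (trimBody B X Y C))

theorem trim_ensures {B X Y C : ℕ} (hB : 30 ≤ B ∨ B < 20) :
    ∃ K, ∀ (s : State) (o : Plane) (τ : ℕ → ℝ),
      CyclicOrder (s.normal X Y) (s.int B) (s.int 20 0) (s.int 21 0) τ →
      (∀ p, s.int 20 0 ≤ p → p < s.int 21 0 →
        dot (s.normal X Y (s.int B p)) o < s.real C (s.int B p)) →
      Ensures (trim B X Y C) s (K * (s.int 21 0 - s.int 20 0)) fun s' =>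
        TrimInv (s.normal X Y) (s.real C) (s.int B) (s.int 20 0) (s.int 21 0)
          (s'.int B) (s'.int 20 0) (s'.int 21 0) (s'.int 21 0 - s'.int 20 0) := by
  refine ⟨4 * ((Test.intLt (ivar 22) (.sub (ivar 21) (ivar 20))).time + 1 +
    (trimBody B X Y C).cost) + (setVar 22 (.lit 0)).cost, fun s o τ hτ ho => ?_⟩
  have hlt := hτ.lt_hi
  have h20 : B ≠ 20 := by omega
  have h21 : B ≠ 21 := by omega
  have h22 : B ≠ 22 := by omega
  refine Ensures.mono (Ensures.seq (Q := fun s' => s'.int = Function.update s.int 22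
    (Function.update (s.int 22) 0 0) ∧ s'.real = s.real) (Ensures.of_wp ?_)
    (T' := (3 * (s.int 21 0 - s.int 20 0) + 1) * ((Test.intLt (ivar 22) (.sub (ivar 21)
      (ivar 20))).time + 1 + (trimBody B X Y C).cost)) ?_) ?_ fun _ _ h => h
  · exact ⟨rfl, rfl⟩
  · rintro s₁ - ⟨hi₁, hr₁⟩
    have hμ : 3 * (s₁.int 21 0 - s₁.int 20 0) - s₁.int 22 0 = 3 * (s.int 21 0 - s.int 20 0) := by
      rw [hi₁]; simp
    rw [← hμ]
    refine Ensures.mono (Ensures.loop (s₀ := s₁)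
      (fun s' => s'.real = s.real ∧ TrimInv (s.normal X Y) (s.real C) (s.int B) (s.int 20 0)
        (s.int 21 0) (s'.int B) (s'.int 20 0) (s'.int 21 0) (s'.int 22 0))
      (fun s' => 3 * (s'.int 21 0 - s'.int 20 0) - s'.int 22 0) ⟨hr₁, ?_⟩ ?_) le_rfl ?_
    · rw [hi₁]
      simp only [Function.update_self, ne_eq, h22, not_false_eq_true, Function.update_of_ne,
        Nat.reduceEqDiff]
      exact ⟨⟨τ, hτ⟩, Nat.zero_le _, fun p hp hp' => by omega,
        fun p hp hp' => ⟨p, hp, hp', rfl⟩, fun q hq => hq, le_rfl⟩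
    · rintro s' - ⟨hr, hI⟩ hb
      have hb' : s'.int 22 0 < s'.int 21 0 - s'.int 20 0 := hb
      have h3 := hI.three_le
      have hcn := hI.cnt_le
      have hn : s'.normal X Y = s.normal X Y := by funext g; simp only [State.normal, hr]
      have htest : (Test.realLt (.lit 0) (marginExpr X Y C (.cell B (.sub (ivar 21) (.lit 1)))
          (.cell B (ivar 20)) (.cell B (.add (ivar 20) (.lit 1))))).Holds s' ↔
          StrictAt (s.normal X Y) (s.real C) (s'.int B) (s'.int 20 0) (s'.int 21 0)
            (s'.int 20 0) := by
        rw [strictAt_first_iff h3]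
        simp only [Test.Holds, eval_marginExpr, RealExpr.eval, IntExpr.eval, Rat.cast_zero, hn, hr]
      refine ⟨fun ht => ?_, fun ht => ?_⟩
      · have := hI.rotate hb' (htest.1 ht)
        simp only [block, Program.wp, IntExpr.eval, State.writeInt_int_self, State.writeInt_real,
          State.writeInt_int_of_ne, ne_eq, h20, h21, h22, h20.symm, h21.symm, h22.symm,
          not_false_eq_true, Nat.reduceEqDiff, Function.update_self, hr,
          true_and]
        exact ⟨this, by omega⟩
      · have := hI.delete hb' ho (htest.not.1 ht)
        simp only [block, Program.wp, IntExpr.eval, State.writeInt_int_self, State.writeInt_real,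
          State.writeInt_int_of_ne, ne_eq, h20, h21, h22, h20.symm, h21.symm, h22.symm,
          not_false_eq_true, Nat.reduceEqDiff, Function.update_self, hr,
          true_and]
        exact ⟨this, by omega⟩
    · rintro s' - ⟨⟨hr, hI⟩, hb⟩
      have hb' : ¬ s'.int 22 0 < s'.int 21 0 - s'.int 20 0 := hb
      have hcn := hI.cnt_le
      have e : s'.int 22 0 = s'.int 21 0 - s'.int 20 0 := by omega
      rwa [e] at hI
  · have : 1 ≤ s.int 21 0 - s.int 20 0 := by omega
    nlinarith

theorem Program.wp_mono {p : Program} {Q R : State → Prop} (h : ∀ s, Q s → R s) {s : State}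
    (hp : p.wp Q s) : p.wp R s := by
  induction p generalizing s Q R with
  | skip => exact h _ hp
  | setInt a e f => exact h _ hp
  | setReal a e f => exact h _ hp
  | seq p q ihp ihq => exact ihp (fun s => ihq h) hp
  | cond b p q ihp ihq => exact ⟨fun hb => ihp h (hp.1 hb), fun hb => ihq h (hp.2 hb)⟩
  | loop b p => exact hp.elim

theorem Program.wp_frame {p : Program} {Q : State → Prop} {s : State} (h : p.wp Q s) :
    p.wp (fun s' => SameOutside p s s' ∧ Q s') s := by
  induction p generalizing s Q with
  | skip => exact ⟨SameOutside.refl _ _, h⟩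
  | setInt a e f => exact ⟨(Runs.setInt s a e f).sameOutside, h⟩
  | setReal a e f => exact ⟨(Runs.setReal s a e f).sameOutside, h⟩
  | seq p q ihp ihq =>
    change p.wp _ s
    refine wp_mono ?_ (ihp h)
    rintro s₁ ⟨h₁, h₂⟩
    refine wp_mono ?_ (ihq h₂)
    rintro s₂ ⟨h₃, h₄⟩
    exact ⟨(h₁.mono (fun _ => Or.inl) fun _ => Or.inl).trans
      (h₃.mono (fun _ => Or.inr) fun _ => Or.inr), h₄⟩
  | cond b p q ihp ihq =>
    refine ⟨fun hb => wp_mono ?_ (ihp (h.1 hb)), fun hb => wp_mono ?_ (ihq (h.2 hb))⟩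
    · exact fun _ h => ⟨h.1.mono (fun _ => Or.inl) fun _ => Or.inl, h.2⟩
    · exact fun _ h => ⟨h.1.mono (fun _ => Or.inr) fun _ => Or.inr, h.2⟩
  | loop b p => exact h.elim

theorem Program.wp_unroll {f : ℕ → Program} (Inv : ℕ → State → Prop) (n : ℕ) {s : State}
    (h₀ : Inv 0 s) (hstep : ∀ i < n, ∀ s, Inv i s → (f i).wp (Inv (i + 1)) s) :
    (unroll f n).wp (Inv n) s := by
  induction n with
  | zero => exact h₀
  | succ n ih =>
    exact Program.wp_mono (hstep n (by omega)) (ih fun i hi => hstep i (by omega))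

/-- The disjunction of two tests. -/
def Test.or (b c : Test) : Test := .not (.and (.not b) (.not c))

theorem Test.holds_or {b c : Test} {s : State} : (b.or c).Holds s ↔ b.Holds s ∨ c.Holds s := by
  simp only [Test.or, Test.Holds]; tauto

/-! ### Programs that run in linear time -/

/-- For all values of the parameter `a`, the program leads from states with the property `Pre a` to
states with the property `Post a` in time `O(n a)`. -/
def Triple {α : Type} (n : α → ℕ) (Pre : α → State → Prop) (p : Program)
    (Post : α → State → Prop) : Prop :=
  ∃ K, ∀ a s, Pre a s → Ensures p s (K * n a) (Post a)

namespace Triple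

variable {α : Type} {n : α → ℕ} {Pre Mid Post : α → State → Prop} {p q : Program}

theorem seq (hp : Triple n Pre p Mid) (hq : Triple n Mid q Post) : Triple n Pre (.seq p q) Post := by
  obtain ⟨K, hK⟩ := hp
  obtain ⟨L, hL⟩ := hq
  refine ⟨K + L, fun a s h => ?_⟩
  rw [Nat.add_mul]
  exact (hK a s h).seq fun s' _ h' => hL a s' h'

theorem conseq {Pre' Post' : α → State → Prop} (h : Triple n Pre p Post)
    (hPre : ∀ a s, Pre' a s → Pre a s) (hPost : ∀ a s, Post a s → Post' a s) :
    Triple n Pre' p Post' := by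
  obtain ⟨K, hK⟩ := h
  exact ⟨K, fun a s h => (hK a s (hPre a s h)).mono le_rfl fun s' _ => hPost a s'⟩

theorem reindex {β : Type} (h : Triple n Pre p Post) (f : β → α) :
    Triple (fun b => n (f b)) (fun b => Pre (f b)) p fun b => Post (f b) := by
  obtain ⟨K, hK⟩ := h
  exact ⟨K, fun b => hK (f b)⟩

/-- A value that exists at the start becomes a parameter that the assertions may refer to; the time
constant does not depend on it. In this way loop invariants mention an earlier state of the memory.
-/
theorem ofExists {β : Type} {n : α → ℕ} {Pre : α → β → State → Prop} {Post : α → State → Prop}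
    (h : Triple (fun x : α × β => n x.1) (fun x => Pre x.1 x.2) p fun x => Post x.1) :
    Triple n (fun a s => ∃ b, Pre a b s) p Post := by
  obtain ⟨K, hK⟩ := h
  exact ⟨K, fun a s ⟨b, hb⟩ => hK (a, b) s hb⟩

theorem frame (h : Triple n Pre p Post) (R : α → State → Prop)
    (hR : ∀ a s s', SameOutside p s s' → R a s → R a s') :
    Triple n (fun a s => Pre a s ∧ R a s) p fun a s => Post a s ∧ R a s := by
  obtain ⟨K, hK⟩ := h
  exact ⟨K, fun a s hs => (hK a s hs.1).mono le_rfl fun s' ho h' => ⟨h', hR a s s' ho hs.2⟩⟩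

theorem wp (hn : ∀ a, 1 ≤ n a) (h : ∀ a s, Pre a s → p.wp (Post a) s) : Triple n Pre p Post :=
  ⟨p.cost, fun a s hs => (Ensures.of_wp (h a s hs)).mono (Nat.le_mul_of_pos_right _ (hn a))
    fun _ _ h => h⟩

theorem skip (hn : ∀ a, 1 ≤ n a) : Triple n Pre .skip Pre := wp hn fun _ _ h => h

theorem cond (hn : ∀ a, 1 ≤ n a) {b : Test}
    (hp : Triple n (fun a s => Pre a s ∧ b.Holds s) p Post)
    (hq : Triple n (fun a s => Pre a s ∧ ¬ b.Holds s) q Post) :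
    Triple n Pre (.cond b p q) Post := by
  obtain ⟨K, hK⟩ := hp
  obtain ⟨L, hL⟩ := hq
  refine ⟨b.time + 1 + (K + L), fun a s h => ?_⟩
  have h1 : K * n a ≤ (K + L) * n a := Nat.mul_le_mul_right _ (by omega)
  have h2 : L * n a ≤ (K + L) * n a := Nat.mul_le_mul_right _ (by omega)
  refine (Ensures.cond (T := (K + L) * n a)
    (fun hb => (hK a s ⟨h, hb⟩).mono h1 fun _ _ h => h)
    (fun hb => (hL a s ⟨h, hb⟩).mono h2 fun _ _ h => h)).mono ?_ fun _ _ h => h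
  rw [Nat.add_mul (b.time + 1)]
  exact Nat.add_le_add_right (Nat.le_mul_of_pos_right _ (hn a)) _

/-- A loop with a loop-free body, an invariant `Inv` and a decreasing measure `μ`. -/
theorem loop (hn : ∀ a, 1 ≤ n a) {b : Test} {Inv : α → State → Prop} (μ : α → State → ℕ) (c : ℕ)
    (hμ : ∀ a s, Inv a s → μ a s ≤ c * n a)
    (hstep : ∀ a s, Inv a s → b.Holds s → p.wp (fun s' => Inv a s' ∧ μ a s' < μ a s) s) :
    Triple n Inv (.loop b p) fun a s => Inv a s ∧ ¬ b.Holds s := by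
  refine ⟨(c + 1) * (b.time + 1 + p.cost), fun a s h => (Ensures.loop (Inv a) (μ a) h
    fun s _ => hstep a s).mono ?_ fun _ _ h => h⟩
  have h1 := hμ a s h
  have h2 := hn a
  calc (μ a s + 1) * (b.time + 1 + p.cost) ≤ ((c + 1) * n a) * (b.time + 1 + p.cost) :=
        Nat.mul_le_mul_right _ (by nlinarith)
    _ = _ := by ring

theorem unroll (hn : ∀ a, 1 ≤ n a) {f : ℕ → Program} (Inv : ℕ → α → State → Prop) (m : ℕ)
    (h : ∀ i < m, Triple n (Inv i) (f i) (Inv (i + 1))) : Triple n (Inv 0) (unroll f m) (Inv m) := by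
  induction m with
  | zero => exact skip hn
  | succ m ih => exact (ih fun i hi => h i (by omega)).seq (h m (by omega))

end Triple

/-! ### Linear search -/

/-- Runs through the numbers `x` (variable `30`) between the values of the variables `32` and `33`
and puts `x` into the variable `31` whenever the test succeeds.  Initially the variables `31` and
`33` are equal. -/
def search (T : Test) : Program :=
  .seq (block [setVar 31 (ivar 33), setVar 30 (ivar 32)])
    (.loop (.intLt (ivar 30) (ivar 33)) (block [.cond T (setVar 31 (ivar 30)) .skip, incr 30]))

/-- The number `d` is optimal among the numbers with property `p` in the interval from `lo` to
`hi`, or there are no such numbers and `d = hi`. -/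
def IsOptimum (p : ℕ → Prop) (better : ℕ → ℕ → Prop) (lo hi d : ℕ) : Prop :=
  (d = hi ∧ ∀ x, lo ≤ x → x < hi → ¬ p x) ∨
    (lo ≤ d ∧ d < hi ∧ p d ∧ ∀ x, lo ≤ x → x < hi → p x → ¬ better x d)

/-- The states differ only in the variables `30` and `31`. -/
def SameButSearch (s s' : State) : Prop :=
  s'.real = s.real ∧ ∀ a, a ≠ 30 → a ≠ 31 → s'.int a = s.int a

theorem SameButSearch.write (s : State) {a : ℕ} (h : a = 30 ∨ a = 31) (i x : ℕ) :
    SameButSearch s (s.writeInt a i x) := by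
  refine ⟨rfl, fun b h1 h2 => ?_⟩
  rw [State.writeInt_int_of_ne _ _ _ (by omega)]

/-- Finding the upper bound in variable `31` means that nothing has been found yet. Correctness of
the test is therefore required only when the variable holds this bound or a valid candidate. With an
empty relation `better` this is a search for any solution. -/
theorem Triple.search {α : Type} {n : α → ℕ} (hn : ∀ a, 1 ≤ n a) {T : Test}
    {Pre : α → State → Prop} (lo hi : α → ℕ) (p : α → ℕ → Prop) (better : α → ℕ → ℕ → Prop) (c : ℕ)
    (hc : ∀ a, hi a - lo a ≤ c * n a)
    (hPre : ∀ a s s', Pre a s → SameButSearch s s' → Pre a s')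
    (hlohi : ∀ a s, Pre a s → s.int 32 0 = lo a ∧ s.int 33 0 = hi a ∧ lo a ≤ hi a)
    (hirr : ∀ a x, ¬ better a x x)
    (htr : ∀ a x y z, better a x y → better a y z → better a x z)
    (hT : ∀ a s, Pre a s → lo a ≤ s.int 30 0 → s.int 30 0 < hi a →
      s.int 31 0 = hi a ∨ (lo a ≤ s.int 31 0 ∧ s.int 31 0 < hi a ∧ p a (s.int 31 0)) →
      (T.Holds s ↔ p a (s.int 30 0) ∧ (s.int 31 0 = hi a ∨ better a (s.int 30 0) (s.int 31 0)))) :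
    Triple n Pre (RealRAM.search T) fun a s =>
      Pre a s ∧ IsOptimum (p a) (better a) (lo a) (hi a) (s.int 31 0) := by
  refine Triple.seq (Mid := fun a s => Pre a s ∧ lo a ≤ s.int 30 0 ∧ s.int 30 0 ≤ hi a ∧
    ((s.int 31 0 = hi a ∧ ∀ x, lo a ≤ x → x < s.int 30 0 → ¬ p a x) ∨
      (lo a ≤ s.int 31 0 ∧ s.int 31 0 < hi a ∧ p a (s.int 31 0) ∧
        ∀ x, lo a ≤ x → x < s.int 30 0 → p a x → ¬ better a x (s.int 31 0))))
    (Triple.wp hn fun a s h => ?_) (Triple.conseq (Triple.loop hn (fun a s => hi a - s.int 30 0) c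
      (fun a s h => (Nat.sub_le_sub_left h.2.1 _).trans (hc a)) fun a s h hb => ?_)
        (fun _ _ h => h) fun a s h => ?_)
  · obtain ⟨h1, h2, h3⟩ := hlohi a s h
    simp only [block, Program.wp, IntExpr.eval, State.writeInt_int_self, State.writeInt_int_of_ne,
      ne_eq, not_false_eq_true, Nat.reduceEqDiff, Function.update_self, h1, h2]
    exact ⟨hPre _ _ _ (hPre _ _ _ h (.write s (.inr rfl) 0 _)) (.write _ (.inl rfl) 0 _), le_rfl, h3,
      Or.inl ⟨trivial, fun x hx hx' => by omega⟩⟩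
  · obtain ⟨hpre, h1, h2, hI⟩ := h
    obtain ⟨-, h33, -⟩ := hlohi a s hpre
    have hb' : s.int 30 0 < hi a := by
      have : s.int 30 0 < s.int 33 0 := hb
      rwa [h33] at this
    have hTs := hT a s hpre h1 hb' (hI.imp (·.1) fun h => ⟨h.1, h.2.1, h.2.2.1⟩)
    refine ⟨fun ht => ?_, fun ht => ?_⟩
    · simp only [block, Program.wp, IntExpr.eval, State.writeInt_int_self,
        State.writeInt_int_of_ne, ne_eq, not_false_eq_true, Nat.reduceEqDiff, Function.update_self]
      obtain ⟨hp, hor⟩ := hTs.1 ht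
      refine ⟨⟨hPre _ _ _ (hPre _ _ _ hpre (.write s (.inr rfl) 0 _)) (.write _ (.inl rfl) 0 _),
        by omega, by omega, Or.inr ⟨h1, hb', hp, ?_⟩⟩, by omega⟩
      intro x hx hx' hpx
      by_cases e : x = s.int 30 0
      · subst e; exact hirr _ _
      · have hx'' : x < s.int 30 0 := by omega
        rcases hI with ⟨-, hI⟩ | ⟨-, hlt, -, hI⟩
        · exact absurd hpx (hI x hx hx'')
        · rcases hor with h | h
          · omega
          · exact fun hbx => hI x hx hx'' hpx (htr _ _ _ _ hbx h)
    · simp only [block, Program.wp, IntExpr.eval, State.writeInt_int_self,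
        State.writeInt_int_of_ne, ne_eq, not_false_eq_true, Nat.reduceEqDiff, Function.update_self]
      refine ⟨⟨hPre _ _ _ hpre (.write _ (.inl rfl) 0 _), by omega, by omega, ?_⟩, by omega⟩
      rw [hTs, not_and, not_or] at ht
      rcases hI with ⟨h3, hI⟩ | ⟨h3, hlt, h4, hI⟩
      · refine Or.inl ⟨h3, fun x hx hx' hpx => ?_⟩
        by_cases e : x = s.int 30 0
        · subst e; exact (ht hpx).1 h3
        · exact hI x hx (by omega) hpx
      · refine Or.inr ⟨h3, hlt, h4, fun x hx hx' hpx => ?_⟩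
        by_cases e : x = s.int 30 0
        · subst e; exact (ht hpx).2
        · exact hI x hx (by omega) hpx
  · obtain ⟨⟨hpre, h1, h2, hI⟩, hb⟩ := h
    obtain ⟨-, h33, -⟩ := hlohi a s hpre
    have hb' : ¬ s.int 30 0 < hi a := by
      have : ¬ s.int 30 0 < s.int 33 0 := hb
      rwa [h33] at this
    have e : s.int 30 0 = hi a := by omega
    rw [e] at hI
    exact ⟨hpre, hI⟩

end RealRAM

/-! ### Polygons with their edges sorted by direction -/

namespace ConvexPolygon

theorem LexLT.irrefl (p : Plane) : ¬ LexLT p p := by unfold LexLT; simp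

theorem LexLT.trans {p q r : Plane} (h : LexLT p q) (h' : LexLT q r) : LexLT p r := by
  unfold LexLT at *
  rcases h with h | ⟨h, h1⟩ <;> rcases h' with h' | ⟨h', h1'⟩
  · left; linarith
  · left; linarith
  · left; linarith
  · right; exact ⟨by linarith, by linarith⟩

variable (P : ConvexPolygon)

/-- If no vertex were minimal, one could descend forever. The set `S` collects the indices passed on
the way; each index is new because the order is strict, so `S` would outgrow the set of all indices.
-/
theorem exists_start : ∃ d < P.size, ∀ t < P.size, ¬ LexLT (P.cyc t) (P.cyc d) := by
  by_contra hc
  push Not at hc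
  have key : ∀ n : ℕ, ∃ d < P.size, ∃ S : Finset ℕ, S.card = n ∧
      ∀ t ∈ S, t < P.size ∧ LexLT (P.cyc d) (P.cyc t) := by
    intro n
    induction n with
    | zero => exact ⟨0, P.size_pos, ∅, rfl, by simp⟩
    | succ n ih =>
      obtain ⟨d, hd, S, hS, h⟩ := ih
      obtain ⟨t, ht, hlt⟩ := hc d hd
      refine ⟨t, ht, insert d S, ?_, ?_⟩
      · rw [Finset.card_insert_of_notMem, hS]
        exact fun hm => LexLT.irrefl _ (h d hm).2
      · intro x hx
        rcases Finset.mem_insert.1 hx with rfl | hx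
        · exact ⟨hd, hlt⟩
        · exact ⟨(h x hx).1, hlt.trans (h x hx).2⟩
  obtain ⟨d, -, S, hS, h⟩ := key (P.size + 1)
  have : S ⊆ Finset.range P.size := fun t ht => Finset.mem_range.2 (h t ht).1
  have := Finset.card_le_card this
  rw [Finset.card_range, hS] at this
  omega

/-- The index of the lexicographically smallest vertex. -/
noncomputable def start : ℕ := P.exists_start.choose

theorem start_lt : P.start < P.size := P.exists_start.choose_spec.1

theorem not_lexLT_start {t : ℕ} (ht : t < P.size) : ¬ LexLT (P.cyc t) (P.cyc P.start) :=
  P.exists_start.choose_spec.2 t ht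

/-- Different indices in one period belong to different points, so there is only one index of a
minimal vertex. -/
theorem eq_start {d : ℕ} (hd : d < P.size) (h : ∀ t < P.size, ¬ LexLT (P.cyc t) (P.cyc d)) :
    d = P.start := by
  have h1 := P.not_lexLT_start hd
  have h2 := h _ P.start_lt
  have hs := P.start_lt
  unfold LexLT at h1 h2
  push Not at h1 h2
  have e1 : (P.cyc d).1 = (P.cyc P.start).1 := le_antisymm h2.1 h1.1
  have e : P.cyc d = P.cyc P.start := Prod.ext e1 (le_antisymm (h2.2 e1.symm) (h1.2 e1))
  rcases lt_trichotomy d P.start with h | h | h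
  · exact absurd e (P.cyc_injOn h (by omega))
  · exact h
  · exact absurd e.symm (P.cyc_injOn h (by omega))

/-- The outer normals, starting with the one of smallest angle. -/
noncomputable def edge (t : ℕ) : Plane := P.normal (P.start + t)

theorem angle_edge_lt {t : ℕ} (ht : t + 1 < P.size) : angle (P.edge t) < angle (P.edge (t + 1)) :=
  P.angle_normal_lt (fun t => by
    obtain ⟨r, hr, e⟩ : ∃ r < P.size, P.cyc t = P.cyc r := by
      refine ⟨t % P.size, Nat.mod_lt _ P.size_pos, ?_⟩
      unfold ConvexPolygon.cyc
      simp
    rw [e]; exact P.not_lexLT_start hr) ht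

end ConvexPolygon

/-! ### Loading the edges -/

/-- The number of edges of the polygons before the `i`-th one. -/
def offset (Q : ℕ → ConvexPolygon) (i : ℕ) : ℕ := ∑ j ∈ Finset.range i, (Q j).size

theorem offset_succ (Q : ℕ → ConvexPolygon) (i : ℕ) : offset Q (i + 1) = offset Q i + (Q i).size :=
  Finset.sum_range_succ _ _

theorem offset_mono (Q : ℕ → ConvexPolygon) : Monotone (offset Q) :=
  monotone_nat_of_le_succ fun i => by rw [offset_succ]; omega

theorem offset_add_lt (Q : ℕ → ConvexPolygon) {i k t : ℕ} (hi : i < k) (ht : t < (Q i).size) :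
    offset Q i + t < offset Q k :=
  calc offset Q i + t < offset Q (i + 1) := by rw [offset_succ]; omega
    _ ≤ offset Q k := offset_mono Q hi

theorem offset_add_inj (Q : ℕ → ConvexPolygon) {i j t u : ℕ} (ht : t < (Q i).size)
    (hu : u < (Q j).size) (h : offset Q i + t = offset Q j + u) : i = j ∧ t = u := by
  rcases lt_trichotomy i j with hij | rfl | hij
  · have := offset_add_lt Q hij ht; omega
  · exact ⟨rfl, by omega⟩
  · have := offset_add_lt Q hij hu; omega

theorem exists_offset_add_eq (Q : ℕ → ConvexPolygon) {k g : ℕ} (hg : g < offset Q k) :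
    ∃ i < k, ∃ t < (Q i).size, g = offset Q i + t := by
  induction k with
  | zero => simp [offset] at hg
  | succ k ih =>
    by_cases h : g < offset Q k
    · obtain ⟨i, hi, r⟩ := ih h
      exact ⟨i, by omega, r⟩
    · rw [offset_succ] at hg
      exact ⟨k, by omega, g - offset Q k, by omega, by omega⟩

/-- The vector `m g`, the number `c g` and the index `own g`, for `g < n`, belong to the `g`-th of
the edges of the translated polygons `V i + Q i`. -/
def EdgeTable (k : ℕ) (Q : ℕ → ConvexPolygon) (V : ℕ → Plane) (n : ℕ) (m : ℕ → Plane)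
    (c : ℕ → ℝ) (own : ℕ → ℕ) : Prop :=
  ∀ i < k, ∀ t < (Q i).size, offset Q i + t < n →
    m (offset Q i + t) = (Q i).edge t ∧
    c (offset Q i + t) = dot ((Q i).edge t) ((Q i).cyc ((Q i).start + t) + V i) ∧
    own (offset Q i + t) = i

namespace RealRAM

/-- The memory holds the polygons `Q i` and the vectors `V i`. -/
structure HasInput (k : ℕ) (Q : ℕ → ConvexPolygon) (V : ℕ → Plane) (s : State) : Prop where
  size : ∀ i < k, s.int 0 i = (Q i).size
  fst : ∀ i < k, s.real 0 (i + i) = (V i).1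
  snd : ∀ i < k, s.real 0 (i + i + 1) = (V i).2
  vertex_fst : ∀ i < k, ∀ t < (Q i).size, s.real (i + 1) (t + t) = ((Q i).cyc t).1
  vertex_snd : ∀ i < k, ∀ t < (Q i).size, s.real (i + 1) (t + t + 1) = ((Q i).cyc t).2

def fstExpr (a : ℕ) (e : IntExpr) : RealExpr := .cell a (.add e e)
def sndExpr (a : ℕ) (e : IntExpr) : RealExpr := .cell a (.add (.add e e) (.lit 1))

/-- Tests whether the point with index `30` precedes the one with index `31`. -/
def lexTest (a : ℕ) : Test :=
  .or (.intEq (ivar 31) (ivar 33)) (.or (.realLt (fstExpr a (ivar 30)) (fstExpr a (ivar 31)))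
    (.and (.realEq (fstExpr a (ivar 30)) (fstExpr a (ivar 31)))
      (.realLt (sndExpr a (ivar 30)) (sndExpr a (ivar 31)))))

/-- Variable `35` is the position to be written, `36` the current vertex and `37` its cyclic
successor; `30` counts the edges. Array `6` records the polygon to which a half-plane belongs. The
constant is the product of the normal with the translated vertex. -/
def loadBody (X Y C i : ℕ) : Program := block [
  .cond (.intEq (.add (ivar 36) (.lit 1)) (ivar 33)) (setVar 37 (.lit 0))
    (setVar 37 (.add (ivar 36) (.lit 1))),
  .setReal X (ivar 35) (.sub (sndExpr (i + 1) (ivar 37)) (sndExpr (i + 1) (ivar 36))),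
  .setReal Y (ivar 35) (.sub (fstExpr (i + 1) (ivar 36)) (fstExpr (i + 1) (ivar 37))),
  .setReal C (ivar 35) (.add
    (.mul (.cell X (ivar 35)) (.add (fstExpr (i + 1) (ivar 36)) (fstExpr 0 (.lit i))))
    (.mul (.cell Y (ivar 35)) (.add (sndExpr (i + 1) (ivar 36)) (sndExpr 0 (.lit i))))),
  .setInt 6 (ivar 35) (.lit i), setVar 36 (ivar 37), incr 35, incr 30]

/-- Writes the edges of the `i`-th polygon into the arrays `X`, `Y`, `C`. -/
def load (X Y C i : ℕ) : Program :=
  .seq (block [setVar 32 (.lit 0), setVar 33 (.cell 0 (.lit i))])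
    (.seq (search (lexTest (i + 1)))
      (.seq (block [setVar 36 (ivar 31), setVar 35 (.cell 2 (.lit i)), setVar 30 (.lit 0)])
        (.seq (.loop (.intLt (ivar 30) (ivar 33)) (loadBody X Y C i))
          (.setInt 2 (.lit (i + 1)) (ivar 35)))))

theorem loadBody_wp {X Y C i k : ℕ} {Q : ℕ → ConvexPolygon} {V : ℕ → Plane} (hX : k < X)
    (hY : k < Y) (hXY : X ≠ Y) (hXC : X ≠ C) (hYC : Y ≠ C) (hi : i < k) {s : State}
    {t : ℕ} (hin : HasInput k Q V s) (h33 : s.int 33 0 = (Q i).size) (h30 : s.int 30 0 = t)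
    (ht : t < (Q i).size) (h35 : s.int 35 0 = offset Q i + t)
    (h36 : s.int 36 0 = ((Q i).start + t) % (Q i).size)
    (hE : EdgeTable k Q V (offset Q i + t) (s.normal X Y) (s.real C) (s.int 6)) :
    (loadBody X Y C i).wp (fun s' => s'.int 30 0 = t + 1 ∧ s'.int 35 0 = offset Q i + (t + 1) ∧
      s'.int 36 0 = ((Q i).start + (t + 1)) % (Q i).size ∧
      EdgeTable k Q V (offset Q i + (t + 1)) (s'.normal X Y) (s'.real C) (s'.int 6)) s := by
  have hpos := (Q i).size_pos
  have hcm : ∀ r, (Q i).cyc (r % (Q i).size) = (Q i).cyc r := fun r => by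
    simp [ConvexPolygon.cyc]
  have hlt : ∀ r, r % (Q i).size < (Q i).size := fun r => Nat.mod_lt _ hpos
  have hv1 : ∀ r, s.real (i + 1) (r % (Q i).size + r % (Q i).size) = ((Q i).cyc r).1 :=
    fun r => by rw [hin.vertex_fst i hi _ (hlt r), hcm]
  have hv2 : ∀ r, s.real (i + 1) (r % (Q i).size + r % (Q i).size + 1) = ((Q i).cyc r).2 :=
    fun r => by rw [hin.vertex_snd i hi _ (hlt r), hcm]
  have n1 : i + 1 ≠ X := by omega
  have n2 : i + 1 ≠ Y := by omega
  have n3 : (0 : ℕ) ≠ X := by omega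
  have n4 : (0 : ℕ) ≠ Y := by omega
  have hnext : ((Q i).start + (t + 1)) % (Q i).size =
      if ((Q i).start + t) % (Q i).size + 1 = (Q i).size then 0
      else ((Q i).start + t) % (Q i).size + 1 := by
    have h1 := Nat.div_add_mod ((Q i).start + t) (Q i).size
    have h2 := hlt ((Q i).start + t)
    rw [← add_assoc]
    conv_lhs => rw [← h1, add_assoc, Nat.mul_add_mod]
    split_ifs with h
    · rw [h, Nat.mod_self]
    · exact Nat.mod_eq_of_lt (by omega)
  -- Both branches of the conditional put the cyclic successor into variable `37`. From there on
  -- they agree.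
  have main : ∀ j', j' = ((Q i).start + (t + 1)) % (Q i).size →
      (block [.setReal X (ivar 35) (.sub (sndExpr (i + 1) (ivar 37)) (sndExpr (i + 1) (ivar 36))),
        .setReal Y (ivar 35) (.sub (fstExpr (i + 1) (ivar 36)) (fstExpr (i + 1) (ivar 37))),
        .setReal C (ivar 35) (.add
          (.mul (.cell X (ivar 35)) (.add (fstExpr (i + 1) (ivar 36)) (fstExpr 0 (.lit i))))
          (.mul (.cell Y (ivar 35)) (.add (sndExpr (i + 1) (ivar 36)) (sndExpr 0 (.lit i))))),
        .setInt 6 (ivar 35) (.lit i), setVar 36 (ivar 37), incr 35, incr 30]).wp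
      (fun s' => s'.int 30 0 = t + 1 ∧ s'.int 35 0 = offset Q i + (t + 1) ∧
        s'.int 36 0 = ((Q i).start + (t + 1)) % (Q i).size ∧
        EdgeTable k Q V (offset Q i + (t + 1)) (s'.normal X Y) (s'.real C) (s'.int 6))
      (s.writeInt 37 0 j') := by
    rintro j' rfl
    simp only [block, Program.wp, IntExpr.eval, RealExpr.eval, fstExpr, sndExpr,
      State.writeInt_int_self, State.writeInt_real,
      State.writeInt_int_of_ne, State.writeReal_int, State.writeReal_real_self,
      State.writeReal_real_of_ne, ne_eq, not_false_eq_true, Nat.reduceEqDiff,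
      Function.update_self, h30, h35, h36, hv1, hv2, n1, n2, n3, n4, hXY, hXC, hYC, hXY.symm,
      hXC.symm, hYC.symm, hin.fst i hi, hin.snd i hi]
    refine ⟨trivial, rfl, trivial, fun j hj u hu hlt => ?_⟩
    simp only [State.normal, State.writeInt_int_self, State.writeInt_real,
      State.writeInt_int_of_ne, State.writeReal_int, State.writeReal_real_self,
      State.writeReal_real_of_ne, ne_eq, not_false_eq_true, Nat.reduceEqDiff, hXY, hXC, hYC,
      hXY.symm, hXC.symm, hYC.symm]
    by_cases e : offset Q j + u = offset Q i + t
    · obtain ⟨rfl, rfl⟩ := offset_add_inj Q hu ht e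
      simp only [Function.update_self]
      refine ⟨rfl, ?_, trivial⟩
      unfold ConvexPolygon.edge ConvexPolygon.normal dot
      simp only [Prod.fst_add, Prod.snd_add, add_assoc]
    · simp only [Function.update_of_ne e]
      exact hE j hj u hu (by omega)
  refine ⟨fun h => ?_, fun h => ?_⟩
  · refine main 0 ?_
    have h' : s.int 36 0 + 1 = s.int 33 0 := h
    rw [h36, h33] at h'
    rw [hnext, if_pos h']
  · refine main (s.int 36 0 + 1) ?_
    have h' : ¬ s.int 36 0 + 1 = s.int 33 0 := h
    rw [h36, h33] at h'
    rw [hnext, if_neg h', h36]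

theorem HasInput.congr {k : ℕ} {Q : ℕ → ConvexPolygon} {V : ℕ → Plane} {s s' : State}
    (h : HasInput k Q V s) (hi : s'.int 0 = s.int 0) (hr : ∀ a ≤ k, s'.real a = s.real a) :
    HasInput k Q V s' where
  size i hk := by rw [hi]; exact h.size i hk
  fst i hk := by rw [hr 0 (by omega)]; exact h.fst i hk
  snd i hk := by rw [hr 0 (by omega)]; exact h.snd i hk
  vertex_fst i hk := by rw [hr (i + 1) (by omega)]; exact h.vertex_fst i hk
  vertex_snd i hk := by rw [hr (i + 1) (by omega)]; exact h.vertex_snd i hk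


/-- The parameter is the bare input; maximality plays no role before the implied half-planes are
removed. Array `2` holds the offsets. -/
structure LoadInv (k X Y C i : ℕ) (a : (ℕ → ConvexPolygon) × (ℕ → Plane)) (s : State) : Prop where
  input : HasInput k a.1 a.2 s
  off : ∀ j ≤ i, s.int 2 j = offset a.1 j
  table : EdgeTable k a.1 a.2 (offset a.1 i) (s.normal X Y) (s.real C) (s.int 6)

theorem LoadInv.congr {k X Y C i : ℕ} {a : (ℕ → ConvexPolygon) × (ℕ → Plane)} {s s' : State}
    (h : LoadInv k X Y C i a s) (h0 : s'.int 0 = s.int 0) (h2 : s'.int 2 = s.int 2)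
    (h6 : s'.int 6 = s.int 6) (hr : s'.real = s.real) : LoadInv k X Y C i a s' := by
  refine ⟨h.input.congr h0 fun a _ => by rw [hr], fun j hj => ?_, ?_⟩
  · rw [h2]; exact h.off j hj
  · have := h.table
    unfold State.normal at *
    rwa [hr, h6]

theorem load_triple {X Y C i k : ℕ} (hX : k < X) (hY : k < Y) (hC : k < C) (hXY : X ≠ Y)
    (hXC : X ≠ C) (hYC : Y ≠ C) (hi : i < k) :
    Triple (fun a : (ℕ → ConvexPolygon) × (ℕ → Plane) => offset a.1 k) (LoadInv k X Y C i)
      (load X Y C i) (LoadInv k X Y C (i + 1)) := by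
  have hsz : ∀ a : (ℕ → ConvexPolygon) × (ℕ → Plane), (a.1 i).size ≤ 1 * offset a.1 k := fun a => by
    have := offset_mono a.1 (show i + 1 ≤ k by omega)
    rw [offset_succ] at this; omega
  have hn : ∀ a : (ℕ → ConvexPolygon) × (ℕ → Plane), 1 ≤ offset a.1 k := fun a => by
    have := hsz a; have := (a.1 i).three_le_size; omega
  refine Triple.seq (Mid := fun a s => LoadInv k X Y C i a s ∧ s.int 32 0 = 0 ∧
    s.int 33 0 = (a.1 i).size) (Triple.wp hn fun a s h => ?_)
    (Triple.seq (Mid := fun a s => LoadInv k X Y C i a s ∧ s.int 33 0 = (a.1 i).size ∧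
      s.int 31 0 = (a.1 i).start) ?_ (Triple.seq (Mid := fun a s => HasInput k a.1 a.2 s ∧
        (∀ j ≤ i, s.int 2 j = offset a.1 j) ∧ s.int 33 0 = (a.1 i).size ∧
        s.int 30 0 ≤ (a.1 i).size ∧ s.int 35 0 = offset a.1 i + s.int 30 0 ∧
        s.int 36 0 = ((a.1 i).start + s.int 30 0) % (a.1 i).size ∧
        EdgeTable k a.1 a.2 (offset a.1 i + s.int 30 0) (s.normal X Y) (s.real C) (s.int 6))
        (Triple.wp hn fun a s h => ?_) (Triple.seq (Triple.loop hn
          (fun a s => (a.1 i).size - s.int 30 0) 1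
          (fun a s h => (Nat.sub_le _ _).trans (hsz a)) fun a s h hb => ?_)
          (Triple.wp hn fun a s h => ?_))))
  · simp only [block, Program.wp, IntExpr.eval, State.writeInt_int_self, State.writeInt_int_of_ne,
      ne_eq, not_false_eq_true, Nat.reduceEqDiff, Function.update_self, OfNat.zero_ne_ofNat,
      h.input.size i hi]
    refine ⟨h.congr ?_ ?_ ?_ rfl, trivial, trivial⟩ <;>
      simp [State.writeInt_int_of_ne]
  · refine Triple.conseq (Triple.search hn (fun _ => 0) (fun a => (a.1 i).size) (fun a _ => True)
      (fun a x y => ConvexPolygon.LexLT ((a.1 i).cyc x) ((a.1 i).cyc y)) 1 (fun a => hsz a)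
      (Pre := fun a s => LoadInv k X Y C i a s ∧ s.int 32 0 = 0 ∧ s.int 33 0 = (a.1 i).size)
      ?_ (fun a s h => ⟨h.2.1, h.2.2, Nat.zero_le _⟩) (fun _ _ => ConvexPolygon.LexLT.irrefl _)
      (fun _ _ _ _ => ConvexPolygon.LexLT.trans) ?_) (fun _ _ h => h) ?_
    · rintro a s s' ⟨h, h32, h33⟩ ⟨hr, hs⟩
      refine ⟨h.congr (hs _ ?_ ?_) (hs _ ?_ ?_) (hs _ ?_ ?_) hr, ?_, ?_⟩ <;>
        first | (rw [hs _ (by norm_num) (by norm_num)]; assumption) | norm_num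
    · rintro a s ⟨h, h32, h33⟩ - h30 h31
      simp only [lexTest, Test.holds_or, Test.Holds, IntExpr.eval, RealExpr.eval, fstExpr, sndExpr,
        h33, true_and]
      refine or_congr_right' fun hne => ?_
      have h31' := (h31.resolve_left hne).2.1
      rw [h.input.vertex_fst i hi _ h30, h.input.vertex_fst i hi _ h31',
        h.input.vertex_snd i hi _ h30, h.input.vertex_snd i hi _ h31']
      rfl
    · rintro a s ⟨⟨h, h32, h33⟩, hopt⟩
      refine ⟨h, h33, ?_⟩
      rcases hopt with ⟨-, h0⟩ | ⟨-, hlt, -, hopt⟩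
      · exact absurd trivial (h0 0 le_rfl (a.1 i).size_pos)
      · exact (a.1 i).eq_start hlt fun t ht => hopt t (Nat.zero_le _) ht trivial
  · obtain ⟨h, h33, h31⟩ := h
    have hst := (a.1 i).start_lt
    simp only [block, Program.wp, IntExpr.eval, State.writeInt_int_self, State.writeInt_int_of_ne,
      ne_eq, not_false_eq_true, Nat.reduceEqDiff, Function.update_self, h31, h33, h.off i le_rfl,
      add_zero, Nat.zero_le, true_and, Nat.mod_eq_of_lt hst]
    exact ⟨h.input.congr (by simp [State.writeInt_int_of_ne]) fun _ _ => rfl, h.off, h.table⟩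
  · obtain ⟨hin, hoff, h33, h30, h35, h36, hE⟩ := h
    have ht : s.int 30 0 < (a.1 i).size := by
      have : s.int 30 0 < s.int 33 0 := hb
      omega
    have h1 := loadBody_wp hX hY hXY hXC hYC hi hin h33 rfl ht h35 h36 hE
    refine Program.wp_mono ?_ (Program.wp_frame h1)
    rintro s' ⟨ho, h30', h35', h36', hE'⟩
    have ho0 : s'.int 0 = s.int 0 := ho.1 0 (by simp [loadBody, block, Program.WritesInt])
    have ho2 : s'.int 2 = s.int 2 := ho.1 2 (by simp [loadBody, block, Program.WritesInt])
    have ho33 : s'.int 33 = s.int 33 := ho.1 33 (by simp [loadBody, block, Program.WritesInt])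
    have hor : ∀ a ≤ k, s'.real a = s.real a := fun a ha => ho.2 a (by
      simp [loadBody, block, Program.WritesReal]; omega)
    rw [ho2, ho33, h30', h35', h36']
    exact ⟨⟨hin.congr ho0 hor, hoff, h33, ht, rfl, rfl, hE'⟩, by omega⟩
  · obtain ⟨⟨hin, hoff, h33, h30, h35, h36, hE⟩, hb⟩ := h
    have ht : s.int 30 0 = (a.1 i).size := by
      have : ¬ s.int 30 0 < s.int 33 0 := hb
      omega
    rw [ht, ← offset_succ] at hE
    rw [ht, ← offset_succ] at h35
    simp only [block, Program.wp, IntExpr.eval, h35]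
    refine ⟨hin.congr (by simp [State.writeInt_int_of_ne]) fun _ _ => rfl, fun j hj => ?_, ?_⟩
    · rw [State.writeInt_int_self]
      by_cases e : j = i + 1
      · subst e; rw [Function.update_self]
      · rw [Function.update_of_ne e]; exact hoff j (by omega)
    · rw [State.writeInt_int_of_ne _ _ _ (by norm_num)]; exact hE

end RealRAM

/-! ### Merging lists of half-planes sorted by direction -/

/-- The half-planes `a` and `b` have the same direction and the first is contained in the second. -/
def Dominates (m : ℕ → Plane) (c : ℕ → ℝ) (a b : ℕ) : Prop :=
  angle (m a) = angle (m b) ∧ ∀ q, dot (m a) q ≤ c a → dot (m b) q ≤ c b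

theorem Dominates.refl (m : ℕ → Plane) (c : ℕ → ℝ) (a : ℕ) : Dominates m c a a :=
  ⟨rfl, fun _ h => h⟩

theorem Dominates.trans {m : ℕ → Plane} {c : ℕ → ℝ} {a b d : ℕ} (h : Dominates m c a b)
    (h' : Dominates m c b d) : Dominates m c a d :=
  ⟨h.1.trans h'.1, fun q hq => h'.2 q (h.2 q hq)⟩

/-- The entries `B lo, …, B (hi - 1)` are sorted by direction and dominate all half-planes with
index less than `n`. -/
structure MergedList (m : ℕ → Plane) (c : ℕ → ℝ) (n : ℕ) (B : ℕ → ℕ) (lo hi : ℕ) : Prop where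
  le : lo ≤ hi
  size_le : hi - lo ≤ n
  lt : ∀ p, lo ≤ p → p < hi → B p < n
  sorted : ∀ p p', lo ≤ p → p < p' → p' < hi → angle (m (B p)) < angle (m (B p'))
  cover : ∀ g < n, ∃ p, lo ≤ p ∧ p < hi ∧ Dominates m c (B p) g

/-- The state of the merging process: the entries from `lo` to `hi` of `B` are to be merged with the
numbers from `n` to `n'`; the first `p - lo` and `q - n` of them have been processed, and the result
is in the positions from `hi` to `r`. -/
structure Merging (m : ℕ → Plane) (c : ℕ → ℝ) (n n' lo hi : ℕ) (B : ℕ → ℕ) (p q r : ℕ) :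
    Prop where
  old : MergedList m c n B lo hi
  le_p : lo ≤ p
  p_le : p ≤ hi
  le_q : n ≤ q
  q_le : q ≤ n'
  le_r : hi ≤ r
  size_le : r - hi ≤ (p - lo) + (q - n)
  lt : ∀ t, hi ≤ t → t < r → B t < n'
  sorted : ∀ t t', hi ≤ t → t < t' → t' < r → angle (m (B t)) < angle (m (B t'))
  lt_left : ∀ t, hi ≤ t → t < r → p < hi → angle (m (B t)) < angle (m (B p))
  lt_right : ∀ t, hi ≤ t → t < r → q < n' → angle (m (B t)) < angle (m q)
  cover_left : ∀ t, lo ≤ t → t < p → ∃ u, hi ≤ u ∧ u < r ∧ Dominates m c (B u) (B t)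
  cover_right : ∀ g, n ≤ g → g < q → ∃ u, hi ≤ u ∧ u < r ∧ Dominates m c (B u) g

/-- This treats all the moves of a merge at once: the new entry `x` is taken from the left, from the
right, or dominates the current entries of both when they have the same direction. -/
theorem Merging.push {m : ℕ → Plane} {c : ℕ → ℝ} {n n' lo hi p q r p' q' x : ℕ} {B : ℕ → ℕ}
    (h : Merging m c n n' lo hi B p q r)
    (hpq : p < p' ∨ q < q') (hp : p' = p ∨ (p' = p + 1 ∧ p < hi ∧ Dominates m c x (B p)))
    (hq : q' = q ∨ (q' = q + 1 ∧ q < n' ∧ Dominates m c x q)) (hx : x < n')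
    (hlt : ∀ t, hi ≤ t → t < r → angle (m (B t)) < angle (m x))
    (hltp : p' < hi → angle (m x) < angle (m (B p'))) (hltq : q' < n' → angle (m x) < angle (m q')) :
    Merging m c n n' lo hi (Function.update B r x) p' q' (r + 1) := by
  have h1 := h.le_p
  have h2 := h.p_le
  have h3 := h.le_q
  have h4 := h.q_le
  have h5 := h.le_r
  have hu : ∀ t, t < r → Function.update B r x t = B t :=
    fun t ht => Function.update_of_ne (by omega) _ _
  have hu' : Function.update B r x r = x := Function.update_self _ _ _
  refine ⟨⟨h.old.le, h.old.size_le, fun t ht ht' => ?_, fun t t' ht htt ht' => ?_, fun g hg => ?_⟩,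
    by omega, by omega, by omega, by omega, by omega, by have := h.size_le; omega,
    fun t ht ht' => ?_, fun t t' ht htt ht' => ?_, fun t ht ht' hp' => ?_, fun t ht ht' hq' => ?_,
    fun t ht ht' => ?_, fun g hg hg' => ?_⟩
  · rw [hu t (by omega)]; exact h.old.lt t ht ht'
  · rw [hu t (by omega), hu t' (by omega)]; exact h.old.sorted t t' ht htt ht'
  · obtain ⟨u, hu1, hu2, hd⟩ := h.old.cover g hg
    exact ⟨u, hu1, hu2, by rwa [hu u (by omega)]⟩
  · by_cases e : t = r
    · rw [e, hu']; exact hx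
    · rw [hu t (by omega)]; exact h.lt t ht (by omega)
  · rw [hu t (by omega)]
    by_cases e : t' = r
    · rw [e, hu']; exact hlt t ht (by omega)
    · rw [hu t' (by omega)]; exact h.sorted t t' ht htt (by omega)
  · rw [hu p' (by omega)]
    by_cases e : t = r
    · rw [e, hu']; exact hltp hp'
    · rw [hu t (by omega)]; exact (hlt t ht (by omega)).trans (hltp hp')
  · by_cases e : t = r
    · rw [e, hu']; exact hltq hq'
    · rw [hu t (by omega)]; exact (hlt t ht (by omega)).trans (hltq hq')
  · by_cases e : t < p
    · obtain ⟨u, hu1, hu2, hd⟩ := h.cover_left t ht e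
      exact ⟨u, hu1, by omega, by rwa [hu u (by omega), hu t (by omega)]⟩
    · rcases hp with hp | ⟨hp, hp1, hd⟩
      · omega
      · have : t = p := by omega
        exact ⟨r, by omega, by omega, by rwa [hu', this, hu p (by omega)]⟩
  · by_cases e : g < q
    · obtain ⟨u, hu1, hu2, hd⟩ := h.cover_right g hg e
      exact ⟨u, hu1, by omega, by rwa [hu u (by omega)]⟩
    · rcases hq with hq | ⟨hq, hq1, hd⟩
      · omega
      · have : g = q := by omega
        exact ⟨r, by omega, by omega, by rwa [hu', this]⟩

theorem Merging.mergedList {m : ℕ → Plane} {c : ℕ → ℝ} {n n' lo hi p q r : ℕ} {B : ℕ → ℕ}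
    (h : Merging m c n n' lo hi B p q r) (hp : ¬ p < hi) (hq : ¬ q < n') :
    MergedList m c n' B hi r := by
  have h1 := h.le_p
  have h2 := h.p_le
  have h3 := h.le_q
  have h4 := h.q_le
  refine ⟨h.le_r, ?_, h.lt, h.sorted, fun g hg => ?_⟩
  · have := h.size_le; have := h.old.size_le; omega
  · by_cases e : g < n
    · obtain ⟨t, ht, ht', hd⟩ := h.old.cover g e
      obtain ⟨u, hu, hu', hd'⟩ := h.cover_left t ht (by omega)
      exact ⟨u, hu, hu', hd'.trans hd⟩
    · exact h.cover_right g (by omega) (by omega)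

theorem exists_smul_of_angle_eq {a b : Plane} (ha : a ≠ 0) (hb : b ≠ 0) (h : angle a = angle b) :
    ∃ r : ℝ, 0 < r ∧ b = r • a := by
  obtain ⟨r, hr, e1⟩ := hasAngle_angle ha
  obtain ⟨r', hr', e2⟩ := hasAngle_angle hb
  refine ⟨r' / r, by positivity, ?_⟩
  rw [← h] at e2
  generalize angle a = θ at e1 e2
  subst e1 e2
  ext
  · simp only [Prod.smul_mk, smul_eq_mul]; field_simp
  · simp only [Prod.smul_mk, smul_eq_mul]; field_simp

/-- Normals with the same angle are positive multiples of each other, with the factor `dot a b / dot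
a a`. The hypothesis compares the rescaled constants without a division. -/
theorem dominates_of_le {m : ℕ → Plane} {c : ℕ → ℝ} {a b : ℕ} (ha : m a ≠ 0) (hb : m b ≠ 0)
    (h : angle (m a) = angle (m b)) (hc : c a * dot (m a) (m b) ≤ c b * dot (m a) (m a)) :
    Dominates m c a b := by
  obtain ⟨r, hr, e⟩ := exists_smul_of_angle_eq ha hb h
  refine ⟨h, fun q hq => ?_⟩
  have hpos := dot_self_pos ha
  have e1 : dot (m a) (m b) = r * dot (m a) (m a) := by
    rw [e]; unfold dot; simp only [Prod.smul_fst, Prod.smul_snd, smul_eq_mul]; ring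
  have e2 : dot (m b) q = r * dot (m a) q := by
    rw [e]; unfold dot; simp only [Prod.smul_fst, Prod.smul_snd, smul_eq_mul]; ring
  rw [e1] at hc
  have : r * c a ≤ c b := by
    by_contra hlt
    push Not at hlt
    nlinarith
  rw [e2]
  nlinarith

theorem dominates_of_not_le {m : ℕ → Plane} {c : ℕ → ℝ} {a b : ℕ} (ha : m a ≠ 0) (hb : m b ≠ 0)
    (h : angle (m a) = angle (m b)) (hc : ¬ c a * dot (m a) (m b) ≤ c b * dot (m a) (m a)) :
    Dominates m c b a := by
  apply dominates_of_le hb ha h.symm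
  obtain ⟨r, hr, e⟩ := exists_smul_of_angle_eq ha hb h
  have e1 : dot (m a) (m b) = r * dot (m a) (m a) := by
    rw [e]; unfold dot; simp only [Prod.smul_fst, Prod.smul_snd, smul_eq_mul]; ring
  have e2 : dot (m b) (m a) = r * dot (m a) (m a) := by
    rw [e]; unfold dot; simp only [Prod.smul_fst, Prod.smul_snd, smul_eq_mul]; ring
  have e3 : dot (m b) (m b) = r * (r * dot (m a) (m a)) := by
    rw [e]; unfold dot; simp only [Prod.smul_fst, Prod.smul_snd, smul_eq_mul]; ring
  rw [e1] at hc
  rw [e2, e3]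
  push Not at hc
  nlinarith

namespace RealRAM

def upperTest (X Y : ℕ) (e : IntExpr) : Test :=
  .or (.realLt (.lit 0) (.cell Y e)) (.and (.realEq (.cell Y e) (.lit 0))
    (.realLt (.cell X e) (.lit 0)))

theorem holds_upperTest {X Y : ℕ} {e : IntExpr} {s : State} :
    (upperTest X Y e).Holds s ↔ InUpperHalf (s.normal X Y (e.eval s)) := by
  simp [upperTest, Test.holds_or, Test.Holds, RealExpr.eval, InUpperHalf, State.normal]

/-- Compares the directions of two normals. -/
def angleTest (X Y : ℕ) (e f : IntExpr) : Test :=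
  .or (.and (.not (upperTest X Y e)) (upperTest X Y f))
    (.and (.or (.and (upperTest X Y e) (upperTest X Y f))
      (.and (.not (upperTest X Y e)) (.not (upperTest X Y f))))
      (.realLt (.lit 0) (crossExpr X Y e f)))

theorem holds_angleTest {X Y : ℕ} {e f : IntExpr} {s : State}
    (he : s.normal X Y (e.eval s) ≠ 0) (hf : s.normal X Y (f.eval s) ≠ 0) :
    (angleTest X Y e f).Holds s ↔
      angle (s.normal X Y (e.eval s)) < angle (s.normal X Y (f.eval s)) := by
  rw [angle_lt_iff he hf]
  simp only [angleTest, Test.holds_or, Test.Holds, holds_upperTest, eval_crossExpr, RealExpr.eval,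
    Rat.cast_zero, iff_iff_and_or_not_and_not]

def dotExpr (X Y : ℕ) (e f : IntExpr) : RealExpr :=
  .add (.mul (.cell X e) (.cell X f)) (.mul (.cell Y e) (.cell Y f))

theorem eval_dotExpr (s : State) (X Y : ℕ) (e f : IntExpr) : (dotExpr X Y e f).eval s =
    dot (s.normal X Y (e.eval s)) (s.normal X Y (f.eval s)) := rfl

/-- Chooses the better one of two half-planes with the same direction. -/
def tighterTest (X Y C : ℕ) (e f : IntExpr) : Test :=
  .not (.realLt (.mul (.cell C f) (dotExpr X Y e e)) (.mul (.cell C e) (dotExpr X Y e f)))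

def mergeBody (X Y C : ℕ) : Program :=
  .cond (.and (.intLt (ivar 23) (ivar 24)) (.or (.not (.intLt (ivar 25) (ivar 26)))
      (angleTest X Y (.cell 3 (ivar 23)) (ivar 25))))
    (block [.setInt 3 (ivar 27) (.cell 3 (ivar 23)), incr 23, incr 27])
    (.cond (.and (.intLt (ivar 25) (ivar 26)) (.or (.not (.intLt (ivar 23) (ivar 24)))
      (angleTest X Y (ivar 25) (.cell 3 (ivar 23)))))
    (block [.setInt 3 (ivar 27) (ivar 25), incr 25, incr 27])
    (.cond (tighterTest X Y C (.cell 3 (ivar 23)) (ivar 25))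
    (block [.setInt 3 (ivar 27) (.cell 3 (ivar 23)), incr 23, incr 25, incr 27])
    (block [.setInt 3 (ivar 27) (ivar 25), incr 23, incr 25, incr 27])))

/-- Merges the edges of the `i`-th polygon into the list in array `3`. -/
def merge (X Y C i : ℕ) : Program :=
  .seq (block [setVar 23 (ivar 20), setVar 24 (ivar 21), setVar 27 (ivar 21),
      setVar 25 (.cell 2 (.lit i)), setVar 26 (.cell 2 (.lit (i + 1)))])
    (.seq (.loop (.or (.intLt (ivar 23) (ivar 24)) (.intLt (ivar 25) (ivar 26)))
      (mergeBody X Y C)) (block [setVar 20 (ivar 24), setVar 21 (ivar 27)]))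

theorem mergeBody_wp {X Y C n n' lo : ℕ} {s : State}
    (hI : Merging (s.normal X Y) (s.real C) n n' lo (s.int 24 0) (s.int 3) (s.int 23 0)
      (s.int 25 0) (s.int 27 0)) (h26 : s.int 26 0 = n') (hnn : n ≤ n')
    (hs : ∀ g, n ≤ g → g + 1 < n' → angle (s.normal X Y g) < angle (s.normal X Y (g + 1)))
    (h0 : ∀ g < n', s.normal X Y g ≠ 0)
    (hb : s.int 23 0 < s.int 24 0 ∨ s.int 25 0 < s.int 26 0) :
    (mergeBody X Y C).wp (fun s' => Merging (s'.normal X Y) (s'.real C) n n' lo (s'.int 24 0)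
      (s'.int 3) (s'.int 23 0) (s'.int 25 0) (s'.int 27 0) ∧
      (s'.int 24 0 - s'.int 23 0) + (n' - s'.int 25 0) <
        (s.int 24 0 - s.int 23 0) + (n' - s.int 25 0)) s := by
  have h1 := hI.le_p
  have h4 := hI.le_q
  have hB : s.int 23 0 < s.int 24 0 → s.int 3 (s.int 23 0) < n' := fun h =>
    (hI.old.lt _ hI.le_p h).trans_le hnn
  have hnorm : ∀ (t : State), t.real = s.real → t.normal X Y = s.normal X Y := fun t ht => by
    unfold State.normal; rw [ht]
  have hpq : s.int 23 0 < s.int 24 0 → s.int 25 0 < n' →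
      ((angleTest X Y (.cell 3 (ivar 23)) (ivar 25)).Holds s ↔
        angle (s.normal X Y (s.int 3 (s.int 23 0))) < angle (s.normal X Y (s.int 25 0))) :=
    fun hp hq => holds_angleTest (h0 (s.int 3 (s.int 23 0)) (hB hp)) (h0 (s.int 25 0) hq)
  have hqp : s.int 23 0 < s.int 24 0 → s.int 25 0 < n' →
      ((angleTest X Y (ivar 25) (.cell 3 (ivar 23))).Holds s ↔
        angle (s.normal X Y (s.int 25 0)) < angle (s.normal X Y (s.int 3 (s.int 23 0)))) :=
    fun hp hq => holds_angleTest (h0 (s.int 25 0) hq) (h0 (s.int 3 (s.int 23 0)) (hB hp))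
  have hsucc : ∀ p, s.int 23 0 + 1 < s.int 24 0 → angle (s.normal X Y (s.int 3 (s.int 23 0))) = p →
      p < angle (s.normal X Y (s.int 3 (s.int 23 0 + 1))) := fun p hp e => by
    rw [← e]; exact hI.old.sorted _ _ hI.le_p (by omega) hp
  have hsucc' : ∀ p, s.int 25 0 + 1 < n' → angle (s.normal X Y (s.int 25 0)) = p →
      p < angle (s.normal X Y (s.int 25 0 + 1)) := fun p hp e => by
    rw [← e]; exact hs _ hI.le_q hp
  refine ⟨fun ht => ?_, fun ht => ⟨fun ht' => ?_, fun ht' => ?_⟩⟩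
  · simp only [Test.Holds, Test.holds_or, IntExpr.eval] at ht
    obtain ⟨hp, hor⟩ := ht
    have hltq : s.int 25 0 < n' → angle (s.normal X Y (s.int 3 (s.int 23 0))) <
        angle (s.normal X Y (s.int 25 0)) := fun hq => by
      have := hor.resolve_left (by omega)
      rwa [hpq hp hq] at this
    simp only [block, Program.wp, IntExpr.eval, State.writeInt_int_self, State.writeInt_int_of_ne,
      ne_eq, not_false_eq_true, Nat.reduceEqDiff, Function.update_self, State.writeInt_real, hnorm]
    refine ⟨hI.push (Or.inl (Nat.lt_succ_self _)) (Or.inr ⟨rfl, hp, .refl _ _ _⟩) (Or.inl rfl)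
      (hB hp) (fun t ht ht' => hI.lt_left t ht ht' hp) (fun h => hsucc _ h rfl) hltq, by omega⟩
  · simp only [Test.Holds, Test.holds_or, IntExpr.eval] at ht ht'
    obtain ⟨hq, hor⟩ := ht'
    rw [h26] at hq
    have hltp : s.int 23 0 < s.int 24 0 → angle (s.normal X Y (s.int 25 0)) <
        angle (s.normal X Y (s.int 3 (s.int 23 0))) := fun hp => by
      have := hor.resolve_left (by omega)
      rwa [hqp hp hq] at this
    simp only [block, Program.wp, IntExpr.eval, State.writeInt_int_self, State.writeInt_int_of_ne,
      ne_eq, not_false_eq_true, Nat.reduceEqDiff, Function.update_self, State.writeInt_real, hnorm]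
    refine ⟨hI.push (Or.inr (Nat.lt_succ_self _)) (Or.inl rfl) (Or.inr ⟨rfl, hq, .refl _ _ _⟩)
      hq (fun t ht ht' => hI.lt_right t ht ht' hq) hltp (fun h => hsucc' _ h rfl), by omega⟩
  · simp only [Test.Holds, Test.holds_or, IntExpr.eval, not_and, not_or, not_not] at ht ht'
    rw [h26] at hb ht ht'
    have hp : s.int 23 0 < s.int 24 0 := by
      rcases hb with h | h
      · exact h
      · by_contra hc
        exact hc (ht' h).1
    have hq : s.int 25 0 < n' := by
      by_contra hc
      exact hc (ht hp).1
    -- Neither direction comes strictly first, so they coincide. The tie is decided in favour of the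
    -- smaller half-plane, and both lists advance.
    have e : angle (s.normal X Y (s.int 3 (s.int 23 0))) = angle (s.normal X Y (s.int 25 0)) := by
      have h2 := (ht hp).2
      have h3 := (ht' hq).2
      rw [hpq hp hq] at h2
      rw [hqp hp hq] at h3
      exact le_antisymm (not_lt.1 h3) (not_lt.1 h2)
    refine ⟨fun hd => ?_, fun hd => ?_⟩
    · have hd' : s.real C (s.int 3 (s.int 23 0)) * _ ≤ s.real C (s.int 25 0) * _ := not_lt.1 hd
      simp only [eval_dotExpr] at hd'
      have hdom := dominates_of_le (h0 _ (hB hp)) (h0 _ hq) e hd'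
      simp only [block, Program.wp, IntExpr.eval, State.writeInt_int_self,
        State.writeInt_int_of_ne, ne_eq, not_false_eq_true, Nat.reduceEqDiff, Function.update_self,
        State.writeInt_real, hnorm]
      refine ⟨hI.push (Or.inr (Nat.lt_succ_self _)) (Or.inr ⟨rfl, hp, .refl _ _ _⟩)
        (Or.inr ⟨rfl, hq, hdom⟩) (hB hp) (fun t ht ht' => hI.lt_left t ht ht' hp)
        (fun h => hsucc _ h rfl) (fun h => hsucc' _ h e.symm), by omega⟩
    · have hd' : ¬ s.real C (s.int 3 (s.int 23 0)) * _ ≤ s.real C (s.int 25 0) * _ :=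
        fun h => hd (not_lt.2 h)
      simp only [eval_dotExpr] at hd'
      have hdom := dominates_of_not_le (h0 _ (hB hp)) (h0 _ hq) e hd'
      simp only [block, Program.wp, IntExpr.eval, State.writeInt_int_self,
        State.writeInt_int_of_ne, ne_eq, not_false_eq_true, Nat.reduceEqDiff, Function.update_self,
        State.writeInt_real, hnorm]
      refine ⟨hI.push (Or.inr (Nat.lt_succ_self _)) (Or.inr ⟨rfl, hp, hdom⟩)
        (Or.inr ⟨rfl, hq, .refl _ _ _⟩) hq (fun t ht ht' => hI.lt_right t ht ht' hq)
        (fun h => hsucc _ h e) (fun h => hsucc' _ h rfl), by omega⟩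

/-- The first `n` half-planes have been merged. -/
structure MergeInv (k X Y C i : ℕ) (a : (ℕ → ConvexPolygon) × (ℕ → Plane)) (s : State) : Prop where
  off : ∀ j ≤ k, s.int 2 j = offset a.1 j
  table : EdgeTable k a.1 a.2 (offset a.1 k) (s.normal X Y) (s.real C) (s.int 6)
  list : MergedList (s.normal X Y) (s.real C) (offset a.1 i) (s.int 3) (s.int 20 0) (s.int 21 0)

theorem merge_triple {X Y C i k : ℕ} (hi : i < k) :
    Triple (fun a : (ℕ → ConvexPolygon) × (ℕ → Plane) => offset a.1 k) (MergeInv k X Y C i)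
      (merge X Y C i) (MergeInv k X Y C (i + 1)) := by
  have hoff : ∀ a : (ℕ → ConvexPolygon) × (ℕ → Plane), offset a.1 (i + 1) ≤ offset a.1 k :=
    fun a => offset_mono a.1 (show i + 1 ≤ k by omega)
  have hle : ∀ a : (ℕ → ConvexPolygon) × (ℕ → Plane), offset a.1 i ≤ offset a.1 (i + 1) :=
    fun a => offset_mono a.1 (Nat.le_succ i)
  have hn : ∀ a : (ℕ → ConvexPolygon) × (ℕ → Plane), 1 ≤ offset a.1 k := fun a => by
    have h := hoff a; have := (a.1 i).three_le_size; rw [offset_succ] at h; omega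
  have hcong : ∀ {s s' : State} (p : Program), SameOutside p s s' → (∀ a, ¬ p.WritesReal a) →
      s'.real = s.real := fun p ho hw => by funext a; exact ho.2 a (hw a)
  refine Triple.seq (Mid := fun a s => (∀ j ≤ k, s.int 2 j = offset a.1 j) ∧
      EdgeTable k a.1 a.2 (offset a.1 k) (s.normal X Y) (s.real C) (s.int 6) ∧
      s.int 26 0 = offset a.1 (i + 1) ∧
      Merging (s.normal X Y) (s.real C) (offset a.1 i) (offset a.1 (i + 1)) (s.int 20 0)
        (s.int 24 0) (s.int 3) (s.int 23 0) (s.int 25 0) (s.int 27 0))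
    (Triple.wp hn fun a s h => ?_) (Triple.seq (Triple.loop hn
      (fun a s => (s.int 24 0 - s.int 23 0) + (offset a.1 (i + 1) - s.int 25 0)) 2
      (fun a s h => ?_) fun a s h hb => ?_) (Triple.wp hn fun a s h => ?_))
  · have h1 := h.off i hi.le
    have h2 := h.off (i + 1) hi
    have h3 := h.list
    simp only [block, Program.wp, IntExpr.eval, State.writeInt_int_self, State.writeInt_int_of_ne,
      ne_eq, not_false_eq_true, Nat.reduceEqDiff, Function.update_self, h1, h2]
    exact ⟨h.off, h.table, trivial, h3, le_rfl, h3.le, le_rfl, hle a, le_rfl, by omega,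
      fun t _ _ => by omega, fun t t' _ _ _ => by omega, fun t _ _ _ => by omega,
      fun t _ _ _ => by omega, fun t _ _ => by omega, fun t _ _ => by omega⟩
  · obtain ⟨-, -, -, hM⟩ := h
    have := hM.old.size_le; have := hM.le_p; have := hM.le_q; have := hoff a; have := hle a
    omega
  · obtain ⟨h2, hE, h26, hM⟩ := h
    have hs : ∀ g, offset a.1 i ≤ g → g + 1 < offset a.1 (i + 1) →
        angle (s.normal X Y g) < angle (s.normal X Y (g + 1)) := by
      intro g hg hg'
      obtain ⟨t, rfl⟩ := Nat.exists_eq_add_of_le hg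
      have h4 := hoff a
      rw [offset_succ] at hg' h4
      rw [(hE i hi t (by omega) (by omega)).1, add_assoc, (hE i hi (t + 1) (by omega) (by omega)).1]
      exact (a.1 i).angle_edge_lt (by omega)
    have h0 : ∀ g < offset a.1 (i + 1), s.normal X Y g ≠ 0 := by
      intro g hg
      have hg' := hg.trans_le (hoff a)
      obtain ⟨j, hj, t, ht, rfl⟩ := exists_offset_add_eq a.1 hg'
      rw [(hE j hj t ht hg').1]
      exact (a.1 j).normal_ne_zero _
    have := mergeBody_wp hM h26 (hle a) hs h0 (by
      rwa [Test.holds_or] at hb)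
    refine Program.wp_mono ?_ (Program.wp_frame this)
    rintro s' ⟨ho, hM', hμ⟩
    have hr := hcong _ ho (by simp [mergeBody, block, Program.WritesReal])
    have hm : s'.normal X Y = s.normal X Y := by unfold State.normal; rw [hr]
    have e : ∀ a ∈ [2, 6, 20, 26], s'.int a = s.int a := fun a ha => ho.1 a (by
      simp [mergeBody, block, Program.WritesInt]; simp at ha; omega)
    rw [e 2 (by simp), e 6 (by simp), e 20 (by simp), e 26 (by simp), hm, hr]
    rw [hm, hr] at hM'
    exact ⟨⟨h2, hE, h26, hM'⟩, hμ⟩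
  · obtain ⟨⟨h2, hE, h26, hM⟩, hb⟩ := h
    rw [Test.holds_or, not_or] at hb
    have h3 : ¬ s.int 23 0 < s.int 24 0 := hb.1
    have h4 : ¬ s.int 25 0 < s.int 26 0 := hb.2
    rw [h26] at h4
    refine ⟨h2, hE, ?_⟩
    simp only [block, Program.wp, IntExpr.eval, State.writeInt_int_self, State.writeInt_int_of_ne,
      ne_eq, not_false_eq_true, Nat.reduceEqDiff, Function.update_self]
    exact hM.mergedList h3 h4

end RealRAM

/-! ### The polygon `I` as an intersection of half-planes -/

/-- The intersection of the first `n` half-planes. -/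
def feasible (m : ℕ → Plane) (c : ℕ → ℝ) (n : ℕ) : Set Plane := {q | ∀ g < n, dot (m g) q ≤ c g}

section
variable {k : ℕ} {Q : ℕ → ConvexPolygon} {V : ℕ → Plane} {m : ℕ → Plane} {c : ℕ → ℝ} {own : ℕ → ℕ}

theorem EdgeTable.forall_iff (h : EdgeTable k Q V (offset Q k) m c own) {i : ℕ} (hi : i < k)
    (q : Plane) : (∀ t < (Q i).size, dot (m (offset Q i + t)) q ≤ c (offset Q i + t)) ↔
      q - V i ∈ (Q i).region := by
  rw [(Q i).mem_region_iff_dot (Q i).start]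
  refine forall₂_congr fun t ht => ?_
  obtain ⟨e1, e2, -⟩ := h i hi t ht (offset_add_lt Q hi ht)
  rw [e1, e2, dot_sub, dot_add]
  unfold ConvexPolygon.edge
  constructor <;> intro h <;> linarith

theorem EdgeTable.overlap_eq (h : EdgeTable k Q V (offset Q k) m c own) :
    overlap (fun i : Fin k => Q i) (fun i : Fin k => V i) = feasible m c (offset Q k) := by
  ext q
  rw [mem_overlap]
  constructor
  · intro hq g hg
    obtain ⟨i, hi, t, ht, rfl⟩ := exists_offset_add_eq Q hg
    exact (h.forall_iff hi q).2 (hq ⟨i, hi⟩) t ht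
  · intro hq i
    exact (h.forall_iff i.2 q).1 fun t ht => hq _ (offset_add_lt Q i.2 ht)

theorem EdgeTable.ne_zero (h : EdgeTable k Q V (offset Q k) m c own) {g : ℕ}
    (hg : g < offset Q k) : m g ≠ 0 := by
  obtain ⟨i, hi, t, ht, rfl⟩ := exists_offset_add_eq Q hg
  rw [(h i hi t ht hg).1]
  exact (Q i).normal_ne_zero _

theorem EdgeTable.exists_dot_pos (h : EdgeTable k Q V (offset Q k) m c own) {i : ℕ} (hi : i < k)
    {u : Plane} (hu : u ≠ 0) : ∃ t < (Q i).size, 0 < dot (m (offset Q i + t)) u := by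
  obtain ⟨t, ht, hpos⟩ := (Q i).exists_dot_normal_pos (Q i).start hu
  exact ⟨t, ht, by rw [(h i hi t ht (offset_add_lt Q hi ht)).1]; exact hpos⟩

theorem EdgeTable.angle_lt (h : EdgeTable k Q V (offset Q k) m c own) {i : ℕ} (hi : i < k) {g : ℕ}
    (hg : offset Q i ≤ g) (hg' : g + 1 < offset Q (i + 1)) :
    angle (m g) < angle (m (g + 1)) := by
  obtain ⟨t, rfl⟩ := Nat.exists_eq_add_of_le hg
  rw [offset_succ] at hg'
  rw [(h i hi t (by omega) (offset_add_lt Q hi (by omega))).1, add_assoc,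
    (h i hi (t + 1) (by omega) (offset_add_lt Q hi (by omega))).1]
  exact (Q i).angle_edge_lt (by omega)

/-- A convex set of positive area has an interior point. From there one can still move a little in
the direction of each normal, so no constraint is tight. -/
theorem exists_strictly_feasible {n : ℕ} (h0 : ∀ g < n, m g ≠ 0)
    (hv : 0 < volume (feasible m c n)) : ∃ o, ∀ g < n, dot (m g) o < c g := by
  have hconv : Convex ℝ (feasible m c n) := by
    intro x hx y hy a b ha hb hab g hg
    rw [dot_add, dot_smul, dot_smul]
    calc a * dot (m g) x + b * dot (m g) y ≤ a * c g + b * c g :=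
          add_le_add (mul_le_mul_of_nonneg_left (hx g hg) ha)
            (mul_le_mul_of_nonneg_left (hy g hg) hb)
      _ = c g := by rw [← add_mul, hab, one_mul]
  have hne : (interior (feasible m c n)).Nonempty := by
    by_contra hc
    rw [Set.not_nonempty_iff_eq_empty] at hc
    have hfr := hconv.addHaar_frontier volume
    have hsub : feasible m c n ⊆ frontier (feasible m c n) := by
      rw [frontier, hc, Set.sdiff_empty]; exact subset_closure
    exact absurd (measure_mono_null hsub hfr) hv.ne'
  obtain ⟨o, ho⟩ := hne
  refine ⟨o, fun g hg => ?_⟩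
  have hcont : Filter.Tendsto (fun ε : ℝ => o + ε • m g) (nhds 0) (nhds o) := by
    have : Continuous fun ε : ℝ => o + ε • m g := by fun_prop
    simpa using this.tendsto 0
  have hev := (hcont.eventually (mem_interior_iff_mem_nhds.1 ho)).filter_mono
    (nhdsWithin_le_nhds (s := Set.Ioi 0))
  obtain ⟨ε, hε, hpos⟩ := (hev.and self_mem_nhdsWithin).exists
  have := hε g hg
  rw [dot_add, dot_smul] at this
  have := mul_pos (Set.mem_Ioi.1 hpos) (dot_self_pos (h0 g hg))
  linarith

end

/-! ### The essential half-planes of the maximal overlap. -/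

/-- The inputs of the algorithm. -/
abbrev Instance (k : ℕ) : Type :=
  {a : (ℕ → ConvexPolygon) × (ℕ → Plane) //
    toConfig (fun i : Fin k => a.2 i) ∈ maximizers fun i : Fin k => a.1 i}

/-- The entries `B lo, …, B (hi - 1)` are the half-planes among the first `n` ones that contribute
an edge to the intersection, in cyclic order. -/
structure Envelope (m : ℕ → Plane) (c : ℕ → ℝ) (n : ℕ) (B : ℕ → ℕ) (lo hi : ℕ) (τ : ℕ → ℝ) :
    Prop where
  order : CyclicOrder m B lo hi τ
  strict : ∀ p, lo ≤ p → p < hi → StrictAt m c B lo hi p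
  implied : ∀ q, (∀ p, lo ≤ p → p < hi → dot (m (B p)) q ≤ c (B p)) → q ∈ feasible m c n
  lt : ∀ p, lo ≤ p → p < hi → B p < n
  size_le : hi - lo ≤ n

/-- Every half-plane is dominated by an entry with the same direction, so the entries inherit from
the original normals that they positively span the plane. -/
theorem MergedList.cyclicOrder {m : ℕ → Plane} {c : ℕ → ℝ} {n lo hi : ℕ} {B : ℕ → ℕ}
    (h : MergedList m c n B lo hi) (h0 : ∀ g < n, m g ≠ 0)
    (hspan : ∀ u : Plane, u ≠ 0 → ∃ g < n, 0 < dot (m g) u) :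
    CyclicOrder m B lo hi fun p => angle (m (B p)) := by
  have hspan' : ∀ u : Plane, u ≠ 0 → ∃ p, lo ≤ p ∧ p < hi ∧ 0 < dot (m (B p)) u := by
    intro u hu
    obtain ⟨g, hg, hpos⟩ := hspan u hu
    obtain ⟨p, hp, hp', hd⟩ := h.cover g hg
    obtain ⟨r, hr, e⟩ := exists_smul_of_angle_eq (h0 _ hg) (h0 _ (h.lt p hp hp')) hd.1.symm
    refine ⟨p, hp, hp', ?_⟩
    have : dot (m (B p)) u = r * dot (m g) u := by
      rw [e]; unfold dot; simp only [Prod.smul_fst, Prod.smul_snd, smul_eq_mul]; ring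
    rw [this]; exact mul_pos hr hpos
  obtain ⟨p, hp, hp', -⟩ := hspan' (1, 0) (by simp)
  exact CyclicOrder.of_angle_lt (by omega) (fun p hp hp' => h0 _ (h.lt p hp hp'))
    (fun p hp hp' => h.sorted p (p + 1) hp (Nat.lt_succ_self p) hp') hspan'

namespace RealRAM

/-- The half-planes that contribute to the intersection have been found. -/
structure EnvelopeInv (k X Y C : ℕ) (a : Instance k) (s : State) : Prop where
  off : ∀ j ≤ k, s.int 2 j = offset a.1.1 j
  table : EdgeTable k a.1.1 a.1.2 (offset a.1.1 k) (s.normal X Y) (s.real C) (s.int 6)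
  env : ∃ τ, Envelope (s.normal X Y) (s.real C) (offset a.1.1 k) (s.int 3) (s.int 20 0)
    (s.int 21 0) τ

theorem trim_triple {X Y C k : ℕ} (hk : 0 < k) :
    Triple (fun a : Instance k => offset a.1.1 k) (fun a => MergeInv k X Y C k a.1)
      (trim 3 X Y C) (EnvelopeInv k X Y C) := by
  obtain ⟨K, hK⟩ := trim_ensures (B := 3) (X := X) (Y := Y) (C := C) (Or.inr (by norm_num))
  refine ⟨K, fun a s h => ?_⟩
  have h0 : ∀ g < offset a.1.1 k, s.normal X Y g ≠ 0 := fun g hg => h.table.ne_zero hg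
  -- Maximality enters here: the overlap has positive area, and this supplies the interior point
  -- needed by the removal.
  obtain ⟨o, ho⟩ := exists_strictly_feasible (c := s.real C) h0 (by
    rw [← h.table.overlap_eq]; exact volume_overlap_pos_of_mem_maximizers a.2)
  have hτ := h.list.cyclicOrder h0 fun u hu => by
    obtain ⟨t, ht, hpos⟩ := h.table.exists_dot_pos hk hu
    exact ⟨_, offset_add_lt _ hk ht, hpos⟩
  refine (hK s o _ hτ fun p hp hp' => ho _ (h.list.lt p hp hp')).mono
    (Nat.mul_le_mul_left _ h.list.size_le) fun s' hs' hT => ?_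
  have hr : s'.real = s.real := by
    funext a; exact hs'.2 a (by simp [trim, trimBody, block, Program.WritesReal])
  have hm : s'.normal X Y = s.normal X Y := by unfold State.normal; rw [hr]
  have e : ∀ a ∈ [2, 6], s'.int a = s.int a := fun a ha => hs'.1 a (by
    simp [trim, trimBody, block, Program.WritesInt]; simp at ha; omega)
  obtain ⟨τ, hτ'⟩ := hT.order
  refine ⟨by rw [e 2 (by simp)]; exact h.off, by rw [hm, hr, e 6 (by simp)]; exact h.table,
    τ, by rw [hm]; exact hτ', ?_, ?_, ?_, hT.size_le.trans h.list.size_le⟩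
  · rw [hm, hr]
    exact fun p hp hp' => hT.strict p (by omega) hp'
  · rw [hm, hr]
    intro q hq g hg
    obtain ⟨p, hp, hp', hd⟩ := h.list.cover g hg
    exact hd.2 q (hT.implied q hq p hp hp')
  · intro p hp hp'
    obtain ⟨p₀, h1, h2, e⟩ := hT.mem p hp hp'
    rw [e]; exact h.list.lt p₀ h1 h2

end RealRAM

/-! ### Extreme points in the directions of the edges -/

/-- The number `x` is the distance between the half-plane `e` and the intersection of the first `n`
half-planes, up to the length of the normal. -/
def IsSlack (m : ℕ → Plane) (c : ℕ → ℝ) (n e : ℕ) (x : ℝ) : Prop :=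
  ∃ w ∈ feasible m c n, x = c e - dot (m e) w ∧ ∀ q ∈ feasible m c n, dot (m e) q ≤ dot (m e) w

section
variable {m : ℕ → Plane} {c : ℕ → ℝ} {n lo hi : ℕ} {B : ℕ → ℕ} {τ : ℕ → ℝ}

theorem CyclicOrder.add_int_mul (h : CyclicOrder m B lo hi τ) (z : ℤ) :
    CyclicOrder m B lo hi fun p => τ p + z * (2 * Real.pi) where
  lt_hi := h.lt_hi
  hasAngle p hp hp' := (h.hasAngle p hp hp').add_int_mul z
  lt p hp hp' := by have := h.lt p hp hp'; linarith
  lt_add_pi p hp hp' := by have := h.lt_add_pi p hp hp'; linarith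
  wrap_lt := by have := h.wrap_lt; linarith
  wrap_lt_add_pi := by have := h.wrap_lt_add_pi; linarith

theorem Envelope.add_int_mul (h : Envelope m c n B lo hi τ) (z : ℤ) :
    Envelope m c n B lo hi fun p => τ p + z * (2 * Real.pi) :=
  ⟨h.order.add_int_mul z, h.strict, h.implied, h.lt, h.size_le⟩

theorem Envelope.rotate (h : Envelope m c n B lo hi τ) :
    Envelope m c n (Function.update B hi (B lo)) (lo + 1) (hi + 1)
      (Function.update τ hi (τ lo + 2 * Real.pi)) := by
  have h3 := h.order.three_le
  have hu : ∀ x p, p < hi → Function.update B hi x p = B p :=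
    fun x p hp => Function.update_of_ne (by omega) _ _
  have hu' : ∀ x, Function.update B hi x hi = x := fun x => Function.update_self _ _ _
  refine ⟨h.order.rotate, fun p hp hp' => ?_, fun q hq => h.implied q fun p hp hp' => ?_,
    fun p hp hp' => ?_, by have := h.size_le; omega⟩
  · by_cases e : p = hi
    · subst e; exact StrictAt.rotate_last h3 (h.strict lo le_rfl (by omega))
    · exact StrictAt.rotate (by omega) (by omega) (h.strict p (by omega) (by omega))
  · by_cases e : p = lo
    · subst e
      have := hq hi (by omega) (by omega)
      rwa [hu'] at this
    · have := hq p (by omega) (by omega)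
      rwa [hu _ _ hp'] at this
  · by_cases e : p = hi
    · subst e; rw [hu']; exact h.lt lo le_rfl (by omega)
    · rw [hu _ _ (by omega)]; exact h.lt p (by omega) (by omega)

/-- The normal of `e` lies in the cone of the normals at `lo` and `lo + 1`. Written as a nonnegative
combination of them, it shows that the vertex where these two lines meet is extreme in its
direction. -/
theorem Envelope.isSlack (h : Envelope m c n B lo hi τ) {e : ℕ}
    (h1 : 0 ≤ cross (m (B lo)) (m e)) (h2 : 0 < cross (m e) (m (B (lo + 1)))) :
    IsSlack m c n e (c e - (c (B lo) * cross (m e) (m (B (lo + 1))) +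
      c (B (lo + 1)) * cross (m (B lo)) (m e)) / cross (m (B lo)) (m (B (lo + 1)))) := by
  have h3 := h.order.three_le
  have hD := h.order.cross_pos le_rfl (show lo + 1 < hi by omega)
  set a := m (B lo) with ha
  set b := m (B (lo + 1)) with hb
  set x := c (B lo) with hx
  set y := c (B (lo + 1)) with hy
  set w : Plane := ((x * b.2 - y * a.2) / cross a b, (a.1 * y - b.1 * x) / cross a b) with hw
  have hD' := hD.ne'
  have hdot : ∀ u : Plane, dot u w = (x * cross u b + y * cross a u) / cross a b := by
    intro u
    unfold dot
    rw [hw]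
    simp only
    rw [mul_div_assoc', mul_div_assoc', ← add_div]
    unfold cross
    ring
  have hself : ∀ u : Plane, cross u u = 0 := fun u => by unfold cross; ring
  have hwI : w ∈ feasible m c n := by
    refine h.implied w fun p hp hp' => h.order.vertex_feasible h.strict ?_ ?_ p hp hp'
    · rw [hdot, hself]; field_simp; ring
    · rw [hdot, hself]; field_simp; ring
  refine ⟨w, hwI, by rw [hdot], fun q hq => ?_⟩
  have e : dot (m e) q = (dot a q * cross (m e) b + dot b q * cross a (m e)) / cross a b := by
    rw [eq_div_iff hD']; unfold dot cross; ring
  rw [e, hdot]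
  have ka : dot a q ≤ x := hq _ (h.lt lo le_rfl (by omega))
  have kb : dot b q ≤ y := hq _ (h.lt (lo + 1) (by omega) (by omega))
  gcongr

end

/-- The state of the computation of the slacks: those of the first `e` half-planes are known.  The
directions of the normals, counted with revolutions, are `α`. -/
structure Locating (m : ℕ → Plane) (c : ℕ → ℝ) (n : ℕ) (α : ℕ → ℝ) (S : ℕ → ℝ) (lo₀ : ℕ) (B : ℕ → ℕ)
    (lo hi e : ℕ) : Prop where
  le : lo₀ ≤ lo
  le_n : e ≤ n
  env : ∃ τ, Envelope m c n B lo hi τ ∧ (e < n → τ lo ≤ α e) ∧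
    ∀ p, lo ≤ p → p < hi → -(3 * Real.pi) + 2 * Real.pi * ((p - lo₀) / (hi - lo) : ℕ) < τ p
  slack : ∀ g < e, IsSlack m c n g (S g)

section
variable {m : ℕ → Plane} {c : ℕ → ℝ} {n k lo₀ lo hi e : ℕ} {α S : ℕ → ℝ} {B : ℕ → ℕ}

theorem Locating.size_le (h : Locating m c n α S lo₀ B lo hi e) : hi - lo ≤ n := by
  obtain ⟨τ, hτ, -⟩ := h.env
  exact hτ.size_le

theorem Locating.found (h : Locating m c n α S lo₀ B lo hi e) (he : e < n)
    (hα : ∀ g, g + 1 < n → α g ≤ α (g + 1)) {x : ℝ} (hx : IsSlack m c n e x) :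
    Locating m c n α (Function.update S e x) lo₀ B lo hi (e + 1) := by
  obtain ⟨τ, h1, h2, h3⟩ := h.env
  refine ⟨h.le, he, ⟨τ, h1, fun h => (h2 he).trans (hα e h), h3⟩, fun g hg => ?_⟩
  by_cases e' : g = e
  · subst e'; rwa [Function.update_self]
  · rw [Function.update_of_ne e']; exact h.slack g (by omega)

/-- A full round of rotations raises the angles by `2π`, and they start above `-3π`. The front entry
never passes the direction of the current edge, which is at most `2πk - π`. So fewer than `k + 1`
full rounds are completed. -/
theorem Locating.lt (h : Locating m c n α S lo₀ B lo hi e) (he : e < n)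
    (hα : ∀ g < n, α g ≤ 2 * Real.pi * k - Real.pi) : lo - lo₀ < (k + 1) * (hi - lo) := by
  obtain ⟨τ, h1, h2, h3⟩ := h.env
  have hlt := h1.order.lt_hi
  have h4 := h3 lo le_rfl hlt
  have h5 := h2 he
  have h6 := hα e he
  rw [← Nat.div_lt_iff_lt_mul (by omega)]
  have : (((lo - lo₀) / (hi - lo) : ℕ) : ℝ) < ((k + 1 : ℕ) : ℝ) := by
    push_cast
    have hpi := Real.pi_pos
    by_contra hc
    push Not at hc
    have := mul_le_mul_of_nonneg_left hc (by positivity : 0 ≤ 2 * Real.pi)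
    nlinarith
  exact_mod_cast this

/-- If the next entry had passed the direction of the edge, the normal of the edge would lie between
the first two entries, and the test would have succeeded. -/
theorem Locating.rotate (h : Locating m c n α S lo₀ B lo hi e) (he : e < n)
    (hα : ∀ g < n, HasAngle (m g) (α g))
    (hc : ¬ (0 ≤ cross (m (B lo)) (m e) ∧ 0 < cross (m e) (m (B (lo + 1))))) :
    Locating m c n α S lo₀ (Function.update B hi (B lo)) (lo + 1) (hi + 1) e := by
  obtain ⟨τ, h1, h2, h3⟩ := h.env
  have h4 := h1.order.three_le
  have hle := h.le
  refine ⟨by omega, h.le_n, ⟨_, h1.rotate, fun _ => ?_, fun p hp hp' => ?_⟩, h.slack⟩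
  · rw [Function.update_of_ne (by omega)]
    by_contra hlt
    push Not at hlt
    have ha := h1.order.hasAngle lo le_rfl (by omega)
    have hb := h1.order.hasAngle (lo + 1) (by omega) (by omega)
    have hgap := h1.order.lt_add_pi lo le_rfl (by omega)
    have h5 := h2 he
    refine hc ⟨?_, (hα e he).cross_pos hb hlt (by linarith)⟩
    rcases h5.eq_or_lt with h6 | h6
    · have hA := hα e he
      rw [← h6] at hA
      exact (ha.cross_eq_zero_of_eq hA).ge
    · exact (ha.cross_pos (hα e he) h6 (by linarith)).le
  · rw [show hi + 1 - (lo + 1) = hi - lo by omega]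
    by_cases e' : p = hi
    · subst e'
      rw [Function.update_self, show p - lo₀ = (lo - lo₀) + (p - lo) by omega,
        Nat.add_div_right _ (by omega)]
      have := h3 lo le_rfl (by omega)
      push_cast at this ⊢
      linarith
    · rw [Function.update_of_ne e']
      exact h3 p (by omega) (by omega)

end

namespace RealRAM

theorem State.normal_writeInt (s : State) (a i x X Y : ℕ) :
    (s.writeInt a i x).normal X Y = s.normal X Y := rfl

theorem State.normal_writeReal (s : State) {a X Y : ℕ} (i : ℕ) (x : ℝ) (hX : X ≠ a) (hY : Y ≠ a) :
    (s.writeReal a i x).normal X Y = s.normal X Y := by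
  unfold State.normal
  rw [State.writeReal_real_of_ne _ _ _ hX, State.writeReal_real_of_ne _ _ _ hY]

def locateBody (X Y C S : ℕ) : Program :=
  .cond (.and (.not (.realLt (crossExpr X Y (.cell 3 (ivar 20)) (ivar 23)) (.lit 0)))
      (.realLt (.lit 0) (crossExpr X Y (ivar 23) (.cell 3 (.add (ivar 20) (.lit 1))))))
    (block [.setReal S (ivar 23) (.sub (.cell C (ivar 23)) (.div (.add
        (.mul (.cell C (.cell 3 (ivar 20)))
          (crossExpr X Y (ivar 23) (.cell 3 (.add (ivar 20) (.lit 1)))))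
        (.mul (.cell C (.cell 3 (.add (ivar 20) (.lit 1))))
          (crossExpr X Y (.cell 3 (ivar 20)) (ivar 23))))
        (crossExpr X Y (.cell 3 (ivar 20)) (.cell 3 (.add (ivar 20) (.lit 1)))))), incr 23])
    (block [.setInt 3 (ivar 21) (.cell 3 (ivar 20)), incr 21, incr 20])

/-- Computes the slacks of all edges. -/
def locate (X Y C S k : ℕ) : Program :=
  .seq (block [setVar 23 (.lit 0), setVar 24 (.cell 2 (.lit k))])
    (.loop (.intLt (ivar 23) (ivar 24)) (locateBody X Y C S))

/-- The measure adds the edges still to be treated and the rotations still allowed. The truncated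
difference really decreases because of `Locating.lt`. -/
theorem locateBody_wp {X Y C S n k lo₀ : ℕ} {α : ℕ → ℝ} {s : State} (hXS : X ≠ S) (hYS : Y ≠ S)
    (hCS : C ≠ S)
    (hI : Locating (s.normal X Y) (s.real C) n α (s.real S) lo₀ (s.int 3) (s.int 20 0) (s.int 21 0)
      (s.int 23 0)) (hlt : s.int 23 0 < n)
    (hα : ∀ g, g + 1 < n → α g ≤ α (g + 1)) (hα' : ∀ g < n, α g ≤ 2 * Real.pi * k - Real.pi)
    (hα'' : ∀ g < n, HasAngle (s.normal X Y g) (α g)) :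
    (locateBody X Y C S).wp (fun s' => Locating (s'.normal X Y) (s'.real C) n α (s'.real S) lo₀
      (s'.int 3) (s'.int 20 0) (s'.int 21 0) (s'.int 23 0) ∧
      (n - s'.int 23 0) + ((k + 1) * (s'.int 21 0 - s'.int 20 0) - (s'.int 20 0 - lo₀)) <
      (n - s.int 23 0) + ((k + 1) * (s.int 21 0 - s.int 20 0) - (s.int 20 0 - lo₀))) s := by
  have hnorm : ∀ (t : State), t.real = s.real → t.normal X Y = s.normal X Y := fun t ht => by
    unfold State.normal; rw [ht]
  have hle := hI.le
  refine ⟨fun ht => ?_, fun ht => ?_⟩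
  · simp only [Test.Holds, eval_crossExpr, RealExpr.eval, IntExpr.eval, Rat.cast_zero, not_lt]
      at ht
    obtain ⟨τ, hτ, -⟩ := hI.env
    have := hI.found hlt hα (hτ.isSlack ht.1 ht.2)
    simp only [block, Program.wp, IntExpr.eval, RealExpr.eval, eval_crossExpr,
      State.writeInt_int_self, State.writeInt_int_of_ne, State.writeReal_int, State.writeInt_real,
      State.writeReal_real_self, State.writeReal_real_of_ne, ne_eq, not_false_eq_true,
      Nat.reduceEqDiff, Function.update_self, State.normal_writeInt, State.normal_writeReal, hXS,
      hYS, hCS]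
    exact ⟨this, by omega⟩
  · simp only [Test.Holds, eval_crossExpr, RealExpr.eval, IntExpr.eval, Rat.cast_zero, not_lt]
      at ht
    have h1 := hI.rotate hlt hα'' ht
    have h2 := hI.lt hlt hα'
    simp only [block, Program.wp, IntExpr.eval, State.writeInt_int_self, State.writeInt_int_of_ne,
      State.writeInt_real, ne_eq, not_false_eq_true, Nat.reduceEqDiff, Function.update_self, hnorm]
    refine ⟨h1, ?_⟩
    rw [Nat.add_sub_add_right]
    omega

/-- The slacks of all edges are known. -/
structure SlackInv (k X Y C S : ℕ) (a : Instance k) (s : State) : Prop where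
  off : ∀ j ≤ k, s.int 2 j = offset a.1.1 j
  table : EdgeTable k a.1.1 a.1.2 (offset a.1.1 k) (s.normal X Y) (s.real C) (s.int 6)
  slack : ∀ g < offset a.1.1 k, IsSlack (s.normal X Y) (s.real C) (offset a.1.1 k) g (s.real S g)

end RealRAM

/-- The direction of the `g`-th edge, raised by one revolution for every polygon before. -/
noncomputable def liftedAngle (m : ℕ → Plane) (own : ℕ → ℕ) (g : ℕ) : ℝ :=
  angle (m g) + own g * (2 * Real.pi)

section
variable {k : ℕ} {Q : ℕ → ConvexPolygon} {V : ℕ → Plane} {m : ℕ → Plane} {c : ℕ → ℝ} {own : ℕ → ℕ}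

theorem EdgeTable.hasAngle_liftedAngle (h : EdgeTable k Q V (offset Q k) m c own) {g : ℕ}
    (hg : g < offset Q k) : HasAngle (m g) (liftedAngle m own g) := by
  have := (hasAngle_angle (h.ne_zero hg)).add_int_mul (own g)
  exact_mod_cast this

theorem EdgeTable.liftedAngle_le (h : EdgeTable k Q V (offset Q k) m c own) {g : ℕ}
    (hg : g < offset Q k) : liftedAngle m own g ≤ 2 * Real.pi * k - Real.pi := by
  obtain ⟨i, hi, t, ht, rfl⟩ := exists_offset_add_eq Q hg
  unfold liftedAngle
  rw [(h i hi t ht hg).2.2]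
  have h1 := angle_le_pi (m (offset Q i + t))
  have h2 : ((i + 1 : ℕ) : ℝ) ≤ k := by exact_mod_cast hi
  push_cast at h2
  nlinarith [Real.pi_pos]

/-- Inside a polygon the angles increase. From the last edge of a polygon to the first of the next
one the angle falls by less than `2π`, which the extra revolution makes up for. -/
theorem EdgeTable.liftedAngle_le_succ (h : EdgeTable k Q V (offset Q k) m c own) {g : ℕ}
    (hg : g + 1 < offset Q k) : liftedAngle m own g ≤ liftedAngle m own (g + 1) := by
  obtain ⟨i, hi, t, ht, rfl⟩ := exists_offset_add_eq Q (show g < offset Q k by omega)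
  unfold liftedAngle
  by_cases ht' : t + 1 < (Q i).size
  · have := h.angle_lt hi (Nat.le_add_right _ t) (by rw [offset_succ]; omega)
    rw [(h i hi t ht (by omega)).2.2, add_assoc, (h i hi (t + 1) ht' (by omega)).2.2]
    rw [add_assoc] at this
    linarith
  · have e : offset Q i + t + 1 = offset Q (i + 1) + 0 := by rw [offset_succ]; omega
    have hi' : i + 1 < k := by
      by_contra hc
      have : k = i + 1 := by omega
      subst this; omega
    rw [(h i hi t ht (by omega)).2.2, e, (h (i + 1) hi' 0 (Q _).size_pos (by omega)).2.2]
    have h1 := angle_le_pi (m (offset Q i + t))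
    have h2 := neg_pi_lt_angle (m (offset Q (i + 1) + 0))
    push_cast
    linarith

end

namespace RealRAM

theorem locate_triple {X Y C S k : ℕ} (hk : 0 < k) (hXS : X ≠ S) (hYS : Y ≠ S) (hCS : C ≠ S) :
    Triple (fun a : Instance k => offset a.1.1 k) (EnvelopeInv k X Y C) (locate X Y C S k)
      (SlackInv k X Y C S) := by
  have hn : ∀ a : Instance k, 1 ≤ offset a.1.1 k := fun a =>
    (Nat.zero_le _).trans_lt (offset_add_lt a.1.1 hk (a.1.1 0).size_pos)
  refine Triple.seq (Mid := fun a s => ∃ lo₀ : ℕ, (∀ j ≤ k, s.int 2 j = offset a.1.1 j) ∧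
    EdgeTable k a.1.1 a.1.2 (offset a.1.1 k) (s.normal X Y) (s.real C) (s.int 6) ∧
    s.int 24 0 = offset a.1.1 k ∧ Locating (s.normal X Y) (s.real C) (offset a.1.1 k)
      (liftedAngle (s.normal X Y) (s.int 6)) (s.real S) lo₀ (s.int 3) (s.int 20 0) (s.int 21 0)
      (s.int 23 0)) (Triple.wp hn fun a s h => ?_) (Triple.ofExists (Triple.conseq (Triple.loop
      (fun x : Instance k × ℕ => hn x.1) (fun x s => (offset x.1.1.1 k - s.int 23 0) +
        ((k + 1) * (s.int 21 0 - s.int 20 0) - (s.int 20 0 - x.2))) (k + 2)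
      (fun x s h => ?_) fun x s h hb => ?_) (fun _ _ h => h) fun x s h => ?_))
  · obtain ⟨τ, hτ⟩ := h.env
    have hpi := Real.pi_pos
    -- The angles of the list are shifted by whole revolutions so that the first one lies in `(-3π,
    -- -π]`, hence before the direction of the first edge.
    obtain ⟨z, hz, -⟩ := existsUnique_add_zsmul_mem_Ioc (a := 2 * Real.pi) (by linarith)
      (τ (s.int 20 0)) (-(3 * Real.pi))
    have h3 := hτ.order.three_le
    simp only [block, Program.wp, IntExpr.eval, State.writeInt_int_self, State.writeInt_int_of_ne,
      ne_eq, not_false_eq_true, Nat.reduceEqDiff, Function.update_self, h.off k le_rfl]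
    refine ⟨s.int 20 0, h.off, h.table, trivial, le_rfl, Nat.zero_le _,
      ⟨_, hτ.add_int_mul z, fun _ => ?_, fun p hp hp' => ?_⟩, fun g hg => by omega⟩
    · rw [zsmul_eq_mul] at hz
      have h1 := hz.2
      unfold liftedAngle
      have h2 := neg_pi_lt_angle (s.normal X Y 0)
      have : 0 ≤ (s.int 6 0 : ℝ) * (2 * Real.pi) := by positivity
      simp only [State.normal, State.writeInt_real] at *
      linarith
    · rw [Nat.div_eq_of_lt (by omega)]
      have h1 := hz.1
      rw [zsmul_eq_mul] at h1
      rcases hp.eq_or_lt with e | e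
      · subst e; push_cast; linarith
      · have := hτ.order.strictMonoOn le_rfl e hp'
        push_cast; linarith
  · obtain ⟨-, -, -, hL⟩ := h
    have := hL.size_le
    have : (k + 1) * (s.int 21 0 - s.int 20 0) ≤ (k + 1) * offset x.1.1.1 k :=
      Nat.mul_le_mul_left _ this
    have e : (k + 2) * offset x.1.1.1 k = offset x.1.1.1 k + (k + 1) * offset x.1.1.1 k := by ring
    omega
  · obtain ⟨h2, hE, h24, hL⟩ := h
    have hlt : s.int 23 0 < offset x.1.1.1 k := by
      have : s.int 23 0 < s.int 24 0 := hb
      omega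
    have := locateBody_wp hXS hYS hCS hL hlt (fun g => hE.liftedAngle_le_succ)
      (fun g => hE.liftedAngle_le) (fun g => hE.hasAngle_liftedAngle)
    refine Program.wp_mono ?_ (Program.wp_frame this)
    rintro s' ⟨ho, hL', hμ⟩
    have er : ∀ a, a ≠ S → s'.real a = s.real a := fun a ha => ho.2 a (by
      simp [locateBody, block, Program.WritesReal]; omega)
    have hm : s'.normal X Y = s.normal X Y := by unfold State.normal; rw [er X hXS, er Y hYS]
    have e : ∀ a ∈ [2, 6, 24], s'.int a = s.int a := fun a ha => ho.1 a (by
      simp [locateBody, block, Program.WritesInt]; simp at ha; omega)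
    rw [e 2 (by simp), e 6 (by simp), e 24 (by simp), hm, er C hCS]
    rw [hm, er C hCS] at hL'
    exact ⟨⟨h2, hE, h24, hL'⟩, hμ⟩
  · obtain ⟨⟨h2, hE, h24, hL⟩, hb⟩ := h
    have hlt : ¬ s.int 23 0 < offset x.1.1.1 k := by
      intro hc
      apply hb
      show s.int 23 0 < s.int 24 0
      omega
    exact ⟨h2, hE, fun g hg => hL.slack g (by omega)⟩

end RealRAM

/-! ### Directions of the edges of a polygon over several revolutions -/

namespace ConvexPolygon

variable (P : ConvexPolygon)

theorem edge_add_size (t : ℕ) : P.edge (t + P.size) = P.edge t := by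
  unfold edge; rw [← add_assoc, P.normal_add_size]

theorem edge_mod (t : ℕ) : P.edge (t % P.size) = P.edge t := by
  conv_rhs => rw [← Nat.mod_add_div t P.size]
  generalize t / P.size = z
  induction z with
  | zero => simp
  | succ z ih => rw [Nat.mul_succ, ← add_assoc, edge_add_size]; exact ih

theorem edge_ne_zero (t : ℕ) : P.edge t ≠ 0 := P.normal_ne_zero _

/-- The angle of `P.edge t`, increased by one revolution for each previous round. -/
noncomputable def edgeAngle (t : ℕ) : ℝ :=
  angle (P.edge (t % P.size)) + (t / P.size : ℕ) * (2 * Real.pi)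

theorem hasAngle_edgeAngle (t : ℕ) : HasAngle (P.edge t) (P.edgeAngle t) := by
  have := (hasAngle_angle (P.edge_ne_zero t)).add_int_mul (t / P.size : ℕ)
  unfold edgeAngle
  rw [edge_mod]
  exact_mod_cast this

theorem edgeAngle_add_size (t : ℕ) : P.edgeAngle (t + P.size) = P.edgeAngle t + 2 * Real.pi := by
  unfold edgeAngle
  rw [Nat.add_mod_right, Nat.add_div_right _ P.size_pos]
  push_cast; ring

/-- Within a round the angles are sorted. From one round to the next the angle falls by less than
the `2π` that are added. -/
theorem strictMono_edgeAngle : StrictMono P.edgeAngle := by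
  refine strictMono_nat_of_lt_succ fun t => ?_
  have hlt := Nat.mod_lt t P.size_pos
  have h1 := Nat.div_add_mod t P.size
  by_cases h : t % P.size + 1 < P.size
  · have e : t + 1 = P.size * (t / P.size) + (t % P.size + 1) := by omega
    have e1 : (t + 1) % P.size = t % P.size + 1 := by
      rw [e, Nat.mul_add_mod, Nat.mod_eq_of_lt h]
    have e2 : (t + 1) / P.size = t / P.size := by
      rw [e, Nat.mul_add_div P.size_pos, Nat.div_eq_of_lt h, add_zero]
    unfold edgeAngle
    rw [e1, e2]
    have := P.angle_edge_lt h
    linarith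
  · have e : t + 1 = P.size * (t / P.size + 1) + 0 := by
      rw [Nat.mul_succ]; omega
    have e1 : (t + 1) % P.size = 0 := by rw [e, Nat.mul_add_mod, Nat.zero_mod]
    have e2 : (t + 1) / P.size = t / P.size + 1 := by
      rw [e, Nat.mul_add_div P.size_pos, Nat.zero_div, add_zero]
    unfold edgeAngle
    rw [e1, e2]
    have := angle_le_pi (P.edge (t % P.size))
    have := neg_pi_lt_angle (P.edge 0)
    push_cast
    linarith

end ConvexPolygon

/-! ### Tight constraints -/

/-- The indices `a` and `b` are consecutive zeros of `σ`. -/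
structure IsGap (sz : ℕ) (σ : ℕ → ℝ) (a b : ℕ) : Prop where
  lt : a < b
  le : b ≤ a + sz
  left : σ a = 0
  right : σ b = 0
  ne : ∀ p, a < p → p < b → σ p ≠ 0

/-- The vector `a`, turned left by a right angle. -/
def turn (a : Plane) : Plane := (-a.2, a.1)

theorem HasAngle.turn {a : Plane} {α : ℝ} (h : HasAngle a α) :
    HasAngle (turn a) (α + Real.pi / 2) := by
  obtain ⟨r, hr, rfl⟩ := h
  refine ⟨r, hr, ?_⟩
  rw [Real.cos_add_pi_div_two, Real.sin_add_pi_div_two]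
  simp [_root_.turn]

theorem dot_turn (a b : Plane) : dot b (turn a) = cross a b := by
  unfold dot turn cross; ring

theorem dot_comm (a b : Plane) : dot a b = dot b a := by unfold dot; ring

section
variable {P : ConvexPolygon} {σ : ℕ → ℝ} {a b : ℕ}

/-- A zero of `σ` can be moved by whole periods to an index after `a` and at most one period later.
Since there is no zero inside the gap, it then lies at `b` or beyond. -/
theorem IsGap.exists_lift (h : IsGap P.size σ a b) (hσ : ∀ t, σ (t + P.size) = σ t) {t : ℕ}
    (ht : σ t = 0) : ∃ t', P.edge t' = P.edge t ∧ P.edgeAngle b ≤ P.edgeAngle t' ∧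
      P.edgeAngle t' ≤ P.edgeAngle a + 2 * Real.pi := by
  have hpos := P.size_pos
  have hper : ∀ z t, σ (t + z * P.size) = σ t ∧ P.edge (t + z * P.size) = P.edge t := by
    intro z t
    induction z with
    | zero => simp
    | succ z ih =>
      rw [Nat.succ_mul, ← add_assoc, hσ, P.edge_add_size]; exact ih
  obtain ⟨t', h1, h2, h3⟩ : ∃ t', a < t' ∧ t' ≤ a + P.size ∧ ∃ z z', t' + z * P.size =
      t + z' * P.size := by
    refine ⟨a + 1 + (t + (a + 1) * P.size - (a + 1)) % P.size, by omega, ?_,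
      (t + (a + 1) * P.size - (a + 1)) / P.size, a + 1, ?_⟩
    · have := Nat.mod_lt (t + (a + 1) * P.size - (a + 1)) hpos; omega
    · have h1 := Nat.mod_add_div' (t + (a + 1) * P.size - (a + 1)) P.size
      have h2 : a + 1 ≤ (a + 1) * P.size := Nat.le_mul_of_pos_right _ hpos
      omega
  obtain ⟨z, z', e⟩ := h3
  have hσ' : σ t' = 0 := by rw [← (hper z t').1, e, (hper z' t).1, ht]
  refine ⟨t', by rw [← (hper z t').2, e, (hper z' t).2], ?_, ?_⟩
  · apply P.strictMono_edgeAngle.monotone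
    by_contra hc
    exact h.ne t' h1 (by omega) hσ'
  · rw [← P.edgeAngle_add_size]
    exact P.strictMono_edgeAngle.monotone h2

/-- For the bisector `u` of the gap, all tight normals lie outside the gap and so make with `u` an
angle of at least half the gap on either side. -/
theorem IsGap.exists_dot_eq (h : IsGap P.size σ a b) (hσ : ∀ t, σ (t + P.size) = σ t) {u : Plane}
    (hu : HasAngle u ((P.edgeAngle a + P.edgeAngle b) / 2)) {t : ℕ} (ht : σ t = 0) :
    ∃ r > 0, ∃ φ, dot (P.edge t) u = r * Real.cos φ ∧
      (P.edgeAngle b - P.edgeAngle a) / 2 ≤ φ ∧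
      φ ≤ 2 * Real.pi - (P.edgeAngle b - P.edgeAngle a) / 2 := by
  obtain ⟨t', e, h1, h2⟩ := h.exists_lift hσ ht
  obtain ⟨r, hr, e'⟩ := hu.dot_eq (P.hasAngle_edgeAngle t')
  rw [dot_comm, e] at e'
  exact ⟨r, hr, _, e', by linarith, by linarith⟩

theorem IsGap.dot_nonpos (h : IsGap P.size σ a b) (hσ : ∀ t, σ (t + P.size) = σ t) {u : Plane}
    (hu : HasAngle u ((P.edgeAngle a + P.edgeAngle b) / 2))
    (hgap : P.edgeAngle a + Real.pi ≤ P.edgeAngle b) {t : ℕ} (ht : σ t = 0) :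
    dot (P.edge t) u ≤ 0 := by
  obtain ⟨r, hr, φ, e, h1, h2⟩ := h.exists_dot_eq hσ hu ht
  rw [e]
  exact mul_nonpos_of_nonneg_of_nonpos hr.le
    (Real.cos_nonpos_of_pi_div_two_le_of_le (by linarith) (by linarith))

theorem IsGap.dot_neg (h : IsGap P.size σ a b) (hσ : ∀ t, σ (t + P.size) = σ t) {u : Plane}
    (hu : HasAngle u ((P.edgeAngle a + P.edgeAngle b) / 2))
    (hgap : P.edgeAngle a + Real.pi < P.edgeAngle b) {t : ℕ} (ht : σ t = 0) :
    dot (P.edge t) u < 0 := by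
  obtain ⟨r, hr, φ, e, h1, h2⟩ := h.exists_dot_eq hσ hu ht
  rw [e]
  exact mul_neg_of_pos_of_neg hr
    (Real.cos_neg_of_pi_div_two_lt_of_lt (by linarith) (by linarith))

/-- The size of a gap in terms of the coordinates of the normals. -/
theorem ConvexPolygon.edgeAngle_gap (P : ConvexPolygon) {a b : ℕ} (hab : a < b)
    (hb : b ≤ a + P.size) :
    (0 < cross (P.edge a) (P.edge b) → P.edgeAngle b < P.edgeAngle a + Real.pi) ∧
    (cross (P.edge a) (P.edge b) = 0 → dot (P.edge a) (P.edge b) < 0 →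
      P.edgeAngle b = P.edgeAngle a + Real.pi) ∧
    (¬ 0 < cross (P.edge a) (P.edge b) →
      ¬ (cross (P.edge a) (P.edge b) = 0 ∧ dot (P.edge a) (P.edge b) < 0) →
      P.edgeAngle a + Real.pi < P.edgeAngle b) := by
  have h1 := P.strictMono_edgeAngle hab
  have h2 := P.strictMono_edgeAngle.monotone hb
  rw [P.edgeAngle_add_size] at h2
  have hA := P.hasAngle_edgeAngle a
  have hB := P.hasAngle_edgeAngle b
  have hpi := Real.pi_pos
  obtain ⟨r, hr, e⟩ := hA.dot_eq hB
  -- A full turn, where `b` is the same edge one period later, is excluded because its cross product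
  -- vanishes.
  have key1 : 0 < cross (P.edge a) (P.edge b) → P.edgeAngle b < P.edgeAngle a + Real.pi := by
    intro h
    rcases h2.lt_or_eq with h2 | h2
    · exact hA.lt_of_cross_pos hB h h2
    · exfalso
      have := hA.add_int_mul 1
      rw [Int.cast_one, one_mul, ← h2] at this
      rw [this.cross_eq_zero_of_eq hB] at h
      exact h.false
  -- When the cross product vanishes beyond `π`, the gap is a full turn and the two normals
  -- coincide. The sign of the inner product tells this from a gap of exactly `π`.
  have key2 : P.edgeAngle a + Real.pi < P.edgeAngle b →
      cross (P.edge a) (P.edge b) = 0 → 0 ≤ dot (P.edge a) (P.edge b) := by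
    intro h h0
    rcases h2.lt_or_eq with h2 | h2
    · exact absurd h0 (hA.cross_neg hB h h2).ne
    · rw [e, h2, add_sub_cancel_left, Real.cos_two_pi]; linarith
  refine ⟨key1, fun h0 hd => ?_, fun hc hd => ?_⟩
  · rcases lt_trichotomy (P.edgeAngle b) (P.edgeAngle a + Real.pi) with h | h | h
    · exact absurd h0 (hA.cross_pos hB h1 h).ne'
    · exact h
    · exact absurd hd (not_lt.2 (key2 h h0))
  · rcases lt_trichotomy (P.edgeAngle b) (P.edgeAngle a + Real.pi) with h | h | h
    · exact absurd (hA.cross_pos hB h1 h) hc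
    · exfalso
      rw [h] at hB
      refine hd ⟨hA.cross_eq_zero_of_add_pi hB, ?_⟩
      rw [e, h, add_sub_cancel_left, Real.cos_pi]; linarith
    · exact h

end

/-- The outcome of comparing consecutive tight constraints `f, …, pp`: `ty` is `0` if all gaps are
less than `π`; it is `1` if the one at `ν` equals `π`; it is `2` if there is a larger one. -/
structure Scan (P : ConvexPolygon) (σ : ℕ → ℝ) (f pp pos ty ν : ℕ) : Prop where
  first : σ f = 0
  last : σ pp = 0
  lt : pp < pos
  le : f ≤ pp
  pos_le : pos ≤ f + P.size + 1
  ne : ∀ p, pp < p → p < pos → σ p ≠ 0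
  small : ty = 0 → ∀ φ, P.edgeAngle f ≤ φ → φ < P.edgeAngle pp → ∃ a b, σ a = 0 ∧ σ b = 0 ∧
    P.edgeAngle a ≤ φ ∧ φ < P.edgeAngle b ∧ P.edgeAngle b < P.edgeAngle a + Real.pi
  straight : ty = 1 → ∃ a b, IsGap P.size σ a b ∧ P.edgeAngle b = P.edgeAngle a + Real.pi ∧
    ν = a % P.size
  large : ty = 2 → ∃ a b, IsGap P.size σ a b ∧ P.edgeAngle a + Real.pi < P.edgeAngle b
  le_two : ty ≤ 2

section
variable {P : ConvexPolygon} {σ : ℕ → ℝ} {f pp pos ty ν : ℕ}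

theorem Scan.init (hf : σ f = 0) : Scan P σ f f (f + 1) 0 ν :=
  ⟨hf, hf, by omega, le_rfl, by have := P.size_pos; omega, fun p h h' => by omega,
    fun _ φ h h' => absurd h (not_le.2 h'), fun h => by omega, fun h => by omega, by omega⟩

theorem Scan.skip (h : Scan P σ f pp pos ty ν) (hpos : pos ≤ f + P.size) (hne : σ pos ≠ 0) :
    Scan P σ f pp (pos + 1) ty ν :=
  ⟨h.first, h.last, by have := h.lt; omega, h.le, by omega, fun p hp hp' => by
    by_cases e : p = pos
    · subst e; exact hne
    · exact h.ne p hp (by omega), h.small, h.straight, h.large, h.le_two⟩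

theorem Scan.isGap (h : Scan P σ f pp pos ty ν) (hpos : pos ≤ f + P.size) (h0 : σ pos = 0) :
    IsGap P.size σ pp pos :=
  ⟨h.lt, by have := h.le; omega, h.last, h0, h.ne⟩

theorem Scan.next (h : Scan P σ f pp pos ty ν) (hpos : pos ≤ f + P.size) (h0 : σ pos = 0)
    (hc : 0 < cross (P.edge pp) (P.edge pos)) : Scan P σ f pos (pos + 1) ty ν := by
  have hg := h.isGap hpos h0
  refine ⟨h.first, h0, by omega, by have := h.le; have := h.lt; omega, by omega,
    fun p hp hp' => by omega, fun ht φ h1 h2 => ?_, h.straight, h.large, h.le_two⟩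
  by_cases h3 : φ < P.edgeAngle pp
  · exact h.small ht φ h1 h3
  · exact ⟨pp, pos, h.last, h0, not_lt.1 h3, h2, (P.edgeAngle_gap hg.lt hg.le).1 hc⟩

/-- An earlier type may be overwritten without harm: each of the values `1` and `2` only asserts
that some gap of its kind exists. -/
theorem Scan.next_straight (h : Scan P σ f pp pos ty ν) (hpos : pos ≤ f + P.size) (h0 : σ pos = 0)
    (hc : cross (P.edge pp) (P.edge pos) = 0) (hd : dot (P.edge pp) (P.edge pos) < 0) :
    Scan P σ f pos (pos + 1) 1 (pp % P.size) := by
  have hg := h.isGap hpos h0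
  exact ⟨h.first, h0, by omega, by have := h.le; have := h.lt; omega, by omega,
    fun p hp hp' => by omega, fun ht => by omega,
    fun _ => ⟨pp, pos, hg, (P.edgeAngle_gap hg.lt hg.le).2.1 hc hd, rfl⟩, fun h => by omega,
    by omega⟩

theorem Scan.next_large (h : Scan P σ f pp pos ty ν) (hpos : pos ≤ f + P.size) (h0 : σ pos = 0)
    (hc : ¬ 0 < cross (P.edge pp) (P.edge pos))
    (hd : ¬ (cross (P.edge pp) (P.edge pos) = 0 ∧ dot (P.edge pp) (P.edge pos) < 0)) :
    Scan P σ f pos (pos + 1) 2 ν := by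
  have hg := h.isGap hpos h0
  exact ⟨h.first, h0, by omega, by have := h.le; have := h.lt; omega, by omega,
    fun p hp hp' => by omega, fun ht => by omega, fun h => by omega,
    fun _ => ⟨pp, pos, hg, (P.edgeAngle_gap hg.lt hg.le).2.2 hc hd⟩, by omega⟩

/-- After one full round the first tight edge has been met again, so it is the last one seen. -/
theorem Scan.eq_of_complete (h : Scan P σ f pp (f + P.size + 1) ty ν)
    (hσ : ∀ t, σ (t + P.size) = σ t) : pp = f + P.size := by
  have h1 := h.lt
  by_contra hc
  exact h.ne (f + P.size) (by omega) (by omega) (by rw [hσ]; exact h.first)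

/-- The direction of `u` falls into one of the gaps. Since that gap is less than `π`, one of its two
ends is within a right angle of `u`. -/
theorem Scan.exists_dot_pos (h : Scan P σ f pp (f + P.size + 1) 0 ν)
    (hσ : ∀ t, σ (t + P.size) = σ t) {u : Plane} (hu : u ≠ 0) :
    ∃ t, σ t = 0 ∧ 0 < dot (P.edge t) u := by
  have hpp := h.eq_of_complete hσ
  have hpi := Real.pi_pos
  obtain ⟨z, hz, -⟩ := existsUnique_add_zsmul_mem_Ico (a := 2 * Real.pi) (by linarith)
    (angle u) (P.edgeAngle f)
  rw [zsmul_eq_mul] at hz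
  have hU := (hasAngle_angle hu).add_int_mul z
  obtain ⟨a, b, ha, hb, h1, h2, h3⟩ := h.small rfl _ hz.1 (by
    rw [hpp, P.edgeAngle_add_size]; exact hz.2)
  set φ := angle u + z * (2 * Real.pi)
  by_cases hc : φ < P.edgeAngle a + Real.pi / 2
  · obtain ⟨r, hr, e⟩ := (P.hasAngle_edgeAngle a).dot_eq hU
    refine ⟨a, ha, ?_⟩
    rw [e]
    exact mul_pos hr (Real.cos_pos_of_mem_Ioo ⟨by linarith, by linarith⟩)
  · obtain ⟨r, hr, e⟩ := (P.hasAngle_edgeAngle b).dot_eq hU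
    refine ⟨b, hb, ?_⟩
    rw [e]
    exact mul_pos hr (Real.cos_pos_of_mem_Ioo ⟨by linarith, by linarith⟩)

end

/-! ### Irredundant descriptions of the Minkowski differences -/

/-- The vector `y` satisfies the `g`-th constraint; it is an equation for `n ≤ g`. -/
def KeyHolds (m : ℕ → Plane) (S : ℕ → ℝ) (n g : ℕ) (y : Plane) : Prop :=
  (g < n → dot (m g) y ≤ S g) ∧ (n ≤ g → dot (m g) y = 0)

/-- The indices of the inequalities and the equations for one of the polygons. -/
def IsKey (lo hi e g : ℕ) : Prop := (lo ≤ g ∧ g < hi) ∨ g = e ∨ g = e + 1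

/-- The set described by the constraints with indices from `lo` to `hi`. -/
def localSet (m : ℕ → Plane) (S : ℕ → ℝ) (lo hi : ℕ) : Set Plane :=
  {y | ∀ g, lo ≤ g → g < hi → dot (m g) y ≤ S g}

/-- The constraints that are kept are an irredundant description of `localSet m S lo hi`, and this
set is not contained in a line unless one of the equations says so. -/
structure LocalSystem (m : ℕ → Plane) (S : ℕ → ℝ) (n lo hi e : ℕ) (keep : ℕ → Prop) : Prop where
  sound : ∀ y, y ∈ localSet m S lo hi ↔ ∀ g, IsKey lo hi e g → keep g → KeyHolds m S n g y
  irredundant : ∀ g, IsKey lo hi e g → keep g → ∃ y, ¬ KeyHolds m S n g y ∧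
    ∀ g', IsKey lo hi e g' → keep g' → g' ≠ g → KeyHolds m S n g' y
  wide : ∀ u, (∀ g, IsKey lo hi e g → keep g → n ≤ g → dot (m g) u = 0) →
    ∃ y ∈ localSet m S lo hi, ∃ t : ℝ, 0 < t ∧ y + t • u ∈ localSet m S lo hi

section
variable {m : ℕ → Plane} {S : ℕ → ℝ} {n lo hi e : ℕ} {keep : ℕ → Prop}

theorem KeyHolds.of_lt {g : ℕ} {y : Plane} (hg : g < n) (h : dot (m g) y ≤ S g) :
    KeyHolds m S n g y := ⟨fun _ => h, fun h => by omega⟩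

theorem KeyHolds.of_le {g : ℕ} {y : Plane} (hg : n ≤ g) (h : dot (m g) y = 0) :
    KeyHolds m S n g y := ⟨fun h => by omega, fun _ => h⟩

theorem dot_zero (a : Plane) : dot a 0 = 0 := by simp [dot]

theorem LocalSystem.congr {m' : ℕ → Plane} {S' : ℕ → ℝ} {keep' : ℕ → Prop}
    (h : LocalSystem m S n lo hi e keep)
    (heq : ∀ g, IsKey lo hi e g → m' g = m g ∧ S' g = S g ∧ (keep' g ↔ keep g)) :
    LocalSystem m' S' n lo hi e keep' := by
  have hk : ∀ g y, IsKey lo hi e g → (KeyHolds m' S' n g y ↔ KeyHolds m S n g y) := by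
    intro g y hg
    unfold KeyHolds
    rw [(heq g hg).1, (heq g hg).2.1]
  have hF : localSet m' S' lo hi = localSet m S lo hi := by
    ext y
    unfold localSet
    refine forall_congr' fun g => forall₂_congr fun h1 h2 => ?_
    rw [(heq g (.inl ⟨h1, h2⟩)).1, (heq g (.inl ⟨h1, h2⟩)).2.1]
  refine ⟨fun y => ?_, fun g hg hkg => ?_, fun u hu => ?_⟩
  · rw [hF, h.sound]
    refine forall₂_congr fun g hg => ?_
    rw [(heq g hg).2.2, hk g y hg]
  · obtain ⟨y, h1, h2⟩ := h.irredundant g hg ((heq g hg).2.2.1 hkg)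
    exact ⟨y, by rwa [hk g y hg], fun g' hg' hk' hne =>
      (hk g' y hg').2 (h2 g' hg' ((heq g' hg').2.2.1 hk') hne)⟩
  · rw [hF]
    refine h.wide u fun g hg hkg hn => ?_
    rw [← (heq g hg).1]
    exact hu g hg ((heq g hg).2.2.2 hkg) hn

/-- The tight normals positively span the plane, so `0` is the only solution. The two coordinate
equations replace all inequalities, and each of them can be violated alone. -/
theorem localSystem_point (he : n ≤ e) (hS : ∀ g, lo ≤ g → g < hi → 0 ≤ S g)
    (htight : ∀ u : Plane, u ≠ 0 → ∃ g, lo ≤ g ∧ g < hi ∧ S g = 0 ∧ 0 < dot (m g) u)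
    (h1 : m e = (1, 0)) (h2 : m (e + 1) = (0, 1)) (hk : ∀ g, lo ≤ g → g < hi → ¬ keep g)
    (hk1 : keep e) (hk2 : keep (e + 1)) : LocalSystem m S n lo hi e keep := by
  have h0 : (0 : Plane) ∈ localSet m S lo hi := fun g hg hg' => by
    rw [dot_zero]; exact hS g hg hg'
  have d1 : ∀ y, dot (m e) y = y.1 := fun y => by rw [h1]; simp [dot]
  have d2 : ∀ y, dot (m (e + 1)) y = y.2 := fun y => by rw [h2]; simp [dot]
  refine ⟨fun y => ⟨fun hy => ?_, fun hy => ?_⟩, ?_, fun u hu => ?_⟩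
  · have : y = 0 := by
      by_contra hne
      obtain ⟨g, hg, hg', h3, h4⟩ := htight y hne
      exact absurd (hy g hg hg') (by rw [h3]; exact not_le.2 h4)
    subst this
    rintro g (⟨h3, h4⟩ | rfl | rfl) hkg
    · exact absurd hkg (hk g h3 h4)
    · exact .of_le he (dot_zero _)
    · exact .of_le (by omega) (dot_zero _)
  · have e1 := (hy e (.inr (.inl rfl)) hk1).2 he
    have e2 := (hy (e + 1) (.inr (.inr rfl)) hk2).2 (by omega)
    rw [d1] at e1
    rw [d2] at e2
    have : y = 0 := Prod.ext e1 e2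
    rw [this]; exact h0
  · rintro g (⟨h3, h4⟩ | rfl | rfl) hkg
    · exact absurd hkg (hk g h3 h4)
    · refine ⟨(1, 0), fun h => ?_, ?_⟩
      · have := h.2 he
        rw [d1] at this; norm_num at this
      · rintro g' (⟨h3, h4⟩ | rfl | rfl) hkg' hne
        · exact absurd hkg' (hk g' h3 h4)
        · exact absurd rfl hne
        · exact .of_le (by omega) (by rw [d2])
    · refine ⟨(0, 1), fun h => ?_, ?_⟩
      · have := h.2 (by omega)
        rw [d2] at this; norm_num at this
      · rintro g' (⟨h3, h4⟩ | rfl | rfl) hkg' hne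
        · exact absurd hkg' (hk g' h3 h4)
        · exact .of_le (by omega) (by rw [d1])
        · exact absurd rfl hne
  · have e1 := hu e (.inr (.inl rfl)) hk1 he
    have e2 := hu (e + 1) (.inr (.inr rfl)) hk2 (by omega)
    rw [d1] at e1
    rw [d2] at e2
    have : u = 0 := Prod.ext e1 e2
    exact ⟨0, h0, 1, one_pos, by rw [this, smul_zero, add_zero]; exact h0⟩

theorem exists_pos_of_eventually {p : ℝ → Prop} (h : ∀ᶠ ε in nhds (0 : ℝ), p ε) :
    ∃ ε, 0 < ε ∧ p ε := by
  have h' := h.filter_mono (nhdsWithin_le_nhds (s := Set.Ioi 0))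
  obtain ⟨ε, hε, hpos⟩ := (h'.and self_mem_nhdsWithin).exists
  exact ⟨ε, hpos, hε⟩

theorem eventually_dot_add_smul_lt (a x u : Plane) {c : ℝ} (h : dot a x < c) :
    ∀ᶠ ε in nhds (0 : ℝ), dot a (x + ε • u) < c := by
  have hcont : Continuous fun ε : ℝ => dot a (x + ε • u) := by unfold dot; fun_prop
  apply hcont.continuousAt.eventually_lt continuousAt_const
  simpa using h

/-- The essential sides imply the others, and each of them can be violated alone. The interior point
`o` allows a small move in every direction. -/
theorem localSystem_polygon (hhi : hi ≤ n) {o : Plane}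
    (ho : ∀ g, lo ≤ g → g < hi → dot (m g) o < S g) {B : ℕ → ℕ} {lo' hi' : ℕ} {τ : ℕ → ℝ}
    (hτ : CyclicOrder m B lo' hi' τ) (hs : ∀ p, lo' ≤ p → p < hi' → StrictAt m S B lo' hi' p)
    (himp : ∀ q, (∀ p, lo' ≤ p → p < hi' → dot (m (B p)) q ≤ S (B p)) → q ∈ localSet m S lo hi)
    (hB : ∀ p, lo' ≤ p → p < hi' → lo ≤ B p ∧ B p < hi)
    (hk : ∀ g, lo ≤ g → g < hi → (keep g ↔ ∃ p, lo' ≤ p ∧ p < hi' ∧ B p = g))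
    (hk1 : ¬ keep e) (hk2 : ¬ keep (e + 1)) : LocalSystem m S n lo hi e keep := by
  have hkey : ∀ g, IsKey lo hi e g → keep g → ∃ p, lo' ≤ p ∧ p < hi' ∧ B p = g := by
    rintro g (⟨h3, h4⟩ | rfl | rfl) hkg
    · exact (hk g h3 h4).1 hkg
    · exact absurd hkg hk1
    · exact absurd hkg hk2
  refine ⟨fun y => ⟨fun hy g hg hkg => ?_, fun hy => himp y fun p hp hp' => ?_⟩,
    fun g hg hkg => ?_, fun u _ => ?_⟩
  · obtain ⟨p, hp, hp', rfl⟩ := hkey g hg hkg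
    obtain ⟨h1, h2⟩ := hB p hp hp'
    exact .of_lt (by omega) (hy _ h1 h2)
  · obtain ⟨h1, h2⟩ := hB p hp hp'
    exact (hy (B p) (.inl ⟨h1, h2⟩) ((hk _ h1 h2).2 ⟨p, hp, hp', rfl⟩)).1 (by omega)
  · obtain ⟨p, hp, hp', rfl⟩ := hkey g hg hkg
    obtain ⟨h1, h2⟩ := hB p hp hp'
    obtain ⟨q, hq1, hq2⟩ := hτ.exists_only_violated hs p hp hp'
    refine ⟨q, fun h => absurd (h.1 (by omega)) (not_le.2 hq1), fun g' hg' hkg' hne => ?_⟩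
    obtain ⟨p', hp1, hp1', rfl⟩ := hkey g' hg' hkg'
    obtain ⟨h3, h4⟩ := hB p' hp1 hp1'
    exact .of_lt (by omega) (hq2 p' hp1 hp1' fun e => hne (by rw [e]))
  · have hev : ∀ᶠ ε in nhds (0 : ℝ), ∀ g ∈ Finset.Ico lo hi, dot (m g) (o + ε • u) < S g := by
      rw [Filter.eventually_all_finset]
      intro g hg
      rw [Finset.mem_Ico] at hg
      exact eventually_dot_add_smul_lt _ _ _ (ho g hg.1 hg.2)
    obtain ⟨ε, hpos, hε⟩ := exists_pos_of_eventually hev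
    exact ⟨o, fun g h1 h2 => (ho g h1 h2).le, ε, hpos,
      fun g h1 h2 => (hε g (Finset.mem_Ico.2 ⟨h1, h2⟩)).le⟩

theorem exists_smul_turn {a y : Plane} (ha : a ≠ 0) (h : dot a y = 0) :
    ∃ t : ℝ, y = t • turn a := by
  have hpos := dot_self_pos ha
  refine ⟨cross a y / dot a a, ?_⟩
  unfold dot at *
  ext
  · simp only [turn, Prod.smul_mk, smul_eq_mul, cross]
    rw [div_mul_eq_mul_div, eq_div_iff hpos.ne']
    linear_combination a.1 * h
  · simp only [turn, Prod.smul_mk, smul_eq_mul, cross]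
    rw [div_mul_eq_mul_div, eq_div_iff hpos.ne']
    linear_combination a.2 * h

/-- Two opposite tight half-planes confine the set to the line through `0` orthogonal to `m a`. At
the point `t • turn (m a)` the constraint `g` reads `t * cross (m a) (m g) ≤ S g`. So `p` gives the
least upper bound for `t` and `q` the greatest lower bound, and constraints with normals parallel to
`m a` say nothing more. The point with parameter `t₀` shows that the segment does not shrink to a
point. -/
theorem localSystem_segment (hhi : hi ≤ n) (he : n ≤ e) (hS : ∀ g, lo ≤ g → g < hi → 0 ≤ S g)
    {a b p q : ℕ} (ha : lo ≤ a ∧ a < hi) (hb : lo ≤ b ∧ b < hi) (hp : lo ≤ p ∧ p < hi)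
    (hq : lo ≤ q ∧ q < hi) (ha0 : m a ≠ 0) (hSa : S a = 0) (hSb : S b = 0) {r : ℝ} (hr : 0 < r)
    (hab : m b = -(r • m a)) (hcp : 0 < cross (m a) (m p)) (hcq : cross (m a) (m q) < 0)
    (hminp : ∀ g, lo ≤ g → g < hi → 0 < cross (m a) (m g) →
      S p / cross (m a) (m p) ≤ S g / cross (m a) (m g))
    (hminq : ∀ g, lo ≤ g → g < hi → cross (m a) (m g) < 0 →
      S g / cross (m a) (m g) ≤ S q / cross (m a) (m q))
    {t₀ : ℝ} (ht₀ : 0 < t₀) (ht : t₀ • turn (m a) ∈ localSet m S lo hi) (h1 : m e = m a)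
    (hk : ∀ g, lo ≤ g → g < hi → (keep g ↔ g = p ∨ g = q)) (hk1 : keep e)
    (hk2 : ¬ keep (e + 1)) : LocalSystem m S n lo hi e keep := by
  have hsp := hS p hp.1 hp.2
  have hsq := hS q hq.1 hq.2
  have hdot : ∀ g (t : ℝ), dot (m g) (t • turn (m a)) = t * cross (m a) (m g) := fun g t => by
    rw [dot_smul, dot_turn]
  have hself : cross (m a) (m a) = 0 := by unfold cross; ring
  have h0 : (0 : Plane) ∈ localSet m S lo hi := fun g hg hg' => by
    rw [dot_zero]; exact hS g hg hg'
  have hline : ∀ y ∈ localSet m S lo hi, dot (m a) y = 0 := by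
    intro y hy
    have h2 := hy a ha.1 ha.2
    have h3 := hy b hb.1 hb.2
    have h4 : dot (m b) y = -(r * dot (m a) y) := by
      rw [hab]; unfold dot; simp only [Prod.fst_neg, Prod.snd_neg, Prod.smul_fst, Prod.smul_snd,
        smul_eq_mul]; ring
    rw [hSa] at h2
    rw [h4, hSb] at h3
    nlinarith
  have hkey : ∀ g, IsKey lo hi e g → keep g → g = p ∨ g = q ∨ g = e := by
    rintro g (⟨h3, h4⟩ | rfl | rfl) hkg
    · exact ((hk g h3 h4).1 hkg).imp id Or.inl
    · exact .inr (.inr rfl)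
    · exact absurd hkg hk2
  have hpq : p ≠ q := by rintro rfl; linarith
  refine ⟨fun y => ⟨fun hy g hg hkg => ?_, fun hy => ?_⟩, fun g hg hkg => ?_, fun u hu => ?_⟩
  · rcases hkey g hg hkg with rfl | rfl | rfl
    · exact .of_lt (by omega) (hy _ hp.1 hp.2)
    · exact .of_lt (by omega) (hy _ hq.1 hq.2)
    · exact .of_le he (by rw [h1]; exact hline y hy)
  · have e1 := (hy e (.inr (.inl rfl)) hk1).2 he
    rw [h1] at e1
    obtain ⟨t, rfl⟩ := exists_smul_turn ha0 e1
    have e2 := (hy p (.inl hp) ((hk p hp.1 hp.2).2 (.inl rfl))).1 (by omega)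
    have e3 := (hy q (.inl hq) ((hk q hq.1 hq.2).2 (.inr rfl))).1 (by omega)
    rw [hdot] at e2 e3
    intro g hg hg'
    rw [hdot]
    rcases lt_trichotomy (cross (m a) (m g)) 0 with hc | hc | hc
    · have h3 := hminq g hg hg' hc
      have h4 : S q / cross (m a) (m q) ≤ t := by rwa [div_le_iff_of_neg hcq]
      exact (div_le_iff_of_neg hc).1 (h3.trans h4)
    · rw [hc, mul_zero]; exact hS g hg hg'
    · have h3 := hminp g hg hg' hc
      have h4 : t ≤ S p / cross (m a) (m p) := by rwa [le_div_iff₀ hcp]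
      exact (le_div_iff₀ hc).1 (h4.trans h3)
  · rcases hkey g hg hkg with rfl | rfl | rfl
    -- To violate one end alone, go one unit beyond it on the line. The other end stays satisfied,
    -- because `0` lies between the two bounds.
    · have hpos : 0 ≤ S g / cross (m a) (m g) := div_nonneg hsp hcp.le
      have hT : S g < (S g / cross (m a) (m g) + 1) * cross (m a) (m g) := by
        rw [add_mul, div_mul_cancel₀ _ hcp.ne']; linarith
      refine ⟨(S g / cross (m a) (m g) + 1) • turn (m a), fun h => ?_, fun g' hg' hkg' hne => ?_⟩
      · have := h.1 (by omega)
        rw [hdot] at this; linarith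
      · rcases hkey g' hg' hkg' with rfl | rfl | rfl
        · exact absurd rfl hne
        · refine .of_lt (by omega) ?_
          rw [hdot]; nlinarith
        · refine .of_le he ?_
          rw [h1, hdot, hself, mul_zero]
    · have hneg : S g / cross (m a) (m g) ≤ 0 := div_nonpos_of_nonneg_of_nonpos hsq hcq.le
      have hT : S g < (S g / cross (m a) (m g) - 1) * cross (m a) (m g) := by
        rw [sub_mul, div_mul_cancel₀ _ hcq.ne]; linarith
      refine ⟨(S g / cross (m a) (m g) - 1) • turn (m a), fun h => ?_, fun g' hg' hkg' hne => ?_⟩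
      · have := h.1 (by omega)
        rw [hdot] at this; linarith
      · rcases hkey g' hg' hkg' with rfl | rfl | rfl
        · refine .of_lt (by omega) ?_
          rw [hdot]; nlinarith
        · exact absurd rfl hne
        · refine .of_le he ?_
          rw [h1, hdot, hself, mul_zero]
    -- At half of `t₀` both end constraints are slack, so a small step off the line along `m a`
    -- violates only the equation.
    · have h3 := ht p hp.1 hp.2
      rw [hdot] at h3
      have h4 : dot (m p) ((t₀ / 2) • turn (m a)) < S p := by
        rw [hdot]; nlinarith [mul_pos ht₀ hcp]
      have h5 : dot (m q) ((t₀ / 2) • turn (m a)) < S q := by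
        rw [hdot]; nlinarith [mul_pos ht₀ (neg_pos.2 hcq)]
      obtain ⟨ε, hpos, h6, h7⟩ := exists_pos_of_eventually
        ((eventually_dot_add_smul_lt _ _ (m a) h4).and (eventually_dot_add_smul_lt _ _ (m a) h5))
      refine ⟨(t₀ / 2) • turn (m a) + ε • m a, fun h => ?_, fun g' hg' hkg' hne => ?_⟩
      · have := h.2 he
        rw [h1, dot_add, hdot, hself, mul_zero, zero_add, dot_smul] at this
        have := mul_pos hpos (dot_self_pos ha0)
        linarith
      · rcases hkey g' hg' hkg' with rfl | rfl | rfl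
        · exact .of_lt (by omega) h6.le
        · exact .of_lt (by omega) h7.le
        · exact absurd rfl hne
  · have e1 := hu e (.inr (.inl rfl)) hk1 he
    rw [h1] at e1
    obtain ⟨t, rfl⟩ := exists_smul_turn ha0 e1
    rcases lt_trichotomy t 0 with h | rfl | h
    · refine ⟨_, ht, t₀ / (-t), div_pos ht₀ (neg_pos.2 h), ?_⟩
      rw [smul_smul, ← add_smul, show t₀ + t₀ / (-t) * t = 0 by field_simp [h.ne]; ring, zero_smul]
      exact h0
    · exact ⟨0, h0, 1, one_pos, by simpa using h0⟩
    · refine ⟨0, h0, t₀ / t, div_pos ht₀ h, ?_⟩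
      rw [smul_smul, zero_add, div_mul_cancel₀ _ h.ne']
      exact ht

/-- A direction that does not leave the tight constraints stays in the set for a while. -/
theorem exists_smul_mem_localSet (hS : ∀ g, lo ≤ g → g < hi → 0 ≤ S g) {u : Plane}
    (hu : ∀ g, lo ≤ g → g < hi → S g = 0 → dot (m g) u ≤ 0) :
    ∃ t : ℝ, 0 < t ∧ t • u ∈ localSet m S lo hi := by
  have hev : ∀ᶠ ε in nhds (0 : ℝ), ∀ g ∈ (Finset.Ico lo hi).filter fun g => S g ≠ 0,
      dot (m g) (0 + ε • u) < S g := by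
    rw [Filter.eventually_all_finset]
    intro g hg
    rw [Finset.mem_filter, Finset.mem_Ico] at hg
    apply eventually_dot_add_smul_lt
    rw [dot_zero]
    exact lt_of_le_of_ne (hS g hg.1.1 hg.1.2) (Ne.symm hg.2)
  obtain ⟨ε, hpos, hε⟩ := exists_pos_of_eventually hev
  refine ⟨ε, hpos, fun g h1 h2 => ?_⟩
  by_cases h3 : S g = 0
  · rw [dot_smul, h3]; exact mul_nonpos_of_nonneg_of_nonpos hpos.le (hu g h1 h2 h3)
  · have := hε g (Finset.mem_filter.2 ⟨Finset.mem_Ico.2 ⟨h1, h2⟩, h3⟩)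
    rw [zero_add] at this
    exact this.le

/-- Take a short step from `0` along `u`: the tight constraints become strict because `u` points
inwards, and the others stay strict by continuity. -/
theorem exists_strict_of_dot_neg (hS : ∀ g, lo ≤ g → g < hi → 0 ≤ S g) {u : Plane}
    (hu : ∀ g, lo ≤ g → g < hi → S g = 0 → dot (m g) u < 0) :
    ∃ o : Plane, ∀ g, lo ≤ g → g < hi → dot (m g) o < S g := by
  have hev : ∀ᶠ ε in nhds (0 : ℝ), ∀ g ∈ (Finset.Ico lo hi).filter fun g => S g ≠ 0,
      dot (m g) (0 + ε • u) < S g := by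
    rw [Filter.eventually_all_finset]
    intro g hg
    rw [Finset.mem_filter, Finset.mem_Ico] at hg
    apply eventually_dot_add_smul_lt
    rw [dot_zero]
    exact lt_of_le_of_ne (hS g hg.1.1 hg.1.2) (Ne.symm hg.2)
  obtain ⟨ε, hpos, hε⟩ := exists_pos_of_eventually hev
  refine ⟨ε • u, fun g h1 h2 => ?_⟩
  by_cases h3 : S g = 0
  · rw [dot_smul, h3]; exact mul_neg_of_pos_of_neg hpos (hu g h1 h2 h3)
  · have := hε g (Finset.mem_filter.2 ⟨Finset.mem_Ico.2 ⟨h1, h2⟩, h3⟩)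
    rwa [zero_add] at this

end

theorem succ_mod_eq_ite {n : ℕ} (hn : 0 < n) (t : ℕ) :
    (t + 1) % n = if t % n + 1 = n then 0 else t % n + 1 := by
  have h1 := Nat.div_add_mod t n
  have h2 := Nat.mod_lt t hn
  conv_lhs => rw [← h1, add_assoc, Nat.mul_add_mod]
  split_ifs with h
  · rw [h, Nat.mod_self]
  · exact Nat.mod_eq_of_lt (by omega)

/-- The outcome of the analysis of the tight constraints: `ty` is the dimension of the set. -/
def Classified (m : ℕ → Plane) (S : ℕ → ℝ) (lo hi ty ν : ℕ) : Prop :=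
  (ty = 0 ∧ ∀ u : Plane, u ≠ 0 → ∃ g, lo ≤ g ∧ g < hi ∧ S g = 0 ∧ 0 < dot (m g) u) ∨
  (ty = 1 ∧ (lo ≤ ν ∧ ν < hi) ∧ S ν = 0 ∧
    (∃ b, (lo ≤ b ∧ b < hi) ∧ S b = 0 ∧ ∃ r : ℝ, 0 < r ∧ m b = -(r • m ν)) ∧
    ∀ g, lo ≤ g → g < hi → S g = 0 → dot (m g) (turn (m ν)) ≤ 0) ∨
  (ty = 2 ∧ ∃ o : Plane, ∀ g, lo ≤ g → g < hi → dot (m g) o < S g)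

/-- For a gap of `π` the bisector is `turn (m ν)`, a direction that no tight constraint forbids, and
the two ends of the gap have opposite normals. For a larger gap the bisector points strictly
inwards. If all gaps are smaller, the tight normals meet every open half-plane of directions. -/
theorem Scan.classified {P : ConvexPolygon} {m : ℕ → Plane} {S : ℕ → ℝ} {lo f pp ty ν : ℕ}
    (hm : ∀ t, m (lo + t % P.size) = P.edge t)
    (h : Scan P (fun t => S (lo + t % P.size)) f pp (f + P.size + 1) ty ν)
    (hS : ∀ g, lo ≤ g → g < lo + P.size → 0 ≤ S g) :
    Classified m S lo (lo + P.size) ty (lo + ν) := by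
  have hmod : ∀ t, lo ≤ lo + t % P.size ∧ lo + t % P.size < lo + P.size := fun t =>
    ⟨by omega, by have := Nat.mod_lt t P.size_pos; omega⟩
  have hσ : ∀ t, S (lo + (t + P.size) % P.size) = S (lo + t % P.size) := fun t => by
    rw [Nat.add_mod_right]
  have hg : ∀ g, lo ≤ g → g < lo + P.size → ∃ t, g = lo + t % P.size := fun g h1 h2 =>
    ⟨g - lo, by rw [Nat.mod_eq_of_lt (by omega)]; omega⟩
  have h2 := h.le_two
  obtain rfl | rfl | rfl : ty = 0 ∨ ty = 1 ∨ ty = 2 := by omega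
  · refine .inl ⟨rfl, fun u hu => ?_⟩
    obtain ⟨t, h3, h4⟩ := h.exists_dot_pos hσ hu
    exact ⟨_, (hmod t).1, (hmod t).2, h3, by rwa [hm]⟩
  · obtain ⟨a, b, hgap, hang, rfl⟩ := h.straight rfl
    have hA := P.hasAngle_edgeAngle a
    have hB := P.hasAngle_edgeAngle b
    refine .inr (.inl ⟨rfl, hmod a, hgap.left, ⟨_, hmod b, hgap.right, ?_⟩, fun g h1 h3 h4 => ?_⟩)
    · rw [hm, hm]
      rw [hang] at hB
      obtain ⟨r, hr, e⟩ := hA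
      obtain ⟨r', hr', e'⟩ := hB
      refine ⟨r' / r, div_pos hr' hr, ?_⟩
      rw [e, e', Real.cos_add_pi, Real.sin_add_pi]
      ext
      · simp only [Prod.fst_neg, Prod.smul_mk, smul_eq_mul]; field_simp
      · simp only [Prod.snd_neg, Prod.smul_mk, smul_eq_mul]; field_simp
    · obtain ⟨t, rfl⟩ := hg g h1 h3
      rw [hm, hm]
      refine hgap.dot_nonpos hσ ?_ hang.ge h4
      have := hA.turn
      rwa [show (P.edgeAngle a + P.edgeAngle b) / 2 = P.edgeAngle a + Real.pi / 2 by
        rw [hang]; ring]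
  · obtain ⟨a, b, hgap, hang⟩ := h.large rfl
    refine .inr (.inr ⟨rfl, ?_⟩)
    have hU : HasAngle (Real.cos ((P.edgeAngle a + P.edgeAngle b) / 2),
        Real.sin ((P.edgeAngle a + P.edgeAngle b) / 2)) ((P.edgeAngle a + P.edgeAngle b) / 2) :=
      ⟨1, one_pos, by simp⟩
    refine exists_strict_of_dot_neg hS (u := (Real.cos ((P.edgeAngle a + P.edgeAngle b) / 2),
      Real.sin ((P.edgeAngle a + P.edgeAngle b) / 2))) fun g h1 h3 h4 => ?_
    obtain ⟨t, rfl⟩ := hg g h1 h3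
    rw [hm]
    exact hgap.dot_neg hσ hU hang h4

namespace RealRAM

/-- Variable `29` runs once around the edges of the polygon, `28` is the last tight edge met and
`38` counts the steps. The type goes to `34` and the edge before a straight gap to `35`. -/
def scanBody (X Y S : ℕ) : Program := block [
  .cond (.intEq (.add (ivar 29) (.lit 1)) (ivar 33)) (setVar 29 (ivar 32))
    (setVar 29 (.add (ivar 29) (.lit 1))),
  .cond (.realEq (.cell S (ivar 29)) (.lit 0))
    (.seq (.cond (.realLt (.lit 0) (crossExpr X Y (ivar 28) (ivar 29))) .skip
      (.cond (.and (.realEq (crossExpr X Y (ivar 28) (ivar 29)) (.lit 0))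
        (.realLt (dotExpr X Y (ivar 28) (ivar 29)) (.lit 0)))
        (block [setVar 34 (.lit 1), setVar 35 (ivar 28)]) (setVar 34 (.lit 2))))
      (setVar 28 (ivar 29))) .skip,
  incr 38]

/-- The variables of the loop with body `scanBody`. -/
structure ScanState (P : ConvexPolygon) (S lo f c : ℕ) (s : State) : Prop where
  count : s.int 38 0 = c
  current : s.int 29 0 = lo + (f + c) % P.size
  scan : ∃ pp ν, s.int 28 0 = lo + pp % P.size ∧ (s.int 34 0 = 1 → s.int 35 0 = lo + ν) ∧
    Scan P (fun t => s.real S (lo + t % P.size)) f pp (f + c + 1) (s.int 34 0) ν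

theorem scanBody_wp {P : ConvexPolygon} {X Y S lo f c : ℕ} {s : State}
    (hm : ∀ t, s.normal X Y (lo + t % P.size) = P.edge t) (h32 : s.int 32 0 = lo)
    (h33 : s.int 33 0 = lo + P.size) (h : ScanState P S lo f c s) (hc : c < P.size) :
    (scanBody X Y S).wp (fun s' => ScanState P S lo f (c + 1) s' ∧ s'.int 38 0 = c + 1) s := by
  obtain ⟨pp, ν, h28, h35, hS⟩ := h.scan
  have hpos : f + c + 1 ≤ f + P.size := by omega
  have main : ∀ j, j = lo + (f + c + 1) % P.size →
      (block [.cond (.realEq (.cell S (ivar 29)) (.lit 0))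
        (.seq (.cond (.realLt (.lit 0) (crossExpr X Y (ivar 28) (ivar 29))) .skip
          (.cond (.and (.realEq (crossExpr X Y (ivar 28) (ivar 29)) (.lit 0))
            (.realLt (dotExpr X Y (ivar 28) (ivar 29)) (.lit 0)))
            (block [setVar 34 (.lit 1), setVar 35 (ivar 28)]) (setVar 34 (.lit 2))))
          (setVar 28 (ivar 29))) .skip, incr 38]).wp
      (fun s' => ScanState P S lo f (c + 1) s' ∧ s'.int 38 0 = c + 1) (s.writeInt 29 0 j) := by
    rintro j rfl
    set s₁ := s.writeInt 29 0 (lo + (f + c + 1) % P.size) with hs₁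
    have e28 : s₁.int 28 0 = lo + pp % P.size := h28
    have e29 : s₁.int 29 0 = lo + (f + c + 1) % P.size := by
      rw [hs₁, State.writeInt_int_self, Function.update_self]
    have t1 : (Test.realEq (.cell S (ivar 29)) (.lit 0)).Holds s₁ ↔
        s.real S (lo + (f + c + 1) % P.size) = 0 := by
      simp only [Test.Holds, RealExpr.eval, IntExpr.eval, e29, Rat.cast_zero]; rfl
    have hm' : ∀ t, s₁.normal X Y (lo + t % P.size) = P.edge t := hm
    have t2 : (Test.realLt (.lit 0) (crossExpr X Y (ivar 28) (ivar 29))).Holds s₁ ↔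
        0 < cross (P.edge pp) (P.edge (f + c + 1)) := by
      simp only [Test.Holds, eval_crossExpr, RealExpr.eval, IntExpr.eval, e28, e29, hm',
        Rat.cast_zero]
    have t3 : (Test.and (.realEq (crossExpr X Y (ivar 28) (ivar 29)) (.lit 0))
        (.realLt (dotExpr X Y (ivar 28) (ivar 29)) (.lit 0))).Holds s₁ ↔
        cross (P.edge pp) (P.edge (f + c + 1)) = 0 ∧
          dot (P.edge pp) (P.edge (f + c + 1)) < 0 := by
      simp only [Test.Holds, eval_crossExpr, eval_dotExpr, RealExpr.eval, IntExpr.eval, e28, e29,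
        hm', Rat.cast_zero]
    refine ⟨fun ht => ⟨fun ht1 => ?_, fun ht1 => ⟨fun ht2 => ?_, fun ht2 => ?_⟩⟩, fun ht => ?_⟩
    all_goals
      rw [t1] at ht
      try rw [t2] at ht1
      try rw [t3] at ht2
      simp only [hs₁, block, Program.wp, IntExpr.eval, State.writeInt_int_self,
        State.writeInt_int_of_ne, ne_eq, not_false_eq_true, Nat.reduceEqDiff, Function.update_self]
      refine ⟨⟨?_, ?_, ?_⟩, ?_⟩ <;>
        simp only [State.writeInt_int_self, State.writeInt_int_of_ne, State.writeInt_real, ne_eq,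
          not_false_eq_true, Nat.reduceEqDiff, Function.update_self, h.count, add_assoc]
      try simp only [← add_assoc]
    · exact ⟨_, ν, rfl, h35, hS.next hpos ht ht1⟩
    · exact ⟨_, pp % P.size, rfl, fun _ => h28, hS.next_straight hpos ht ht2.1 ht2.2⟩
    · exact ⟨_, ν, rfl, fun h => by simp at h, hS.next_large hpos ht ht1 ht2⟩
    · exact ⟨pp, ν, h28, h35, hS.skip hpos ht⟩
  have hnext := succ_mod_eq_ite P.size_pos (f + c)
  refine ⟨fun ht => ?_, fun ht => ?_⟩
  · have ht' : s.int 29 0 + 1 = s.int 33 0 := ht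
    rw [h.current, h33] at ht'
    rw [if_pos (by omega)] at hnext
    refine main _ ?_
    show s.int 32 0 = _
    rw [h32, hnext, add_zero]
  · have ht' : ¬ s.int 29 0 + 1 = s.int 33 0 := ht
    rw [h.current, h33] at ht'
    rw [if_neg (by omega)] at hnext
    refine main _ ?_
    show s.int 29 0 + 1 = _
    rw [h.current, hnext, add_assoc]

end RealRAM

/-! ### Computing irredundant descriptions of the Minkowski differences -/

/-- The indices of the constraints for the `i`-th polygon. -/
def KeyOf (Q : ℕ → ConvexPolygon) (k i g : ℕ) : Prop :=
  IsKey (offset Q i) (offset Q (i + 1)) (offset Q k + (i + i)) g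

/-- The inequalities of different polygons occupy disjoint ranges below `offset Q k`. Above it each
polygon owns two cells for equations. -/
theorem KeyOf.unique {Q : ℕ → ConvexPolygon} {k i j g : ℕ} (hi : i < k) (hj : j < k)
    (h : KeyOf Q k i g) (h' : KeyOf Q k j g) : i = j := by
  have h1 := offset_mono Q (show i + 1 ≤ k by omega)
  have h2 := offset_mono Q (show j + 1 ≤ k by omega)
  unfold KeyOf IsKey at h h'
  rcases lt_trichotomy i j with hij | hij | hij
  · have := offset_mono Q (show i + 1 ≤ j by omega); omega
  · exact hij
  · have := offset_mono Q (show j + 1 ≤ i by omega); omega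

namespace RealRAM

/-- The states have the same data for the `g`-th constraint. -/
structure SameCell (X Y S g : ℕ) (s s' : State) : Prop where
  fst : s'.real X g = s.real X g
  snd : s'.real Y g = s.real Y g
  slack : s'.real S g = s.real S g
  own : s'.int 6 g = s.int 6 g
  keep : s'.int 5 g = s.int 5 g

/-- The irredundant description of the `j`-th Minkowski difference is in the memory. -/
structure LocalDone (k X Y S j : ℕ) (a : Instance k) (s : State) : Prop where
  system : LocalSystem (s.normal X Y) (s.real S) (offset a.1.1 k) (offset a.1.1 j)
    (offset a.1.1 (j + 1)) (offset a.1.1 k + (j + j)) fun g => s.int 5 g ≠ 0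
  slack : s.real S (offset a.1.1 k + (j + j)) = 0
  slack' : s.real S (offset a.1.1 k + (j + j) + 1) = 0
  own : s.int 6 (offset a.1.1 k + (j + j)) = j
  own' : s.int 6 (offset a.1.1 k + (j + j) + 1) = j

theorem LocalDone.congr {k X Y S j : ℕ} {a : Instance k} {s s' : State}
    (h : LocalDone k X Y S j a s) (hg : ∀ g, KeyOf a.1.1 k j g → SameCell X Y S g s s') :
    LocalDone k X Y S j a s' := by
  have h1 := hg _ (.inr (.inl rfl))
  have h2 := hg _ (.inr (.inr rfl))
  refine ⟨h.system.congr fun g hkey => ?_, by rw [h1.slack, h.slack], by rw [h2.slack, h.slack'],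
    by rw [h1.own, h.own], by rw [h2.own, h.own']⟩
  have := hg g hkey
  exact ⟨Prod.ext this.fst this.snd, this.slack, by rw [this.keep]⟩

/-- The part of the memory that is not concerned with the `i`-th Minkowski difference. -/
structure LocalBase (k X Y C S i : ℕ) (a : Instance k) (s : State) : Prop where
  off : ∀ j ≤ k, s.int 2 j = offset a.1.1 j
  table : EdgeTable k a.1.1 a.1.2 (offset a.1.1 k) (s.normal X Y) (s.real C) (s.int 6)
  slack : ∀ g < offset a.1.1 k, IsSlack (s.normal X Y) (s.real C) (offset a.1.1 k) g (s.real S g)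
  done : ∀ j < i, LocalDone k X Y S j a s
  todo : ∀ j, i < j → j < k → ∀ g, KeyOf a.1.1 k j g → s.int 5 g = 0

theorem IsSlack.congr {m m' : ℕ → Plane} {c : ℕ → ℝ} {n e : ℕ} {x : ℝ} (h : IsSlack m c n e x)
    (hm : ∀ g < n, m' g = m g) (he : e < n) : IsSlack m' c n e x := by
  have hF : feasible m' c n = feasible m c n := by
    ext q
    exact forall₂_congr fun g hg => by rw [hm g hg]
  unfold IsSlack
  rw [hF, hm e he]; exact h

theorem LocalBase.congr {k X Y C S i : ℕ} {a : Instance k} {s s' : State} (hi : i < k)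
    (h : LocalBase k X Y C S i a s) (h2 : s'.int 2 = s.int 2) (hC : s'.real C = s.real C)
    (hg : ∀ g, ¬ KeyOf a.1.1 k i g → SameCell X Y S g s s')
    (hlt : ∀ g < offset a.1.1 k, s'.real X g = s.real X g ∧ s'.real Y g = s.real Y g ∧
      s'.real S g = s.real S g ∧ s'.int 6 g = s.int 6 g) : LocalBase k X Y C S i a s' := by
  have hm : ∀ g < offset a.1.1 k, s'.normal X Y g = s.normal X Y g := fun g hg =>
    Prod.ext (hlt g hg).1 (hlt g hg).2.1
  refine ⟨by rw [h2]; exact h.off, fun j hj t ht hlt' => ?_, fun g hg' => ?_, fun j hj => ?_,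
    fun j hj hjk g hkey => ?_⟩
  · rw [hm _ hlt', hC, (hlt _ hlt').2.2.2]
    exact h.table j hj t ht hlt'
  · rw [hC, (hlt g hg').2.2.1]
    exact IsSlack.congr (h.slack g hg') hm hg'
  · exact (h.done j hj).congr fun g hkey => hg g fun hkey' => by
      have := KeyOf.unique hi (by omega) hkey' hkey; omega
  · rw [(hg g fun hkey' => by have := KeyOf.unique hi hjk hkey' hkey; omega).keep]
    exact h.todo j hj hjk g hkey

theorem LocalBase.slack_nonneg {k X Y C S i : ℕ} {a : Instance k} {s : State}
    (h : LocalBase k X Y C S i a s) {g : ℕ} (hg : g < offset a.1.1 k) : 0 ≤ s.real S g := by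
  obtain ⟨w, hw, e, -⟩ := h.slack g hg
  rw [e]; exact sub_nonneg.2 (hw g hg)

/-- Nothing has been done yet for the `i`-th Minkowski difference. -/
structure LocalStart (k X Y C S i : ℕ) (a : Instance k) (s : State) : Prop where
  base : LocalBase k X Y C S i a s
  lo : s.int 32 0 = offset a.1.1 i
  hi : s.int 33 0 = offset a.1.1 (i + 1)
  slack : s.real S (offset a.1.1 k + (i + i)) = 0
  slack' : s.real S (offset a.1.1 k + (i + i) + 1) = 0
  own : s.int 6 (offset a.1.1 k + (i + i)) = i
  own' : s.int 6 (offset a.1.1 k + (i + i) + 1) = i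
  keep : ∀ g, KeyOf a.1.1 k i g → s.int 5 g = 0

theorem LocalStart.congr {k X Y C S i : ℕ} {a : Instance k} {s s' : State} (hi : i < k)
    (h : LocalStart k X Y C S i a s) (hr : s'.real = s.real)
    (hint : ∀ b ∈ [2, 5, 6, 32, 33], s'.int b = s.int b) : LocalStart k X Y C S i a s' := by
  have h5 := hint 5 (by simp)
  have h6 := hint 6 (by simp)
  refine ⟨h.base.congr hi (hint 2 (by simp)) (by rw [hr])
    (fun g _ => ⟨by rw [hr], by rw [hr], by rw [hr], by rw [h6], by rw [h5]⟩)
    (fun g _ => ⟨by rw [hr], by rw [hr], by rw [hr], by rw [h6]⟩),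
    by rw [hint 32 (by simp), h.lo], by rw [hint 33 (by simp), h.hi], by rw [hr, h.slack],
    by rw [hr, h.slack'], by rw [h6, h.own], by rw [h6, h.own'], by rw [h5]; exact h.keep⟩

/-- The position of the first of the two cells behind the `n` edges that are reserved for equations
of the `i`-th polygon. -/
def eqExpr (k i : ℕ) : IntExpr := .add (.cell 2 (.lit k)) (.lit (i + i))
def eqExpr' (k i : ℕ) : IntExpr := .add (eqExpr k i) (.lit 1)

def localInit (S k i : ℕ) : Program := block [
  setVar 32 (.cell 2 (.lit i)), setVar 33 (.cell 2 (.lit (i + 1))),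
  .setReal S (eqExpr k i) (.lit 0), .setReal S (eqExpr' k i) (.lit 0),
  .setInt 6 (eqExpr k i) (.lit i), .setInt 6 (eqExpr' k i) (.lit i)]

/-- The second condition lets only the first success count, so the scan begins at the first tight
edge. -/
def tightTest (S : ℕ) : Test := .and (.realEq (.cell S (ivar 30)) (.lit 0)) (.intEq (ivar 31) (ivar 33))

/-- Finds out the dimension of a Minkowski difference. -/
def classify (X Y S : ℕ) : Program :=
  .seq (search (tightTest S)) (.cond (.intEq (ivar 31) (ivar 33)) (setVar 34 (.lit 2))
    (.seq (block [setVar 28 (ivar 31), setVar 29 (ivar 31), setVar 38 (.lit 0), setVar 34 (.lit 0)])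
      (.loop (.intLt (ivar 38) (.sub (ivar 33) (ivar 32))) (scanBody X Y S))))

section
variable {k X Y C S i : ℕ} (hi : i < k)
include hi

theorem one_le_offset (a : Instance k) : 1 ≤ offset a.1.1 k :=
  (Nat.zero_le _).trans_lt (offset_add_lt a.1.1 hi (a.1.1 i).size_pos)

theorem size_le_offset (a : Instance k) : (a.1.1 i).size ≤ offset a.1.1 k := by
  have := offset_mono a.1.1 (show i + 1 ≤ k by omega)
  rw [offset_succ] at this; omega

theorem offset_le_offset (a : Instance k) : offset a.1.1 (i + 1) ≤ offset a.1.1 k :=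
  offset_mono a.1.1 (show i + 1 ≤ k by omega)

theorem localInit_triple (hXS : X ≠ S) (hYS : Y ≠ S) (hCS : C ≠ S) :
    Triple (fun a : Instance k => offset a.1.1 k)
      (fun a s => LocalBase k X Y C S i a s ∧ ∀ g, KeyOf a.1.1 k i g → s.int 5 g = 0)
      (localInit S k i) (LocalStart k X Y C S i) := by
  refine Triple.wp (one_le_offset hi) fun a s ⟨h, h0⟩ => ?_
  simp only [localInit, block, Program.wp, IntExpr.eval, RealExpr.eval, eqExpr, eqExpr',
    State.writeInt_int_self, State.writeInt_int_of_ne, State.writeReal_int, ne_eq,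
    not_false_eq_true, Nat.reduceEqDiff, Function.update_self, h.off i hi.le, h.off (i + 1) hi,
    h.off k le_rfl, Rat.cast_zero]
  set e := offset a.1.1 k + (i + i) with he
  have hne : ∀ g, ¬ KeyOf a.1.1 k i g → g ≠ e ∧ g ≠ e + 1 := fun g hg =>
    ⟨fun h => hg (.inr (.inl h)), fun h => hg (.inr (.inr h))⟩
  have hS : ∀ g, g ≠ e ∧ g ≠ e + 1 →
      Function.update (Function.update (s.real S) e 0) (e + 1) 0 g = s.real S g := fun g hg => by
    rw [Function.update_of_ne hg.2, Function.update_of_ne hg.1]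
  have ho : ∀ g, g ≠ e ∧ g ≠ e + 1 →
      Function.update (Function.update (s.int 6) e i) (e + 1) i g = s.int 6 g := fun g hg => by
    rw [Function.update_of_ne hg.2, Function.update_of_ne hg.1]
  have hlt : ∀ g < offset a.1.1 k, g ≠ e ∧ g ≠ e + 1 := fun g hg => by omega
  refine ⟨h.congr hi ?_ ?_ (fun g hg => ⟨?_, ?_, ?_, ?_, ?_⟩) (fun g hg => ⟨?_, ?_, ?_, ?_⟩),
    ?_, ?_, ?_, ?_, ?_, ?_, ?_⟩
  all_goals
    simp only [State.writeInt_int_self, State.writeInt_int_of_ne, State.writeReal_int,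
      State.writeInt_real, State.writeReal_real_self, State.writeReal_real_of_ne, ne_eq,
      not_false_eq_true, Nat.reduceEqDiff, Function.update_self, hXS, hYS, hCS]
  all_goals try rw [← he]
  · exact hS g (hne g hg)
  · exact ho g (hne g hg)
  · exact hS g (hlt g hg)
  · exact ho g (hlt g hg)
  · rw [Function.update_of_ne (by omega), Function.update_self]
  · rw [Function.update_self]
  · rw [Function.update_of_ne (by omega), Function.update_self]
  · rw [Function.update_self]
  · exact h0

theorem edge_eq {a : Instance k} {s : State} (h : LocalStart k X Y C S i a s) (t : ℕ) :
    s.normal X Y (offset a.1.1 i + t % (a.1.1 i).size) = (a.1.1 i).edge t := by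
  have hlt := Nat.mod_lt t (a.1.1 i).size_pos
  rw [(h.base.table i hi _ hlt (offset_add_lt _ hi hlt)).1, ConvexPolygon.edge_mod]

theorem classify_triple : Triple (fun a : Instance k => offset a.1.1 k) (LocalStart k X Y C S i)
    (classify X Y S) fun a s => LocalStart k X Y C S i a s ∧ Classified (s.normal X Y) (s.real S)
      (offset a.1.1 i) (offset a.1.1 (i + 1)) (s.int 34 0) (s.int 35 0) := by
  have hn := one_le_offset hi
  have hle : ∀ a : Instance k, offset a.1.1 i ≤ offset a.1.1 (i + 1) := fun a =>
    offset_mono _ (Nat.le_succ i)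
  refine Triple.seq (Triple.conseq (Post' := fun a s => LocalStart k X Y C S i a s ∧
    IsOptimum (fun g => s.real S g = 0) (fun _ _ => False) (offset a.1.1 i) (offset a.1.1 (i + 1))
      (s.int 31 0)) (Triple.ofExists (Pre := fun a S₀ s => LocalStart k X Y C S i a s ∧
        s.real S = S₀) (Triple.conseq (Triple.search (fun x => hn x.1)
      (fun x : Instance k × (ℕ → ℝ) => offset x.1.1.1 i)
      (fun x => offset x.1.1.1 (i + 1)) (fun x g => x.2 g = 0)
      (fun _ _ _ => False) 1 (fun x => ?_) ?_ ?_ (fun _ _ h => h) (fun _ _ _ _ h => h.elim) ?_)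
      (fun _ _ h => h) ?_)) (fun a s h => ⟨_, h, rfl⟩) fun _ _ h => h) ?_
  · have := offset_le_offset hi x.1; omega
  · rintro a s s' ⟨h, e⟩ ⟨hr, hs⟩
    exact ⟨h.congr hi hr fun b hb => hs b (by rintro rfl; simp at hb)
      (by rintro rfl; simp at hb), by rw [hr, e]⟩
  · rintro a s ⟨h, -⟩
    exact ⟨h.lo, h.hi, hle a.1⟩
  · rintro a s ⟨h, e⟩ - - -
    simp only [tightTest, Test.Holds, RealExpr.eval, IntExpr.eval, Rat.cast_zero, e, h.hi,
      or_false]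
  · rintro ⟨a, S₀⟩ s ⟨⟨h, rfl⟩, hopt⟩
    exact ⟨h, hopt⟩
  · refine Triple.cond hn (Triple.wp hn ?_) (Triple.seq (Mid := fun a s => ∃ f : ℕ,
      LocalStart k X Y C S i a s ∧ s.int 38 0 ≤ (a.1.1 i).size ∧
        ScanState (a.1.1 i) S (offset a.1.1 i) f (s.int 38 0) s) (Triple.wp hn ?_)
      (Triple.ofExists (Triple.conseq (Triple.loop (fun x : Instance k × ℕ => hn x.1)
        (fun x s => (x.1.1.1 i).size - s.int 38 0) 1 (fun x s h => ?_) ?_) (fun _ _ h => h) ?_)))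
    -- Without tight constraints the origin itself satisfies all of them strictly.
    · rintro a s ⟨⟨h, hopt⟩, hb⟩
      have hb' : s.int 31 0 = s.int 33 0 := hb
      rw [h.hi] at hb'
      refine ⟨h.congr hi rfl fun b hb => State.writeInt_int_of_ne _ _ _
        (by rintro rfl; simp at hb), .inr (.inr ⟨?_, 0, fun g h1 h2 => ?_⟩)⟩
      · rw [State.writeInt_int_self]; rfl
      · rw [dot_zero]
        have h3 := h.base.slack_nonneg (h2.trans_le (offset_le_offset hi a))
        rcases hopt with ⟨-, hopt⟩ | ⟨-, hopt, -⟩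
        · exact lt_of_le_of_ne h3 (Ne.symm (hopt g h1 h2))
        · omega
    · rintro a s ⟨⟨h, hopt⟩, hb⟩
      have hb' : ¬ s.int 31 0 = s.int 33 0 := hb
      rw [h.hi] at hb'
      obtain ⟨h1, h2, h3, -⟩ := hopt.resolve_left fun h => hb' h.1
      obtain ⟨f, hf⟩ := Nat.exists_eq_add_of_le h1
      have hf' : f % (a.1.1 i).size = f := Nat.mod_eq_of_lt (by
        rw [offset_succ] at h2; omega)
      simp only [block, Program.wp, IntExpr.eval, State.writeInt_int_self,
        State.writeInt_int_of_ne, ne_eq, not_false_eq_true, Nat.reduceEqDiff, Function.update_self,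
        Nat.zero_le, true_and, hf]
      refine ⟨f, h.congr hi rfl fun b hb => ?_, ?_, ?_, f, 0, ?_, ?_, ?_⟩
      all_goals
        try simp only [State.writeInt_int_self, State.writeInt_int_of_ne, ne_eq, not_false_eq_true,
          Nat.reduceEqDiff, Function.update_self, hf', add_zero]
      · simp only [List.mem_cons, List.not_mem_nil, or_false] at hb
        rw [State.writeInt_int_of_ne _ _ _ (by omega), State.writeInt_int_of_ne _ _ _ (by omega),
          State.writeInt_int_of_ne _ _ _ (by omega), State.writeInt_int_of_ne _ _ _ (by omega)]
      · simp
      · refine Scan.init ?_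
        show s.real S _ = 0
        rw [hf', ← hf]; exact h3
    · have := size_le_offset hi x.1; omega
    · rintro ⟨a, f⟩ s ⟨h, h38, hsc⟩ hb
      have hb' : s.int 38 0 < (a.1.1 i).size := by
        have : s.int 38 0 < s.int 33 0 - s.int 32 0 := hb
        have l := h.lo
        have r := h.hi
        rw [offset_succ] at r
        simp only at l r
        omega
      have := scanBody_wp (edge_eq hi h) h.lo (by rw [h.hi, offset_succ]) hsc hb'
      refine Program.wp_mono ?_ (Program.wp_frame this)
      rintro s' ⟨ho, h1, h2⟩
      have hr : s'.real = s.real := by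
        funext b; exact ho.2 b (by simp [scanBody, block, Program.WritesReal])
      rw [h2]
      refine ⟨⟨h.congr hi hr fun b hb => ho.1 b ?_, hb', h1⟩, by simp only; omega⟩
      simp only [List.mem_cons, List.not_mem_nil, or_false] at hb
      simp [scanBody, block, Program.WritesInt]; omega
    · rintro ⟨a, f⟩ s ⟨⟨h, h38, hsc⟩, hb⟩
      have hb' : s.int 38 0 = (a.1.1 i).size := by
        have : ¬ s.int 38 0 < s.int 33 0 - s.int 32 0 := hb
        have l := h.lo
        have r := h.hi
        rw [offset_succ] at r
        simp only at h38 l r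
        omega
      rw [hb'] at hsc
      obtain ⟨pp, ν, -, h35, hS⟩ := hsc.scan
      have hcl := hS.classified (edge_eq hi h) fun g h1 h2 =>
        h.base.slack_nonneg (h2.trans_le (by
          have := offset_le_offset hi a; rwa [offset_succ] at this))
      refine ⟨h, ?_⟩
      rw [← offset_succ] at hcl
      rcases hcl with h1 | ⟨h1, h2⟩ | h1
      · exact .inl h1
      · rw [h35 h1]; exact .inr (.inl ⟨h1, h2⟩)
      · exact .inr (.inr h1)

end

/-- What the treatment of the `i`-th Minkowski difference does not change. -/
structure LocalFrame (k X Y i : ℕ) (a : Instance k) (s₀ s : State) : Prop where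
  int : ∀ b ∈ [2, 6, 32, 33, 35], s.int b = s₀.int b
  real : ∀ b, b ≠ X → b ≠ Y → s.real b = s₀.real b
  fst : ∀ g, g ≠ offset a.1.1 k + (i + i) → g ≠ offset a.1.1 k + (i + i) + 1 →
    s.real X g = s₀.real X g
  snd : ∀ g, g ≠ offset a.1.1 k + (i + i) → g ≠ offset a.1.1 k + (i + i) + 1 →
    s.real Y g = s₀.real Y g
  keep : ∀ g, ¬ KeyOf a.1.1 k i g → s.int 5 g = s₀.int 5 g

section
variable {k X Y C S i : ℕ}

theorem LocalFrame.normal {a : Instance k} {s₀ s : State} (h : LocalFrame k X Y i a s₀ s) {g : ℕ}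
    (hg : g < offset a.1.1 k) : s.normal X Y g = s₀.normal X Y g :=
  Prod.ext (h.fst g (by omega) (by omega)) (h.snd g (by omega) (by omega))

theorem LocalFrame.trans {a : Instance k} {s₀ s s' : State} (h : LocalFrame k X Y i a s₀ s)
    (h' : LocalFrame k X Y i a s s') : LocalFrame k X Y i a s₀ s' :=
  ⟨fun b hb => (h'.int b hb).trans (h.int b hb), fun b h1 h2 => (h'.real b h1 h2).trans (h.real b h1 h2),
    fun g h1 h2 => (h'.fst g h1 h2).trans (h.fst g h1 h2),
    fun g h1 h2 => (h'.snd g h1 h2).trans (h.snd g h1 h2),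
    fun g hg => (h'.keep g hg).trans (h.keep g hg)⟩

theorem LocalFrame.of_int {a : Instance k} {s₀ s : State} (hr : s.real = s₀.real)
    (hint : ∀ b ∈ [2, 6, 32, 33, 35], s.int b = s₀.int b)
    (hk : ∀ g, ¬ KeyOf a.1.1 k i g → s.int 5 g = s₀.int 5 g) : LocalFrame k X Y i a s₀ s :=
  ⟨hint, fun _ _ _ => by rw [hr], fun _ _ _ => by rw [hr], fun _ _ _ => by rw [hr], hk⟩

/-- This leaves to each of the three cases only two tasks: that its program stays within its own
cells, and that the marked constraints form a `LocalSystem`. -/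
theorem LocalStart.finish (hi : i < k) (hXS : X ≠ S) (hYS : Y ≠ S) (hXC : X ≠ C) (hYC : Y ≠ C)
    {a : Instance k} {s₀ s : State} (h : LocalStart k X Y C S i a s₀)
    (hf : LocalFrame k X Y i a s₀ s) (hsys : LocalSystem (s.normal X Y) (s₀.real S)
      (offset a.1.1 k) (offset a.1.1 i) (offset a.1.1 (i + 1)) (offset a.1.1 k + (i + i))
      fun g => s.int 5 g ≠ 0) :
    LocalBase k X Y C S i a s ∧ LocalDone k X Y S i a s := by
  have hS : s.real S = s₀.real S := hf.real S hXS.symm hYS.symm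
  have h6 := hf.int 6 (by simp)
  refine ⟨h.base.congr hi (hf.int 2 (by simp)) (hf.real C hXC.symm hYC.symm) (fun g hg => ?_)
    fun g hg => ⟨hf.fst g (by omega) (by omega), hf.snd g (by omega) (by omega), by rw [hS],
      by rw [h6]⟩, ⟨by rw [hS]; exact hsys, by rw [hS, h.slack], by rw [hS, h.slack'],
      by rw [h6, h.own], by rw [h6, h.own']⟩⟩
  have h1 : g ≠ offset a.1.1 k + (i + i) := fun e => hg (.inr (.inl e))
  have h2 : g ≠ offset a.1.1 k + (i + i) + 1 := fun e => hg (.inr (.inr e))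
  exact ⟨hf.fst g h1 h2, hf.snd g h1 h2, by rw [hS], by rw [h6], hf.keep g hg⟩

theorem LocalStart.slack_nonneg (hi : i < k) {a : Instance k} {s : State}
    (h : LocalStart k X Y C S i a s) (g : ℕ) (_ : offset a.1.1 i ≤ g)
    (hg : g < offset a.1.1 (i + 1)) : 0 ≤ s.real S g :=
  h.base.slack_nonneg (hg.trans_le (offset_le_offset hi a))

/-! ### Minkowski differences that are points. -/

def pointBranch (X Y k i : ℕ) : Program := block [
  .setReal X (eqExpr k i) (.lit 1), .setReal Y (eqExpr k i) (.lit 0),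
  .setReal X (eqExpr' k i) (.lit 0), .setReal Y (eqExpr' k i) (.lit 1),
  .setInt 5 (eqExpr k i) (.lit 1), .setInt 5 (eqExpr' k i) (.lit 1)]

theorem pointBranch_wp (hi : i < k) (hXY : X ≠ Y) (hXS : X ≠ S) (hYS : Y ≠ S) (hXC : X ≠ C)
    (hYC : Y ≠ C) {a : Instance k} {s : State} (h : LocalStart k X Y C S i a s)
    (hc : Classified (s.normal X Y) (s.real S) (offset a.1.1 i) (offset a.1.1 (i + 1))
      (s.int 34 0) (s.int 35 0)) (h0 : s.int 34 0 = 0) :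
    (pointBranch X Y k i).wp (fun s => LocalBase k X Y C S i a s ∧ LocalDone k X Y S i a s) s := by
  have htight := (hc.resolve_right (by rintro (⟨h1, -⟩ | ⟨h1, -⟩) <;> omega)).2
  have hlt := offset_le_offset hi a
  simp only [pointBranch, block, Program.wp, IntExpr.eval, RealExpr.eval, eqExpr, eqExpr',
    State.writeInt_int_of_ne, State.writeReal_int, ne_eq, not_false_eq_true, Nat.reduceEqDiff,
    h.base.off k le_rfl, Rat.cast_zero, Rat.cast_one]
  generalize hs : State.writeInt _ _ _ _ = s'
  have hf : LocalFrame k X Y i a s s' := by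
    subst hs
    refine ⟨fun b hb => ?_, fun b h1 h2 => ?_, fun g h1 h2 => ?_, fun g h1 h2 => ?_,
      fun g hg => ?_⟩
    · simp only [List.mem_cons, List.not_mem_nil, or_false] at hb
      rw [State.writeInt_int_of_ne _ _ _ (by omega), State.writeInt_int_of_ne _ _ _ (by omega)]
      rfl
    · simp only [State.writeInt_real, State.writeReal_real_of_ne, ne_eq, h1, h2,
        not_false_eq_true]
    · simp only [State.writeInt_real, State.writeReal_real_of_ne, State.writeReal_real_self, ne_eq,
        h1, h2, hXY, hXY.symm, not_false_eq_true, Function.update_of_ne]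
    · simp only [State.writeInt_real, State.writeReal_real_of_ne, State.writeReal_real_self, ne_eq,
        h1, h2, hXY, hXY.symm, not_false_eq_true, Function.update_of_ne]
    · have h1 : g ≠ offset a.1.1 k + (i + i) := fun e => hg (.inr (.inl e))
      have h2 : g ≠ offset a.1.1 k + (i + i) + 1 := fun e => hg (.inr (.inr e))
      simp only [State.writeInt_int_self, State.writeReal_int, ne_eq, h1, h2, not_false_eq_true,
        Function.update_of_ne]
  refine h.finish hi hXS hYS hXC hYC hf (localSystem_point (by omega) (h.slack_nonneg hi)
    (fun u hu => ?_) ?_ ?_ (fun g h1 h2 => ?_) ?_ ?_)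
  · obtain ⟨g, h1, h2, h3, h4⟩ := htight u hu
    exact ⟨g, h1, h2, h3, by rwa [hf.normal (by omega)]⟩
  all_goals
    subst hs
    simp [State.normal, State.writeInt_real, State.writeInt_int_self, State.writeReal_int,
      State.writeReal_real_of_ne, State.writeReal_real_self, hXY, hXY.symm, Function.update_apply]
  rw [if_neg (by omega), if_neg (by omega), h.keep g (.inl ⟨h1, h2⟩)]

/-! ### Segments -/

/-- Tests whether the edge `30` cuts the line with normal vector `35` earlier than the edge `31`. -/
def ratioTest (X Y S : ℕ) (σ : ℚ) : Test :=
  .and (.realLt (.lit 0) (.mul (.lit σ) (crossExpr X Y (ivar 35) (ivar 30))))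
    (.or (.intEq (ivar 31) (ivar 33)) (.realLt
      (.div (.cell S (ivar 30)) (.mul (.lit σ) (crossExpr X Y (ivar 35) (ivar 30))))
      (.div (.cell S (ivar 31)) (.mul (.lit σ) (crossExpr X Y (ivar 35) (ivar 31))))))

def pick (X Y S : ℕ) (σ : ℚ) : Program :=
  .seq (search (ratioTest X Y S σ)) (.setInt 5 (ivar 31) (.lit 1))

/-- The state while the set is being described as a segment. -/
structure SegmentInv (k X Y C S i : ℕ) (x : Instance k × State) (F : ℕ → ℕ) (s : State) :
    Prop where
  start : LocalStart k X Y C S i x.1 x.2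
  cls : Classified (x.2.normal X Y) (x.2.real S) (offset x.1.1.1 i) (offset x.1.1.1 (i + 1))
    1 (x.2.int 35 0)
  frame : LocalFrame k X Y i x.1 x.2 s
  eq : s.normal X Y (offset x.1.1.1 k + (i + i)) = x.2.normal X Y (x.2.int 35 0)
  keep : s.int 5 = F

/-- The edge `d` is the first one to cut the line with normal vector `m ν`. -/
def FirstCut (m : ℕ → Plane) (S : ℕ → ℝ) (lo hi ν : ℕ) (σ : ℚ) (d : ℕ) : Prop :=
  (lo ≤ d ∧ d < hi) ∧ 0 < σ * cross (m ν) (m d) ∧ ∀ g, lo ≤ g → g < hi →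
    0 < σ * cross (m ν) (m g) → S d / (σ * cross (m ν) (m d)) ≤ S g / (σ * cross (m ν) (m g))

theorem Classified.one {m : ℕ → Plane} {S : ℕ → ℝ} {lo hi ν : ℕ}
    (h : Classified m S lo hi 1 ν) : (lo ≤ ν ∧ ν < hi) ∧ S ν = 0 ∧
    (∃ b, (lo ≤ b ∧ b < hi) ∧ S b = 0 ∧ ∃ r : ℝ, 0 < r ∧ m b = -(r • m ν)) ∧
    ∀ g, lo ≤ g → g < hi → S g = 0 → dot (m g) (turn (m ν)) ≤ 0 := by
  rcases h with ⟨h1, -⟩ | ⟨-, h2⟩ | ⟨h1, -⟩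
  · omega
  · exact h2
  · omega

theorem pick_triple (hi : i < k) (hXS : X ≠ S) (hYS : Y ≠ S) {σ : ℚ} (hσ : σ ≠ 0) :
    Triple (fun x : (Instance k × State) × (ℕ → ℕ) => offset x.1.1.1.1 k)
      (fun x s => SegmentInv k X Y C S i x.1 x.2 s) (pick X Y S σ)
      (fun x s => ∃ d, FirstCut (x.1.2.normal X Y) (x.1.2.real S) (offset x.1.1.1.1 i)
        (offset x.1.1.1.1 (i + 1)) (x.1.2.int 35 0) σ d ∧
        SegmentInv k X Y C S i x.1 (Function.update x.2 d 1) s) := by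
  have hn : ∀ x : (Instance k × State) × (ℕ → ℕ), 1 ≤ offset x.1.1.1.1 k := fun x =>
    one_le_offset hi x.1.1
  refine Triple.seq (Triple.search hn (fun x => offset x.1.1.1.1 i)
    (fun x => offset x.1.1.1.1 (i + 1))
    (fun x g => 0 < σ * cross (x.1.2.normal X Y (x.1.2.int 35 0)) (x.1.2.normal X Y g))
    (fun x g d =>
      x.1.2.real S g / (σ * cross (x.1.2.normal X Y (x.1.2.int 35 0)) (x.1.2.normal X Y g)) <
      x.1.2.real S d / (σ * cross (x.1.2.normal X Y (x.1.2.int 35 0)) (x.1.2.normal X Y d)))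
    1 (fun x => ?_) ?_ ?_ (fun _ _ => lt_irrefl _) (fun _ _ _ _ => lt_trans) ?_)
    (Triple.wp hn ?_)
  · have := offset_le_offset hi x.1.1; omega
  · rintro x s s' h ⟨hr, hs⟩
    have hs' : ∀ b ∈ [2, 5, 6, 32, 33, 35], s'.int b = s.int b := fun b hb =>
      hs b (by rintro rfl; simp at hb) (by rintro rfl; simp at hb)
    refine ⟨h.start, h.cls, h.frame.trans (.of_int hr (fun b hb => hs' b ?_)
      fun g _ => by rw [hs' 5 (by simp)]), ?_, by rw [hs' 5 (by simp), h.keep]⟩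
    · simp only [List.mem_cons, List.not_mem_nil, or_false] at hb ⊢; omega
    · unfold State.normal; rw [hr]; exact h.eq
  · rintro x s h
    exact ⟨by rw [h.frame.int 32 (by simp), h.start.lo], by rw [h.frame.int 33 (by simp), h.start.hi],
      offset_mono _ (Nat.le_succ i)⟩
  · rintro x s h h1 h2 h3
    have hle := offset_le_offset hi x.1.1
    have hν := (Classified.one h.cls).1
    have e1 := h.frame.normal (g := s.int 30 0) (by omega)
    have e2 := h.frame.normal (g := x.1.2.int 35 0) (by omega)
    have e3 := h.frame.int 35 (by simp)
    have e4 := h.frame.real S hXS.symm hYS.symm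
    have e5 : s.int 33 0 = offset x.1.1.1.1 (i + 1) := by
      rw [h.frame.int 33 (by simp), h.start.hi]
    simp only [ratioTest, Test.Holds, Test.holds_or, RealExpr.eval, eval_crossExpr, IntExpr.eval,
      e1, e2, e3, e4, e5, Rat.cast_zero]
    rcases h3 with h3 | ⟨-, h3, -⟩
    · simp only [h3, true_or]
    · rw [h.frame.normal (g := s.int 31 0) (by omega)]
  · rintro ⟨⟨a, s₀⟩, F⟩ s ⟨h, hopt⟩
    have hle := offset_le_offset hi a
    simp only at h hopt
    have hν : offset a.1.1 i ≤ s₀.int 35 0 ∧ s₀.int 35 0 < offset a.1.1 (i + 1) :=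
      (Classified.one h.cls).1
    have hν0 := h.start.base.table.ne_zero (g := s₀.int 35 0) (by simp only; omega)
    have hd : FirstCut (s₀.normal X Y) (s₀.real S) (offset a.1.1 i)
        (offset a.1.1 (i + 1)) (s₀.int 35 0) σ (s.int 31 0) := by
      rcases hopt with ⟨-, hopt⟩ | ⟨h1, h2, h3, h4⟩
      -- The search cannot fail: the normals of a polygon positively span the plane, so one of them
      -- has a positive product with either direction of the line.
      · exfalso
        obtain ⟨t, ht, hpos⟩ := h.start.base.table.exists_dot_pos hi
          (u := (σ : ℝ) • turn (s₀.normal X Y (s₀.int 35 0))) (by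
            refine smul_ne_zero (by exact_mod_cast hσ) fun e => hν0 ?_
            simp only [turn, Prod.mk_eq_zero, neg_eq_zero] at e
            exact Prod.ext e.2 e.1)
        rw [dot_smul, dot_turn] at hpos
        simp only at ht hpos
        exact hopt _ (Nat.le_add_right _ t) (by simp only [offset_succ]; omega) hpos
      · exact ⟨⟨h1, h2⟩, h3, fun g hg hg' hp => not_lt.1 (h4 g hg hg' hp)⟩
    refine ⟨s.int 31 0, hd, h.start, h.cls, h.frame.trans (.of_int rfl (fun b hb => ?_)
      fun g hg => ?_), h.eq, ?_⟩
    · exact State.writeInt_int_of_ne _ _ _ (by rintro rfl; simp at hb)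
    · rw [State.writeInt_int_self]
      exact Function.update_of_ne (fun e => hg (.inl (by rw [e]; exact hd.1))) _ _
    · rw [State.writeInt_int_self, h.keep]; rfl

def segmentBranch (X Y S k i : ℕ) : Program :=
  .seq (block [.setReal X (eqExpr k i) (.cell X (ivar 35)),
      .setReal Y (eqExpr k i) (.cell Y (ivar 35)), .setInt 5 (eqExpr k i) (.lit 1)])
    (.seq (pick X Y S 1) (pick X Y S (-1)))

/-- The equation gets a copy of the normal at `ν`. The search with sign `1` finds the upper end of
the segment, the one with sign `-1` the lower end. The state before the branch is carried along as a
parameter, because the normals stored for the equation change. -/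
theorem segmentBranch_triple (hi : i < k) (hXY : X ≠ Y) (hXS : X ≠ S) (hYS : Y ≠ S) (hXC : X ≠ C)
    (hYC : Y ≠ C) : Triple (fun a : Instance k => offset a.1.1 k)
      (fun a s => LocalStart k X Y C S i a s ∧ Classified (s.normal X Y) (s.real S)
        (offset a.1.1 i) (offset a.1.1 (i + 1)) 1 (s.int 35 0)) (segmentBranch X Y S k i)
      fun a s => LocalBase k X Y C S i a s ∧ LocalDone k X Y S i a s := by
  refine Triple.seq (Mid := fun a s => ∃ s₀ : State, SegmentInv k X Y C S i (a, s₀)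
      (Function.update (s₀.int 5) (offset a.1.1 k + (i + i)) 1) s)
    (Triple.wp (one_le_offset hi) fun a s ⟨h, hc⟩ => ?_)
    (Triple.seq (Mid := fun a s => ∃ y : State × ℕ, FirstCut (y.1.normal X Y) (y.1.real S)
        (offset a.1.1 i) (offset a.1.1 (i + 1)) (y.1.int 35 0) 1 y.2 ∧
        SegmentInv k X Y C S i (a, y.1) (Function.update
          (Function.update (y.1.int 5) (offset a.1.1 k + (i + i)) 1) y.2 1) s)
      (Triple.ofExists (Triple.conseq ((pick_triple hi hXS hYS one_ne_zero).reindex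
        fun x : Instance k × State => (x, Function.update (x.2.int 5)
          (offset x.1.1.1 k + (i + i)) 1)) (fun _ _ h => h) ?_))
      (Triple.ofExists (Triple.conseq (((pick_triple hi hXS hYS (σ := -1) (by norm_num)).reindex
        fun x : Instance k × (State × ℕ) => ((x.1, x.2.1), Function.update (Function.update
          (x.2.1.int 5) (offset x.1.1.1 k + (i + i)) 1) x.2.2 1)).frame
        (fun x _ => FirstCut (x.2.1.normal X Y) (x.2.1.real S) (offset x.1.1.1 i)
          (offset x.1.1.1 (i + 1)) (x.2.1.int 35 0) 1 x.2.2) fun _ _ _ _ h => h)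
        (fun _ _ h => ⟨h.2, h.1⟩) ?_)))
  · simp only [block, Program.wp, IntExpr.eval, RealExpr.eval, eqExpr, State.writeReal_int,
      h.base.off k le_rfl]
    have hle := offset_le_offset hi a
    have hν := (Classified.one hc).1
    refine ⟨s, h, hc, ⟨fun b hb => ?_, fun b h1 h2 => ?_, fun g h1 h2 => ?_, fun g h1 h2 => ?_,
      fun g hg => ?_⟩, ?_, ?_⟩
    · exact State.writeInt_int_of_ne _ _ _ (by rintro rfl; simp at hb)
    · simp only [State.writeInt_real, State.writeReal_real_of_ne, ne_eq, h1, h2,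
        not_false_eq_true]
    · simp only [State.writeInt_real, State.writeReal_real_of_ne, State.writeReal_real_self, ne_eq,
        h1, h2, hXY, hXY.symm, not_false_eq_true, Function.update_of_ne]
    · simp only [State.writeInt_real, State.writeReal_real_of_ne, State.writeReal_real_self, ne_eq,
        h1, h2, hXY, hXY.symm, not_false_eq_true, Function.update_of_ne]
    · rw [State.writeInt_int_self]
      exact Function.update_of_ne (fun e => hg (.inr (.inl e))) _ _
    · simp [State.normal, State.writeInt_real, State.writeReal_real_of_ne,
        State.writeReal_real_self, hXY, hXY.symm, ivar, IntExpr.eval]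
    · rw [State.writeInt_int_self]; rfl
  · rintro ⟨a, s₀⟩ s ⟨d, hd, h⟩
    exact ⟨(s₀, d), hd, h⟩
  · rintro ⟨a, s₀, p⟩ s ⟨⟨q, hq, h⟩, hp⟩
    simp only at hq h hp
    have hle := offset_le_offset hi a
    obtain ⟨hν, hSν, ⟨b, hb, hSb, r, hr, hab⟩, hturn⟩ := Classified.one h.cls
    simp only at hν hSν hb hSb hab hturn
    have hS := h.start.slack_nonneg hi
    have hf := h.frame
    have hm : ∀ g, offset a.1.1 i ≤ g → g < offset a.1.1 (i + 1) →
        s.normal X Y g = s₀.normal X Y g := fun g _ hg => hf.normal (g := g) (by simp only; omega)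
    obtain ⟨hp1, hp2, hp3⟩ := hp
    obtain ⟨hq1, hq2, hq3⟩ := hq
    obtain ⟨t₀, ht₀, ht⟩ := exists_smul_mem_localSet hS hturn
    simp only [Rat.cast_one, one_mul] at hp2 hp3
    simp only [Rat.cast_neg, Rat.cast_one, neg_mul, one_mul, Left.neg_pos_iff, div_neg,
      neg_le_neg_iff] at hq2 hq3
    refine h.start.finish hi hXS hYS hXC hYC hf (localSystem_segment (a := s₀.int 35 0) (b := b)
      (p := p) (q := q) hle (by omega) hS hν hb hp1 hq1 ?_ hSν hSb hr ?_ ?_ ?_ ?_ ?_ ht₀ ?_ ?_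
      (fun g h1 h2 => ?_) ?_ ?_)
    · rw [hm _ hν.1 hν.2]; exact h.start.base.table.ne_zero (by simp only; omega)
    · rw [hm _ hν.1 hν.2, hm _ hb.1 hb.2]; exact hab
    · rwa [hm _ hν.1 hν.2, hm _ hp1.1 hp1.2]
    · rwa [hm _ hν.1 hν.2, hm _ hq1.1 hq1.2]
    · intro g h1 h2
      rw [hm _ hν.1 hν.2, hm _ hp1.1 hp1.2, hm _ h1 h2]
      exact hp3 g h1 h2
    · intro g h1 h2
      rw [hm _ hν.1 hν.2, hm _ hq1.1 hq1.2, hm _ h1 h2]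
      exact hq3 g h1 h2
    · intro g h1 h2
      rw [hm _ hν.1 hν.2, hm _ h1 h2]
      exact ht g h1 h2
    · rw [hm _ hν.1 hν.2]; exact h.eq
    all_goals
      rw [h.keep]
      simp only [Function.update_apply]
    · have := h.start.keep g (.inl ⟨h1, h2⟩)
      simp only at this
      simp only at h1 h2
      rw [this, if_neg (show g ≠ offset a.1.1 k + (i + i) by omega)]
      split_ifs <;> simp_all
    · simp
    · have := h.start.keep _ (.inr (.inr rfl))
      simp only at this hp1 hq1
      rw [if_neg (by omega), if_neg (by omega), if_neg (by omega), this]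
      simp

end

/-! ### Minkowski differences with interior points. -/

/-- Lists the edges of the `i`-th polygon in array `4`. -/
def fill : Program :=
  .seq (block [setVar 20 (.lit 0), setVar 21 (.lit 0)])
    (.loop (.intLt (ivar 21) (.sub (ivar 33) (ivar 32)))
      (block [.setInt 4 (ivar 21) (.add (ivar 32) (ivar 21)), incr 21]))

/-- Marks the edges that are listed in array `4`. -/
def mark : Program :=
  .loop (.intLt (ivar 20) (ivar 21)) (block [.setInt 5 (.cell 4 (ivar 20)) (.lit 1), incr 20])

def polygonBranch (X Y S : ℕ) : Program := .seq fill (.seq (trim 4 X Y S) mark)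

/-- The state while the set is being described as a polygon; `b` lists the integer arrays that have
not been changed. -/
structure PolygonInv (k X Y C S i : ℕ) (x : Instance k × State) (b : List ℕ) (s : State) :
    Prop where
  start : LocalStart k X Y C S i x.1 x.2
  strict : ∃ o : Plane, ∀ g, offset x.1.1.1 i ≤ g → g < offset x.1.1.1 (i + 1) →
    dot (x.2.normal X Y g) o < x.2.real S g
  real : s.real = x.2.real
  int : ∀ c ∈ b, s.int c = x.2.int c

/-- The entries `B lo', …, B (hi' - 1)` are the essential constraints in cyclic order. -/
structure Essential (m : ℕ → Plane) (S : ℕ → ℝ) (lo hi : ℕ) (B : ℕ → ℕ) (lo' hi' : ℕ) : Prop where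
  order : ∃ τ, CyclicOrder m B lo' hi' τ
  strict : ∀ p, lo' ≤ p → p < hi' → StrictAt m S B lo' hi' p
  implied : ∀ q, (∀ p, lo' ≤ p → p < hi' → dot (m (B p)) q ≤ S (B p)) → q ∈ localSet m S lo hi
  mem : ∀ p, lo' ≤ p → p < hi' → lo ≤ B p ∧ B p < hi
  size_le : hi' - lo' ≤ hi - lo

section
variable {k X Y C S i : ℕ}

theorem PolygonInv.congr {x : Instance k × State} {b b' : List ℕ} {s s' : State}
    (h : PolygonInv k X Y C S i x b s) (hr : s'.real = s.real)
    (hint : ∀ c ∈ b', c ∈ b ∧ s'.int c = s.int c) : PolygonInv k X Y C S i x b' s' :=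
  ⟨h.start, h.strict, hr.trans h.real, fun c hc => (hint c hc).2.trans (h.int c (hint c hc).1)⟩

theorem fill_triple (hi : i < k) : Triple (fun x : Instance k × State => offset x.1.1.1 k)
    (fun x s => PolygonInv k X Y C S i x [2, 5, 6, 32, 33, 35] s) fill
    fun x s => PolygonInv k X Y C S i x [2, 5, 6, 32, 33, 35] s ∧ s.int 20 0 = 0 ∧
      s.int 21 0 = (x.1.1.1 i).size ∧
      ∀ p < (x.1.1.1 i).size, s.int 4 p = offset x.1.1.1 i + p := by
  have hn : ∀ x : Instance k × State, 1 ≤ offset x.1.1.1 k := fun x => one_le_offset hi x.1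
  have hsize : ∀ (x : Instance k × State) (s : State),
      PolygonInv k X Y C S i x [2, 5, 6, 32, 33, 35] s →
      s.int 33 0 - s.int 32 0 = (x.1.1.1 i).size ∧ s.int 32 0 = offset x.1.1.1 i := by
    intro x s h
    rw [h.int 33 (by simp), h.int 32 (by simp), h.start.lo, h.start.hi, offset_succ]
    omega
  refine Triple.seq (Mid := fun x s => PolygonInv k X Y C S i x [2, 5, 6, 32, 33, 35] s ∧
      s.int 20 0 = 0 ∧ s.int 21 0 ≤ (x.1.1.1 i).size ∧
      ∀ p < s.int 21 0, s.int 4 p = offset x.1.1.1 i + p) (Triple.wp hn fun x s h => ?_)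
    (Triple.conseq (Triple.loop hn (fun x s => (x.1.1.1 i).size - s.int 21 0) 1 (fun x s h => ?_)
      fun x s h hb => ?_) (fun _ _ h => h) fun x s ⟨h, hb⟩ => ?_)
  · simp only [block, Program.wp, IntExpr.eval, State.writeInt_int_self, State.writeInt_int_of_ne,
      ne_eq, not_false_eq_true, Nat.reduceEqDiff, Function.update_self]
    refine ⟨h.congr rfl fun c hc => ⟨hc, ?_⟩, trivial, Nat.zero_le _, fun p hp => by omega⟩
    rw [State.writeInt_int_of_ne _ _ _ (by rintro rfl; simp at hc),
      State.writeInt_int_of_ne _ _ _ (by rintro rfl; simp at hc)]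
  · have := size_le_offset hi x.1; omega
  · obtain ⟨h1, h2, h3, h4⟩ := h
    obtain ⟨h5, h6⟩ := hsize x s h1
    have hb' : s.int 21 0 < s.int 33 0 - s.int 32 0 := hb
    simp only [block, Program.wp, IntExpr.eval, State.writeInt_int_self, State.writeInt_int_of_ne,
      ne_eq, not_false_eq_true, Nat.reduceEqDiff, Function.update_self]
    refine ⟨⟨h1.congr rfl fun c hc => ⟨hc, ?_⟩, h2, by omega, fun p hp => ?_⟩, by omega⟩
    · rw [State.writeInt_int_of_ne _ _ _ (by rintro rfl; simp at hc),
        State.writeInt_int_of_ne _ _ _ (by rintro rfl; simp at hc)]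
    · rw [Function.update_apply]
      split_ifs with e
      · rw [e, h6]
      · exact h4 p (by omega)
  · obtain ⟨h1, h2, h3, h4⟩ := h
    obtain ⟨h5, h6⟩ := hsize x s h1
    have hb' : ¬ s.int 21 0 < s.int 33 0 - s.int 32 0 := hb
    have e : s.int 21 0 = (x.1.1.1 i).size := by omega
    rw [e] at h4
    exact ⟨h1, h2, e, h4⟩

/-- This is the same removal as before, with the slacks in place of the constants. The edges of a
single polygon are sorted already, so there is nothing to merge. -/
theorem trim_local_triple (hi : i < k) :
    Triple (fun x : Instance k × State => offset x.1.1.1 k)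
    (fun x s => PolygonInv k X Y C S i x [2, 5, 6, 32, 33, 35] s ∧ s.int 20 0 = 0 ∧
      s.int 21 0 = (x.1.1.1 i).size ∧ ∀ p < (x.1.1.1 i).size, s.int 4 p = offset x.1.1.1 i + p)
    (trim 4 X Y S) fun x s => PolygonInv k X Y C S i x [2, 5, 6, 32, 33, 35] s ∧
      Essential (x.2.normal X Y) (x.2.real S) (offset x.1.1.1 i) (offset x.1.1.1 (i + 1))
        (s.int 4) (s.int 20 0) (s.int 21 0) := by
  obtain ⟨K, hK⟩ := trim_ensures (B := 4) (X := X) (Y := Y) (C := S) (Or.inr (by norm_num))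
  refine ⟨K, fun ⟨a, s₀⟩ s ⟨h, h20, h21, h4⟩ => ?_⟩
  simp only at h h20 h21 h4 ⊢
  have hr : s.real = s₀.real := h.real
  have hm : s.normal X Y = s₀.normal X Y := by unfold State.normal; rw [hr]
  obtain ⟨o, ho⟩ := h.strict
  simp only at ho
  have hle := offset_le_offset hi a
  have hsucc := offset_succ a.1.1 i
  have htab := h.start.base.table
  simp only at htab
  have hτ : CyclicOrder (s.normal X Y) (s.int 4) (s.int 20 0) (s.int 21 0) fun p =>
      angle (s.normal X Y (s.int 4 p)) := by
    rw [hm, h20, h21]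
    refine CyclicOrder.of_angle_lt (a.1.1 i).size_pos (fun p _ hp => ?_) (fun p _ hp => ?_)
      fun u hu => ?_
    · rw [h4 p hp]; exact htab.ne_zero (by omega)
    · rw [h4 p (by omega), h4 (p + 1) hp, ← add_assoc]
      exact htab.angle_lt hi (by omega) (by omega)
    · obtain ⟨t, ht, hpos⟩ := htab.exists_dot_pos hi hu
      exact ⟨t, Nat.zero_le _, ht, by rw [h4 t ht]; exact hpos⟩
  refine (hK s o _ hτ fun p hp hp' => ?_).frame.mono (Nat.mul_le_mul_left _ ?_) fun s' _ hs => ?_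
  · rw [hm, hr, h4 p (by omega)]
    exact ho _ (by omega) (by omega)
  · have := size_le_offset hi a; omega
  · obtain ⟨ho', hT⟩ := hs
    refine ⟨h.congr (by
      funext c; exact ho'.2 c (by simp [trim, trimBody, block, Program.WritesReal]))
      fun c hc => ⟨hc, ho'.1 c (by
        simp [trim, trimBody, block, Program.WritesInt]; simp at hc; omega)⟩, ?_⟩
    rw [hm, hr] at hT
    refine ⟨hT.order, fun p hp hp' => hT.strict p (by omega) hp', fun q hq g h1 h2 => ?_,
      fun p hp hp' => ?_, hT.size_le.trans (by omega)⟩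
    · have := hT.implied q hq (g - offset a.1.1 i) (by omega) (by omega)
      rwa [h4 _ (by omega), Nat.add_sub_cancel' h1] at this
    · obtain ⟨p₀, h1, h2, e⟩ := hT.mem p hp hp'
      rw [e, h4 p₀ (by omega)]
      omega

theorem mark_triple (hi : i < k) (hXS : X ≠ S) (hYS : Y ≠ S) (hXC : X ≠ C) (hYC : Y ≠ C) :
    Triple (fun x : Instance k × State => offset x.1.1.1 k)
    (fun x s => PolygonInv k X Y C S i x [2, 5, 6, 32, 33, 35] s ∧
      Essential (x.2.normal X Y) (x.2.real S) (offset x.1.1.1 i) (offset x.1.1.1 (i + 1))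
        (s.int 4) (s.int 20 0) (s.int 21 0)) mark
    fun x s => LocalBase k X Y C S i x.1 s ∧ LocalDone k X Y S i x.1 s := by
  refine Triple.conseq (Pre := fun x s => ∃ s₁ : State,
    PolygonInv k X Y C S i x [2, 6, 32, 33, 35] s ∧
    Essential (x.2.normal X Y) (x.2.real S) (offset x.1.1.1 i) (offset x.1.1.1 (i + 1))
        (s₁.int 4) (s₁.int 20 0) (s₁.int 21 0) ∧ s.int 4 = s₁.int 4 ∧ s.int 21 = s₁.int 21 ∧
    s₁.int 20 0 ≤ s.int 20 0 ∧ s.int 20 0 ≤ s.int 21 0 ∧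
    (∀ g, ¬ KeyOf x.1.1.1 k i g → s.int 5 g = x.2.int 5 g) ∧
    ∀ g, KeyOf x.1.1.1 k i g → (s.int 5 g ≠ 0 ↔ ∃ p, s₁.int 20 0 ≤ p ∧ p < s.int 20 0 ∧
      s.int 4 p = g)) (Triple.ofExists (Triple.conseq (Triple.loop
    (fun x : (Instance k × State) × State => one_le_offset hi x.1.1) (fun x s => s.int 21 0 - s.int 20 0) 1 (fun x s h => ?_) fun x s h hb => ?_)
    (fun _ _ h => h) ?_)) (fun x s h => ?_) fun _ _ h => h
  · obtain ⟨-, hE, -, h21, h1, h2, -⟩ := h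
    have := hE.size_le
    have := size_le_offset hi x.1.1
    rw [offset_succ] at *
    rw [h21] at h2 ⊢
    omega
  · obtain ⟨hP, hE, h4, h21, h1, h2, h5, h6⟩ := h
    have hb' : s.int 20 0 < s.int 21 0 := hb
    have hmem := hE.mem (s.int 20 0) h1 (by rw [← h21]; exact hb')
    have hkey : KeyOf x.1.1.1.1 k i (s.int 4 (s.int 20 0)) := by rw [h4]; exact .inl hmem
    simp only [block, Program.wp, IntExpr.eval, State.writeInt_int_self, State.writeInt_int_of_ne,
      ne_eq, not_false_eq_true, Nat.reduceEqDiff, Function.update_self]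
    refine ⟨⟨hP.congr rfl fun c hc => ⟨hc, ?_⟩, hE, h4, h21, by omega, by omega, fun g hg => ?_,
      fun g hg => ?_⟩, by omega⟩
    · rw [State.writeInt_int_of_ne _ _ _ (by rintro rfl; simp at hc),
        State.writeInt_int_of_ne _ _ _ (by rintro rfl; simp at hc)]
    · rw [Function.update_of_ne (by rintro rfl; exact hg hkey)]; exact h5 g hg
    · rw [Function.update_apply]
      split_ifs with e
      · simp only [one_ne_zero, not_false_eq_true, true_iff]
        exact ⟨s.int 20 0, h1, by omega, e.symm⟩
      · rw [← ne_eq, h6 g hg]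
        constructor
        · rintro ⟨p, hp, hp', e'⟩
          exact ⟨p, hp, by omega, e'⟩
        · rintro ⟨p, hp, hp', e'⟩
          refine ⟨p, hp, ?_, e'⟩
          by_contra hc
          have : p = s.int 20 0 := by omega
          exact e (by rw [← e', this])
  · rintro ⟨⟨a, s₀⟩, s₁⟩ s ⟨⟨hP, hE, h4, h21, h1, h2, h5, h6⟩, hb⟩
    have hb' : ¬ s.int 20 0 < s.int 21 0 := hb
    have hle := offset_le_offset hi a
    have hm : s.normal X Y = s₀.normal X Y := by unfold State.normal; rw [hP.real]
    obtain ⟨τ, hτ⟩ := hE.order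
    obtain ⟨o, ho⟩ := hP.strict
    have e20 : s.int 20 0 = s₁.int 21 0 := by rw [← h21]; omega
    simp only at hE hτ ho h6 h5 h4 e20
    -- The list contains only edges, so neither of the cells for equations gets a mark.
    have hne : ∀ g, KeyOf a.1.1 k i g → offset a.1.1 k ≤ g → ¬ s.int 5 g ≠ 0 := by
      intro g hg hn hc
      obtain ⟨p, hp, hp', e⟩ := (h6 g hg).1 hc
      have := (hE.mem p hp (by omega)).2
      rw [h4] at e
      omega
    refine hP.start.finish hi hXS hYS hXC hYC (.of_int hP.real hP.int h5) ?_
    rw [hm]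
    refine localSystem_polygon hle ho hτ hE.strict hE.implied hE.mem (fun g h1 h2 => ?_)
      (hne _ (.inr (.inl rfl)) (by simp only; omega)) (hne _ (.inr (.inr rfl)) (by simp only; omega))
    rw [h6 g (.inl ⟨h1, h2⟩), e20, h4]
  · obtain ⟨hP, hE⟩ := h
    have h5 := hP.int 5 (by simp)
    obtain ⟨τ, hτ⟩ := hE.order
    refine ⟨s, hP.congr rfl fun c hc => ⟨?_, rfl⟩, hE, rfl, rfl, le_rfl, hτ.lt_hi.le,
      fun g _ => by rw [h5], fun g hg => ?_⟩
    · simp only [List.mem_cons, List.not_mem_nil, or_false] at hc ⊢; omega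
    · rw [h5]
      have := hP.start.keep g hg
      constructor
      · exact fun hc => absurd this hc
      · rintro ⟨p, h1, h2, -⟩; omega

theorem polygonBranch_triple (hi : i < k) (hXS : X ≠ S) (hYS : Y ≠ S) (hXC : X ≠ C) (hYC : Y ≠ C) :
    Triple (fun a : Instance k => offset a.1.1 k)
      (fun a s => LocalStart k X Y C S i a s ∧ ∃ o : Plane, ∀ g, offset a.1.1 i ≤ g →
        g < offset a.1.1 (i + 1) → dot (s.normal X Y g) o < s.real S g) (polygonBranch X Y S)
      fun a s => LocalBase k X Y C S i a s ∧ LocalDone k X Y S i a s :=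
  Triple.conseq (Triple.ofExists (Pre := fun a s₀ s => PolygonInv k X Y C S i (a, s₀)
      [2, 5, 6, 32, 33, 35] s) ((fill_triple hi).seq ((trim_local_triple hi).seq
        (mark_triple hi hXS hYS hXC hYC))))
    (fun _ s h => ⟨s, h.1, h.2, rfl, fun _ _ => rfl⟩) fun _ _ h => h

/-! ### All Minkowski differences -/

/-- Computes an irredundant description of the `i`-th Minkowski difference. -/
def localize (X Y S k i : ℕ) : Program :=
  .seq (localInit S k i) (.seq (classify X Y S)
    (.cond (.intEq (ivar 34) (.lit 0)) (pointBranch X Y k i)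
      (.cond (.intEq (ivar 34) (.lit 1)) (segmentBranch X Y S k i) (polygonBranch X Y S))))

theorem localize_triple (hi : i < k) (hXY : X ≠ Y) (hXS : X ≠ S) (hYS : Y ≠ S) (hCS : C ≠ S)
    (hXC : X ≠ C) (hYC : Y ≠ C) : Triple (fun a : Instance k => offset a.1.1 k)
      (fun a s => LocalBase k X Y C S i a s ∧ ∀ g, KeyOf a.1.1 k i g → s.int 5 g = 0)
      (localize X Y S k i) fun a s => LocalBase k X Y C S i a s ∧ LocalDone k X Y S i a s := by
  have hn : ∀ a : Instance k, 1 ≤ offset a.1.1 k := one_le_offset hi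
  refine (localInit_triple hi hXS hYS hCS).seq ((classify_triple hi).seq (Triple.cond hn
    (Triple.wp hn fun a s ⟨⟨h, hc⟩, hb⟩ => pointBranch_wp hi hXY hXS hYS hXC hYC h hc hb)
    (Triple.cond hn (Triple.conseq (segmentBranch_triple hi hXY hXS hYS hXC hYC)
      (fun a s ⟨⟨⟨h, hc⟩, _⟩, hb⟩ => ⟨h, ?_⟩) fun _ _ h => h)
      (Triple.conseq (polygonBranch_triple hi hXS hYS hXC hYC)
      (fun a s ⟨⟨⟨h, hc⟩, hb⟩, hb'⟩ => ⟨h, ?_⟩) fun _ _ h => h))))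
  · have hb' : s.int 34 0 = 1 := hb
    rwa [hb'] at hc
  · rcases hc with ⟨h1, -⟩ | ⟨h1, -⟩ | ⟨-, h2⟩
    · exact absurd h1 hb
    · exact absurd h1 hb'
    · exact h2

end

/-- The Minkowski differences before the `i`-th one have been treated. -/
structure LocalInv (k X Y C S i : ℕ) (a : Instance k) (s : State) : Prop where
  off : ∀ j ≤ k, s.int 2 j = offset a.1.1 j
  table : EdgeTable k a.1.1 a.1.2 (offset a.1.1 k) (s.normal X Y) (s.real C) (s.int 6)
  slack : ∀ g < offset a.1.1 k, IsSlack (s.normal X Y) (s.real C) (offset a.1.1 k) g (s.real S g)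
  done : ∀ j < i, LocalDone k X Y S j a s
  todo : ∀ j, i ≤ j → j < k → ∀ g, KeyOf a.1.1 k j g → s.int 5 g = 0

theorem localize_all_triple {k X Y C S : ℕ} (hk : 0 < k) (hXY : X ≠ Y) (hXS : X ≠ S) (hYS : Y ≠ S)
    (hCS : C ≠ S) (hXC : X ≠ C) (hYC : Y ≠ C) : Triple (fun a : Instance k => offset a.1.1 k)
      (LocalInv k X Y C S 0) (unroll (localize X Y S k) k) (LocalInv k X Y C S k) := by
  refine Triple.unroll (one_le_offset hk) (fun i => LocalInv k X Y C S i) k fun i hi => ?_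
  refine (localize_triple hi hXY hXS hYS hCS hXC hYC).conseq (fun a s h => ?_) fun a s ⟨h, h'⟩ => ?_
  · exact ⟨⟨h.off, h.table, h.slack, h.done, fun j hj => h.todo j hj.le⟩, h.todo i le_rfl hi⟩
  · refine ⟨h.off, h.table, h.slack, fun j hj => ?_, fun j hj => h.todo j hj⟩
    rcases (Nat.lt_succ_iff.1 hj).lt_or_eq with hj | rfl
    · exact h.done j hj
    · exact h'

end RealRAM

/-! ### Eliminating the translation -/

theorem exists_keyOf {Q : ℕ → ConvexPolygon} {k g : ℕ} (hg : g < offset Q k + (k + k)) :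
    ∃ i < k, KeyOf Q k i g := by
  by_cases h : g < offset Q k
  · obtain ⟨i, hi, t, ht, rfl⟩ := exists_offset_add_eq Q h
    exact ⟨i, hi, .inl ⟨by omega, by rw [offset_succ]; omega⟩⟩
  · refine ⟨(g - offset Q k) / 2, by omega, .inr ?_⟩
    omega

theorem KeyOf.lt {Q : ℕ → ConvexPolygon} {k i g : ℕ} (hi : i < k) (h : KeyOf Q k i g) :
    g < offset Q k + (k + k) := by
  have := offset_mono Q (show i + 1 ≤ k by omega)
  rcases h with h | h | h <;> omega

/-- The coefficients at the `i`-th vector in the constraint `g` after the elimination of the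
translation by means of the equations `g₁` and `g₂`. -/
noncomputable def gaugeCoef (m : ℕ → Plane) (own : ℕ → ℕ) (g₁ g₂ g i : ℕ) : Plane :=
  (if own g = i then m g else 0) -
    (if own g₁ = i then (cross (m g) (m g₂) / cross (m g₁) (m g₂)) • m g₁ else 0) -
    (if own g₂ = i then (cross (m g₁) (m g) / cross (m g₁) (m g₂)) • m g₂ else 0)

noncomputable def gaugeForm (k : ℕ) (m : ℕ → Plane) (own : ℕ → ℕ) (g₁ g₂ g : ℕ) :
    (Fin k → Plane) →ₗ[ℝ] ℝ where
  toFun y := ∑ i : Fin k, dot (gaugeCoef m own g₁ g₂ g i) (y i)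
  map_add' x y := by simp only [Pi.add_apply, dot_add, Finset.sum_add_distrib]
  map_smul' r y := by
    simp only [Pi.smul_apply, dot_smul, RingHom.id_apply, smul_eq_mul, Finset.mul_sum]

/-- The vector whose products with `m g₁` and `m g₂` are those of `a` and `b`. -/
noncomputable def gaugePoint (m : ℕ → Plane) (g₁ g₂ : ℕ) (a b : Plane) : Plane :=
  (dot (m g₁) a / cross (m g₁) (m g₂)) • ((m g₂).2, -(m g₂).1) +
    (dot (m g₂) b / cross (m g₁) (m g₂)) • (-(m g₁).2, (m g₁).1)

section
variable {k : ℕ} {Q : ℕ → ConvexPolygon} {m : ℕ → Plane} {S : ℕ → ℝ} {own : ℕ → ℕ}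
  {keep : ℕ → Prop} {g₁ g₂ : ℕ}

theorem dot_gaugePoint_left (h : cross (m g₁) (m g₂) ≠ 0) (a b : Plane) :
    dot (m g₁) (gaugePoint m g₁ g₂ a b) = dot (m g₁) a := by
  unfold gaugePoint
  rw [dot_add, dot_smul, dot_smul]
  have e1 : dot (m g₁) ((m g₂).2, -(m g₂).1) = cross (m g₁) (m g₂) := by unfold dot cross; ring
  have e2 : dot (m g₁) (-(m g₁).2, (m g₁).1) = 0 := by unfold dot; ring
  rw [e1, e2, div_mul_cancel₀ _ h, mul_zero, add_zero]

theorem dot_gaugePoint_right (h : cross (m g₁) (m g₂) ≠ 0) (a b : Plane) :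
    dot (m g₂) (gaugePoint m g₁ g₂ a b) = dot (m g₂) b := by
  unfold gaugePoint
  rw [dot_add, dot_smul, dot_smul]
  have e1 : dot (m g₂) ((m g₂).2, -(m g₂).1) = 0 := by unfold dot; ring
  have e2 : dot (m g₂) (-(m g₁).2, (m g₁).1) = cross (m g₁) (m g₂) := by unfold dot cross; ring
  rw [e1, e2, div_mul_cancel₀ _ h, mul_zero, zero_add]

/-- Two equations with independent normals determine the translation, by Cramer's rule. -/
theorem eq_gaugePoint (h : cross (m g₁) (m g₂) ≠ 0) {a b u : Plane}
    (h1 : dot (m g₁) (a - u) = 0) (h2 : dot (m g₂) (b - u) = 0) :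
    u = gaugePoint m g₁ g₂ a b := by
  rw [dot_sub, sub_eq_zero] at h1 h2
  unfold gaugePoint
  rw [h1, h2]
  unfold dot cross at *
  ext
  · simp only [Prod.fst_add, Prod.smul_mk, smul_eq_mul]; field_simp; ring
  · simp only [Prod.snd_add, Prod.smul_mk, smul_eq_mul]; field_simp; ring

theorem dot_zero_left (a : Plane) : dot 0 a = 0 := by simp [dot]

theorem dot_ite (p : Prop) [Decidable p] (a b : Plane) :
    dot (if p then a else 0) b = if p then dot a b else 0 := by
  split_ifs
  · rfl
  · exact dot_zero_left b

/-- Expanding `m g` in the basis `m g₁`, `m g₂` expresses its product with the gauge point by the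
vectors of the owners of `g₁` and `g₂`. The coefficients of this expansion are the quotients in
`gaugeCoef`. -/
theorem gaugeForm_eq {g : ℕ} {i i₁ i₂ : Fin k} (hi : own g = i) (hi₁ : own g₁ = i₁)
    (hi₂ : own g₂ = i₂) (y : Fin k → Plane) : gaugeForm k m own g₁ g₂ g y =
      dot (m g) (y i - gaugePoint m g₁ g₂ (y i₁) (y i₂)) := by
  have hsub : ∀ a b c d : Plane, dot (a - b - c) d = dot a d - dot b d - dot c d := by
    intro a b c d; unfold dot; simp only [Prod.fst_sub, Prod.snd_sub]; ring
  have hsum : ∀ (j : Fin k) (a : Plane),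
      ∑ x : Fin k, dot (if (j : ℕ) = x then a else 0) (y x) = dot a (y j) := by
    intro j a
    simp only [dot_ite, Fin.val_inj, Finset.sum_ite_eq, Finset.mem_univ, if_true]
  show ∑ x : Fin k, dot (gaugeCoef m own g₁ g₂ g x) (y x) = _
  simp only [gaugeCoef, hsub, Finset.sum_sub_distrib, hi, hi₁, hi₂, hsum]
  unfold gaugePoint
  simp only [dot, cross, Prod.fst_sub, Prod.snd_sub, Prod.fst_add, Prod.snd_add, Prod.smul_fst,
    Prod.smul_snd, Prod.smul_mk, smul_eq_mul]
  ring

/-- The constraint `g`, with the translation eliminated. -/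
def GaugeHolds (k : ℕ) (m : ℕ → Plane) (S : ℕ → ℝ) (own : ℕ → ℕ) (n g₁ g₂ g : ℕ)
    (y : Fin k → Plane) : Prop :=
  (g < n → gaugeForm k m own g₁ g₂ g y ≤ S g) ∧ (n ≤ g → gaugeForm k m own g₁ g₂ g y = 0)

/-- The constraints that describe the Minkowski differences; the equations `g₁` and `g₂` are to be
used for eliminating the translation. -/
structure Gauge (k : ℕ) (Q : ℕ → ConvexPolygon) (m : ℕ → Plane) (S : ℕ → ℝ) (own : ℕ → ℕ)
    (keep : ℕ → Prop) (g₁ g₂ : ℕ) : Prop where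
  system : ∀ i < k, LocalSystem m S (offset Q k) (offset Q i) (offset Q (i + 1))
    (offset Q k + (i + i)) keep
  zero_mem : ∀ i < k, (0 : Plane) ∈ localSet m S (offset Q i) (offset Q (i + 1))
  own : ∀ i < k, ∀ g, KeyOf Q k i g → own g = i
  left : offset Q k ≤ g₁ ∧ g₁ < offset Q k + (k + k) ∧ keep g₁
  right : offset Q k ≤ g₂ ∧ g₂ < offset Q k + (k + k) ∧ keep g₂
  cross_ne : cross (m g₁) (m g₂) ≠ 0

theorem Gauge.exists_owner (h : Gauge k Q m S own keep g₁ g₂) {g : ℕ}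
    (hg : g < offset Q k + (k + k)) : ∃ i : Fin k, own g = i ∧ KeyOf Q k i g := by
  obtain ⟨i, hi, hkey⟩ := exists_keyOf hg
  exact ⟨⟨i, hi⟩, h.own i hi g hkey, hkey⟩

theorem Gauge.gaugeHolds_iff (h : Gauge k Q m S own keep g₁ g₂) {i₁ i₂ : Fin k}
    (hi₁ : own g₁ = i₁) (hi₂ : own g₂ = i₂) {g : ℕ} {i : Fin k} (hi : KeyOf Q k i g)
    (y : Fin k → Plane) : GaugeHolds k m S own (offset Q k) g₁ g₂ g y ↔
      KeyHolds m S (offset Q k) g (y i - gaugePoint m g₁ g₂ (y i₁) (y i₂)) := by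
  unfold GaugeHolds KeyHolds
  rw [gaugeForm_eq (h.own i i.2 g hi) hi₁ hi₂]

/-- The equations `g₁` and `g₂` force `u` to be the gauge point, which can be substituted into the
remaining constraints. Conversely, the gauge point satisfies these two equations by construction. -/
theorem Gauge.exists_translate_iff (h : Gauge k Q m S own keep g₁ g₂) (y : Fin k → Plane) :
    (∃ u : Plane, ∀ i : Fin k, y i - u ∈ localSet m S (offset Q i) (offset Q (i + 1))) ↔
      ∀ g < offset Q k + (k + k), keep g ∧ g ≠ g₁ ∧ g ≠ g₂ →
        GaugeHolds k m S own (offset Q k) g₁ g₂ g y := by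
  obtain ⟨i₁, hi₁, hkey₁⟩ := h.exists_owner h.left.2.1
  obtain ⟨i₂, hi₂, hkey₂⟩ := h.exists_owner h.right.2.1
  constructor
  · rintro ⟨u, hu⟩ g hg ⟨hk, -, -⟩
    have hu' := fun i : Fin k => ((h.system i i.2).sound _).1 (hu i)
    obtain ⟨i, -, hkey⟩ := h.exists_owner hg
    rw [h.gaugeHolds_iff hi₁ hi₂ hkey, ← eq_gaugePoint h.cross_ne
      ((hu' i₁ g₁ hkey₁ h.left.2.2).2 h.left.1) ((hu' i₂ g₂ hkey₂ h.right.2.2).2 h.right.1)]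
    exact hu' i g hkey hk
  · intro hy
    refine ⟨gaugePoint m g₁ g₂ (y i₁) (y i₂), fun i => ((h.system i i.2).sound _).2
      fun g hkey hk => ?_⟩
    by_cases e₁ : g = g₁
    · subst e₁
      have : i = i₁ := Fin.ext (KeyOf.unique i.2 i₁.2 hkey hkey₁)
      subst this
      exact .of_le h.left.1 (by rw [dot_sub, dot_gaugePoint_left h.cross_ne, sub_self])
    by_cases e₂ : g = g₂
    · subst e₂
      have : i = i₂ := Fin.ext (KeyOf.unique i.2 i₂.2 hkey hkey₂)
      subst this
      exact .of_le h.right.1 (by rw [dot_sub, dot_gaugePoint_right h.cross_ne, sub_self])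
    rw [← h.gaugeHolds_iff hi₁ hi₂ hkey]
    exact hy g (KeyOf.lt i.2 hkey) ⟨hk, e₁, e₂⟩

/-- Take a vector violating only `g` in the factor to which `g` belongs, and zero in all other
factors. The equations `g₁` and `g₂` still hold with translation zero, so the gauge point is zero
and the elimination changes nothing. -/
theorem Gauge.exists_only_violated (h : Gauge k Q m S own keep g₁ g₂) {g : ℕ}
    (hg : g < offset Q k + (k + k)) (hk : keep g ∧ g ≠ g₁ ∧ g ≠ g₂) : ∃ y : Fin k → Plane,
      ¬ GaugeHolds k m S own (offset Q k) g₁ g₂ g y ∧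
      ∀ g' < offset Q k + (k + k), keep g' ∧ g' ≠ g₁ ∧ g' ≠ g₂ → g' ≠ g →
        GaugeHolds k m S own (offset Q k) g₁ g₂ g' y := by
  obtain ⟨i₁, hi₁, hkey₁⟩ := h.exists_owner h.left.2.1
  obtain ⟨i₂, hi₂, hkey₂⟩ := h.exists_owner h.right.2.1
  obtain ⟨i, -, hkey⟩ := h.exists_owner hg
  obtain ⟨x, hx, hx'⟩ := (h.system i i.2).irredundant g hkey hk.1
  have main : ∀ g', ∀ j : Fin k, KeyOf Q k j g' → keep g' → g' ≠ g →
      KeyHolds m S (offset Q k) g' (Function.update (0 : Fin k → Plane) i x j) := by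
    intro g' j hj hk' hne
    by_cases e : j = i
    · subst e; rw [Function.update_self]; exact hx' g' hj hk' hne
    · rw [Function.update_of_ne e]
      exact ((h.system j j.2).sound 0).1 (h.zero_mem j j.2) g' hj hk'
  have h0 : gaugePoint m g₁ g₂ (Function.update (0 : Fin k → Plane) i x i₁)
      (Function.update (0 : Fin k → Plane) i x i₂) = 0 := by
    refine (eq_gaugePoint h.cross_ne ?_ ?_).symm
    · rw [sub_zero]
      exact (main g₁ i₁ hkey₁ h.left.2.2 hk.2.1.symm).2 h.left.1
    · rw [sub_zero]
      exact (main g₂ i₂ hkey₂ h.right.2.2 hk.2.2.symm).2 h.right.1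
  refine ⟨Function.update 0 i x, ?_, fun g' hg' hk' hne => ?_⟩
  · rw [h.gaugeHolds_iff hi₁ hi₂ hkey, h0, sub_zero, Function.update_self]; exact hx
  · obtain ⟨j, -, hj⟩ := h.exists_owner hg'
    rw [h.gaugeHolds_iff hi₁ hi₂ hj, h0, sub_zero]
    exact main g' j hj hk'.1 hne

theorem localSet_segment {lo hi : ℕ} {y u : Plane} {s t : ℝ} (hy : y ∈ localSet m S lo hi)
    (ht : y + t • u ∈ localSet m S lo hi) (hs : 0 ≤ s) (hst : s ≤ t) :
    y + s • u ∈ localSet m S lo hi := by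
  intro g h1 h2
  have h3 := hy g h1 h2
  have h4 := ht g h1 h2
  rw [dot_add, dot_smul] at h4 ⊢
  rcases le_total (dot (m g) u) 0 with h | h
  · nlinarith
  · nlinarith

/-- There are enough equations for eliminating the translation. -/
theorem exists_equation (hk : 0 < k) (hsys : ∀ i < k, LocalSystem m S (offset Q k) (offset Q i)
      (offset Q (i + 1)) (offset Q k + (i + i)) keep)
    (hinj : ∀ (y : Fin k → Plane) (u : Plane),
      (∀ i : Fin k, y i ∈ localSet m S (offset Q i) (offset Q (i + 1))) →
      (∀ i : Fin k, y i + u ∈ localSet m S (offset Q i) (offset Q (i + 1))) → u = 0)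
    {u : Plane} (hu : u ≠ 0) :
    ∃ g, offset Q k ≤ g ∧ g < offset Q k + (k + k) ∧ keep g ∧ dot (m g) u ≠ 0 := by
  by_contra hc
  push Not at hc
  -- If all equations annihilated `u`, every factor would contain a segment in the direction `u`.
  -- The shortest of the steps moves all factors at once, against injectivity.
  have hw : ∀ i : Fin k, ∃ y ∈ localSet m S (offset Q i) (offset Q (i + 1)), ∃ t : ℝ, 0 < t ∧
      y + t • u ∈ localSet m S (offset Q i) (offset Q (i + 1)) := fun i =>
    (hsys i i.2).wide u fun g hg hkg hn => hc g hn (KeyOf.lt i.2 hg) hkg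
  choose y hy t ht hyt using hw
  have : Nonempty (Fin k) := ⟨⟨0, hk⟩⟩
  obtain ⟨i₀, hi₀⟩ := Finite.exists_min t
  have := hinj y (t i₀ • u) hy fun i => localSet_segment (hy i) (hyt i) (ht i₀).le (hi₀ i)
  exact (smul_ne_zero (ht i₀).ne' hu) this

/-- The set of maximal placements in terms of the constraints. -/
theorem mem_maximizers_iff {V : ℕ → Plane} {c : ℕ → ℝ} (hk : 0 < k)
    (hmax : toConfig (fun i : Fin k => V i) ∈ maximizers fun i : Fin k => Q i)
    (ht : EdgeTable k Q V (offset Q k) m c own)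
    (hS : ∀ g < offset Q k, IsSlack m c (offset Q k) g (S g)) :
    (∀ w : Fin k → Plane, toConfig w ∈ maximizers (fun i : Fin k => Q i) ↔
      ∃ u : Plane, ∀ i : Fin k, V i - w i - u ∈ localSet m S (offset Q i) (offset Q (i + 1))) ∧
    ∀ (y : Fin k → Plane) (u : Plane),
      (∀ i : Fin k, y i ∈ localSet m S (offset Q i) (offset Q (i + 1))) →
      (∀ i : Fin k, y i + u ∈ localSet m S (offset Q i) (offset Q (i + 1))) → u = 0 := by
  have hb := bijOn_toConfig hk hmax
  have hmem : ∀ x : Fin k → Plane, x ∈ differenceProduct (fun i : Fin k => Q i)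
      (overlap (fun i : Fin k => Q i) fun i : Fin k => V i) ↔
      ∀ i : Fin k, V i - x i ∈ localSet m S (offset Q i) (offset Q (i + 1)) := by
    intro x
    unfold differenceProduct
    rw [Set.mem_univ_pi]
    refine forall_congr' fun i => ?_
    have e1 : x i ∈ minkowskiDiff (-(Q i).region) (-overlap (fun i : Fin k => Q i)
        fun i : Fin k => V i) ↔ ∀ q ∈ feasible m c (offset Q k), q - x i ∈ (Q i).region := by
      rw [ht.overlap_eq]
      unfold minkowskiDiff
      simp only [Set.mem_ofPred_eq, Set.subset_def, Set.mem_vadd_set, Set.mem_neg, vadd_eq_add]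
      constructor
      · intro h q hq
        have := h (x i + -q) ⟨-q, by rwa [neg_neg], rfl⟩
        rwa [neg_add, neg_neg, neg_add_eq_sub] at this
      · rintro h _ ⟨q, hq, rfl⟩
        rw [show -(x i + q) = -q - x i by abel]
        exact h _ hq
    rw [e1]
    have e2 : ∀ q : Plane, q - x i ∈ (Q i).region ↔
        ∀ t < (Q i).size, dot (m (offset Q i + t)) q + dot (m (offset Q i + t)) (V i - x i) ≤
          c (offset Q i + t) := by
      intro q
      rw [show q - x i = q + (V i - x i) - V i by abel, ← ht.forall_iff i.2]
      simp only [dot_add]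
    simp only [e2]
    -- Only a point of `I` that is extreme in the direction of the side matters; its distance to the
    -- side is the slack.
    constructor
    · intro h g h1 h2
      obtain ⟨t, rfl⟩ := Nat.exists_eq_add_of_le h1
      rw [offset_succ] at h2
      obtain ⟨w, hw, e, -⟩ := hS _ (offset_add_lt Q i.2 (show t < (Q i).size by omega))
      have := h w hw t (by omega)
      rw [e]; linarith
    · intro h q hq t ht'
      obtain ⟨w, -, e, hw⟩ := hS _ (offset_add_lt Q i.2 ht')
      have h1 := h (offset Q i + t) (by omega) (by rw [offset_succ]; omega)
      have h2 := hw q hq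
      rw [e] at h1; linarith
  have hcfg : ∀ x w : Fin k → Plane, toConfig x = toConfig w ↔ ∃ u, x = fun i => w i + u := by
    intro x w
    rw [eq_comm, toConfig_eq_iff]
    exact exists_congr fun u => ⟨fun h => funext fun i => by rw [h, add_comm],
      fun h i => by rw [h, add_comm]⟩
  refine ⟨fun w => ⟨fun hw => ?_, fun ⟨u, hu⟩ => ?_⟩, fun y u hy hyu => ?_⟩
  · obtain ⟨x, hx, hxw⟩ := hb.surjOn hw
    obtain ⟨u, rfl⟩ := (hcfg x w).1 hxw
    refine ⟨u, fun i => ?_⟩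
    have := (hmem _).1 hx i
    rwa [← sub_sub] at this
  · rw [← (hcfg (fun i => w i + u) w).2 ⟨u, rfl⟩]
    refine hb.mapsTo ((hmem _).2 fun i => ?_)
    rw [← sub_sub]; exact hu i
  · have h1 : (fun i : Fin k => V i - y i) ∈ differenceProduct (fun i : Fin k => Q i)
        (overlap (fun i : Fin k => Q i) fun i : Fin k => V i) := (hmem _).2 fun i => by
      simp only [sub_sub_cancel]; exact hy i
    have h2 : (fun i : Fin k => V i - (y i + u)) ∈ differenceProduct (fun i : Fin k => Q i)
        (overlap (fun i : Fin k => Q i) fun i : Fin k => V i) := (hmem _).2 fun i => by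
      simp only [sub_sub_cancel]; exact hyu i
    have := congrFun (hb.injOn h1 h2 ((hcfg _ _).2 ⟨u, funext fun i => by abel⟩)) ⟨0, hk⟩
    simpa using this

end

/-! ### Choosing two equations with independent normals. -/

namespace RealRAM

def firstTest : Test :=
  .and (.not (.intEq (.cell 5 (ivar 30)) (.lit 0))) (.intEq (ivar 31) (ivar 33))

def secondTest (X Y : ℕ) : Test :=
  .and (.and (.not (.intEq (.cell 5 (ivar 30)) (.lit 0)))
    (.not (.realEq (crossExpr X Y (ivar 39) (ivar 30)) (.lit 0)))) (.intEq (ivar 31) (ivar 33))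

/-- Chooses two equations for eliminating the translation. -/
def chooseGauge (X Y k : ℕ) : Program :=
  .seq (block [setVar 32 (.cell 2 (.lit k)), setVar 33 (.add (.cell 2 (.lit k)) (.lit (k + k)))])
    (.seq (search firstTest) (.seq (setVar 39 (ivar 31)) (.seq (search (secondTest X Y))
      (block [setVar 40 (ivar 31), .setInt 5 (ivar 39) (.lit 0), .setInt 5 (ivar 40) (.lit 0)]))))

/-- The equations for eliminating the translation are known. -/
structure GaugeInv (k X Y C S : ℕ) (a : Instance k) (s : State) : Prop where
  off : s.int 2 k = offset a.1.1 k
  table : EdgeTable k a.1.1 a.1.2 (offset a.1.1 k) (s.normal X Y) (s.real C) (s.int 6)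
  slack : ∀ g < offset a.1.1 k, IsSlack (s.normal X Y) (s.real C) (offset a.1.1 k) g (s.real S g)
  zero : ∀ g, offset a.1.1 k ≤ g → g < offset a.1.1 k + (k + k) → s.real S g = 0
  gauge : ∃ keep : ℕ → Prop, Gauge k a.1.1 (s.normal X Y) (s.real S) (s.int 6) keep (s.int 39 0)
    (s.int 40 0) ∧ ∀ g, s.int 5 g ≠ 0 ↔ keep g ∧ g ≠ s.int 39 0 ∧ g ≠ s.int 40 0

/-- The state during the search for the equations. -/
structure ChoiceInv (k X Y C S : ℕ) (x : Instance k × State) (s : State) : Prop where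
  inv : LocalInv k X Y C S k x.1 x.2
  real : s.real = x.2.real
  int : ∀ b ∈ [2, 5, 6], s.int b = x.2.int b
  lo : s.int 32 0 = offset x.1.1.1 k
  hi : s.int 33 0 = offset x.1.1.1 k + (k + k)

section
variable {k X Y C S : ℕ}

theorem ChoiceInv.congr {x : Instance k × State} {s s' : State} (h : ChoiceInv k X Y C S x s)
    (hr : s'.real = s.real) (hint : ∀ b ∈ [2, 5, 6, 32, 33], s'.int b = s.int b) :
    ChoiceInv k X Y C S x s' :=
  ⟨h.inv, hr.trans h.real, fun b hb => (hint b (by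
    simp only [List.mem_cons, List.not_mem_nil, or_false] at hb ⊢; omega)).trans (h.int b hb),
    by rw [hint 32 (by simp), h.lo], by rw [hint 33 (by simp), h.hi]⟩

theorem LocalInv.exists_equation {a : Instance k} {s : State} (h : LocalInv k X Y C S k a s)
    (hk : 0 < k) {u : Plane} (hu : u ≠ 0) : ∃ g, offset a.1.1 k ≤ g ∧
      g < offset a.1.1 k + (k + k) ∧ s.int 5 g ≠ 0 ∧ dot (s.normal X Y g) u ≠ 0 :=
  _root_.exists_equation hk (fun i hi => (h.done i hi).system)
    (mem_maximizers_iff hk a.2 h.table h.slack).2 hu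

/-- An equation with zero normal would hold everywhere, against irredundancy. -/
theorem LocalInv.ne_zero {a : Instance k} {s : State} (h : LocalInv k X Y C S k a s) {g : ℕ}
    (hg : offset a.1.1 k ≤ g) (hg' : g < offset a.1.1 k + (k + k)) (hk : s.int 5 g ≠ 0) :
    s.normal X Y g ≠ 0 := by
  intro h0
  obtain ⟨i, hi, hkey⟩ := exists_keyOf hg'
  obtain ⟨y, hy, -⟩ := (h.done i hi).system.irredundant g hkey hk
  exact hy (.of_le hg (by rw [h0, dot_zero_left]))

theorem first_triple (hk : 0 < k) : Triple (fun x : Instance k × State => offset x.1.1.1 k)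
    (fun x s => ChoiceInv k X Y C S x s) (search firstTest)
    fun x s => ChoiceInv k X Y C S x s ∧ offset x.1.1.1 k ≤ s.int 31 0 ∧
      s.int 31 0 < offset x.1.1.1 k + (k + k) ∧ x.2.int 5 (s.int 31 0) ≠ 0 := by
  have hn : ∀ x : Instance k × State, 1 ≤ offset x.1.1.1 k := fun x => one_le_offset hk x.1
  refine Triple.conseq (Triple.search hn (fun x => offset x.1.1.1 k)
    (fun x => offset x.1.1.1 k + (k + k)) (fun x g => x.2.int 5 g ≠ 0)
    (fun _ _ _ => False) (k + k) (fun x => ?_) ?_ ?_ (fun _ _ h => h) (fun _ _ _ _ h => h.elim) ?_)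
    (fun _ _ h => h) ?_
  · have := Nat.mul_le_mul_left (k + k) (hn x); omega
  · rintro x s s' h ⟨hr, hs⟩
    exact h.congr hr fun b hb => hs b (by rintro rfl; simp at hb) (by rintro rfl; simp at hb)
  · rintro x s h
    exact ⟨h.lo, h.hi, by omega⟩
  · rintro x s h - - -
    simp only [firstTest, Test.Holds, IntExpr.eval, h.int 5 (by simp), h.hi, or_false, ne_eq]
  · rintro x s ⟨h, hopt⟩
    rcases hopt with ⟨-, hopt⟩ | ⟨h1, h2, h3, -⟩
    · obtain ⟨g, h1, h2, h3, -⟩ := h.inv.exists_equation hk (u := (1, 0)) (by simp)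
      exact absurd h3 (hopt g h1 h2)
    · exact ⟨h, h1, h2, h3⟩

/-- Applied to the first normal turned by a right angle, `LocalInv.exists_equation` yields an
equation whose normal is not parallel to the first one. -/
theorem second_triple (hk : 0 < k) :
    Triple (fun x : Instance k × State => offset x.1.1.1 k)
    (fun x s => ChoiceInv k X Y C S x s ∧ offset x.1.1.1 k ≤ s.int 39 0 ∧
      s.int 39 0 < offset x.1.1.1 k + (k + k) ∧ x.2.int 5 (s.int 39 0) ≠ 0) (search (secondTest X Y))
    fun x s => (ChoiceInv k X Y C S x s ∧ offset x.1.1.1 k ≤ s.int 39 0 ∧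
      s.int 39 0 < offset x.1.1.1 k + (k + k) ∧ x.2.int 5 (s.int 39 0) ≠ 0) ∧
      offset x.1.1.1 k ≤ s.int 31 0 ∧ s.int 31 0 < offset x.1.1.1 k + (k + k) ∧
      x.2.int 5 (s.int 31 0) ≠ 0 ∧
      cross (x.2.normal X Y (s.int 39 0)) (x.2.normal X Y (s.int 31 0)) ≠ 0 := by
  have hn : ∀ x : Instance k × State, 1 ≤ offset x.1.1.1 k := fun x => one_le_offset hk x.1
  refine Triple.conseq (Pre := fun x s => ∃ g₁, (ChoiceInv k X Y C S x s ∧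
    offset x.1.1.1 k ≤ s.int 39 0 ∧ s.int 39 0 < offset x.1.1.1 k + (k + k) ∧
    x.2.int 5 (s.int 39 0) ≠ 0) ∧ s.int 39 0 = g₁)
    (Triple.ofExists (Triple.conseq (Triple.search
    (fun y : (Instance k × State) × ℕ => hn y.1) (fun y => offset y.1.1.1.1 k)
    (fun y => offset y.1.1.1.1 k + (k + k)) (fun y g => y.1.2.int 5 g ≠ 0 ∧
      cross (y.1.2.normal X Y y.2) (y.1.2.normal X Y g) ≠ 0)
    (fun _ _ _ => False) (k + k) (fun y => ?_) ?_ ?_ (fun _ _ h => h) (fun _ _ _ _ h => h.elim) ?_)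
    (fun _ _ h => h) ?_)) (fun x s h => ⟨_, h, rfl⟩) fun _ _ h => h
  · have := Nat.mul_le_mul_left (k + k) (hn y.1); omega
  · rintro x s s' ⟨⟨h, h1⟩, h2⟩ ⟨hr, hs⟩
    have h39 : s'.int 39 = s.int 39 := hs 39 (by omega) (by omega)
    rw [h39]
    exact ⟨⟨h.congr hr fun b hb => hs b (by rintro rfl; simp at hb) (by rintro rfl; simp at hb),
      h1⟩, h2⟩
  · rintro x s ⟨⟨h, -⟩, -⟩
    exact ⟨h.lo, h.hi, by omega⟩
  · rintro x s ⟨⟨h, -⟩, h2⟩ - - -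
    have hm : s.normal X Y = x.1.2.normal X Y := by unfold State.normal; rw [h.real]
    simp only [secondTest, Test.Holds, RealExpr.eval, eval_crossExpr, IntExpr.eval,
      h.int 5 (by simp), h.hi, hm, h2, or_false, ne_eq, Rat.cast_zero]
  · rintro ⟨x, g₁⟩ s ⟨⟨⟨h, h1, h2, h3⟩, rfl⟩, hopt⟩
    rcases hopt with ⟨-, hopt⟩ | ⟨h4, h5, h6, -⟩
    · have h0 := h.inv.ne_zero h1 h2 h3
      obtain ⟨g, h4, h5, h6, h7⟩ := h.inv.exists_equation hk
        (u := turn (x.2.normal X Y (s.int 39 0))) (by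
          intro e
          apply h0
          simp only [turn, Prod.mk_eq_zero, neg_eq_zero] at e
          exact Prod.ext e.2 e.1)
      rw [dot_turn] at h7
      exact absurd ⟨h6, h7⟩ (hopt g h4 h5)
    · exact ⟨⟨h, h1, h2, h3⟩, h4, h5, h6⟩

theorem chooseGauge_triple (hk : 0 < k) : Triple (fun a : Instance k => offset a.1.1 k)
    (LocalInv k X Y C S k) (chooseGauge X Y k) (GaugeInv k X Y C S) := by
  have hn : ∀ a : Instance k, 1 ≤ offset a.1.1 k := one_le_offset hk
  refine Triple.seq (Mid := fun a s => ∃ s₀ : State, ChoiceInv k X Y C S (a, s₀) s)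
    (Triple.wp hn fun a s h => ?_) (Triple.ofExists ((first_triple hk).seq (Triple.seq
      (Triple.wp (fun x => hn x.1) fun x s h => ?_) ((second_triple (C := C) (S := S) hk).seq
        (Triple.wp (fun x => hn x.1) fun x s h => ?_)))))
  · simp only [block, Program.wp, IntExpr.eval, State.writeInt_int_self, State.writeInt_int_of_ne,
      ne_eq, not_false_eq_true, Nat.reduceEqDiff, Function.update_self]
    refine ⟨s, h, rfl, fun b hb => ?_, ?_, ?_⟩
    · rw [State.writeInt_int_of_ne _ _ _ (by rintro rfl; simp at hb),
        State.writeInt_int_of_ne _ _ _ (by rintro rfl; simp at hb)]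
    · rw [State.writeInt_int_of_ne _ _ _ (by omega), State.writeInt_int_self, Function.update_self,
        h.off k le_rfl]
    · rw [State.writeInt_int_self, Function.update_self, h.off k le_rfl]
  · obtain ⟨h, h1⟩ := h
    refine ⟨h.congr rfl fun b hb => State.writeInt_int_of_ne _ _ _ (by rintro rfl; simp at hb), ?_⟩
    simp only [IntExpr.eval, State.writeInt_int_self, Function.update_self]
    exact h1
  · obtain ⟨⟨h, h1, h2, h3⟩, h4, h5, h6, h7⟩ := h
    have hm : s.normal X Y = x.2.normal X Y := by unfold State.normal; rw [h.real]
    simp only [block, Program.wp, IntExpr.eval, State.writeInt_int_self, State.writeInt_int_of_ne,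
      ne_eq, not_false_eq_true, Nat.reduceEqDiff, Function.update_self]
    have e2 := h.int 2 (by simp)
    have e6 := h.int 6 (by simp)
    have e5 := h.int 5 (by simp)
    refine ⟨?_, ?_, ?_, ?_, fun g => x.2.int 5 g ≠ 0, ⟨fun i hi => ?_, fun i hi => ?_,
      fun i hi g hg => ?_, ?_, ?_, ?_⟩, fun g => ?_⟩
    all_goals
      simp only [State.writeInt_int_self, State.writeInt_int_of_ne, State.normal_writeInt,
        State.writeInt_real, ne_eq, not_false_eq_true, Nat.reduceEqDiff, Function.update_self, hm,
        h.real, e2, e6, e5]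
    · exact h.inv.off k le_rfl
    · exact h.inv.table
    · exact h.inv.slack
    · intro g hg hg'
      obtain ⟨i, hi, hkey⟩ := exists_keyOf hg'
      rcases hkey with ⟨-, hkey⟩ | rfl | rfl
      · have := offset_mono x.1.1.1 (show i + 1 ≤ k by omega); omega
      · exact (h.inv.done i hi).slack
      · exact (h.inv.done i hi).slack'
    · exact (h.inv.done i hi).system
    · intro g hg hg'
      have hlt := offset_mono x.1.1.1 (show i + 1 ≤ k by omega)
      obtain ⟨w, hw, e, -⟩ := h.inv.slack g (by omega)
      rw [dot_zero, e]
      exact sub_nonneg.2 (hw g (by omega))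
    · rcases hg with ⟨hg, hg'⟩ | rfl | rfl
      · obtain ⟨t, rfl⟩ := Nat.exists_eq_add_of_le hg
        rw [offset_succ] at hg'
        exact (h.inv.table i hi t (by omega) (offset_add_lt _ hi (by omega))).2.2
      · exact (h.inv.done i hi).own
      · exact (h.inv.done i hi).own'
    · exact ⟨h1, h2, h3⟩
    · exact ⟨h4, h5, h6⟩
    · exact h7
    · simp only [Function.update_apply]
      split_ifs with e e' <;> simp_all

end

/-! ### Writing the constraints after the elimination. -/

/-- The `i`-th vector in the real array `A`. -/
def State.pair (s : State) (A i : ℕ) : Plane := (s.real A (i + i), s.real A (i + i + 1))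

theorem State.pair_congr {s s' : State} {A : ℕ} (h : s'.real A = s.real A) (i : ℕ) :
    s'.pair A i = s.pair A i := by unfold State.pair; rw [h]

def setPair (A : ℕ) (e : IntExpr) (x y : RealExpr) : Program :=
  block [.setReal A (.add e e) x, .setReal A (.add (.add e e) (.lit 1)) y]

/-- The state `s'` arises from `s` by changing the `j`-th vector in the real array `A` to `p`. -/
structure PairWritten (A j : ℕ) (p : Plane) (s s' : State) : Prop where
  int : s'.int = s.int
  real : ∀ c, c ≠ A → s'.real c = s.real c
  self : s'.pair A j = p
  ne : ∀ i, i ≠ j → s'.pair A i = s.pair A i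

theorem setPair_wp {A j : ℕ} {e : IntExpr} {x y : RealExpr} {s : State} {p : Plane}
    {R : State → Prop} (he : e.eval s = j) (he' : ∀ r, e.eval (s.writeReal A (j + j) r) = j)
    (hx : x.eval s = p.1) (hy : ∀ r, y.eval (s.writeReal A (j + j) r) = p.2)
    (h : ∀ s', PairWritten A j p s s' → R s') : (setPair A e x y).wp R s := by
  simp only [setPair, block, Program.wp, IntExpr.eval, he, hx, he', hy]
  refine h _ ⟨rfl, fun c hc => ?_, ?_, fun i hi => ?_⟩
  · rw [State.writeReal_real_of_ne _ _ _ hc, State.writeReal_real_of_ne _ _ _ hc]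
  · simp [State.pair, State.writeReal_real_self]
  · simp only [State.pair, State.writeReal_real_self]
    rw [Function.update_of_ne (by omega), Function.update_of_ne (by omega),
      Function.update_of_ne (by omega), Function.update_of_ne (by omega)]

/-- Adds the vector `(x, y)` to a vector in array `W`. -/
def addPair (W : ℕ) (e : IntExpr) (x y : RealExpr) : Program :=
  setPair W e (.add (fstExpr W e) x) (.add (sndExpr W e) y)

theorem addPair_wp {W j : ℕ} {e : IntExpr} {x y : RealExpr} {s : State} {p : Plane}
    {R : State → Prop} (he : ∀ s' : State, s'.int = s.int → e.eval s' = j)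
    (hx : x.eval s = p.1) (hy : ∀ r, y.eval (s.writeReal W (j + j) r) = p.2)
    (h : ∀ s' : State, s'.int = s.int → (∀ c, c ≠ W → s'.real c = s.real c) →
      (∀ i, s'.pair W i = s.pair W i + if j = i then p else 0) → R s') :
    (addPair W e x y).wp R s := by
  refine setPair_wp (p := s.pair W j + p) (he s rfl) (fun r => he _ rfl) ?_ (fun r => ?_)
    fun s' h' => h s' h'.int h'.real fun i => ?_
  · simp only [fstExpr, RealExpr.eval, IntExpr.eval, he s rfl, hx]; rfl
  · simp only [sndExpr, RealExpr.eval, IntExpr.eval, he _ (State.writeReal_int _ _ _ _), hy,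
      State.writeReal_real_self]
    rw [Function.update_of_ne (by omega)]; rfl
  · split_ifs with e
    · subst e; exact h'.self
    · rw [add_zero, h'.ne i (Ne.symm e)]

def zeroPairs (W : ℕ) (i : ℕ) : Program := setPair W (.lit i) (.lit 0) (.lit 0)

/-- Computes the coefficients of the constraint with index `41`. -/
def combine (X Y W k : ℕ) : Program :=
  .seq (unroll (zeroPairs W) k)
  (.seq (addPair W (.cell 6 (ivar 41)) (.cell X (ivar 41)) (.cell Y (ivar 41)))
  (.seq (addPair W (.cell 6 (ivar 39))
    (.sub (.lit 0) (.mul (.div (crossExpr X Y (ivar 41) (ivar 40)) (crossExpr X Y (ivar 39) (ivar 40)))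
      (.cell X (ivar 39))))
    (.sub (.lit 0) (.mul (.div (crossExpr X Y (ivar 41) (ivar 40)) (crossExpr X Y (ivar 39) (ivar 40)))
      (.cell Y (ivar 39)))))
  (addPair W (.cell 6 (ivar 40))
    (.sub (.lit 0) (.mul (.div (crossExpr X Y (ivar 39) (ivar 41)) (crossExpr X Y (ivar 39) (ivar 40)))
      (.cell X (ivar 40))))
    (.sub (.lit 0) (.mul (.div (crossExpr X Y (ivar 39) (ivar 41)) (crossExpr X Y (ivar 39) (ivar 40)))
      (.cell Y (ivar 40)))))))

/-- The contributions of `g`, `g₁` and `g₂` are added to a vector of zeros and not assigned, because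
the three may belong to the same polygon. -/
theorem combine_wp {X Y W k : ℕ} (hX : X ≠ W) (hY : Y ≠ W) {s : State} {R : State → Prop}
    (h : ∀ s' : State, s'.int = s.int → (∀ c, c ≠ W → s'.real c = s.real c) →
      (∀ i < k, s'.pair W i = gaugeCoef (s.normal X Y) (s.int 6) (s.int 39 0) (s.int 40 0)
        (s.int 41 0) i) → R s') : (combine X Y W k).wp R s := by
  have hm : ∀ s' : State, (∀ c, c ≠ W → s'.real c = s.real c) → s'.normal X Y = s.normal X Y :=
    fun s' h' => by unfold State.normal; rw [h' X hX, h' Y hY]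
  show (unroll (zeroPairs W) k).wp _ s
  refine Program.wp_mono ?_ (Program.wp_unroll (fun i s' => s'.int = s.int ∧
    (∀ c, c ≠ W → s'.real c = s.real c) ∧ ∀ j < i, s'.pair W j = 0) k
    ⟨rfl, fun _ _ => rfl, fun j hj => by omega⟩ fun i _ s' ⟨h1, h2, h3⟩ =>
      setPair_wp (e := .lit i) (x := .lit 0) (y := .lit 0) (j := i) (p := 0) rfl (fun _ => rfl)
      (by simp [RealExpr.eval]) (fun _ => by simp [RealExpr.eval]) fun s'' h' =>
      ⟨h'.int.trans h1, fun c hc => (h'.real c hc).trans (h2 c hc), fun j hj => ?_⟩)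
  swap
  · by_cases e : j = i
    · rw [e]; exact h'.self
    · rw [h'.ne j e]; exact h3 j (by omega)
  rintro s₁ ⟨i₁, r₁, z₁⟩
  refine addPair_wp (p := s.normal X Y (s.int 41 0)) (j := s.int 6 (s.int 41 0))
    (fun s' h' => ?_) ?_ (fun r => ?_) fun s₂ i₂ r₂ z₂ => ?_
  · simp only [IntExpr.eval, h', i₁]
  · simp only [RealExpr.eval, IntExpr.eval, i₁, r₁ X hX, State.normal]
  · simp only [RealExpr.eval, IntExpr.eval, i₁, State.writeReal_int, ne_eq, hY, not_false_eq_true,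
      State.writeReal_real_of_ne, r₁ Y hY, State.normal]
  have i₂' := i₂.trans i₁
  have r₂' : ∀ c, c ≠ W → s₂.real c = s.real c := fun c hc => (r₂ c hc).trans (r₁ c hc)
  refine addPair_wp (p := -((cross (s.normal X Y (s.int 41 0)) (s.normal X Y (s.int 40 0)) /
      cross (s.normal X Y (s.int 39 0)) (s.normal X Y (s.int 40 0))) • s.normal X Y (s.int 39 0)))
    (j := s.int 6 (s.int 39 0)) (fun s' h' => ?_) ?_ (fun r => ?_) fun s₃ i₃ r₃ z₃ => ?_
  · simp only [IntExpr.eval, h', i₂']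
  · simp only [RealExpr.eval, IntExpr.eval, eval_crossExpr, i₂', r₂' X hX, hm s₂ r₂']
    simp [State.normal]
  · simp only [RealExpr.eval, IntExpr.eval, eval_crossExpr, i₂', State.writeReal_int, ne_eq, hX, hY,
      not_false_eq_true, State.writeReal_real_of_ne, r₂' Y hY, State.normal_writeReal, hm s₂ r₂']
    simp [State.normal]
  have i₃' := i₃.trans i₂'
  have r₃' : ∀ c, c ≠ W → s₃.real c = s.real c := fun c hc => (r₃ c hc).trans (r₂' c hc)
  refine addPair_wp (p := -((cross (s.normal X Y (s.int 39 0)) (s.normal X Y (s.int 41 0)) /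
      cross (s.normal X Y (s.int 39 0)) (s.normal X Y (s.int 40 0))) • s.normal X Y (s.int 40 0)))
    (j := s.int 6 (s.int 40 0)) (fun s' h' => ?_) ?_ (fun r => ?_) fun s₄ i₄ r₄ z₄ => ?_
  · simp only [IntExpr.eval, h', i₃']
  · simp only [RealExpr.eval, IntExpr.eval, eval_crossExpr, i₃', r₃' X hX, hm s₃ r₃']
    simp [State.normal]
  · simp only [RealExpr.eval, IntExpr.eval, eval_crossExpr, i₃', State.writeReal_int, ne_eq, hX, hY,
      not_false_eq_true, State.writeReal_real_of_ne, r₃' Y hY, State.normal_writeReal, hm s₃ r₃']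
    simp [State.normal]
  refine h s₄ (i₄.trans i₃') (fun c hc => (r₄ c hc).trans (r₃' c hc)) fun i hi => ?_
  rw [z₄, z₃, z₂, z₁ i hi]
  unfold gaugeCoef
  split_ifs <;> abel

/-- The forms are evaluated at `v - w`, so the coefficients at `w` are kept as they are and the
constant is lowered by the value of the form at `v`, one term for each polygon. -/
def copyPair (W k i : ℕ) : Program :=
  .seq (setPair (k + 1 + i) (ivar 42) (fstExpr W (.lit i)) (sndExpr W (.lit i)))
    (.setReal (2 * k + 1) (ivar 42) (.sub (.cell (2 * k + 1) (ivar 42))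
      (.add (.mul (fstExpr W (.lit i)) (fstExpr 0 (.lit i)))
        (.mul (sndExpr W (.lit i)) (sndExpr 0 (.lit i))))))

/-- Writes the constraint with index `41` to position `42` of the output. -/
def emit (X Y S W k : ℕ) : Program :=
  .seq (combine X Y W k) (.seq (.setReal (2 * k + 1) (ivar 42) (.cell S (ivar 41)))
    (.seq (unroll (copyPair W k) k)
      -- By truncated subtraction `1 - (n - g)` is `1` for `n ≤ g`, the equations, and `0` for the
      -- inequalities.
      (.setInt 1 (.add (ivar 42) (.lit 1)) (.sub (.lit 1) (.sub (.cell 2 (.lit k)) (ivar 41))))))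

/-- The `j`-th constraint in the output. -/
structure Recorded (k : ℕ) (coef : ℕ → Plane) (r : ℝ) (flag : ℕ) (j : ℕ) (s : State) : Prop where
  flag : s.int 1 (j + 1) = flag
  coef : ∀ i < k, s.pair (k + 1 + i) j = coef i
  const : s.real (2 * k + 1) j = r

/-- The memory outside the output and the auxiliary array `W` is the same. -/
structure OutputFrame (k W : ℕ) (s s' : State) : Prop where
  int : ∀ b, b ≠ 1 → s'.int b = s.int b
  real : ∀ c, c < k + 1 ∨ 2 * k + 1 < c → c ≠ W → s'.real c = s.real c

theorem emit_wp {X Y S W k : ℕ} (hX : X ≠ W) (hY : Y ≠ W) (hS : S ≠ W)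
    (hW : 2 * k + 1 < W) {s : State} {R : State → Prop}
    (h : ∀ s' : State, OutputFrame k W s s' →
      Recorded k (gaugeCoef (s.normal X Y) (s.int 6) (s.int 39 0) (s.int 40 0) (s.int 41 0))
        (s.real S (s.int 41 0) - ∑ i ∈ Finset.range k, dot (gaugeCoef (s.normal X Y) (s.int 6)
          (s.int 39 0) (s.int 40 0) (s.int 41 0) i) (s.pair 0 i))
        (1 - (s.int 2 k - s.int 41 0)) (s.int 42 0) s' →
      (∀ j, j ≠ s.int 42 0 → ∀ coef r flag, Recorded k coef r flag j s →
        Recorded k coef r flag j s') → R s') : (emit X Y S W k).wp R s := by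
  refine combine_wp hX hY fun s₁ i₁ r₁ z₁ => ?_
  show (unroll (copyPair W k) k).wp _ _
  refine Program.wp_mono ?_ (Program.wp_unroll (fun i s' => s'.int = s.int ∧
    (∀ c, c < k + 1 ∨ 2 * k + 1 < c → s'.real c = s₁.real c) ∧
    (∀ j < i, s'.pair (k + 1 + j) (s.int 42 0) = s₁.pair W j) ∧
    (∀ j, j ≠ s.int 42 0 → ∀ i < k, s'.pair (k + 1 + i) j = s.pair (k + 1 + i) j) ∧
    (∀ j, j ≠ s.int 42 0 → s'.real (2 * k + 1) j = s.real (2 * k + 1) j) ∧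
    s'.real (2 * k + 1) (s.int 42 0) = s.real S (s.int 41 0) -
      ∑ j ∈ Finset.range i, dot (s₁.pair W j) (s.pair 0 j)) k ?_ ?_)
  · rintro s₂ ⟨i₂, r₂, a, b, c, d⟩
    simp only [Program.wp, IntExpr.eval, i₂]
    refine h _ ⟨fun b hb => ?_, fun c hc hc' => ?_⟩ ⟨?_, fun i hi => ?_, ?_⟩
      fun j hj coef r flag hrec => ⟨?_, fun i hi => ?_, ?_⟩
    · rw [State.writeInt_int_of_ne _ _ _ hb, i₂]
    · rw [State.writeInt_real, r₂ c hc, r₁ c hc']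
    · rw [State.writeInt_int_self, Function.update_self]
    · rw [← z₁ i hi]; exact a i hi
    · rw [State.writeInt_real, d]
      congr 1
      exact Finset.sum_congr rfl fun i hi => by rw [z₁ i (Finset.mem_range.1 hi)]
    · rw [State.writeInt_int_self, Function.update_of_ne (by omega), i₂]; exact hrec.flag
    · rw [← hrec.coef i hi]; exact b j hj i hi
    · rw [← hrec.const]; exact c j hj
  · simp only [IntExpr.eval, RealExpr.eval, i₁]
    refine ⟨i₁, fun c hc => State.writeReal_real_of_ne _ _ _ (by omega), fun j hj => by omega,
      fun j hj i hi => ?_, fun j hj => ?_, ?_⟩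
    · rw [State.pair_congr (State.writeReal_real_of_ne _ _ _ (by omega)),
        State.pair_congr (r₁ _ (by omega))]
    · rw [State.writeReal_real_self, Function.update_of_ne hj, r₁ _ (by omega)]
    · rw [State.writeReal_real_self, Function.update_self, r₁ S hS, Finset.sum_range_zero, sub_zero]
  · rintro i hi s₂ ⟨i₂, r₂, a, b, c, d⟩
    refine setPair_wp (p := s₁.pair W i) (j := s.int 42 0) ?_ (fun r => ?_) ?_ (fun r => ?_)
      fun s₃ h₃ => ?_
    · simp only [IntExpr.eval, i₂]
    · simp only [IntExpr.eval, State.writeReal_int, i₂]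
    · simp only [fstExpr, RealExpr.eval, IntExpr.eval, r₂ W (.inr hW)]; rfl
    · simp only [sndExpr, RealExpr.eval, IntExpr.eval, State.writeReal_int]
      rw [State.writeReal_real_of_ne _ _ _ (by omega), r₂ W (.inr hW)]; rfl
    have e0 : s₃.real 0 = s.real 0 := by
      rw [h₃.real 0 (by omega), r₂ 0 (by omega), r₁ 0 (by omega)]
    have eW : s₃.real W = s₁.real W := by rw [h₃.real W (by omega), r₂ W (by omega)]
    have ec : s₃.real (2 * k + 1) = s₂.real (2 * k + 1) := h₃.real _ (by omega)
    simp only [Program.wp, IntExpr.eval, RealExpr.eval, fstExpr, sndExpr]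
    refine ⟨h₃.int.trans i₂, fun c hc => ?_, fun j hj => ?_, fun j hj l hl => ?_, fun j hj => ?_, ?_⟩
    · rw [State.writeReal_real_of_ne _ _ _ (by omega), h₃.real c (by omega), r₂ c hc]
    · rw [State.pair_congr (State.writeReal_real_of_ne _ _ _ (by omega))]
      by_cases e : j = i
      · rw [e]; exact h₃.self
      · rw [State.pair_congr (h₃.real _ (by omega))]; exact a j (by omega)
    · rw [State.pair_congr (State.writeReal_real_of_ne _ _ _ (by omega)), ← b j hj l hl]
      by_cases e : l = i
      · rw [e]; exact h₃.ne j hj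
      · exact State.pair_congr (h₃.real _ (by omega)) j
    · rw [State.writeReal_real_self, h₃.int, i₂, Function.update_of_ne hj, ec]; exact c j hj
    · rw [State.writeReal_real_self, h₃.int, i₂, Function.update_self, e0, eW, ec, d, Finset.sum_range_succ]
      simp only [dot, State.pair]; ring

def emitBody (X Y S W k : ℕ) : Program :=
  .seq (.cond (.intEq (.cell 5 (ivar 41)) (.lit 0)) .skip (.seq (emit X Y S W k) (incr 42)))
    (incr 41)

/-- Writes all constraints to the output. -/
def emitAll (X Y S W k : ℕ) : Program :=
  .seq (block [setVar 41 (.lit 0), setVar 42 (.lit 0),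
      setVar 43 (.add (.cell 2 (.lit k)) (.lit (k + k)))])
    (.seq (.loop (.intLt (ivar 41) (ivar 43)) (emitBody X Y S W k))
      (.setInt 1 (.lit 0) (ivar 42)))

/-- The `g`-th constraint, computed from the memory `s`, is the `j`-th one in the output `s'`. -/
def Emitted (k X Y S n : ℕ) (s : State) (g j : ℕ) (s' : State) : Prop :=
  Recorded k (gaugeCoef (s.normal X Y) (s.int 6) (s.int 39 0) (s.int 40 0) g)
    (s.real S g - ∑ i ∈ Finset.range k, dot (gaugeCoef (s.normal X Y) (s.int 6) (s.int 39 0)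
      (s.int 40 0) g i) (s.pair 0 i)) (1 - (n - g)) j s'

/-- The output when the first `b` constraints, computed from the memory `x.2`, have been treated. -/
structure EmitInv (k X Y C S W : ℕ) (x : Instance k × State) (s : State) : Prop where
  gauge : GaugeInv k X Y C S x.1 x.2
  int : ∀ b, b ≠ 1 → b ≠ 41 → b ≠ 42 → b ≠ 43 → s.int b = x.2.int b
  real : ∀ c, c < k + 1 ∨ 2 * k + 1 < c → c ≠ W → s.real c = x.2.real c
  bound : s.int 43 0 = offset x.1.1.1 k + (k + k)
  le : s.int 41 0 ≤ offset x.1.1.1 k + (k + k)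
  count : s.int 42 0 = Nat.count (fun g => x.2.int 5 g ≠ 0) (s.int 41 0)
  emitted : ∀ g < s.int 41 0, x.2.int 5 g ≠ 0 → Emitted k X Y S (offset x.1.1.1 k) x.2 g
    (Nat.count (fun g => x.2.int 5 g ≠ 0) g) s

theorem Recorded.congr {k j flag : ℕ} {coef : ℕ → Plane} {r : ℝ} {s s' : State}
    (h : Recorded k coef r flag j s) (hint : s'.int 1 (j + 1) = s.int 1 (j + 1))
    (hr : s'.real = s.real) : Recorded k coef r flag j s' :=
  ⟨hint.trans h.flag, fun i hi => (State.pair_congr (by rw [hr]) j).trans (h.coef i hi),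
    by rw [hr, h.const]⟩

section
variable {k X Y C S W : ℕ}

/-- The position of a constraint in the output is the number of kept indices before it. Different
kept constraints have different positions, so nothing written earlier is lost. -/
theorem emitBody_wp (hX : X ≠ W) (hY : Y ≠ W) (hS : S ≠ W) (hX' : 2 * k + 1 < X)
    (hY' : 2 * k + 1 < Y) (hS' : 2 * k + 1 < S) (hW : 2 * k + 1 < W) {x : Instance k × State}
    {s : State} (h : EmitInv k X Y C S W x s) (hlt : s.int 41 0 < offset x.1.1.1 k + (k + k)) :
    (emitBody X Y S W k).wp (fun s' => EmitInv k X Y C S W x s' ∧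
      s'.int 41 0 = s.int 41 0 + 1) s := by
  have e5 : s.int 5 = x.2.int 5 := h.int 5 (by omega) (by omega) (by omega) (by omega)
  refine ⟨fun ht => ?_, fun ht => ?_⟩
  · have ht' : s.int 5 (s.int 41 0) = 0 := ht
    rw [e5] at ht'
    refine ⟨⟨h.gauge, fun b h1 h2 h3 h4 => ?_, h.real, h.bound, ?_, ?_, fun g hg hk => ?_⟩, ?_⟩
    · exact (State.writeInt_int_of_ne _ _ _ h2).trans (h.int b h1 h2 h3 h4)
    · rw [State.writeInt_int_self]
      exact hlt
    · rw [State.writeInt_int_self, State.writeInt_int_of_ne _ _ _ (by omega)]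
      simp only [IntExpr.eval, Function.update_self, Nat.count_succ, h.count]
      simp [ht']
    · rw [State.writeInt_int_self] at hg
      simp only [IntExpr.eval, Function.update_self] at hg
      have hne : g ≠ s.int 41 0 := by rintro rfl; exact hk ht'
      exact Recorded.congr (h.emitted g (by omega) hk) rfl rfl
    · rw [State.writeInt_int_self]; rfl
  · have ht' : ¬ s.int 5 (s.int 41 0) = 0 := ht
    rw [e5] at ht'
    refine emit_wp hX hY hS hW fun s' hf hrec hold => ?_
    have e41 : s'.int 41 = s.int 41 := hf.int 41 (by omega)
    have e42 : s'.int 42 = s.int 42 := hf.int 42 (by omega)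
    have hm : s.normal X Y = x.2.normal X Y := by
      unfold State.normal; rw [h.real X (.inr hX') hX, h.real Y (.inr hY') hY]
    have hint : ∀ b ∈ [2, 6, 39, 40], s.int b = x.2.int b := fun b hb => by
      simp only [List.mem_cons, List.not_mem_nil, or_false] at hb
      exact h.int b (by omega) (by omega) (by omega) (by omega)
    rw [hm, hint 6 (by simp), hint 39 (by simp), hint 40 (by simp), h.real S (.inr hS') hS,
      hint 2 (by simp), h.gauge.off, h.count] at hrec
    simp only [State.pair_congr (h.real 0 (by omega) (by omega))] at hrec
    simp only [Program.wp, IntExpr.eval, State.writeInt_int_self, State.writeInt_int_of_ne, ne_eq,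
      not_false_eq_true, Nat.reduceEqDiff, Function.update_self, e41, e42]
    refine ⟨⟨h.gauge, fun b h1 h2 h3 h4 => ?_, fun c hc hc' => (hf.real c hc hc').trans
      (h.real c hc hc'), ?_, ?_, ?_, fun g hg hk => ?_⟩, ?_⟩
    · rw [State.writeInt_int_of_ne _ _ _ h2, State.writeInt_int_of_ne _ _ _ h3, hf.int b h1]
      exact h.int b h1 h2 h3 h4
    · rw [State.writeInt_int_of_ne _ _ _ (by omega), State.writeInt_int_of_ne _ _ _ (by omega),
        hf.int 43 (by omega)]
      exact h.bound
    · rw [State.writeInt_int_self, Function.update_self]; exact hlt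
    · rw [State.writeInt_int_self, State.writeInt_int_of_ne _ _ _ (by omega),
        State.writeInt_int_self]
      simp only [Function.update_self, Nat.count_succ, h.count]
      simp [ht']
    · rw [State.writeInt_int_self, Function.update_self] at hg
      refine Recorded.congr (s := s') ?_ ?_ rfl
      · by_cases e : g = s.int 41 0
        · subst e; exact hrec
        · refine hold _ ?_ _ _ _ (h.emitted g (by omega) hk)
          rw [h.count]
          exact (Nat.count_strict_mono (p := fun g => x.2.int 5 g ≠ 0) hk (by omega)).ne
      · rw [State.writeInt_int_of_ne _ _ _ (by omega), State.writeInt_int_of_ne _ _ _ (by omega)]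
    · trivial

theorem emitAll_triple (hk : 0 < k) (hX : X ≠ W) (hY : Y ≠ W) (hS : S ≠ W) (hX' : 2 * k + 1 < X)
    (hY' : 2 * k + 1 < Y) (hS' : 2 * k + 1 < S) (hW : 2 * k + 1 < W) :
    Triple (fun a : Instance k => offset a.1.1 k)
      (fun a s => GaugeInv k X Y C S a s ∧ ∀ i < k, s.pair 0 i = a.1.2 i) (emitAll X Y S W k)
      fun a s => ∃ s₀ : State, (GaugeInv k X Y C S a s₀ ∧ ∀ i < k, s₀.pair 0 i = a.1.2 i) ∧
        s.int 1 0 = Nat.count (fun g => s₀.int 5 g ≠ 0) (offset a.1.1 k + (k + k)) ∧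
        ∀ g < offset a.1.1 k + (k + k), s₀.int 5 g ≠ 0 → Emitted k X Y S (offset a.1.1 k) s₀ g
          (Nat.count (fun g => s₀.int 5 g ≠ 0) g) s := by
  have hn : ∀ a : Instance k, 1 ≤ offset a.1.1 k := one_le_offset hk
  refine Triple.seq (Mid := fun a s => ∃ s₀ : State, EmitInv k X Y C S W (a, s₀) s ∧
      ∀ i < k, s₀.pair 0 i = a.1.2 i) (Triple.wp hn fun a s ⟨h, hV⟩ => ?_)
    (Triple.ofExists (Triple.seq (Triple.loop (fun x : Instance k × State => hn x.1)
      (fun x s => offset x.1.1.1 k + (k + k) - s.int 41 0) (1 + (k + k)) (fun x s h => ?_)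
      fun x s h hb => ?_) (Triple.wp (fun x => hn x.1) fun x s h => ?_)))
  · simp only [block, Program.wp, IntExpr.eval, State.writeInt_int_self, State.writeInt_int_of_ne,
      ne_eq, not_false_eq_true, Nat.reduceEqDiff, Function.update_self]
    refine ⟨s, ⟨h, fun b _ h2 h3 h4 => ?_, fun _ _ _ => rfl, ?_, ?_, ?_, fun g hg => ?_⟩, hV⟩
    · rw [State.writeInt_int_of_ne _ _ _ h4, State.writeInt_int_of_ne _ _ _ h3,
        State.writeInt_int_of_ne _ _ _ h2]
    · rw [State.writeInt_int_self, Function.update_self, h.off]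
    · rw [State.writeInt_int_of_ne _ _ _ (by omega), State.writeInt_int_of_ne _ _ _ (by omega),
        State.writeInt_int_self, Function.update_self]
      exact Nat.zero_le _
    · rw [State.writeInt_int_of_ne _ _ _ (by omega), State.writeInt_int_self, Function.update_self,
        State.writeInt_int_of_ne _ _ _ (by omega), State.writeInt_int_of_ne _ _ _ (by omega),
        State.writeInt_int_self, Function.update_self, Nat.count_zero]
    · rw [State.writeInt_int_of_ne _ _ _ (by omega), State.writeInt_int_of_ne _ _ _ (by omega),
        State.writeInt_int_self, Function.update_self] at hg
      omega
  · have := Nat.mul_le_mul_left (k + k) (hn x.1)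
    rw [Nat.add_mul]
    omega
  · have hb' : s.int 41 0 < s.int 43 0 := hb
    rw [h.1.bound] at hb'
    refine Program.wp_mono ?_ (emitBody_wp hX hY hS hX' hY' hS' hW h.1 hb')
    rintro s' ⟨h', e⟩
    simp only at hb' ⊢
    exact ⟨⟨h', h.2⟩, by omega⟩
  · obtain ⟨⟨h, hV⟩, hb⟩ := h
    have hb' : ¬ s.int 41 0 < s.int 43 0 := hb
    have e : s.int 41 0 = offset x.1.1.1 k + (k + k) := by
      have := h.le
      rw [h.bound] at hb'
      simp only at this hb'
      omega
    refine ⟨x.2, ⟨h.gauge, hV⟩, ?_, fun g hg hk => ?_⟩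
    · rw [State.writeInt_int_self, ← e, ← h.count]; rfl
    · refine Recorded.congr (h.emitted g (by omega) hk) ?_ rfl
      rw [State.writeInt_int_self]
      exact Function.update_of_ne (Nat.succ_ne_zero _) _ _

end

end RealRAM

/-! ### The output as a description of the maximal placements. -/

theorem exists_count_eq (p : ℕ → Prop) [DecidablePred p] {n j : ℕ} (h : j < Nat.count p n) :
    ∃ g < n, p g ∧ Nat.count p g = j := by
  induction n with
  | zero => simp at h
  | succ n ih =>
    rw [Nat.count_succ] at h
    by_cases h' : j < Nat.count p n
    · obtain ⟨g, hg, r⟩ := ih h'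
      exact ⟨g, by omega, r⟩
    · split_ifs at h with hp
      · exact ⟨n, by omega, hp, by omega⟩
      · omega

namespace RealRAM

/-- The output is an irredundant description of the set of maximal placements. -/
theorem exists_constraints {k X Y C S : ℕ} (hk : 0 < k) {a : Instance k} {s₀ s : State}
    (hG : GaugeInv k X Y C S a s₀) (hV : ∀ i < k, s₀.pair 0 i = a.1.2 i)
    (hcount : s.int 1 0 = Nat.count (fun g => s₀.int 5 g ≠ 0) (offset a.1.1 k + (k + k)))
    (hem : ∀ g < offset a.1.1 k + (k + k), s₀.int 5 g ≠ 0 →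
      Emitted k X Y S (offset a.1.1 k) s₀ g (Nat.count (fun g => s₀.int 5 g ≠ 0) g) s) :
    ∃ (m : ℕ) (L : Fin m → LinearConstraint k), m ≤ offset a.1.1 k + (k + k) ∧ Outputs s L ∧
      Describes L (maximizers fun i : Fin k => a.1.1 i) ∧ Irredundant L := by
  obtain ⟨keep, hgauge, hkeep⟩ := hG.gauge
  set m := s₀.normal X Y
  set own := s₀.int 6
  set g₁ := s₀.int 39 0
  set g₂ := s₀.int 40 0
  set N := offset a.1.1 k
  set V : Fin k → Plane := fun i => a.1.2 i
  have hex : ∀ j : Fin (Nat.count (fun g => s₀.int 5 g ≠ 0) (N + (k + k))), ∃ g < N + (k + k),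
      s₀.int 5 g ≠ 0 ∧ Nat.count (fun g => s₀.int 5 g ≠ 0) g = j := fun j => exists_count_eq _ j.2
  choose γ hγ hγk hγc using hex
  obtain ⟨i₁, hi₁, -⟩ := hgauge.exists_owner hgauge.left.2.1
  obtain ⟨i₂, hi₂, -⟩ := hgauge.exists_owner hgauge.right.2.1
  -- Adding `u` to all vectors adds `u` to the gauge point, so the forms vanish on the diagonal and
  -- descend to the configuration space.
  have hker : ∀ g < N + (k + k), diagonal k ≤ LinearMap.ker (gaugeForm k m own g₁ g₂ g) := by
    rintro g hg _ ⟨u, rfl⟩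
    obtain ⟨i, hi, -⟩ := hgauge.exists_owner hg
    rw [LinearMap.mem_ker, gaugeForm_eq hi hi₁ hi₂]
    simp only [LinearMap.pi_apply, LinearMap.id_apply]
    rw [← eq_gaugePoint hgauge.cross_ne (u := u) (by rw [sub_self, dot_zero])
      (by rw [sub_self, dot_zero]), sub_self, dot_zero]
  -- The inequality `form (V - w) ≤ S` is rearranged to `0 ≤ form w + (S - form V)`. For an equation
  -- `S = 0` by `hG.zero`, and the sign is immaterial.
  let L : Fin (Nat.count (fun g => s₀.int 5 g ≠ 0) (N + (k + k))) → LinearConstraint k := fun j =>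
    { functional := (diagonal k).liftQ (gaugeForm k m own g₁ g₂ (γ j)) (hker _ (hγ j))
      const := s₀.real S (γ j) - gaugeForm k m own g₁ g₂ (γ j) V
      isEquality := decide (N ≤ γ j) }
  have hholds : ∀ j w, (L j).Holds (toConfig w) ↔
      GaugeHolds k m (s₀.real S) own N g₁ g₂ (γ j) (V - w) := by
    intro j w
    unfold GaugeHolds
    rw [map_sub]
    by_cases h : N ≤ γ j
    · have e : (L j).isEquality = true := decide_eq_true h
      have e0 := hG.zero _ h (hγ j)
      unfold LinearConstraint.Holds
      rw [e]
      show gaugeForm k m own g₁ g₂ (γ j) w + (s₀.real S (γ j) - _) = 0 ↔ _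
      rw [e0]
      constructor
      · intro h'
        exact ⟨fun h'' => by omega, fun _ => by linarith⟩
      · intro h'
        have := h'.2 h
        linarith
    · have e : (L j).isEquality = false := decide_eq_false h
      unfold LinearConstraint.Holds
      rw [e]
      show 0 ≤ gaugeForm k m own g₁ g₂ (γ j) w + (s₀.real S (γ j) - _) ↔ _
      constructor
      · intro h'
        exact ⟨fun _ => by linarith, fun h'' => absurd h'' h⟩
      · intro h'
        have := h'.1 (by omega)
        linarith
  have hall : ∀ (w : Fin k → Plane) (T : ℕ → Prop),
      (∀ j, T (γ j) → (L j).Holds (toConfig w)) ↔ ∀ g < N + (k + k),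
        keep g ∧ g ≠ g₁ ∧ g ≠ g₂ → T g → GaugeHolds k m (s₀.real S) own N g₁ g₂ g (V - w) := by
    intro w T
    constructor
    · intro h g hg hk' hT
      have hkg := (hkeep g).2 hk'
      have hlt := Nat.count_strict_mono (p := fun g => s₀.int 5 g ≠ 0) hkg hg
      have e : γ ⟨_, hlt⟩ = g :=
        Nat.count_injective (p := fun g => s₀.int 5 g ≠ 0) (hγk _) hkg (hγc ⟨_, hlt⟩)
      have := (hholds ⟨_, hlt⟩ w).1 (h ⟨_, hlt⟩ (by rwa [e]))
      rwa [e] at this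
    · intro h j hT
      exact (hholds j w).2 (h _ (hγ j) ((hkeep _).1 (hγk j)) hT)
  refine ⟨_, L, ?_, ⟨hcount, fun j => ?_⟩, ?_, fun j hj => ?_⟩
  · exact Nat.count_le _
  · have hrec := hem (γ j) (hγ j) (hγk j)
    rw [hγc] at hrec
    refine ⟨?_, fun w => ?_, ?_⟩
    · rw [hrec.flag]
      show _ = if decide (N ≤ γ j) = true then 1 else 0
      simp only [decide_eq_true_eq]
      split_ifs <;> omega
    · show ∑ i : Fin k, dot (gaugeCoef m own g₁ g₂ (γ j) i) (w i) = _
      refine Finset.sum_congr rfl fun i _ => ?_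
      rw [← hrec.coef i i.2, two_mul]
      rfl
    · rw [hrec.const]
      show _ = s₀.real S (γ j) - ∑ i : Fin k, dot (gaugeCoef m own g₁ g₂ (γ j) i) (a.1.2 i)
      rw [← Fin.sum_univ_eq_sum_range (fun i => dot (gaugeCoef m own g₁ g₂ (γ j) i) (s₀.pair 0 i)) k]
      congr 1
      exact Finset.sum_congr rfl fun i _ => by rw [hV i i.2]
  · ext c
    obtain ⟨w, rfl⟩ := toConfig_surjective c
    rw [(mem_maximizers_iff hk a.2 hG.table hG.slack).1 w]
    have := hall w fun _ => True
    simp only [true_imp_iff] at this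
    refine this.trans (hgauge.exists_translate_iff (V - w)).symm
  · obtain ⟨y, hy, hy'⟩ := hgauge.exists_only_violated (hγ j) ((hkeep _).1 (hγk j))
    have h1 : toConfig (V - y) ∈ {c | ∀ j', j' ≠ j → (L j').Holds c} := by
      intro j' hj'
      rw [hholds, sub_sub_cancel]
      refine hy' _ (hγ j') ((hkeep _).1 (hγk j')) fun e => hj' (Fin.ext ?_)
      rw [← hγc j', ← hγc j, e]
    rw [hj] at h1
    have := h1 j
    rw [hholds, sub_sub_cancel] at this
    exact hy this

/-! ### Assembling the algorithm. -/

theorem writesInt_unroll {f : ℕ → Program} {n b : ℕ} (h : ∀ i, ¬ (f i).WritesInt b) :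
    ¬ (unroll f n).WritesInt b := by
  induction n with
  | zero => exact id
  | succ n ih => exact fun hc => hc.elim ih (h n)

theorem writesReal_unroll {f : ℕ → Program} {n b : ℕ} (h : ∀ i, ¬ (f i).WritesReal b) :
    ¬ (unroll f n).WritesReal b := by
  induction n with
  | zero => exact id
  | succ n ih => exact fun hc => hc.elim ih (h n)

/-- The vectors `v i` are in the memory. -/
def HasShift (k : ℕ) (a : Instance k) (s : State) : Prop := ∀ i < k, s.pair 0 i = a.1.2 i

def NoneKept (s : State) : Prop := ∀ g, s.int 5 g = 0

theorem Triple.hasShift {k : ℕ} {Pre Post : Instance k → State → Prop} {p : Program}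
    {n : Instance k → ℕ} (h : Triple n Pre p Post) (h0 : ¬ p.WritesReal 0) :
    Triple n (fun a s => Pre a s ∧ HasShift k a s) p fun a s => Post a s ∧ HasShift k a s :=
  h.frame _ fun _ _ _ ho hs i hi => (State.pair_congr (ho.2 0 h0) i).trans (hs i hi)

theorem Triple.noneKept {k : ℕ} {Pre Post : Instance k → State → Prop} {p : Program}
    {n : Instance k → ℕ} (h : Triple n Pre p Post) (h5 : ¬ p.WritesInt 5) :
    Triple n (fun a s => Pre a s ∧ NoneKept s) p fun a s => Post a s ∧ NoneKept s :=
  h.frame (fun _ s => NoneKept s) fun _ _ _ ho hs g => by rw [ho.1 5 h5]; exact hs g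

/-- The algorithm; `w` is the first of the arrays it uses for its computations. -/
def solve (k w : ℕ) : Program :=
  .seq (.seq (unroll (load w (w + 1) (w + 2)) k) (block [setVar 20 (.lit 0), setVar 21 (.lit 0)]))
  (.seq (unroll (merge w (w + 1) (w + 2)) k) (.seq (trim 3 w (w + 1) (w + 2))
  (.seq (locate w (w + 1) (w + 2) (w + 3) k) (.seq (unroll (localize w (w + 1) (w + 3) k) k)
  (.seq (chooseGauge w (w + 1) k) (emitAll w (w + 1) (w + 3) (w + 4) k))))))

theorem solve_triple {k w : ℕ} (hk : 0 < k) (hw : 2 * k + 1 < w) :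
    Triple (fun a : Instance k => offset a.1.1 k)
      (fun a s => HasInput k a.1.1 a.1.2 s ∧ s.int 2 0 = 0 ∧ NoneKept s) (solve k w)
      fun a s => ∃ (m : ℕ) (L : Fin m → LinearConstraint k), m ≤ offset a.1.1 k + (k + k) ∧
        Outputs s L ∧ Describes L (maximizers fun i : Fin k => a.1.1 i) ∧ Irredundant L := by
  have hn : ∀ a : Instance k, 1 ≤ offset a.1.1 k := one_le_offset hk
  have hload : Triple (fun a : Instance k => offset a.1.1 k)
      (fun a s => HasInput k a.1.1 a.1.2 s ∧ s.int 2 0 = 0 ∧ NoneKept s)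
      (.seq (unroll (load w (w + 1) (w + 2)) k) (block [setVar 20 (.lit 0), setVar 21 (.lit 0)]))
      fun a s => (MergeInv k w (w + 1) (w + 2) 0 a.1 s ∧ HasShift k a s) ∧ NoneKept s := by
    have hall := (Triple.unroll (n := fun a : (ℕ → ConvexPolygon) × (ℕ → Plane) => offset a.1 k)
      (fun a => (Nat.zero_le _).trans_lt (offset_add_lt a.1 hk (a.1 0).size_pos))
      (LoadInv k w (w + 1) (w + 2)) k fun i hi => load_triple (by omega) (by omega) (by omega)
      (by omega) (by omega) (by omega) hi).reindex fun a : Instance k => a.1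
    refine (Triple.conseq (Triple.noneKept hall (writesInt_unroll fun i => ?_)) ?_
      fun _ _ h => h).seq (Triple.wp hn ?_)
    · simp [load, loadBody, search, block, Program.WritesInt]
    · rintro a s ⟨h1, h2, h3⟩
      refine ⟨⟨h1, fun j hj => ?_, fun i _ t _ ht => ?_⟩, h3⟩
      · obtain rfl : j = 0 := by omega
        rw [h2]; simp [offset]
      · simp [offset] at ht
    · rintro a s ⟨h, h0⟩
      simp only [block, Program.wp, IntExpr.eval]
      refine ⟨⟨⟨fun j hj => ?_, ?_, ?_⟩, fun i hi => ?_⟩, fun g => ?_⟩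
      · rw [State.writeInt_int_of_ne _ _ _ (by omega), State.writeInt_int_of_ne _ _ _ (by omega)]
        exact h.off j hj
      · rw [State.writeInt_int_of_ne _ _ _ (by omega), State.writeInt_int_of_ne _ _ _ (by omega)]
        exact h.table
      · rw [State.writeInt_int_self, State.writeInt_int_of_ne _ _ _ (show 20 ≠ 21 by omega),
          State.writeInt_int_self, Function.update_self, Function.update_self]
        exact ⟨le_rfl, Nat.zero_le _, fun p _ hp => by omega, fun p p' _ _ hp => by omega,
          fun g hg => by simp [offset] at hg⟩
      · exact Prod.ext (h.input.fst i hi) (h.input.snd i hi)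
      · rw [State.writeInt_int_of_ne _ _ _ (by omega), State.writeInt_int_of_ne _ _ _ (by omega)]
        exact h0 g
  have hmerge := (Triple.unroll (n := fun a : (ℕ → ConvexPolygon) × (ℕ → Plane) => offset a.1 k)
      (fun a => (Nat.zero_le _).trans_lt (offset_add_lt a.1 hk (a.1 0).size_pos))
      (MergeInv k w (w + 1) (w + 2)) k fun i hi => merge_triple hi).reindex
        fun a : Instance k => a.1
  refine Triple.conseq (hload.seq (((Triple.hasShift hmerge ?_).noneKept ?_).seq
    ((((trim_triple hk).hasShift ?_).noneKept ?_).seq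
    ((((locate_triple hk (by omega) (by omega) (by omega)).hasShift ?_).noneKept ?_).seq
    ((Triple.conseq ((localize_all_triple hk (C := w + 2) (by omega) (by omega) (by omega) (by omega)
      (by omega) (by omega)).hasShift ?_) ?_ fun _ _ h => h).seq
    (((chooseGauge_triple hk).hasShift ?_).seq
    (emitAll_triple hk (by omega) (by omega) (by omega) (by omega) (by omega) (by omega)
      (by omega)))))))) (fun _ _ h => h) ?_
  · refine writesReal_unroll fun i => ?_
    simp [merge, mergeBody, block, Program.WritesReal]
  · refine writesInt_unroll fun i => ?_
    simp [merge, mergeBody, block, Program.WritesInt]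
  · simp [trim, trimBody, block, Program.WritesReal]
  · simp [trim, trimBody, block, Program.WritesInt]
  · simp [locate, locateBody, block, Program.WritesReal]
  · simp [locate, locateBody, block, Program.WritesInt]
  · refine writesReal_unroll fun i => ?_
    simp [localize, localInit, classify, scanBody, pointBranch, segmentBranch, pick, search, mark,
      polygonBranch, trim, trimBody, fill, block, Program.WritesReal]
    omega
  · rintro a s ⟨⟨h, hs⟩, h0⟩
    exact ⟨⟨h.off, h.table, h.slack, fun j hj => by omega, fun _ _ _ g _ => h0 g⟩, hs⟩
  · simp [chooseGauge, search, block, Program.WritesReal]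
  · rintro a s ⟨s₀, ⟨h, hV⟩, hc, he⟩
    exact exists_constraints hk h hV hc he

theorem hasInput_inputState {k : ℕ} (Q : ℕ → ConvexPolygon) (V : ℕ → Plane) :
    HasInput k Q V (inputState (fun i : Fin k => Q i) fun i : Fin k => V i) := by
  have hc : ∀ {n : ℕ} (f : Fin n → Plane) {i : ℕ} (hi : i < n),
      coordinates f (i + i) = (f ⟨i, hi⟩).1 ∧ coordinates f (i + i + 1) = (f ⟨i, hi⟩).2 := by
    intro n f i hi
    have h1 : (i + i) / 2 = i := by omega
    have h2 : (i + i + 1) / 2 = i := by omega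
    have h3 : (i + i) % 2 = 0 := by omega
    have h4 : (i + i + 1) % 2 = 1 := by omega
    unfold coordinates
    simp only [h1, h2, h3, h4, hi, dif_pos, if_true, one_ne_zero, if_false, and_self]
  refine ⟨fun i hi => ?_, fun i hi => ?_, fun i hi => ?_, fun i hi t ht => ?_, fun i hi t ht => ?_⟩
  · simp [inputState, hi]
  · simp only [inputState, if_true]; exact (hc _ hi).1
  · simp only [inputState, if_true]; exact (hc _ hi).2
  · simp only [inputState, Nat.succ_ne_zero, if_false, Nat.add_sub_cancel, hi, dif_pos]
    rw [(hc _ ht).1, ConvexPolygon.cyc_of_lt _ ht]; rfl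
  · simp only [inputState, Nat.succ_ne_zero, if_false, Nat.add_sub_cancel, hi, dif_pos]
    rw [(hc _ ht).2, ConvexPolygon.cyc_of_lt _ ht]; rfl

end RealRAM

theorem theorem1p2 (k : ℕ) (hk : 2 ≤ k) :
    ∃ (prog : RealRAM.Program) (C : ℕ),
      ∀ (P : Fin k → ConvexPolygon) (v : Fin k → Plane), toConfig v ∈ maximizers P →
        Set.BijOn toConfig (differenceProduct P (overlap P v)) (maximizers P) ∧
        ∃ (s : RealRAM.State) (t : ℕ),
          RealRAM.Runs prog (inputState P v) s t ∧ t ≤ C * totalVertices P ∧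
          ∃ (m : ℕ) (L : Fin m → LinearConstraint k),
            m ≤ C * totalVertices P ∧ Outputs s L ∧
            Describes L (maximizers P) ∧ Irredundant L := by
  have hk0 : 0 < k := by omega
  obtain ⟨K, hK⟩ := RealRAM.solve_triple (k := k) (w := 2 * k + 2) hk0 (by omega)
  -- The array `2k + 2` is the first one after the input and the output. The summand `K` bounds the
  -- time, and `1 + 2k` bounds the number `n + 2k` of constraints in terms of `n ≥ 1`.
  refine ⟨RealRAM.solve k (2 * k + 2), K + (1 + (k + k)), fun P v hv => ⟨bijOn_toConfig hk0 hv, ?_⟩⟩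
  -- The families are extended to all natural numbers, which avoids proofs of bounds in the
  -- invariants; the values from `k` on are arbitrary.
  obtain ⟨Q, rfl⟩ : ∃ Q : ℕ → ConvexPolygon, P = fun i : Fin k => Q i :=
    ⟨fun i => if h : i < k then P ⟨i, h⟩ else P ⟨0, hk0⟩, funext fun i => by simp⟩
  obtain ⟨V, rfl⟩ : ∃ V : ℕ → Plane, v = fun i : Fin k => V i :=
    ⟨fun i => if h : i < k then v ⟨i, h⟩ else 0, funext fun i => by simp⟩
  have htot : totalVertices (fun i : Fin k => Q i) = offset Q k :=
    Fin.sum_univ_eq_sum_range (fun i => (Q i).size) k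
  have h1 : 1 ≤ offset Q k := RealRAM.one_le_offset hk0 ⟨(Q, V), hv⟩
  obtain ⟨s, t, hrun, ht, m, L, hm, hL⟩ := hK ⟨(Q, V), hv⟩ _
    ⟨RealRAM.hasInput_inputState Q V, by simp [inputState], fun g => by simp [inputState]⟩
  rw [htot]
  refine ⟨s, t, hrun, ht.trans (Nat.mul_le_mul_right _ (by omega)), m, L, hm.trans ?_, hL⟩
  have := Nat.mul_le_mul_left (k + k) h1
  rw [Nat.add_mul, Nat.add_mul]
  simp only
  omega
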